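/- Let $M$ be a $C^\infty$ embedded submanifold of $\mathbb R^n$ of dimension $m$ (not assumed compact, connected, closed or orientable), with the Riemannian metric induced by the Euclidean metric, and let $\mathrm{vol}_M$ be the associated measure. A differential $j$-form $\omega$ on $M$ is $L^p$ if it is measurable and $|\omega|_p:=\big\| x\mapsto|\omega(x)|\big\|_{L^p(\mathrm{vol}_M)}<\infty$, where $|\omega(x)|$ is the norm of the multilinear form $\omega(x)$ on the Euclidean space $T_xM$. An $L^1_{loc}$ $j$-form $\alpha$ on an open set $U\subset\mathbb R^m$ is weakly differentiable if there is an $L^1_{loc}$ $(j+1)$-form $\overline d\alpha$ on $U$ with $\int_U\alpha\wedge d\varphi=(-1)^{j+1}\int_U\overline d\alpha\wedge\varphi$ for all smooth $(m-j-1)$-forms $\varphi$ with compact support in $U$; a form on $M$ is weakly differentiable if it is so in all coordinate systems of $M$, and its weak differential $\overline d$ is obtained from those in the coordinate systems. As usual, weakly differentiable forms that agree almost everywhere are identified, and the support of such a form is the complement of the largest open subset of $M$ on which it vanishes almost everywhere. Let $\Omega^j(M)$ be the space of smooth $j$-forms and $\overline\Omega^j(M)$ that of weakly differentiable $j$-forms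 on $M$, with $\overline\Omega^{-1}(M)=0$. **(A)** There are sequences of linear operators $R_i:\overline\Omega^j(M)\to\Omega^j(M)$ and $A_i:\overline\Omega^{j}(M)\to\overline\Omega^{j-1}(M)$, $i\in\mathbb N$, $j\ge 0$, such that: 1. for all $j$, $i$ and $\omega\in\overline\Omega^j(M)$, $\;R_i\omega-\omega=\overline d A_i\omega+A_i\overline d\omega$; 2. for every $i$ there is a constant $C_i$ such that for all $p\in[1,\infty]$ and every $L^p$ form $\omega\in\overline\Omega^j(M)$, the forms $R_i\omega$ and $A_i\omega$ are $L^p$, with $|R_i\omega|_p\le C_i|\omega|_p$ and $|A_i\omega|_p\le C_i|\omega|_p$; 3. for every $p\in[1,\infty)$ and every $L^p$ form $\omega\in\overline\Omega^j(M)$, $|R_i\omega-\omega|_p\to0$ and $|A_i\omega|_p\to0$ as $i\to\infty$; 4. if $\omega\in\overline\Omega^j(M)$ and $W\subset M$ is a uniform neighborhood of $\operatorname{supp}\omega$, that is, $W$ contains all the points of $M$ at Euclidean distance less than $\delta$ from $\operatorname{supp}\omega$ for some $\delta>0$ (if $\operatorname{supp}\omega$ is compact, every neighborhood of it is of this kind),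 then $\operatorname{supp}R_i\omega\subset W$ and $\operatorname{supp}A_i\omega\subset W$ for all sufficiently large $i$. **(B)** For $p\in[1,\infty]$, let $\Omega^j_p(M)$ be the space of smooth $L^p$ $j$-forms $\omega$ on $M$ such that $d\omega$ is $L^p$, and let $\overline\Omega^j_p(M)$ be the space of weakly differentiable $L^p$ $j$-forms $\omega$ on $M$ such that $\overline d\omega$ is $L^p$. Then for every $p\in[1,\infty]$ the inclusions $\Omega^j_p(M)\hookrightarrow\overline\Omega^j_p(M)$, $j\in\mathbb N$, are well defined, satisfy $\overline d\omega=d\omega$, and induce isomorphisms between the cohomology groups of $(\Omega^\bullet_p(M),d)$ and those of $(\overline\Omega^\bullet_p(M),\overline d)$. -/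

import Mathlib

open MeasureTheory Filter Topology
open scoped ENNReal NNReal

namespace LpForms

noncomputable section

/-! ### Forms on open subsets of `ℝ^m` and their weak exterior differential -/

/-- The coefficient of the top-degree form `α ∧ β` on `ℝ^m`, that is, its value on the canonical
basis, where
`(α ∧ β)(v₁, …, v_m) = (j! k!)⁻¹ ∑ σ, sign σ · α (v_σ(1), …, v_σ(j)) · β (v_σ(j+1), …, v_σ(m))`. -/
def wedgeTop {m j k : ℕ} (h : j + k = m)
    (α : EuclideanSpace ℝ (Fin m) [⋀^Fin j]→L[ℝ] ℝ)
    (β : EuclideanSpace ℝ (Fin m) [⋀^Fin k]→L[ℝ] ℝ) : ℝ :=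
  ((j.factorial : ℝ) * (k.factorial : ℝ))⁻¹ *
    ∑ σ : Equiv.Perm (Fin m), ((Equiv.Perm.sign σ : ℤ) : ℝ) *
      (α (fun i => EuclideanSpace.single (σ (Fin.cast h (Fin.castAdd k i))) 1) *
        β (fun i => EuclideanSpace.single (σ (Fin.cast h (Fin.natAdd j i))) 1))

/-- Smooth `k`-forms with compact support in the open set `U ⊆ ℝ^m`. -/
structure IsTestForm {m k : ℕ} (U : Set (EuclideanSpace ℝ (Fin m)))
    (φ : EuclideanSpace ℝ (Fin m) → EuclideanSpace ℝ (Fin m) [⋀^Fin k]→L[ℝ] ℝ) : Prop where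
  contDiff : ContDiff ℝ (⊤ : ℕ∞) φ
  hasCompactSupport : HasCompactSupport φ
  tsupport_subset : tsupport φ ⊆ U

/-- The `L^1_loc` form `β` is a weak exterior differential of the `L^1_loc` form `α` on the open
set `U ⊆ ℝ^m`: `∫_U α ∧ dφ = (-1)^(j+1) ∫_U β ∧ φ` for every test form `φ` of degree
`k = m - j - 1`. (If `j ≥ m`, there is no such degree, and `β` is zero as a form of degree
`j + 1 > m`.) -/
structure IsWeakExtDerivOn {m j : ℕ} (U : Set (EuclideanSpace ℝ (Fin m)))
    (α : EuclideanSpace ℝ (Fin m) → EuclideanSpace ℝ (Fin m) [⋀^Fin j]→L[ℝ] ℝ)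
    (β : EuclideanSpace ℝ (Fin m) → EuclideanSpace ℝ (Fin m) [⋀^Fin (j + 1)]→L[ℝ] ℝ) :
    Prop where
  locallyIntegrableOn_left : LocallyIntegrableOn α U volume
  locallyIntegrableOn_right : LocallyIntegrableOn β U volume
  integral_eq : ∀ (k : ℕ) (h : j + 1 + k = m) (h' : j + (k + 1) = m)
    (φ : EuclideanSpace ℝ (Fin m) → EuclideanSpace ℝ (Fin m) [⋀^Fin k]→L[ℝ] ℝ),
    IsTestForm U φ →
      ∫ u in U, wedgeTop h' (α u) (extDeriv φ u) =
        (-1 : ℝ) ^ (j + 1) * ∫ u in U, wedgeTop h (β u) (φ u)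

/-! ### Smooth submanifolds of `ℝ^n` -/

variable {n m j : ℕ} {M : Set (EuclideanSpace ℝ (Fin n))}

/-- `e` is a (smooth) coordinate system of `M ⊆ ℝ^n`: a homeomorphism from an open subset of `M`
onto an open subset of `ℝ^m` whose inverse is a smooth immersion into `ℝ^n`. -/
structure IsCoord (e : OpenPartialHomeomorph M (EuclideanSpace ℝ (Fin m))) : Prop where
  contDiffOn : ContDiffOn ℝ (⊤ : ℕ∞) (fun u => (e.symm u : EuclideanSpace ℝ (Fin n))) e.target
  injective_fderiv : ∀ u ∈ e.target,
    Function.Injective (fderiv ℝ (fun u => (e.symm u : EuclideanSpace ℝ (Fin n))) u)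

/-- `M` is a `C^∞` (embedded) submanifold of `ℝ^n` of dimension `m`. -/
def IsSmoothSubmanifold (m : ℕ) (M : Set (EuclideanSpace ℝ (Fin n))) : Prop :=
  ∀ x : M, ∃ e : OpenPartialHomeomorph M (EuclideanSpace ℝ (Fin m)), IsCoord e ∧ x ∈ e.source

/-- The tangent space `T_x M`, as a subspace of `ℝ^n`; it carries the inner product of `ℝ^n`. -/
def tangentSpaceAt (M : Set (EuclideanSpace ℝ (Fin n))) (x : M) :
    Submodule ℝ (EuclideanSpace ℝ (Fin n)) :=
  Submodule.span ℝ (tangentConeAt ℝ M (x : EuclideanSpace ℝ (Fin n)))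

/-- The Riemannian volume of an `m`-dimensional submanifold of `ℝ^n`: the `m`-dimensional Hausdorff
measure, normalized so as to agree with Lebesgue measure on `ℝ^m`. -/
def vol (m : ℕ) (M : Set (EuclideanSpace ℝ (Fin n))) : Measure M :=
  Measure.euclideanHausdorffMeasure m

/-- (Not necessarily continuous) differential `j`-forms on `M`. -/
def Form (M : Set (EuclideanSpace ℝ (Fin n))) (j : ℕ) : Type :=
  (x : M) → (tangentSpaceAt M x) [⋀^Fin j]→L[ℝ] ℝ

instance : CoeFun (Form M j) (fun _ => (x : M) → (tangentSpaceAt M x) [⋀^Fin j]→L[ℝ] ℝ) :=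
  ⟨fun ω => ω⟩

/-- Forms are added pointwise. -/
instance : AddCommGroup (Form M j) :=
  inferInstanceAs (AddCommGroup ((x : M) → (tangentSpaceAt M x) [⋀^Fin j]→L[ℝ] ℝ))

/-- Forms are multiplied by real numbers pointwise. -/
instance : Module ℝ (Form M j) :=
  inferInstanceAs (Module ℝ ((x : M) → (tangentSpaceAt M x) [⋀^Fin j]→L[ℝ] ℝ))

lemma Form.add_apply (ω ω' : Form M j) (x : M) : (ω + ω') x = ω x + ω' x := rfl

lemma Form.sub_apply (ω ω' : Form M j) (x : M) : (ω - ω') x = ω x - ω' x := rfl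

lemma Form.smul_apply (c : ℝ) (ω : Form M j) (x : M) : (c • ω) x = c • ω x := rfl

lemma Form.zero_apply (x : M) : (0 : Form M j) x = 0 := rfl

/-- The expression of `ω` in the coordinate system `e`, that is, the pull-back of `ω` under
`e.symm : e.target → M`. (On `e.target` the differential of `e.symm` at `u` takes its values in the
tangent space, so that the orthogonal projection only restricts the codomain.) -/
def pullback (e : OpenPartialHomeomorph M (EuclideanSpace ℝ (Fin m))) (ω : Form M j)
    (u : EuclideanSpace ℝ (Fin m)) : EuclideanSpace ℝ (Fin m) [⋀^Fin j]→L[ℝ] ℝ :=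
  (ω (e.symm u)).compContinuousLinearMap
    ((tangentSpaceAt M (e.symm u)).orthogonalProjectionOnto ∘L
      fderiv ℝ (fun u => (e.symm u : EuclideanSpace ℝ (Fin n))) u)

/-- `ω x` extended to all of `ℝ^n` through the orthogonal projection onto `T_x M`. -/
def ambient (ω : Form M j) (x : M) : EuclideanSpace ℝ (Fin n) [⋀^Fin j]→L[ℝ] ℝ :=
  (ω x).compContinuousLinearMap (tangentSpaceAt M x).orthogonalProjectionOnto

/-! ### Smooth forms, weakly differentiable forms, `L^p` forms -/

/-- `ω` is `C^∞`. -/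
def IsSmooth (m : ℕ) (ω : Form M j) : Prop :=
  ∀ e : OpenPartialHomeomorph M (EuclideanSpace ℝ (Fin m)), IsCoord e →
    ContDiffOn ℝ (⊤ : ℕ∞) (pullback e ω) e.target

/-- `η = dω` (for a smooth form `ω`). -/
def IsExtDeriv (m : ℕ) (ω : Form M j) (η : Form M (j + 1)) : Prop :=
  ∀ e : OpenPartialHomeomorph M (EuclideanSpace ℝ (Fin m)), IsCoord e →
    ∀ u ∈ e.target, pullback e η u = extDeriv (pullback e ω) u

/-- `η` is a weak exterior differential of `ω`. It is determined by `ω` almost everywhere. -/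
def IsWeakExtDeriv (m : ℕ) (ω : Form M j) (η : Form M (j + 1)) : Prop :=
  ∀ e : OpenPartialHomeomorph M (EuclideanSpace ℝ (Fin m)), IsCoord e →
    IsWeakExtDerivOn e.target (pullback e ω) (pullback e η)

/-- The `L^p` norm of `ω`, possibly infinite; `‖ω x‖` is the norm of the multilinear map `ω x` on
`T_x M`. -/
def lpNorm (m : ℕ) (p : ℝ≥0∞) (ω : Form M j) : ℝ≥0∞ :=
  eLpNorm (fun x => ‖ω x‖) p (vol m M)

/-- `ω` is (measurable and) `L^p`. -/
structure IsLp (m : ℕ) (p : ℝ≥0∞) (ω : Form M j) : Prop where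
  aestronglyMeasurable : AEStronglyMeasurable (ambient ω) (vol m M)
  lpNorm_lt_top : lpNorm m p ω < ∞

/-- The support of a form that is given up to a null set: the complement of the largest open
subset of `M` on which it vanishes almost everywhere. -/
def essSupport (m : ℕ) (ω : Form M j) : Set M :=
  {x | ∀ U ∈ 𝓝 x, ¬ ∀ᵐ y ∂(vol m M), y ∈ U → ω y = 0}

/-! ### Linearity -/

lemma pullback_add (e : OpenPartialHomeomorph M (EuclideanSpace ℝ (Fin m))) (ω ω' : Form M j) :
    pullback e (ω + ω') = pullback e ω + pullback e ω' := rfl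

lemma pullback_smul (e : OpenPartialHomeomorph M (EuclideanSpace ℝ (Fin m))) (c : ℝ)
    (ω : Form M j) : pullback e (c • ω) = c • pullback e ω := rfl

lemma pullback_zero (e : OpenPartialHomeomorph M (EuclideanSpace ℝ (Fin m))) :
    pullback e (0 : Form M j) = 0 := rfl

lemma norm_ambient (ω : Form M j) (x : M) : ‖ambient ω x‖ = ‖ω x‖ := by
  apply le_antisymm
  · refine (ContinuousAlternatingMap.norm_compContinuousLinearMap_le _ _).trans ?_
    refine mul_le_of_le_one_right (norm_nonneg (ω x)) ?_
    exact pow_le_one₀ (norm_nonneg (tangentSpaceAt M x).orthogonalProjectionOnto)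
      (Submodule.orthogonalProjectionOnto_norm_le _)
  · refine ContinuousAlternatingMap.opNorm_le_bound _ (norm_nonneg _) fun v => ?_
    have := (ambient ω x).le_opNorm (fun i => (v i : EuclideanSpace ℝ (Fin n)))
    simpa [ambient, Function.comp_def] using this

lemma isLp_iff_memLp {p : ℝ≥0∞} {ω : Form M j} :
    IsLp m p ω ↔ MemLp (ambient ω) p (vol m M) := by
  have : eLpNorm (ambient ω) p (vol m M) = lpNorm m p ω := by
    rw [lpNorm, ← eLpNorm_norm]
    simp only [norm_ambient]
  exact ⟨fun h => ⟨h.1, this ▸ h.2⟩, fun h => ⟨h.1, this ▸ h.2⟩⟩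

lemma ambient_add (ω ω' : Form M j) : ambient (ω + ω') = ambient ω + ambient ω' := rfl

lemma ambient_smul (c : ℝ) (ω : Form M j) : ambient (c • ω) = c • ambient ω := rfl

lemma ambient_zero : ambient (0 : Form M j) = 0 := rfl

lemma IsLp.add {p : ℝ≥0∞} {ω ω' : Form M j} (h : IsLp m p ω) (h' : IsLp m p ω') :
    IsLp m p (ω + ω') := by
  rw [isLp_iff_memLp, ambient_add]
  exact MemLp.add (ε := EuclideanSpace ℝ (Fin n) [⋀^Fin j]→L[ℝ] ℝ)
    (isLp_iff_memLp.1 h) (isLp_iff_memLp.1 h')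

lemma IsLp.smul {p : ℝ≥0∞} {ω : Form M j} (c : ℝ) (h : IsLp m p ω) : IsLp m p (c • ω) := by
  rw [isLp_iff_memLp, ambient_smul]
  exact (isLp_iff_memLp.1 h).const_smul c

lemma IsLp.zero {p : ℝ≥0∞} : IsLp m p (0 : Form M j) := by
  rw [isLp_iff_memLp, ambient_zero]
  exact MemLp.zero (ε := EuclideanSpace ℝ (Fin n) [⋀^Fin j]→L[ℝ] ℝ)

lemma IsSmooth.add {ω ω' : Form M j} (h : IsSmooth m ω) (h' : IsSmooth m ω') :
    IsSmooth m (ω + ω') := fun e he => by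
  rw [pullback_add]; exact (h e he).add (h' e he)

lemma IsSmooth.smul {ω : Form M j} (c : ℝ) (h : IsSmooth m ω) : IsSmooth m (c • ω) :=
  fun e he => by rw [pullback_smul]; exact contDiffOn_const.smul (h e he)

lemma IsSmooth.zero : IsSmooth m (0 : Form M j) := fun e _ => by
  rw [pullback_zero]; exact contDiffOn_const

lemma IsSmooth.differentiableAt {ω : Form M j} (h : IsSmooth m ω)
    {e : OpenPartialHomeomorph M (EuclideanSpace ℝ (Fin m))} (he : IsCoord e)
    {u : EuclideanSpace ℝ (Fin m)} (hu : u ∈ e.target) : DifferentiableAt ℝ (pullback e ω) u :=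
  ((h e he).contDiffAt (e.open_target.mem_nhds hu)).differentiableAt (by simp)

lemma IsExtDeriv.add {ω ω' : Form M j} {η η' : Form M (j + 1)} (hω : IsSmooth m ω)
    (hω' : IsSmooth m ω') (h : IsExtDeriv m ω η) (h' : IsExtDeriv m ω' η') :
    IsExtDeriv m (ω + ω') (η + η') := fun e he u hu => by
  rw [pullback_add, pullback_add, extDeriv_add (hω.differentiableAt he hu)
    (hω'.differentiableAt he hu), Pi.add_apply, h e he u hu, h' e he u hu]

lemma IsExtDeriv.smul {ω : Form M j} {η : Form M (j + 1)} (c : ℝ)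
    (h : IsExtDeriv m ω η) : IsExtDeriv m (c • ω) (c • η) := fun e he u hu => by
  rw [pullback_smul, pullback_smul, extDeriv_smul, Pi.smul_apply, h e he u hu]

lemma IsExtDeriv.zero : IsExtDeriv m (0 : Form M j) 0 := fun e _ u _ => by
  rw [pullback_zero, pullback_zero]
  have := extDeriv_smul (x := u) (0 : ℝ)
    (0 : EuclideanSpace ℝ (Fin m) → EuclideanSpace ℝ (Fin m) [⋀^Fin j]→L[ℝ] ℝ)
  rw [zero_smul, zero_smul] at this
  rw [this]; rfl

lemma wedgeTop_add_left {k : ℕ} (h : j + k = m)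
    (α α' : EuclideanSpace ℝ (Fin m) [⋀^Fin j]→L[ℝ] ℝ)
    (β : EuclideanSpace ℝ (Fin m) [⋀^Fin k]→L[ℝ] ℝ) :
    wedgeTop h (α + α') β = wedgeTop h α β + wedgeTop h α' β := by
  simp only [wedgeTop, ContinuousAlternatingMap.add_apply, add_mul, mul_add,
    Finset.sum_add_distrib]

lemma wedgeTop_smul_left {k : ℕ} (h : j + k = m) (c : ℝ)
    (α : EuclideanSpace ℝ (Fin m) [⋀^Fin j]→L[ℝ] ℝ)
    (β : EuclideanSpace ℝ (Fin m) [⋀^Fin k]→L[ℝ] ℝ) :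
    wedgeTop h (c • α) β = c * wedgeTop h α β := by
  simp only [wedgeTop, ContinuousAlternatingMap.smul_apply, smul_eq_mul, Finset.mul_sum]
  refine Finset.sum_congr rfl fun σ _ => by ring

lemma wedgeTop_zero_left {k : ℕ} (h : j + k = m)
    (β : EuclideanSpace ℝ (Fin m) [⋀^Fin k]→L[ℝ] ℝ) : wedgeTop h 0 β = 0 := by
  simp [wedgeTop]

lemma wedgeTop_zero_right {k : ℕ} (h : j + k = m)
    (α : EuclideanSpace ℝ (Fin m) [⋀^Fin j]→L[ℝ] ℝ) : wedgeTop h α 0 = 0 := by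
  simp [wedgeTop]

lemma IsTestForm.extDeriv {k : ℕ} {U : Set (EuclideanSpace ℝ (Fin m))}
    {φ : EuclideanSpace ℝ (Fin m) → EuclideanSpace ℝ (Fin m) [⋀^Fin k]→L[ℝ] ℝ}
    (h : IsTestForm U φ) : IsTestForm U (extDeriv φ) := by
  have hs : tsupport (_root_.extDeriv φ) ⊆ tsupport φ := by
    refine closure_minimal (fun x hx => ?_) (isClosed_tsupport _)
    by_contra hx'
    apply hx
    have h0 : fderiv ℝ φ x = 0 :=
      Function.notMem_support.1 fun h1 => hx' (support_fderiv_subset ℝ h1)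
    simp only [_root_.extDeriv, h0]
    exact map_zero (ContinuousAlternatingMap.alternatizeUncurryFinCLM ℝ _ ℝ)
  refine ⟨?_, h.2.mono' (subset_closure.trans hs), hs.trans h.3⟩
  exact (ContinuousAlternatingMap.alternatizeUncurryFinCLM ℝ _ ℝ).contDiff.comp
    (h.1.fderiv_right (m := (⊤ : ℕ∞)) (by simp))

lemma integrableOn_wedgeTop {k : ℕ} (h : j + k = m) {U : Set (EuclideanSpace ℝ (Fin m))}
    (hU : IsOpen U)
    {α : EuclideanSpace ℝ (Fin m) → EuclideanSpace ℝ (Fin m) [⋀^Fin j]→L[ℝ] ℝ}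
    {φ : EuclideanSpace ℝ (Fin m) → EuclideanSpace ℝ (Fin m) [⋀^Fin k]→L[ℝ] ℝ}
    (hα : LocallyIntegrableOn α U volume) (hφ : IsTestForm U φ) :
    IntegrableOn (fun u => wedgeTop h (α u) (φ u)) U volume := by
  have hK : IsCompact (tsupport φ) := hφ.2
  have hαK : IntegrableOn α (tsupport φ) volume :=
    hα.integrableOn_compact_subset hφ.3 hK
  have key : IntegrableOn (fun u => wedgeTop h (α u) (φ u)) (tsupport φ) volume := by
    unfold wedgeTop
    refine Integrable.const_mul (integrable_finsetSum _ fun σ _ => Integrable.const_mul ?_ _) _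
    refine IntegrableOn.mul_continuousOn (K := tsupport φ) ?_ ?_ hK
    · exact (ContinuousAlternatingMap.apply ℝ _ ℝ _).integrable_comp hαK
    · exact ((ContinuousAlternatingMap.apply ℝ _ ℝ _).continuous.comp
        hφ.1.continuous).continuousOn
  refine key.of_forall_sdiff_eq_zero hU.measurableSet fun x hx => ?_
  rw [image_eq_zero_of_notMem_tsupport hx.2, wedgeTop_zero_right]

lemma IsWeakExtDeriv.add {ω ω' : Form M j} {η η' : Form M (j + 1)}
    (h : IsWeakExtDeriv m ω η) (h' : IsWeakExtDeriv m ω' η') :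
    IsWeakExtDeriv m (ω + ω') (η + η') := fun e he => by
  have a := h e he
  have a' := h' e he
  refine ⟨by
      rw [pullback_add]
      exact LocallyIntegrableOn.add (ε'' := EuclideanSpace ℝ (Fin m) [⋀^Fin j]→L[ℝ] ℝ) a.1 a'.1,
    by
      rw [pullback_add]
      exact LocallyIntegrableOn.add (ε'' := EuclideanSpace ℝ (Fin m) [⋀^Fin (j + 1)]→L[ℝ] ℝ)
        a.2 a'.2,
    fun k hk hk' φ hφ => ?_⟩
  simp only [pullback_add, Pi.add_apply, wedgeTop_add_left]
  rw [integral_add (integrableOn_wedgeTop hk' e.open_target a.1 hφ.extDeriv)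
      (integrableOn_wedgeTop hk' e.open_target a'.1 hφ.extDeriv),
    integral_add (integrableOn_wedgeTop hk e.open_target a.2 hφ)
      (integrableOn_wedgeTop hk e.open_target a'.2 hφ),
    a.3 k hk hk' φ hφ, a'.3 k hk hk' φ hφ, mul_add]

lemma IsWeakExtDeriv.smul {ω : Form M j} {η : Form M (j + 1)} (c : ℝ)
    (h : IsWeakExtDeriv m ω η) : IsWeakExtDeriv m (c • ω) (c • η) := fun e he => by
  have a := h e he
  refine ⟨by rw [pullback_smul]; exact a.1.smul c, by rw [pullback_smul]; exact a.2.smul c,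
    fun k hk hk' φ hφ => ?_⟩
  simp only [pullback_smul, Pi.smul_apply, wedgeTop_smul_left]
  rw [integral_const_mul, integral_const_mul, a.3 k hk hk' φ hφ]
  ring

lemma IsWeakExtDeriv.zero : IsWeakExtDeriv m (0 : Form M j) 0 := fun e _ => by
  have hz : ∀ i : ℕ, LocallyIntegrableOn (pullback e (0 : Form M i)) e.target volume := fun i => by
    rw [pullback_zero]; exact fun x _ =>
      ⟨Set.univ, univ_mem, integrableOn_zero (ε' := EuclideanSpace ℝ (Fin m) [⋀^Fin i]→L[ℝ] ℝ)⟩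
  refine ⟨hz _, hz _, fun k hk hk' φ _ => ?_⟩
  simp [pullback_zero, wedgeTop_zero_left]

/-- `d̄ d̄ = 0`. -/
lemma IsWeakExtDeriv.isWeakExtDeriv_zero {ω : Form M j} {η : Form M (j + 1)}
    (h : IsWeakExtDeriv m ω η) : IsWeakExtDeriv m η 0 := fun e he => by
  have a := h e he
  refine ⟨a.2, (IsWeakExtDeriv.zero (m := m) e he).2, fun k hk hk' φ hφ => ?_⟩
  have b := a.3 (k + 1) hk' (by omega) (extDeriv φ) hφ.extDeriv
  rw [extDeriv_extDeriv hφ.1 (by simpa using ENat.LEInfty.out)] at b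
  simp only [Pi.zero_apply, wedgeTop_zero_right, integral_zero] at b
  have b' := (mul_eq_zero.1 b.symm).resolve_left (by simp)
  rw [b']
  simp [pullback_zero, wedgeTop_zero_left]

/-! ### Spaces of forms and cohomology -/

/-- `Ω^j(M)`: the smooth `j`-forms. -/
def smoothForms (m : ℕ) (M : Set (EuclideanSpace ℝ (Fin n))) (j : ℕ) :
    Submodule ℝ (Form M j) where
  carrier := {ω | IsSmooth m ω}
  add_mem' := IsSmooth.add
  zero_mem' := IsSmooth.zero
  smul_mem' c _ h := h.smul c

/-- `Ω̄^j(M)`: the weakly differentiable `j`-forms. -/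
def weakForms (m : ℕ) (M : Set (EuclideanSpace ℝ (Fin n))) (j : ℕ) :
    Submodule ℝ (Form M j) where
  carrier := {ω | ∃ η, IsWeakExtDeriv m ω η}
  add_mem' := fun ⟨η, h⟩ ⟨η', h'⟩ => ⟨η + η', h.add h'⟩
  zero_mem' := ⟨0, .zero⟩
  smul_mem' := fun c _ ⟨η, h⟩ => ⟨c • η, h.smul c⟩

/-- A weak exterior differential is itself weakly differentiable. -/
lemma IsWeakExtDeriv.mem_weakForms {ω : Form M j} {η : Form M (j + 1)}
    (h : IsWeakExtDeriv m ω η) : η ∈ weakForms m M (j + 1) :=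
  ⟨0, h.isWeakExtDeriv_zero⟩

/-- `Ω_p^j(M)`: the smooth `L^p` forms `ω` for which `dω` is `L^p`. -/
def smoothLpForms (m : ℕ) (M : Set (EuclideanSpace ℝ (Fin n))) (p : ℝ≥0∞) (j : ℕ) :
    Submodule ℝ (Form M j) where
  carrier := {ω | IsSmooth m ω ∧ IsLp m p ω ∧ ∃ η, IsExtDeriv m ω η ∧ IsLp m p η}
  add_mem' := fun ⟨s, l, η, d, l'⟩ ⟨s₁, l₁, η₁, d₁, l₁'⟩ =>
    ⟨s.add s₁, l.add l₁, η + η₁, d.add s s₁ d₁, l'.add l₁'⟩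
  zero_mem' := ⟨.zero, .zero, 0, .zero, .zero⟩
  smul_mem' := fun c _ ⟨s, l, η, d, l'⟩ => ⟨s.smul c, l.smul c, c • η, d.smul c, l'.smul c⟩

/-- `Ω̄_p^j(M)`: the weakly differentiable `L^p` forms `ω` for which `d̄ω` is `L^p`. -/
def weakLpForms (m : ℕ) (M : Set (EuclideanSpace ℝ (Fin n))) (p : ℝ≥0∞) (j : ℕ) :
    Submodule ℝ (Form M j) where
  carrier := {ω | IsLp m p ω ∧ ∃ η, IsWeakExtDeriv m ω η ∧ IsLp m p η}
  add_mem' := fun ⟨l, η, d, l'⟩ ⟨l₁, η₁, d₁, l₁'⟩ => ⟨l.add l₁, η + η₁, d.add d₁, l'.add l₁'⟩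
  zero_mem' := ⟨.zero, 0, .zero, .zero⟩
  smul_mem' := fun c _ ⟨l, η, d, l'⟩ => ⟨l.smul c, c • η, d.smul c, l'.smul c⟩

/-- The kernel of `d` on `Ω_p^j(M)`. -/
def smoothCocycles (m : ℕ) (M : Set (EuclideanSpace ℝ (Fin n))) (p : ℝ≥0∞) (j : ℕ) :
    Submodule ℝ (Form M j) where
  carrier := {ω | ω ∈ smoothLpForms m M p j ∧ IsExtDeriv m ω 0}
  add_mem' := fun ⟨a, d⟩ ⟨a', d'⟩ =>
    ⟨add_mem a a', by simpa using d.add a.1 a'.1 d'⟩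
  zero_mem' := ⟨zero_mem _, .zero⟩
  smul_mem' := fun c _ ⟨a, d⟩ => ⟨Submodule.smul_mem _ c a, by simpa using d.smul c⟩

/-- The image of `d` in degree `j`. -/
def smoothCoboundaries (m : ℕ) (M : Set (EuclideanSpace ℝ (Fin n))) (p : ℝ≥0∞) :
    (j : ℕ) → Submodule ℝ (Form M j)
  | 0 => ⊥
  | j + 1 =>
    { carrier := {ω | ∃ α ∈ smoothLpForms m M p j, IsExtDeriv m α ω}
      add_mem' := fun ⟨α, a, d⟩ ⟨α', a', d'⟩ => ⟨α + α', add_mem a a', d.add a.1 a'.1 d'⟩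
      zero_mem' := ⟨0, zero_mem _, .zero⟩
      smul_mem' := fun c _ ⟨α, a, d⟩ => ⟨c • α, Submodule.smul_mem _ c a, d.smul c⟩ }

/-- The `L^p` cohomology `H_p^j(M)` of smooth forms. -/
abbrev smoothCohomology (m : ℕ) (M : Set (EuclideanSpace ℝ (Fin n))) (p : ℝ≥0∞) (j : ℕ) : Type :=
  smoothCocycles m M p j ⧸ (smoothCoboundaries m M p j).submoduleOf (smoothCocycles m M p j)

/-- The kernel of `d̄` on `Ω̄_p^j(M)`. -/
def weakCocycles (m : ℕ) (M : Set (EuclideanSpace ℝ (Fin n))) (p : ℝ≥0∞) (j : ℕ) :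
    Submodule ℝ (Form M j) where
  carrier := {ω | ω ∈ weakLpForms m M p j ∧ IsWeakExtDeriv m ω 0}
  add_mem' := fun ⟨a, d⟩ ⟨a', d'⟩ => ⟨add_mem a a', by simpa using d.add d'⟩
  zero_mem' := ⟨zero_mem _, .zero⟩
  smul_mem' := fun c _ ⟨a, d⟩ => ⟨Submodule.smul_mem _ c a, by simpa using d.smul c⟩

/-- The image of `d̄` in degree `j`. Weakly differentiable forms that agree almost everywhere are
identified: in degree `0` the image consists of the forms that vanish almost everywhere, and in
positive degree it contains these forms, since `d̄α` is only determined almost everywhere. -/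
def weakCoboundaries (m : ℕ) (M : Set (EuclideanSpace ℝ (Fin n))) (p : ℝ≥0∞) :
    (j : ℕ) → Submodule ℝ (Form M j)
  | 0 =>
    { carrier := {ω | ∀ᵐ x ∂(vol m M), ω x = 0}
      add_mem' := fun {ω ω'} h h' => by
        rw [Set.mem_ofPred_eq] at h h' ⊢
        filter_upwards [h, h'] with x hx hx'
        rw [Form.add_apply, hx, hx', add_zero]
      zero_mem' := by
        rw [Set.mem_ofPred_eq]
        exact Eventually.of_forall fun _ => rfl
      smul_mem' := fun c ω h => by
        rw [Set.mem_ofPred_eq] at h ⊢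
        filter_upwards [h] with x hx
        rw [Form.smul_apply, hx, smul_zero] }
  | j + 1 =>
    { carrier := {ω | ∃ α ∈ weakLpForms m M p j, IsWeakExtDeriv m α ω}
      add_mem' := fun ⟨α, a, d⟩ ⟨α', a', d'⟩ => ⟨α + α', add_mem a a', d.add d'⟩
      zero_mem' := ⟨0, zero_mem _, .zero⟩
      smul_mem' := fun c _ ⟨α, a, d⟩ => ⟨c • α, Submodule.smul_mem _ c a, d.smul c⟩ }

/-- The `L^p` cohomology `H̄_p^j(M)` of weakly differentiable forms. -/
abbrev weakCohomology (m : ℕ) (M : Set (EuclideanSpace ℝ (Fin n))) (p : ℝ≥0∞) (j : ℕ) : Type :=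
  weakCocycles m M p j ⧸ (weakCoboundaries m M p j).submoduleOf (weakCocycles m M p j)

end

end LpForms

/-!
The operators are averages over small displacements of the points of `M`. Let `π` be the nearest
point retraction of a neighborhood `N` of `M` onto `M` (`exists_isTubularRetraction`), and let `ε` be
a smooth function, positive on `M`, that is small compared with the distance from the boundary of `N`
and with the scale on which the differential of `π` varies, and has a small Lipschitz constant `κ`
(`IsScale`, `IsTubularRetraction.exists_isScale`). For a form `ω` on `M`, `Rω` is the restriction to
`M` of the average over `t`, with respect to a smooth density on the unit ball of `ℝ^n`, of the
pull-backs of `π^*ω` under `x ↦ x + ε(x) t`. The operator `A` is the average of the contractions with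
`∂/∂s` of the pull-backs under `(s, x) ↦ x + s ε(x) t`, over `t` and `s ∈ [0, 1]`. For smooth `ω` the
homotopy formula on the cylinder (`hasDerivAt_cylinder`), integrated over `s` and `t`, gives
`Rω - ω = dAω + Adω` (`IsScale.isExtDeriv_homForm`).

For the `L^p` bounds, the displacement followed by `π` is a small perturbation of the identity of
`M`, hence antilipschitz with constant `2`, so that preimages have at most `2 ^ m` times the volume
(`IsScale.map_move_le`). With Minkowski's integral inequality this bounds the averages in every
`L^p`, with a constant that does not depend on `p` (`IsKernel.eLpNorm_le`), and also locally in `L^1`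
(`IsKernel.setLIntegral_le`). In particular `Aω` exists almost everywhere for locally integrable `ω`.
It is linear in `ω` up to null sets, and a linear choice of representatives yields a linear operator
(`IsScale.exists_homOp`). On the other hand `π^*ω` is locally integrable near `M`
(`IsScale.integrableOn_extForm`), and the substitution `y = x + ε(x) t` turns `Rω` into an integral
against a smooth kernel. Hence `Rω` exists at every point and is smooth
(`IsScale.contDiffAt_average`).

Weakly differentiable forms are, together with their weak differentials, local `L^1` limits of smooth
forms, by mollification in coordinates (`IsWeakExtDerivOn.exists_approx`, `exists_hasSmoothApprox`).
Both sides of the homotopy formula are continuous under such limits, because of the local `L^1`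
bounds, so it holds for weakly differentiable forms (`IsScale.isWeakExtDeriv_homForm`, and
`IsScale.ae_regForm_sub_eq` in degree `0`).

The sequences of operators belong to scales with `κ → 0`. The bound for `A` contains the factor `κ`.
For `R` the convergence in `L^p`, `p < ∞`, reduces to that of composition with maps that tend
uniformly to the identity and have bounded effect on the measure (`tendsto_eLpNorm_comp_sub`). Points
are displaced by at most `8 κ`, which gives the statement on supports
(`IsAveraging.essSupport_subset`).

The isomorphism in cohomology needs a single scale. A weakly closed form `ω` is cohomologous to the
smooth closed form `Rω`, since `Rω - ω` is the weak differential of `Aω`. If a smooth form `ω` is the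
weak differential of `α`, then it is the differential of the smooth form `Rα - Aω`
(`IsScale.isExtDeriv_regForm_sub`).
-/

namespace LpForms

noncomputable section

/-! ### Pulling back alternating maps -/

section Alternating

variable {E F : Type*} [NormedAddCommGroup E] [NormedSpace ℝ E]
  [NormedAddCommGroup F] [NormedSpace ℝ F] {j : ℕ}

instance finiteDimensional_continuousAlternatingMap [FiniteDimensional ℝ E] :
    FiniteDimensional ℝ (E [⋀^Fin j]→L[ℝ] ℝ) := by
  let T : (E [⋀^Fin j]→L[ℝ] ℝ) →ₗ[ℝ] MultilinearMap ℝ (fun _ : Fin j => E) ℝ :=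
    { toFun := fun f => f.toContinuousMultilinearMap.toMultilinearMap
      map_add' := fun _ _ => rfl
      map_smul' := fun _ _ => rfl }
  refine Module.Finite.of_injective T fun f g h => ?_
  ext v
  exact congrArg (fun q : MultilinearMap ℝ (fun _ : Fin j => E) ℝ => q v) h

/-- In finite dimensions, a map into the alternating maps is smooth as soon as its composition with
the inclusion into the multilinear maps is. -/
lemma contDiff_of_toContinuousMultilinearMap [FiniteDimensional ℝ E] {k : WithTop ℕ∞}
    {f : F → E [⋀^Fin j]→L[ℝ] ℝ}
    (h : ContDiff ℝ k fun x => (f x).toContinuousMultilinearMap) : ContDiff ℝ k f := by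
  let T := (ContinuousAlternatingMap.toContinuousMultilinearMapCLM (𝕜 := ℝ) (E := E) (F := ℝ)
    (ι := Fin j) ℝ)
  have hT : Function.Injective T := ContinuousAlternatingMap.toContinuousMultilinearMap_injective
  let T' : ContinuousMultilinearMap ℝ (fun _ : Fin j => E) ℝ →ₗ[ℝ]
      MultilinearMap ℝ (fun _ : Fin j => E) ℝ :=
    { toFun := fun f => f.toMultilinearMap
      map_add' := fun _ _ => rfl
      map_smul' := fun _ _ => rfl }
  have : FiniteDimensional ℝ (ContinuousMultilinearMap ℝ (fun _ : Fin j => E) ℝ) := by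
    refine Module.Finite.of_injective T' fun f g h => ?_
    ext v
    exact congrArg (fun q : MultilinearMap ℝ (fun _ : Fin j => E) ℝ => q v) h
  obtain ⟨g, hg⟩ := T.toLinearMap.exists_leftInverse_of_injective (LinearMap.ker_eq_bot.2 hT)
  have : f = fun x => LinearMap.toContinuousLinearMap g ((f x).toContinuousMultilinearMap) := by
    funext x
    exact (LinearMap.congr_fun hg (f x)).symm
  rw [this]
  exact (LinearMap.toContinuousLinearMap g).contDiff.comp h

lemma contDiff_compContinuousLinearMap [FiniteDimensional ℝ E] {k : WithTop ℕ∞} :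
    ContDiff ℝ k (fun q : (F [⋀^Fin j]→L[ℝ] ℝ) × (E →L[ℝ] F) =>
      q.1.compContinuousLinearMap q.2) := by
  apply contDiff_of_toContinuousMultilinearMap
  change ContDiff ℝ k (fun q : (F [⋀^Fin j]→L[ℝ] ℝ) × (E →L[ℝ] F) =>
    ContinuousMultilinearMap.compContinuousLinearMapContinuousMultilinear ℝ
        (fun _ : Fin j ↦ E) (fun _ ↦ F) ℝ (fun _ => q.2)
      (ContinuousAlternatingMap.toContinuousMultilinearMapCLM (𝕜 := ℝ) ℝ q.1))
  refine ContDiff.clm_apply ?_ ?_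
  · exact (ContinuousMultilinearMap.contDiff _).comp (contDiff_pi.2 fun _ => contDiff_snd)
  · exact (ContinuousLinearMap.contDiff _).comp contDiff_fst

lemma continuous_compContinuousLinearMap [FiniteDimensional ℝ E] :
    Continuous (fun q : (F [⋀^Fin j]→L[ℝ] ℝ) × (E →L[ℝ] F) =>
      q.1.compContinuousLinearMap q.2) :=
  (contDiff_compContinuousLinearMap (k := 0)).continuous

lemma contDiff_curryLeft_apply {k : WithTop ℕ∞} :
    ContDiff ℝ k (fun q : (E [⋀^Fin (j + 1)]→L[ℝ] ℝ) × E => q.1.curryLeft q.2) := by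
  let L : (E [⋀^Fin (j + 1)]→L[ℝ] ℝ) →L[ℝ] (E →L[ℝ] E [⋀^Fin j]→L[ℝ] ℝ) :=
    (ContinuousAlternatingMap.curryLeftLI (𝕜 := ℝ) (E := E) (F := ℝ)
      (n := j)).toContinuousLinearMap
  have hL := ContinuousLinearMap.contDiff (𝕜 := ℝ) (E := E [⋀^Fin (j + 1)]→L[ℝ] ℝ)
    (F := E →L[ℝ] E [⋀^Fin j]→L[ℝ] ℝ) (n := k) L
  have h : ContDiff ℝ k (fun q : (E [⋀^Fin (j + 1)]→L[ℝ] ℝ) × E => L q.1) :=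
    hL.comp contDiff_fst
  exact h.clm_apply contDiff_snd

lemma norm_curryLeft_apply_le (f : E [⋀^Fin (j + 1)]→L[ℝ] ℝ) (v : E) :
    ‖f.curryLeft v‖ ≤ ‖f‖ * ‖v‖ := by
  simpa using f.curryLeft.le_opNorm v

end Alternating

/-! ### The wedge pairing -/

section Wedge

variable {m : ℕ}

/-- The product `λ ∧ α` of a linear form with an alternating map. -/
def linWedge {E : Type*} [NormedAddCommGroup E] [NormedSpace ℝ E] {j : ℕ} (l : E →L[ℝ] ℝ)
    (α : E [⋀^Fin j]→L[ℝ] ℝ) : E [⋀^Fin (j + 1)]→L[ℝ] ℝ :=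
  .alternatizeUncurryFin (l.smulRight α)

lemma linWedge_apply {E : Type*} [NormedAddCommGroup E] [NormedSpace ℝ E] {j : ℕ} (l : E →L[ℝ] ℝ)
    (α : E [⋀^Fin j]→L[ℝ] ℝ) (v : Fin (j + 1) → E) :
    linWedge l α v = ∑ i : Fin (j + 1), (-1 : ℝ) ^ (i : ℕ) * (l (v i) * α (i.removeNth v)) := by
  simp [linWedge, ContinuousAlternatingMap.alternatizeUncurryFin_apply]

/-- The expansion of `λ ∧ α` with its signs read as signs of the cycles `(0 1 … i)`, which move the
`i`-th argument to the front. -/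
lemma linWedge_eq_sum_cycleRange {E : Type*} [NormedAddCommGroup E] [NormedSpace ℝ E] {j : ℕ}
    (l : E →L[ℝ] ℝ) (α : E [⋀^Fin j]→L[ℝ] ℝ) (v : Fin (j + 1) → E) :
    linWedge l α v = ∑ i : Fin (j + 1), ((Equiv.Perm.sign i.cycleRange : ℤ) : ℝ) *
      (l (v (i.cycleRange.symm 0)) * α fun p => v (i.cycleRange.symm p.succ)) := by
  rw [linWedge_apply]
  refine Finset.sum_congr rfl fun i _ => ?_
  have : i.removeNth v = fun p => v (i.succAbove p) := rfl
  simp [Fin.sign_cycleRange, this]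

/-- The signed sum over all permutations of a function of the permuted indices. -/
def signedSum (Q : (Fin m → Fin m) → ℝ) : ℝ :=
  ∑ σ : Equiv.Perm (Fin m), ((Equiv.Perm.sign σ : ℤ) : ℝ) * Q σ

lemma signedSum_comp (τ : Equiv.Perm (Fin m)) (Q : (Fin m → Fin m) → ℝ) :
    signedSum (fun σ => Q (σ ∘ τ)) = ((Equiv.Perm.sign τ : ℤ) : ℝ) * signedSum Q := by
  unfold signedSum
  rw [← Equiv.sum_comp (Equiv.mulRight τ) fun σ : Equiv.Perm (Fin m) =>
    ((Equiv.Perm.sign σ : ℤ) : ℝ) * Q σ, Finset.mul_sum]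
  refine Finset.sum_congr rfl fun σ _ => ?_
  simp only [Equiv.coe_mulRight, Equiv.Perm.coe_mul, map_mul, Units.val_mul, Int.cast_mul]
  have h : ((Equiv.Perm.sign τ : ℤ) : ℝ) * ((Equiv.Perm.sign τ : ℤ) : ℝ) = 1 := by
    rw [← Int.cast_mul, Int.units_coe_mul_self, Int.cast_one]
  linear_combination -(((Equiv.Perm.sign σ : ℤ) : ℝ) * Q (σ ∘ τ)) * h

lemma wedgeTop_eq_signedSum {j k : ℕ} (h : j + k = m)
    (α : EuclideanSpace ℝ (Fin m) [⋀^Fin j]→L[ℝ] ℝ)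
    (β : EuclideanSpace ℝ (Fin m) [⋀^Fin k]→L[ℝ] ℝ) :
    wedgeTop h α β = ((j.factorial : ℝ) * (k.factorial : ℝ))⁻¹ * signedSum fun σ =>
      α (fun i => EuclideanSpace.single (σ (Fin.cast h (Fin.castAdd k i))) 1) *
        β (fun i => EuclideanSpace.single (σ (Fin.cast h (Fin.natAdd j i))) 1) := rfl

/-- The permutation of `Fin m` that acts by `c` on the first `j` indices and by `c'` on the last
`k` ones. -/
def blockPerm {j k : ℕ} (h : j + k = m) (c : Equiv.Perm (Fin j)) (c' : Equiv.Perm (Fin k)) :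
    Equiv.Perm (Fin m) :=
  (finSumFinEquiv.trans (finCongr h)).permCongr (Equiv.Perm.sumCongr c c')

lemma sign_blockPerm {j k : ℕ} (h : j + k = m) (c : Equiv.Perm (Fin j))
    (c' : Equiv.Perm (Fin k)) :
    Equiv.Perm.sign (blockPerm h c c') = Equiv.Perm.sign c * Equiv.Perm.sign c' := by
  rw [blockPerm, Equiv.Perm.sign_permCongr, Equiv.Perm.sign_sumCongr]

lemma blockPerm_castAdd {j k : ℕ} (h : j + k = m) (c : Equiv.Perm (Fin j))
    (c' : Equiv.Perm (Fin k)) (i : Fin j) :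
    blockPerm h c c' (Fin.cast h (Fin.castAdd k i)) = Fin.cast h (Fin.castAdd k (c i)) := by
  subst h; simp [blockPerm, Equiv.permCongr_apply]

lemma blockPerm_natAdd {j k : ℕ} (h : j + k = m) (c : Equiv.Perm (Fin j))
    (c' : Equiv.Perm (Fin k)) (i : Fin k) :
    blockPerm h c c' (Fin.cast h (Fin.natAdd j i)) = Fin.cast h (Fin.natAdd j (c' i)) := by
  subst h; simp [blockPerm, Equiv.permCongr_apply]

lemma signedSum_sum {ι : Type*} (s : Finset ι) (Q : ι → (Fin m → Fin m) → ℝ) :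
    signedSum (fun σ => ∑ i ∈ s, Q i σ) = ∑ i ∈ s, signedSum (Q i) := by
  unfold signedSum
  rw [Finset.sum_comm]
  simp only [Finset.mul_sum]

lemma signedSum_const_mul (c : ℝ) (Q : (Fin m → Fin m) → ℝ) :
    signedSum (fun σ => c * Q σ) = c * signedSum Q := by
  unfold signedSum
  rw [Finset.mul_sum]
  exact Finset.sum_congr rfl fun σ _ => by ring

lemma signedSum_sign_mul_comp (τ : Equiv.Perm (Fin m)) (Q : (Fin m → Fin m) → ℝ) :
    signedSum (fun σ => ((Equiv.Perm.sign τ : ℤ) : ℝ) * Q (σ ∘ τ)) = signedSum Q := by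
  rw [signedSum_const_mul, signedSum_comp, ← mul_assoc, ← Int.cast_mul, Int.units_coe_mul_self,
    Int.cast_one, one_mul]

/-- In the signed sum the `k + 1` terms of the expansion of `λ ∧ c` all contribute the same amount,
so that it suffices to take the one in which `λ` is in front. -/
lemma wedgeTop_linWedge_right {j k : ℕ} (h' : j + (k + 1) = m)
    (l : EuclideanSpace ℝ (Fin m) →L[ℝ] ℝ)
    (α : EuclideanSpace ℝ (Fin m) [⋀^Fin j]→L[ℝ] ℝ)
    (c : EuclideanSpace ℝ (Fin m) [⋀^Fin k]→L[ℝ] ℝ) :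
    wedgeTop h' α (linWedge l c) = ((j.factorial : ℝ) * (k.factorial : ℝ))⁻¹ * signedSum fun σ =>
      α (fun i => EuclideanSpace.single (σ (Fin.cast h' (Fin.castAdd (k + 1) i))) 1) *
        (l (EuclideanSpace.single (σ (Fin.cast h' (Fin.natAdd j 0))) 1) *
        c (fun i => EuclideanSpace.single (σ (Fin.cast h' (Fin.natAdd j i.succ))) 1)) := by
  rw [wedgeTop_eq_signedSum]
  simp only [linWedge_eq_sum_cycleRange, Finset.mul_sum]
  rw [signedSum_sum]
  have key : ∀ i : Fin (k + 1), (signedSum fun σ =>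
      α (fun i => EuclideanSpace.single (σ (Fin.cast h' (Fin.castAdd (k + 1) i))) 1) *
      (((Equiv.Perm.sign i.cycleRange : ℤ) : ℝ) *
        (l (EuclideanSpace.single (σ (Fin.cast h' (Fin.natAdd j (i.cycleRange.symm 0)))) 1) *
        c (fun p => EuclideanSpace.single
          (σ (Fin.cast h' (Fin.natAdd j (i.cycleRange.symm p.succ)))) 1)))) = signedSum fun σ =>
      α (fun i => EuclideanSpace.single (σ (Fin.cast h' (Fin.castAdd (k + 1) i))) 1) *
        (l (EuclideanSpace.single (σ (Fin.cast h' (Fin.natAdd j 0))) 1) *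
        c (fun i => EuclideanSpace.single (σ (Fin.cast h' (Fin.natAdd j i.succ))) 1)) := by
    intro i
    rw [← signedSum_sign_mul_comp (blockPerm h' 1 i.cycleRange)]
    simp only [Function.comp_apply, blockPerm_castAdd, blockPerm_natAdd, sign_blockPerm]
    congr 1
    funext σ
    have hs : (-1 : ℝ) ^ (i : ℕ) * (-1) ^ (i : ℕ) = 1 := by rw [← mul_pow]; simp
    simp only [Equiv.apply_symm_apply, Equiv.Perm.one_apply, map_one, one_mul,
      Fin.sign_cycleRange, Units.val_pow_eq_pow_val, Units.val_neg, Units.val_one, Int.cast_pow,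
      Int.cast_neg, Int.cast_one]
    linear_combination (α (fun i =>
        EuclideanSpace.single (σ (Fin.cast h' (Fin.castAdd (k + 1) i))) 1) *
        (l (EuclideanSpace.single (σ (Fin.cast h' (Fin.natAdd j 0))) 1) *
        c (fun i => EuclideanSpace.single (σ (Fin.cast h' (Fin.natAdd j i.succ))) 1))) * hs
  rw [Finset.sum_congr rfl fun i _ => key i, Finset.sum_const, Finset.card_univ, Fintype.card_fin,
    nsmul_eq_mul, Nat.factorial_succ]
  have : ((k : ℝ) + 1) ≠ 0 := by positivity
  push_cast
  field_simp

/-- As for `wedgeTop_linWedge_right`, with the term in which `λ` is evaluated at the last of the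
first `j + 1` arguments; the sign is that of the cycle that moves it there. -/
lemma wedgeTop_linWedge_left {j k : ℕ} (h : j + 1 + k = m) (l : EuclideanSpace ℝ (Fin m) →L[ℝ] ℝ)
    (α : EuclideanSpace ℝ (Fin m) [⋀^Fin j]→L[ℝ] ℝ)
    (c : EuclideanSpace ℝ (Fin m) [⋀^Fin k]→L[ℝ] ℝ) :
    wedgeTop h (linWedge l α) c =
      (-1) ^ j * (((j.factorial : ℝ) * (k.factorial : ℝ))⁻¹ * signedSum fun σ =>
      (l (EuclideanSpace.single (σ (Fin.cast h (Fin.castAdd k (Fin.last j)))) 1) *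
        α (fun i => EuclideanSpace.single (σ (Fin.cast h (Fin.castAdd k i.castSucc))) 1)) *
        c (fun i => EuclideanSpace.single (σ (Fin.cast h (Fin.natAdd (j + 1) i))) 1)) := by
  rw [wedgeTop_eq_signedSum]
  simp only [linWedge_eq_sum_cycleRange, Finset.sum_mul]
  rw [signedSum_sum]
  have key : ∀ i : Fin (j + 1), (signedSum fun σ =>
      (((Equiv.Perm.sign i.cycleRange : ℤ) : ℝ) *
        (l (EuclideanSpace.single (σ (Fin.cast h (Fin.castAdd k (i.cycleRange.symm 0)))) 1) *
        α (fun p => EuclideanSpace.single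
          (σ (Fin.cast h (Fin.castAdd k (i.cycleRange.symm p.succ)))) 1))) *
      c (fun i => EuclideanSpace.single (σ (Fin.cast h (Fin.natAdd (j + 1) i))) 1)) =
      signedSum fun σ =>
      (l (EuclideanSpace.single (σ (Fin.cast h (Fin.castAdd k 0))) 1) *
        α (fun i => EuclideanSpace.single (σ (Fin.cast h (Fin.castAdd k i.succ))) 1)) *
        c (fun i => EuclideanSpace.single (σ (Fin.cast h (Fin.natAdd (j + 1) i))) 1) := by
    intro i
    rw [← signedSum_sign_mul_comp (blockPerm h i.cycleRange 1)]
    simp only [Function.comp_apply, blockPerm_castAdd, blockPerm_natAdd, sign_blockPerm]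
    congr 1
    funext σ
    have hs : (-1 : ℝ) ^ (i : ℕ) * (-1) ^ (i : ℕ) = 1 := by rw [← mul_pow]; simp
    simp only [Equiv.apply_symm_apply, Equiv.Perm.one_apply, map_one, mul_one,
      Fin.sign_cycleRange, Units.val_pow_eq_pow_val, Units.val_neg, Units.val_one, Int.cast_pow,
      Int.cast_neg, Int.cast_one]
    linear_combination ((l (EuclideanSpace.single (σ (Fin.cast h (Fin.castAdd k 0))) 1) *
        α (fun i => EuclideanSpace.single (σ (Fin.cast h (Fin.castAdd k i.succ))) 1)) *
        c (fun i => EuclideanSpace.single (σ (Fin.cast h (Fin.natAdd (j + 1) i))) 1)) * hs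
  -- all the terms agree with the first one, hence also with the last one
  rw [Finset.sum_congr rfl fun i _ => key i, Finset.sum_const, Finset.card_univ, Fintype.card_fin,
    nsmul_eq_mul, Nat.factorial_succ, ← key (Fin.last j)]
  have : ((j : ℝ) + 1) ≠ 0 := by positivity
  have h2 : ∀ p : Fin j, (finRotate (j + 1)).symm p.succ = p.castSucc := fun p => by
    rw [Equiv.symm_apply_eq]; simp
  have h3 : (finRotate (j + 1)).symm 0 = Fin.last j := by
    rw [Equiv.symm_apply_eq]; simp
  simp only [Fin.cycleRange_last, h2, h3, mul_assoc, signedSum_const_mul]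
  push_cast
  field_simp
  simp [mul_comm]

/-- Moving a linear form across the wedge pairing. -/
lemma wedgeTop_linWedge {j k : ℕ} (h : j + 1 + k = m) (h' : j + (k + 1) = m)
    (l : EuclideanSpace ℝ (Fin m) →L[ℝ] ℝ)
    (α : EuclideanSpace ℝ (Fin m) [⋀^Fin j]→L[ℝ] ℝ)
    (c : EuclideanSpace ℝ (Fin m) [⋀^Fin k]→L[ℝ] ℝ) :
    wedgeTop h' α (linWedge l c) = (-1) ^ j * wedgeTop h (linWedge l α) c := by
  rw [wedgeTop_linWedge_right, wedgeTop_linWedge_left, ← mul_assoc, ← mul_pow, neg_one_mul, neg_neg,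
    one_pow, one_mul]
  congr 2
  funext σ
  have e1 : ∀ i : Fin j, Fin.cast h' (Fin.castAdd (k + 1) i)
    = Fin.cast h (Fin.castAdd k i.castSucc) := fun i => by ext; simp
  have e2 : Fin.cast h' (Fin.natAdd j (0 : Fin (k + 1)))
    = Fin.cast h (Fin.castAdd k (Fin.last j)) := by ext; simp
  have e3 : ∀ i : Fin k, Fin.cast h' (Fin.natAdd j i.succ)
    = Fin.cast h (Fin.natAdd (j + 1) i) := fun i => by ext; simp; ring
  simp only [e1, e2, e3]
  ring

lemma wedgeTop_zero_degree (h : m + 0 = m) (γ : EuclideanSpace ℝ (Fin m) [⋀^Fin m]→L[ℝ] ℝ)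
    (c : EuclideanSpace ℝ (Fin m) [⋀^Fin 0]→L[ℝ] ℝ) :
    wedgeTop h γ c = γ (fun i => EuclideanSpace.single i 1) * c ![] := by
  unfold wedgeTop
  have hc : ∀ w : Fin 0 → EuclideanSpace ℝ (Fin m), c w = c ![] := fun w => by
    congr 1; exact Subsingleton.elim _ _
  have key : ∀ σ : Equiv.Perm (Fin m), ((Equiv.Perm.sign σ : ℤ) : ℝ) *
      (γ (fun i => EuclideanSpace.single (σ (Fin.cast h (Fin.castAdd 0 i))) 1) *
        c (fun i => EuclideanSpace.single (σ (Fin.cast h (Fin.natAdd m i))) 1))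
      = γ (fun i => EuclideanSpace.single i 1) * c ![] := fun σ => by
    rw [hc]
    have : γ (fun i => EuclideanSpace.single (σ (Fin.cast h (Fin.castAdd 0 i))) 1)
        = ((Equiv.Perm.sign σ : ℤ) : ℝ) * γ (fun i => EuclideanSpace.single i 1) := by
      have := γ.toAlternatingMap.map_perm (fun i => EuclideanSpace.single i (1 : ℝ)) σ
      simpa [Function.comp_def, Units.smul_def] using this
    rw [this, ← mul_assoc, ← mul_assoc, ← Int.cast_mul, Int.units_coe_mul_self]
    simp
  rw [Finset.sum_congr rfl fun σ _ => key σ, Finset.sum_const, Finset.card_univ, Fintype.card_perm,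
    Fintype.card_fin, nsmul_eq_mul, Nat.factorial_zero]
  have : (m.factorial : ℝ) ≠ 0 := by positivity
  field_simp
  simp

/-- An alternating map vanishes if its values on the standard basis do. -/
lemma alternatingMap_eq_zero_of_basis {j : ℕ} {γ : EuclideanSpace ℝ (Fin m) [⋀^Fin j]→L[ℝ] ℝ}
    (h : ∀ I : Fin j → Fin m, Function.Injective I →
      γ (fun i => EuclideanSpace.single (I i) 1) = 0) : γ = 0 := by
  have : γ.toAlternatingMap = 0 := by
    refine Module.Basis.ext_alternating (EuclideanSpace.basisFun (Fin m) ℝ).toBasis fun I hI => ?_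
    simpa using h I hI
  ext v
  exact congrArg (fun q : AlternatingMap ℝ _ _ _ => q v) this

lemma continuousAlternatingMap_eq_zero_of_lt {j : ℕ} (h : m < j)
    (γ : EuclideanSpace ℝ (Fin m) [⋀^Fin j]→L[ℝ] ℝ) : γ = 0 :=
  alternatingMap_eq_zero_of_basis fun I hI => by
    have := Fintype.card_le_of_injective I hI
    simp at this
    omega

lemma eq_zero_of_linWedge_eq_zero {j : ℕ} (hj : j < m)
    {γ : EuclideanSpace ℝ (Fin m) [⋀^Fin j]→L[ℝ] ℝ}
    (h : ∀ l, linWedge l γ = 0) : γ = 0 := by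
  refine alternatingMap_eq_zero_of_basis fun I _ => ?_
  -- the values of `γ` on the basis vectors with indices `I` are those of `dx_p ∧ γ` on the basis
  -- vectors with indices `p, I`, where `p` is not one of the indices `I`
  obtain ⟨p, hp⟩ : ∃ p : Fin m, p ∉ Set.range I := by
    by_contra! hc
    have := Fintype.card_le_of_surjective I fun p => hc p
    simp at this
    omega
  have := congrArg (fun q : EuclideanSpace ℝ (Fin m) [⋀^Fin (j + 1)]→L[ℝ] ℝ =>
    q (Fin.cons (EuclideanSpace.single p 1) fun i => EuclideanSpace.single (I i) 1))
      (h (EuclideanSpace.proj p))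
  simp only [linWedge_apply, Fin.sum_univ_succ] at this
  have hz : ∀ i : Fin j, p ≠ I i := fun i hi => hp ⟨i, hi.symm⟩
  simpa [hz] using this

/-- The wedge pairing is nondegenerate. -/
lemma eq_zero_of_wedgeTop_eq_zero {k : ℕ} : ∀ {j : ℕ} (h : j + k = m)
    {γ : EuclideanSpace ℝ (Fin m) [⋀^Fin j]→L[ℝ] ℝ}
    (_ : ∀ c, wedgeTop h γ c = 0), γ = 0 := by
  induction k with
  | zero =>
    intro j h γ hγ
    obtain rfl : j = m := by omega
    have h1 := hγ (ContinuousAlternatingMap.constOfIsEmpty ℝ _ _ 1)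
    rw [wedgeTop_zero_degree] at h1
    refine alternatingMap_eq_zero_of_basis fun I hI => ?_
    have h2 := γ.toAlternatingMap.map_perm (fun i => EuclideanSpace.single i (1 : ℝ))
      (Equiv.ofBijective I (Finite.injective_iff_bijective.1 hI))
    simp [Function.comp_def] at h1 h2
    rw [h2, h1, smul_zero]
  | succ k ih =>
    intro j h γ hγ
    -- `(λ ∧ γ) ∧ c = ± γ ∧ (λ ∧ c) = 0` for all linear forms `λ`
    refine eq_zero_of_linWedge_eq_zero (by omega) fun l => ih (by omega) fun c => ?_
    have := wedgeTop_linWedge (by omega) h l γ c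
    rw [hγ] at this
    exact (mul_eq_zero.1 this.symm).resolve_left (by simp)

end Wedge

/-! ### Weak exterior differentials on open subsets of `ℝ^m` -/

section WeakEuclidean

variable {m j k : ℕ}

lemma wedgeTop_add_right (h : j + k = m)
    (α : EuclideanSpace ℝ (Fin m) [⋀^Fin j]→L[ℝ] ℝ)
    (β β' : EuclideanSpace ℝ (Fin m) [⋀^Fin k]→L[ℝ] ℝ) :
    wedgeTop h α (β + β') = wedgeTop h α β + wedgeTop h α β' := by
  simp only [wedgeTop, ContinuousAlternatingMap.add_apply, mul_add, Finset.sum_add_distrib]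

lemma wedgeTop_smul_right (h : j + k = m) (c : ℝ)
    (α : EuclideanSpace ℝ (Fin m) [⋀^Fin j]→L[ℝ] ℝ)
    (β : EuclideanSpace ℝ (Fin m) [⋀^Fin k]→L[ℝ] ℝ) :
    wedgeTop h α (c • β) = c * wedgeTop h α β := by
  simp only [wedgeTop, ContinuousAlternatingMap.smul_apply, smul_eq_mul, Finset.mul_sum]
  refine Finset.sum_congr rfl fun σ _ => by ring

/-- The wedge pairing as a continuous bilinear map. -/
def wedgeL (h : j + k = m) : (EuclideanSpace ℝ (Fin m) [⋀^Fin j]→L[ℝ] ℝ) →L[ℝ]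
    (EuclideanSpace ℝ (Fin m) [⋀^Fin k]→L[ℝ] ℝ) →L[ℝ] ℝ :=
  LinearMap.toContinuousLinearMap
    { toFun := fun α => LinearMap.toContinuousLinearMap
        { toFun := fun β => wedgeTop h α β
          map_add' := wedgeTop_add_right h α
          map_smul' := fun c β => wedgeTop_smul_right h c α β }
      map_add' := fun α α' => by
        ext β
        exact wedgeTop_add_left h α α' β
      map_smul' := fun c α => by
        ext β
        exact wedgeTop_smul_left h c α β }

lemma wedgeL_apply (h : j + k = m) (α : EuclideanSpace ℝ (Fin m) [⋀^Fin j]→L[ℝ] ℝ)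
    (β : EuclideanSpace ℝ (Fin m) [⋀^Fin k]→L[ℝ] ℝ) : wedgeL h α β = wedgeTop h α β := rfl

/-- The product with a linear form as a continuous linear map. -/
def linWedgeL {E : Type*} [NormedAddCommGroup E] [NormedSpace ℝ E] (j : ℕ) (l : E →L[ℝ] ℝ) :
    (E [⋀^Fin j]→L[ℝ] ℝ) →L[ℝ] (E [⋀^Fin (j + 1)]→L[ℝ] ℝ) :=
  (ContinuousAlternatingMap.alternatizeUncurryFinCLM ℝ E ℝ).comp
    (ContinuousLinearMap.smulRightL ℝ E (E [⋀^Fin j]→L[ℝ] ℝ) l)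

lemma linWedgeL_apply {E : Type*} [NormedAddCommGroup E] [NormedSpace ℝ E] (l : E →L[ℝ] ℝ)
    (α : E [⋀^Fin j]→L[ℝ] ℝ) : linWedgeL j l α = linWedge l α := rfl

/-- `dα = ∑ i, dx_i ∧ ∂α/∂x_i`. -/
lemma extDeriv_eq_sum
    (α : EuclideanSpace ℝ (Fin m) → EuclideanSpace ℝ (Fin m) [⋀^Fin j]→L[ℝ] ℝ)
    (u : EuclideanSpace ℝ (Fin m)) :
    extDeriv α u = ∑ i : Fin m, linWedge (EuclideanSpace.proj i : EuclideanSpace ℝ (Fin m) →L[ℝ] ℝ)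
      (fderiv ℝ α u (EuclideanSpace.single i 1)) := by
  have h : fderiv ℝ α u = ∑ i : Fin m,
      (EuclideanSpace.proj i : EuclideanSpace ℝ (Fin m) →L[ℝ] ℝ).smulRight
        (fderiv ℝ α u (EuclideanSpace.single i 1)) := by
    ext1 v
    rw [_root_.sum_apply]
    conv_lhs => rw [← (EuclideanSpace.basisFun (Fin m) ℝ).sum_repr v, map_sum]
    simp
  conv_lhs => rw [extDeriv, h]
  rw [← ContinuousAlternatingMap.alternatizeUncurryFinCLM_apply, map_sum]
  rfl

/-- Stokes' theorem, by integration by parts in each coordinate. -/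
lemma isWeakExtDerivOn_integral_of_contDiff (h : j + 1 + k = m) (h' : j + (k + 1) = m)
    {α : EuclideanSpace ℝ (Fin m) → EuclideanSpace ℝ (Fin m) [⋀^Fin j]→L[ℝ] ℝ}
    {φ : EuclideanSpace ℝ (Fin m) → EuclideanSpace ℝ (Fin m) [⋀^Fin k]→L[ℝ] ℝ}
    (hα : ContDiff ℝ 1 α) (hφ : ContDiff ℝ 1 φ) (hc : HasCompactSupport φ) :
    ∫ u, wedgeTop h' (α u) (extDeriv φ u) =
      (-1 : ℝ) ^ (j + 1) * ∫ u, wedgeTop h (extDeriv α u) (φ u) := by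
  have hdα : Continuous (fderiv ℝ α) := hα.continuous_fderiv one_ne_zero
  have hdφ : Continuous (fderiv ℝ φ) := hφ.continuous_fderiv one_ne_zero
  have hcd : HasCompactSupport (fderiv ℝ φ) := hc.fderiv ℝ
  let l : Fin m → (EuclideanSpace ℝ (Fin m) →L[ℝ] ℝ) := fun i => EuclideanSpace.proj i
  let B : Fin m → (EuclideanSpace ℝ (Fin m) [⋀^Fin j]→L[ℝ] ℝ) →L[ℝ]
      (EuclideanSpace ℝ (Fin m) [⋀^Fin k]→L[ℝ] ℝ) →L[ℝ] ℝ := fun i =>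
    ((wedgeL h').flip.comp (linWedgeL k (l i))).flip
  have hB : ∀ i a p, B i a p = wedgeTop h' a (linWedge (l i) p) := fun i a p => rfl
  have hB' : ∀ i a p, B i a p = (-1) ^ j * wedgeTop h (linWedge (l i) a) p := fun i a p => by
    rw [hB, wedgeTop_linWedge h h']
  have hint : ∀ i (f : EuclideanSpace ℝ (Fin m) → EuclideanSpace ℝ (Fin m) [⋀^Fin j]→L[ℝ] ℝ)
      (g : EuclideanSpace ℝ (Fin m) → EuclideanSpace ℝ (Fin m) [⋀^Fin k]→L[ℝ] ℝ),
      Continuous f → Continuous g → HasCompactSupport g →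
      Integrable (fun u => B i (f u) (g u)) := fun i f g hf hg hcg => by
    refine Continuous.integrable_of_hasCompactSupport
      (((B i).continuous.comp hf).clm_apply hg) ?_
    refine hcg.mono fun u hu hgu => hu ?_
    change B i (f u) (g u) = 0
    rw [hgu, map_zero]
  have hcdi : ∀ v, HasCompactSupport fun u => fderiv ℝ φ u v := fun v =>
    hcd.mono fun u hu h0 => hu (by change fderiv ℝ φ u v = 0; rw [h0]; rfl)
  have key : ∀ i, ∫ u, B i (α u) (fderiv ℝ φ u (EuclideanSpace.single i 1)) =
      -∫ u, B i (fderiv ℝ α u (EuclideanSpace.single i 1)) (φ u) := fun i =>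
    integral_bilinear_hasFDerivAt_right_eq_neg_left_of_integrable
      (hint i _ _ (hdα.clm_apply continuous_const) hφ.continuous hc)
      (hint i _ _ hα.continuous (hdφ.clm_apply continuous_const) (hcdi _))
      (hint i _ _ hα.continuous hφ.continuous hc)
      (fun u _ => (hα.differentiable one_ne_zero u).hasFDerivAt)
      (fun u _ => (hφ.differentiable one_ne_zero u).hasFDerivAt)
  have e1 : ∀ u, wedgeTop h' (α u) (extDeriv φ u) =
      ∑ i, B i (α u) (fderiv ℝ φ u (EuclideanSpace.single i 1)) := fun u => by
    rw [extDeriv_eq_sum, ← wedgeL_apply, map_sum]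
    rfl
  have e2 : ∀ u, wedgeTop h (extDeriv α u) (φ u) =
      (-1) ^ j * ∑ i, B i (fderiv ℝ α u (EuclideanSpace.single i 1)) (φ u) := fun u => by
    rw [extDeriv_eq_sum, ← wedgeL_apply, map_sum, _root_.sum_apply, Finset.mul_sum]
    refine Finset.sum_congr rfl fun i _ => ?_
    rw [hB', ← mul_assoc, ← mul_pow]
    simp [wedgeL_apply, l]
  simp only [e1, e2]
  rw [integral_finsetSum _ fun i _ => hint i _ _ hα.continuous (hdφ.clm_apply continuous_const)
    (hcdi _), integral_const_mul, integral_finsetSum _ fun i _ =>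
    hint i _ _ (hdα.clm_apply continuous_const) hφ.continuous hc, Finset.sum_congr rfl
    fun i _ => key i, Finset.sum_neg_distrib, pow_succ]
  have hs : (-1 : ℝ) ^ j * (-1) ^ j = 1 := by rw [← mul_pow]; simp
  linear_combination (∑ i, ∫ u, B i (fderiv ℝ α u (EuclideanSpace.single i 1)) (φ u)) * hs

lemma exists_cutoff {E : Type*} [NormedAddCommGroup E] [NormedSpace ℝ E] [FiniteDimensional ℝ E]
    {K U : Set E} (hK : IsCompact K) (hU : IsOpen U) (hKU : K ⊆ U) :
    ∃ χ : E → ℝ, ContDiff ℝ (⊤ : ℕ∞) χ ∧ HasCompactSupport χ ∧ tsupport χ ⊆ U ∧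
      ∃ V, IsOpen V ∧ K ⊆ V ∧ ∀ u ∈ V, χ u = 1 := by
  obtain ⟨L, hL, hKL, hLU⟩ := exists_compact_between hK hU hKU
  obtain ⟨f, hf1, hf0, -⟩ := exists_contMDiffMap_one_nhds_of_subset_interior
    (n := (⊤ : ℕ∞)) (modelWithCornersSelf ℝ E) hK.isClosed hKL
  obtain ⟨V, hV, hKV, hV1⟩ := mem_nhdsSet_iff_exists.1 hf1
  have hs : tsupport f ⊆ L := closure_minimal (fun x hx => by
    by_contra h; exact hx (hf0 x h)) hL.isClosed
  exact ⟨f, f.contMDiff.contDiff, hL.of_isClosed_subset (isClosed_tsupport _) hs, hs.trans hLU,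
    V, hV, hKV, hV1⟩

lemma contDiff_smul_cutoff {E G : Type*} [NormedAddCommGroup E] [NormedSpace ℝ E]
    [NormedAddCommGroup G] [NormedSpace ℝ G] {k : WithTop ℕ∞} {f : E → G} {U : Set E}
    (hf : ContDiffOn ℝ k f U) (hU : IsOpen U) {χ : E → ℝ} (hχ : ContDiff ℝ k χ)
    (hs : tsupport χ ⊆ U) : ContDiff ℝ k fun u => χ u • f u := by
  rw [contDiff_iff_contDiffAt]
  intro u
  by_cases hu : u ∈ tsupport χ
  · exact hχ.contDiffAt.smul (hf.contDiffAt (hU.mem_nhds (hs hu)))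
  · refine (contDiffAt_const (c := (0 : G))).congr_of_eventuallyEq ?_
    filter_upwards [(isClosed_tsupport χ).isOpen_compl.mem_nhds hu] with v hv
    rw [image_eq_zero_of_notMem_tsupport hv, zero_smul]

lemma setIntegral_wedgeTop_eq (h : j + k = m) {U : Set (EuclideanSpace ℝ (Fin m))}
    (α : EuclideanSpace ℝ (Fin m) → EuclideanSpace ℝ (Fin m) [⋀^Fin j]→L[ℝ] ℝ)
    {φ : EuclideanSpace ℝ (Fin m) → EuclideanSpace ℝ (Fin m) [⋀^Fin k]→L[ℝ] ℝ}
    (hφ : tsupport φ ⊆ U) :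
    ∫ u in U, wedgeTop h (α u) (φ u) = ∫ u, wedgeTop h (α u) (φ u) :=
  setIntegral_eq_integral_of_forall_compl_eq_zero fun u hu => by
    rw [image_eq_zero_of_notMem_tsupport fun h => hu (hφ h), wedgeTop_zero_right]

/-- The exterior differential of a smooth form is a weak exterior differential. -/
lemma isWeakExtDerivOn_of_contDiffOn {U : Set (EuclideanSpace ℝ (Fin m))} (hU : IsOpen U)
    {α : EuclideanSpace ℝ (Fin m) → EuclideanSpace ℝ (Fin m) [⋀^Fin j]→L[ℝ] ℝ}
    {β : EuclideanSpace ℝ (Fin m) → EuclideanSpace ℝ (Fin m) [⋀^Fin (j + 1)]→L[ℝ] ℝ}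
    (hα : ContDiffOn ℝ (⊤ : ℕ∞) α U) (hβ : ∀ u ∈ U, β u = extDeriv α u) :
    IsWeakExtDerivOn U α β := by
  have hd : ContinuousOn β U := by
    refine ContinuousOn.congr ?_ hβ
    exact (ContinuousAlternatingMap.alternatizeUncurryFinCLM ℝ _ ℝ).continuous.comp_continuousOn
      (hα.continuousOn_fderiv_of_isOpen hU (by simp))
  refine ⟨hα.continuousOn.locallyIntegrableOn hU.measurableSet,
    hd.locallyIntegrableOn hU.measurableSet, fun k h h' φ hφ => ?_⟩
  obtain ⟨χ, hχ, -, hχU, V, hV, hKV, hV1⟩ := exists_cutoff hφ.2 hU hφ.3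
  have hα' : ContDiff ℝ (⊤ : ℕ∞) fun u => χ u • α u := contDiff_smul_cutoff hα hU hχ hχU
  have hd0 : ∀ u ∈ tsupport φ, extDeriv (fun u => χ u • α u) u = β u := fun u hu => by
    rw [hβ u (hφ.3 hu)]
    apply Filter.EventuallyEq.extDeriv_eq
    filter_upwards [hV.mem_nhds (hKV hu)] with v hv
    rw [hV1 v hv, one_smul]
  rw [setIntegral_wedgeTop_eq h' α hφ.extDeriv.3, setIntegral_wedgeTop_eq h β hφ.3]
  -- replacing `α` by `χ • α`, which is smooth on `ℝ^m`, does not change the integrals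
  have e1 : ∀ u, wedgeTop h' (α u) (extDeriv φ u) = wedgeTop h' (χ u • α u) (extDeriv φ u) := by
    intro u
    by_cases hu : u ∈ tsupport φ
    · rw [hV1 u (hKV hu), one_smul]
    · have : extDeriv φ u = 0 := by
        have hz : φ =ᶠ[𝓝 u] 0 := notMem_tsupport_iff_eventuallyEq.1 hu
        have h2 := hz.fderiv_eq (𝕜 := ℝ)
        rw [extDeriv, h2]
        simp [← ContinuousAlternatingMap.alternatizeUncurryFinCLM_apply]
      rw [this, wedgeTop_zero_right, wedgeTop_zero_right]
  have e2 : ∀ u, wedgeTop h (β u) (φ u) = wedgeTop h (extDeriv (fun u => χ u • α u) u) (φ u) := by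
    intro u
    by_cases hu : u ∈ tsupport φ
    · rw [hd0 u hu]
    · rw [image_eq_zero_of_notMem_tsupport hu, wedgeTop_zero_right, wedgeTop_zero_right]
  simp only [e1, e2]
  exact isWeakExtDerivOn_integral_of_contDiff h h' (hα'.of_le (by simp)) (hφ.1.of_le (by simp)) hφ.2

lemma isTestForm_smul_const {U : Set (EuclideanSpace ℝ (Fin m))} {χ : EuclideanSpace ℝ (Fin m) → ℝ}
    (hχ : ContDiff ℝ (⊤ : ℕ∞) χ) (hc : HasCompactSupport χ) (hs : tsupport χ ⊆ U)
    (c : EuclideanSpace ℝ (Fin m) [⋀^Fin k]→L[ℝ] ℝ) : IsTestForm U fun u => χ u • c :=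
  ⟨hχ.smul contDiff_const, hc.smul_right, (tsupport_smul_subset_left χ _).trans hs⟩

/-- A weak exterior differential that is continuous, of a smooth form, is its exterior
differential. -/
lemma IsWeakExtDerivOn.eq_extDeriv {U : Set (EuclideanSpace ℝ (Fin m))} (hU : IsOpen U)
    {α : EuclideanSpace ℝ (Fin m) → EuclideanSpace ℝ (Fin m) [⋀^Fin j]→L[ℝ] ℝ}
    {β : EuclideanSpace ℝ (Fin m) → EuclideanSpace ℝ (Fin m) [⋀^Fin (j + 1)]→L[ℝ] ℝ}
    (h : IsWeakExtDerivOn U α β) (hα : ContDiffOn ℝ (⊤ : ℕ∞) α U) (hβ : ContinuousOn β U) :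
    ∀ u ∈ U, β u = extDeriv α u := by
  intro u hu
  by_cases hjm : m ≤ j
  · rw [continuousAlternatingMap_eq_zero_of_lt (by omega) (β u),
      continuousAlternatingMap_eq_zero_of_lt (by omega) (extDeriv α u)]
  obtain ⟨k, hk⟩ : ∃ k, j + 1 + k = m := ⟨m - (j + 1), by omega⟩
  have hd : ContinuousOn (extDeriv α) U :=
    (ContinuousAlternatingMap.alternatizeUncurryFinCLM ℝ _ ℝ).continuous.comp_continuousOn
      (hα.continuousOn_fderiv_of_isOpen hU (by simp))
  have hsm := isWeakExtDerivOn_of_contDiffOn hU hα (β := extDeriv α) fun _ _ => rfl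
  rw [← sub_eq_zero]
  refine eq_zero_of_wedgeTop_eq_zero hk fun c => ?_
  have hcont : ∀ γ : EuclideanSpace ℝ (Fin m) → EuclideanSpace ℝ (Fin m) [⋀^Fin (j + 1)]→L[ℝ] ℝ,
      ContinuousOn γ U → ContinuousOn (fun u => wedgeTop hk (γ u) c) U := fun γ hγ =>
    ((wedgeL hk).flip c).continuous.comp_continuousOn hγ
  have hc := (hcont β hβ).sub (hcont _ hd)
  -- the test forms `χ • c` with a test function `χ` and a constant form `c`
  have key : ∀ᵐ u : EuclideanSpace ℝ (Fin m), u ∈ U →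
      wedgeTop hk (β u) c - wedgeTop hk (extDeriv α u) c = 0 := by
    refine hU.ae_eq_zero_of_integral_contDiff_smul_eq_zero
      (hc.locallyIntegrableOn hU.measurableSet) fun χ hχ hχc hχU => ?_
    have ht := isTestForm_smul_const hχ hχc hχU c
    have e1 := h.integral_eq k hk (by omega) _ ht
    rw [hsm.integral_eq k hk (by omega) _ ht] at e1
    have e2 := mul_left_cancel₀ (pow_ne_zero _ (by norm_num)) e1
    have i1 := integrableOn_wedgeTop hk hU h.2 ht
    have i2 := integrableOn_wedgeTop hk hU hsm.2 ht
    rw [setIntegral_wedgeTop_eq hk _ ht.3, setIntegral_wedgeTop_eq hk _ ht.3] at e2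
    have hz : ∀ γ : EuclideanSpace ℝ (Fin m) → EuclideanSpace ℝ (Fin m) [⋀^Fin (j + 1)]→L[ℝ] ℝ,
      ∀ u ∉ U, wedgeTop hk (γ u) (χ u • c) = 0 := fun γ u hu => by
        rw [image_eq_zero_of_notMem_tsupport fun h' => hu (hχU h'), zero_smul, wedgeTop_zero_right]
    rw [integrableOn_iff_integrable_of_support_subset fun u hu => by
      by_contra h'; exact hu (hz _ u h')] at i1 i2
    have e3 : ∀ u, χ u • (wedgeTop hk (β u) c - wedgeTop hk (extDeriv α u) c) =
        wedgeTop hk (β u) (χ u • c) - wedgeTop hk (extDeriv α u) (χ u • c) := fun u => by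
      rw [wedgeTop_smul_right, wedgeTop_smul_right, smul_eq_mul, mul_sub]
    simp only [e3]
    rw [integral_sub i1 i2, e2, sub_self]
  have h1 := Measure.eqOn_open_of_ae_eq (μ := volume) (U := U)
    (f := fun u => wedgeTop hk (β u) c - wedgeTop hk (extDeriv α u) c) (g := fun _ => 0)
    ((ae_restrict_iff' hU.measurableSet).2 key) hU hc continuousOn_const hu
  have h2 : wedgeTop hk (β u) c - wedgeTop hk (extDeriv α u) c = 0 := h1
  rw [← wedgeL_apply, map_sub]
  exact h2

lemma IsWeakExtDerivOn.congr_ae {U : Set (EuclideanSpace ℝ (Fin m))} (hU : IsOpen U)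
    {α α' : EuclideanSpace ℝ (Fin m) → EuclideanSpace ℝ (Fin m) [⋀^Fin j]→L[ℝ] ℝ}
    {β β' : EuclideanSpace ℝ (Fin m) → EuclideanSpace ℝ (Fin m) [⋀^Fin (j + 1)]→L[ℝ] ℝ}
    (h : IsWeakExtDerivOn U α β) (hα : α =ᵐ[volume.restrict U] α')
    (hβ : β =ᵐ[volume.restrict U] β') : IsWeakExtDerivOn U α' β' := by
  have hloc : ∀ {i : ℕ}
      {γ γ' : EuclideanSpace ℝ (Fin m) → EuclideanSpace ℝ (Fin m) [⋀^Fin i]→L[ℝ] ℝ},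
      γ =ᵐ[volume.restrict U] γ' → LocallyIntegrableOn γ U → LocallyIntegrableOn γ' U := by
    intro i γ γ' hγ hl
    rw [locallyIntegrableOn_iff hU.isLocallyClosed] at hl ⊢
    exact fun K hK hc => (hl K hK hc).congr
      (ae_mono (Measure.restrict_mono hK le_rfl) hγ)
  refine ⟨hloc hα h.1, hloc hβ h.2, fun k hk hk' φ hφ => ?_⟩
  have e1 : (fun u => wedgeTop hk' (α u) (extDeriv φ u)) =ᵐ[volume.restrict U]
      fun u => wedgeTop hk' (α' u) (extDeriv φ u) := hα.mono fun u hu => by simp only [hu]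
  have e2 : (fun u => wedgeTop hk (β u) (φ u)) =ᵐ[volume.restrict U]
      fun u => wedgeTop hk (β' u) (φ u) := hβ.mono fun u hu => by simp only [hu]
  rw [← integral_congr_ae e1, ← integral_congr_ae e2]
  exact h.3 k hk hk' φ hφ

lemma IsWeakExtDerivOn.mono {U V : Set (EuclideanSpace ℝ (Fin m))} (hVU : V ⊆ U)
    {α : EuclideanSpace ℝ (Fin m) → EuclideanSpace ℝ (Fin m) [⋀^Fin j]→L[ℝ] ℝ}
    {β : EuclideanSpace ℝ (Fin m) → EuclideanSpace ℝ (Fin m) [⋀^Fin (j + 1)]→L[ℝ] ℝ}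
    (h : IsWeakExtDerivOn U α β) : IsWeakExtDerivOn V α β := by
  refine ⟨h.1.mono_set hVU, h.2.mono_set hVU, fun k hk hk' φ hφ => ?_⟩
  have hφ' : IsTestForm U φ := ⟨hφ.1, hφ.2, hφ.3.trans hVU⟩
  rw [setIntegral_wedgeTop_eq hk' _ hφ.extDeriv.3, setIntegral_wedgeTop_eq hk _ hφ.3,
    ← setIntegral_wedgeTop_eq hk' _ hφ'.extDeriv.3, ← setIntegral_wedgeTop_eq hk _ hφ'.3]
  exact h.3 k hk hk' φ hφ'

end WeakEuclidean

section WeakEuclideanLimit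

variable {m j k : ℕ}

lemma extDeriv_finsetSum {ι : Type*} (s : Finset ι)
    {φ : ι → EuclideanSpace ℝ (Fin m) → EuclideanSpace ℝ (Fin m) [⋀^Fin k]→L[ℝ] ℝ}
    (h : ∀ i, Differentiable ℝ (φ i)) (u : EuclideanSpace ℝ (Fin m)) :
    extDeriv (fun u => ∑ i ∈ s, φ i u) u = ∑ i ∈ s, extDeriv (φ i) u := by
  unfold extDeriv
  rw [fderiv_fun_sum fun i _ => h i u, ← ContinuousAlternatingMap.alternatizeUncurryFinCLM_apply,
    map_sum]
  rfl

lemma exists_finite_partition {E ι : Type*} [NormedAddCommGroup E] [NormedSpace ℝ E]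
    [FiniteDimensional ℝ E] {K : Set E} (hK : IsCompact K) (V : ι → Set E)
    (hVo : ∀ i, IsOpen (V i)) (hKV : K ⊆ ⋃ i, V i) :
    ∃ (s : Finset ι) (f : ι → E → ℝ), (∀ i, ContDiff ℝ (⊤ : ℕ∞) (f i)) ∧
      (∀ i, tsupport (f i) ⊆ V i) ∧ ∀ u ∈ K, ∑ i ∈ s, f i u = 1 := by
  obtain ⟨f, hf⟩ := SmoothPartitionOfUnity.exists_isSubordinate
    (modelWithCornersSelf ℝ E) hK.isClosed V hVo hKV
  have hfin := f.locallyFinite.finite_nonempty_inter_compact hK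
  refine ⟨hfin.toFinset, fun i => f i, fun i => (f i).contMDiff.contDiff, hf, fun u hu => ?_⟩
  rw [← f.sum_eq_one hu, finsum_eq_sum_of_support_subset]
  exact fun i hi => hfin.mem_toFinset.2 ⟨u, hi, hu⟩

lemma isTestForm_smul {U V : Set (EuclideanSpace ℝ (Fin m))} {χ : EuclideanSpace ℝ (Fin m) → ℝ}
    (hχ : ContDiff ℝ (⊤ : ℕ∞) χ) (hs : tsupport χ ⊆ V)
    {φ : EuclideanSpace ℝ (Fin m) → EuclideanSpace ℝ (Fin m) [⋀^Fin k]→L[ℝ] ℝ}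
    (hφ : IsTestForm U φ) : IsTestForm V fun u => χ u • φ u :=
  ⟨hχ.smul hφ.1, hφ.2.mono' ((Function.support_smul_subset_right χ φ).trans subset_closure),
    (tsupport_smul_subset_left χ φ).trans hs⟩

/-- The defining identity for a test form follows from the local ones by a partition of unity. -/
lemma integral_eq_of_locally {U : Set (EuclideanSpace ℝ (Fin m))} (hU : IsOpen U)
    {α : EuclideanSpace ℝ (Fin m) → EuclideanSpace ℝ (Fin m) [⋀^Fin j]→L[ℝ] ℝ}
    {β : EuclideanSpace ℝ (Fin m) → EuclideanSpace ℝ (Fin m) [⋀^Fin (j + 1)]→L[ℝ] ℝ}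
    (V : EuclideanSpace ℝ (Fin m) → Set (EuclideanSpace ℝ (Fin m)))
    (hVo : ∀ u ∈ U, IsOpen (V u)) (hV : ∀ u ∈ U, u ∈ V u) (hVU : ∀ u ∈ U, V u ⊆ U)
    (hw : ∀ u ∈ U, IsWeakExtDerivOn (V u) α β)
    (h1 : LocallyIntegrableOn α U) (h2 : LocallyIntegrableOn β U)
    (hk : j + 1 + k = m) (hk' : j + (k + 1) = m)
    {φ : EuclideanSpace ℝ (Fin m) → EuclideanSpace ℝ (Fin m) [⋀^Fin k]→L[ℝ] ℝ}
    (hφ : IsTestForm U φ) :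
    ∫ u in U, wedgeTop hk' (α u) (extDeriv φ u) =
      (-1 : ℝ) ^ (j + 1) * ∫ u in U, wedgeTop hk (β u) (φ u) := by
  obtain ⟨s, f, hfs, hf, hone⟩ := exists_finite_partition hφ.2 (fun i : U => V i)
    (fun i => hVo i i.2) fun u hu => Set.mem_iUnion.2 ⟨⟨u, hφ.3 hu⟩, hV u (hφ.3 hu)⟩
  have hsum : φ = fun u => ∑ i ∈ s, f i u • φ u := by
    funext u
    by_cases hu : u ∈ tsupport φ
    · rw [← Finset.sum_smul]
      rw [hone u hu, one_smul]
    · simp [image_eq_zero_of_notMem_tsupport hu]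
  obtain ⟨ψ, hψd⟩ : ∃ ψ : U → EuclideanSpace ℝ (Fin m) →
      EuclideanSpace ℝ (Fin m) [⋀^Fin k]→L[ℝ] ℝ,
      ∀ i, ψ i = fun u => f i u • φ u := ⟨_, fun i => rfl⟩
  have hψ : ∀ i : U, IsTestForm (V i) (ψ i) := fun i => by
    rw [hψd]
    exact isTestForm_smul (hfs i) (hf i) hφ
  have hsum' : φ = fun u => ∑ i ∈ s, ψ i u := by simpa only [hψd] using hsum
  have hψU : ∀ i : U, IsTestForm U (ψ i) := fun i =>
    ⟨(hψ i).1, (hψ i).2, (hψ i).3.trans (hVU i i.2)⟩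
  have hdψ : extDeriv φ = fun u => ∑ i ∈ s, extDeriv (ψ i) u := by
    funext u
    conv_lhs => rw [hsum']
    exact extDeriv_finsetSum s (fun i => (hψ i).1.differentiable (by simp)) u
  have e1 : ∀ u, wedgeTop hk' (α u) (extDeriv φ u)
      = ∑ i ∈ s, wedgeTop hk' (α u) (extDeriv (ψ i) u) := fun u => by
    rw [hdψ, ← wedgeL_apply, map_sum]; rfl
  have e2 : ∀ u, wedgeTop hk (β u) (φ u) = ∑ i ∈ s, wedgeTop hk (β u) (ψ i u) := fun u => by
    conv_lhs => rw [hsum']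
    rw [← wedgeL_apply, map_sum]; rfl
  simp only [e1, e2]
  rw [integral_finsetSum _ fun i _ => integrableOn_wedgeTop hk' hU h1 (hψU i).extDeriv,
    integral_finsetSum _ fun i _ => integrableOn_wedgeTop hk hU h2 (hψU i), Finset.mul_sum]
  refine Finset.sum_congr rfl fun i _ => ?_
  rw [setIntegral_wedgeTop_eq hk' _ (hψU i).extDeriv.3, setIntegral_wedgeTop_eq hk _ (hψU i).3,
    ← setIntegral_wedgeTop_eq hk' _ (hψ i).extDeriv.3, ← setIntegral_wedgeTop_eq hk _ (hψ i).3]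
  exact (hw i i.2).3 k hk hk' _ (hψ i)

lemma isWeakExtDerivOn_of_locally {U : Set (EuclideanSpace ℝ (Fin m))} (hU : IsOpen U)
    {α : EuclideanSpace ℝ (Fin m) → EuclideanSpace ℝ (Fin m) [⋀^Fin j]→L[ℝ] ℝ}
    {β : EuclideanSpace ℝ (Fin m) → EuclideanSpace ℝ (Fin m) [⋀^Fin (j + 1)]→L[ℝ] ℝ}
    (h : ∀ u ∈ U, ∃ V, IsOpen V ∧ u ∈ V ∧ V ⊆ U ∧ IsWeakExtDerivOn V α β) :
    IsWeakExtDerivOn U α β := by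
  choose! V hVo hV hVU hw using h
  have hloc : ∀ {i : ℕ}
      {γ : EuclideanSpace ℝ (Fin m) → EuclideanSpace ℝ (Fin m) [⋀^Fin i]→L[ℝ] ℝ},
      (∀ u ∈ U, LocallyIntegrableOn γ (V u)) → LocallyIntegrableOn γ U := by
    intro i γ hγ u hu
    have := hγ u hu u (hV u hu)
    rw [(hVo u hu).nhdsWithin_eq (hV u hu)] at this
    exact this.filter_mono nhdsWithin_le_nhds
  have h1 : LocallyIntegrableOn α U := hloc fun u hu => (hw u hu).1
  have h2 : LocallyIntegrableOn β U := hloc fun u hu => (hw u hu).2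
  exact ⟨h1, h2, fun k hk hk' φ hφ =>
    integral_eq_of_locally hU V hVo hV hVU hw h1 h2 hk hk' hφ⟩

lemma abs_wedgeTop_le (h : j + k = m) (α : EuclideanSpace ℝ (Fin m) [⋀^Fin j]→L[ℝ] ℝ)
    (β : EuclideanSpace ℝ (Fin m) [⋀^Fin k]→L[ℝ] ℝ) :
    |wedgeTop h α β| ≤ m.factorial * ‖α‖ * ‖β‖ := by
  unfold wedgeTop
  rw [abs_mul]
  have h1 : |((j.factorial : ℝ) * (k.factorial : ℝ))⁻¹| ≤ 1 := by
    rw [abs_of_nonneg (by positivity)]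
    refine inv_le_one_of_one_le₀ ?_
    exact_mod_cast Nat.one_le_iff_ne_zero.2 (mul_ne_zero j.factorial_ne_zero k.factorial_ne_zero)
  have hsg : ∀ σ : Equiv.Perm (Fin m), |((Equiv.Perm.sign σ : ℤ) : ℝ)| = 1 := fun σ => by
    rw [← Int.cast_abs, Int.isUnit_iff_abs_eq.1 (Units.isUnit _), Int.cast_one]
  refine (mul_le_of_le_one_left (abs_nonneg _) h1).trans ((Finset.abs_sum_le_sum_abs _ _).trans ?_)
  refine (Finset.sum_le_card_nsmul _ _ (‖α‖ * ‖β‖) fun σ _ => ?_).trans ?_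
  · rw [abs_mul, hsg, one_mul, abs_mul]
    refine mul_le_mul ?_ ?_ (abs_nonneg _) (norm_nonneg _)
    · simpa using α.le_opNorm
        (fun i => EuclideanSpace.single (σ (Fin.cast h (Fin.castAdd k i))) (1 : ℝ))
    · simpa using β.le_opNorm
        (fun i => EuclideanSpace.single (σ (Fin.cast h (Fin.natAdd j i))) (1 : ℝ))
  · rw [Finset.card_univ, Fintype.card_perm, Fintype.card_fin, nsmul_eq_mul, mul_assoc]

lemma tendsto_integral_wedgeTop (h : j + k = m) {U : Set (EuclideanSpace ℝ (Fin m))}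
    (hU : IsOpen U)
    {α : EuclideanSpace ℝ (Fin m) → EuclideanSpace ℝ (Fin m) [⋀^Fin j]→L[ℝ] ℝ}
    {a : ℕ → EuclideanSpace ℝ (Fin m) → EuclideanSpace ℝ (Fin m) [⋀^Fin j]→L[ℝ] ℝ}
    (hα : LocallyIntegrableOn α U) (ha : ∀ i, LocallyIntegrableOn (a i) U)
    (hlim : Tendsto (fun i => ∫⁻ u in U, ‖a i u - α u‖ₑ) atTop (𝓝 0))
    {φ : EuclideanSpace ℝ (Fin m) → EuclideanSpace ℝ (Fin m) [⋀^Fin k]→L[ℝ] ℝ}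
    (hφ : IsTestForm U φ) :
    Tendsto (fun i => ∫ u in U, wedgeTop h (a i u) (φ u)) atTop
      (𝓝 (∫ u in U, wedgeTop h (α u) (φ u))) := by
  obtain ⟨C, hC⟩ := hφ.2.exists_bound_of_continuous hφ.1.continuous
  have hC0 : 0 ≤ C := (norm_nonneg _).trans (hC 0)
  refine tendsto_integral_of_L1 (μ := volume.restrict U) _
    (integrableOn_wedgeTop h hU hα hφ).aestronglyMeasurable
    (Eventually.of_forall fun i => integrableOn_wedgeTop h hU (ha i) hφ) ?_
  have hb : ∀ i, ∫⁻ u in U, ‖wedgeTop h (a i u) (φ u) - wedgeTop h (α u) (φ u)‖ₑ ≤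
      ENNReal.ofReal (m.factorial * C) * ∫⁻ u in U, ‖a i u - α u‖ₑ := fun i => by
    rw [← lintegral_const_mul' _ _ ENNReal.ofReal_ne_top]
    refine lintegral_mono fun u => ?_
    rw [← ofReal_norm, ← ofReal_norm, ← ENNReal.ofReal_mul (by positivity)]
    refine ENNReal.ofReal_le_ofReal ?_
    have h1 : wedgeTop h (a i u) (φ u) - wedgeTop h (α u) (φ u) = wedgeL h (a i u - α u) (φ u) := by
      rw [map_sub]; rfl
    rw [h1]
    calc ‖wedgeL h (a i u - α u) (φ u)‖ ≤ m.factorial * ‖a i u - α u‖ * ‖φ u‖ :=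
          abs_wedgeTop_le h _ _
      _ ≤ m.factorial * ‖a i u - α u‖ * C := by gcongr; exact hC u
      _ = _ := by ring
  refine tendsto_of_tendsto_of_tendsto_of_le_of_le tendsto_const_nhds ?_ (fun i => zero_le) hb
  have := ENNReal.Tendsto.const_mul (a := ENNReal.ofReal (m.factorial * C)) hlim
    (Or.inr ENNReal.ofReal_ne_top)
  rwa [mul_zero] at this

/-- Weak exterior differentials pass to the limit in `L^1`. -/
lemma isWeakExtDerivOn_of_tendsto {U : Set (EuclideanSpace ℝ (Fin m))} (hU : IsOpen U)
    {α : EuclideanSpace ℝ (Fin m) → EuclideanSpace ℝ (Fin m) [⋀^Fin j]→L[ℝ] ℝ}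
    {β : EuclideanSpace ℝ (Fin m) → EuclideanSpace ℝ (Fin m) [⋀^Fin (j + 1)]→L[ℝ] ℝ}
    {a : ℕ → EuclideanSpace ℝ (Fin m) → EuclideanSpace ℝ (Fin m) [⋀^Fin j]→L[ℝ] ℝ}
    {b : ℕ → EuclideanSpace ℝ (Fin m) → EuclideanSpace ℝ (Fin m) [⋀^Fin (j + 1)]→L[ℝ] ℝ}
    (hα : LocallyIntegrableOn α U) (hβ : LocallyIntegrableOn β U)
    (h : ∀ i, IsWeakExtDerivOn U (a i) (b i))
    (hlim : Tendsto (fun i => ∫⁻ u in U, ‖a i u - α u‖ₑ) atTop (𝓝 0))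
    (hlim' : Tendsto (fun i => ∫⁻ u in U, ‖b i u - β u‖ₑ) atTop (𝓝 0)) :
    IsWeakExtDerivOn U α β := by
  refine ⟨hα, hβ, fun k hk hk' φ hφ => ?_⟩
  have t1 := tendsto_integral_wedgeTop hk' hU hα (fun i => (h i).1) hlim hφ.extDeriv
  have t2 := tendsto_integral_wedgeTop hk hU hβ (fun i => (h i).2) hlim' hφ
  simp only [(h _).3 k hk hk' φ hφ] at t1
  exact tendsto_nhds_unique t1 (t2.const_mul _)

end WeakEuclideanLimit

/-! ### Averages over families of maps close to the identity -/

section Averages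

variable {X T G : Type*} [MeasurableSpace X] [MeasurableSpace T] [NormedAddCommGroup G]
  {μ : Measure X} {ν : Measure T}

/-- Averaging over a probability space is a contraction in `L^p`: pointwise, the `L^1` norm with
respect to a probability measure is at most the `L^p` norm. -/
lemma eLpNorm_lintegral_le [SFinite μ] [IsProbabilityMeasure ν] {p : ℝ≥0∞} (hp : 1 ≤ p)
    {F : X × T → G} (hF : AEStronglyMeasurable F (μ.prod ν)) :
    eLpNorm (fun x => ∫⁻ t, ‖F (x, t)‖ₑ ∂ν) p μ ≤ eLpNorm F p (μ.prod ν) := by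
  have hs : ∀ᵐ x ∂μ, AEStronglyMeasurable (fun t => F (x, t)) ν := hF.prodMk_left
  have h1 : ∀ᵐ x ∂μ, ∫⁻ t, ‖F (x, t)‖ₑ ∂ν ≤ eLpNorm (fun t => F (x, t)) p ν := by
    filter_upwards [hs] with x hx
    rw [← eLpNorm_one_eq_lintegral_enorm]
    exact eLpNorm_le_eLpNorm_of_exponent_le hp hx
  refine (eLpNorm_mono_enorm_ae (g := fun x => eLpNorm (fun t => F (x, t)) p ν)
    (h1.mono fun x hx => by simpa using hx)).trans ?_
  have hp0 : p ≠ 0 := (zero_lt_one.trans_le hp).ne'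
  by_cases hpt : p = ∞
  · subst hpt
    simp only [eLpNorm_exponent_top]
    have h2 : ∀ᵐ x ∂μ, ∀ᵐ t ∂ν, ‖F (x, t)‖ₑ ≤ eLpNormEssSup F (μ.prod ν) :=
      Measure.ae_ae_of_ae_prod (ae_le_eLpNormEssSup (f := F) (μ := μ.prod ν))
    refine essSup_le_of_ae_le _ ?_
    filter_upwards [h2] with x hx
    rw [enorm_eq_self]
    exact essSup_le_of_ae_le _ hx
  · have hpr : 0 < p.toReal := ENNReal.toReal_pos hp0 hpt
    rw [eLpNorm_eq_lintegral_rpow_enorm_toReal hp0 hpt,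
      eLpNorm_eq_lintegral_rpow_enorm_toReal hp0 hpt,
      lintegral_prod _ (hF.enorm.pow_const _)]
    refine le_of_eq ?_
    congr 1
    refine lintegral_congr fun x => ?_
    rw [enorm_eq_self, eLpNorm_eq_lintegral_rpow_enorm_toReal hp0 hpt, ← ENNReal.rpow_mul,
      one_div, inv_mul_cancel₀ hpr.ne', ENNReal.rpow_one]

/-- Since `1 ≤ C`, the constant is uniform in `p`. -/
lemma eLpNorm_le_of_map_le {Y : Type*} [MeasurableSpace Y] {μ' : Measure Y} {h : Y → X} {C : ℝ≥0}
    {p : ℝ≥0∞} (hp : 1 ≤ p) (hC : 1 ≤ C)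
    (hh : AEMeasurable h μ') (hle : μ'.map h ≤ (C : ℝ≥0∞) • μ) {f : X → G}
    (hf : AEStronglyMeasurable f μ) : eLpNorm (f ∘ h) p μ' ≤ C * eLpNorm f p μ := by
  have hac : μ'.map h ≪ μ := (Measure.absolutelyContinuous_of_le hle).trans
    Measure.smul_absolutelyContinuous
  rw [← eLpNorm_map_measure (hf.mono_ac hac) hh]
  refine (eLpNorm_mono_measure _ hle).trans ?_
  have hp0 : p ≠ 0 := (zero_lt_one.trans_le hp).ne'
  have hC' : (1 : ℝ≥0∞) ≤ C := by exact_mod_cast hC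
  rw [eLpNorm_smul_measure_of_ne_zero (by positivity)]
  rw [smul_eq_mul]
  gcongr
  by_cases hpt : p = ∞
  · simp [hpt, hC']
  · calc (C : ℝ≥0∞) ^ (1 / p).toReal ≤ (C : ℝ≥0∞) ^ (1 : ℝ) := by
          refine ENNReal.rpow_le_rpow_of_exponent_le hC' ?_
          rw [one_div]
          refine ENNReal.toReal_le_of_le_ofReal zero_le_one ?_
          simpa using hp
      _ = C := ENNReal.rpow_one _

end Averages

section Averages

/-- Averages over maps that tend uniformly to the identity and do not increase the measure by more
than a constant factor converge in `L^p`. -/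
lemma tendsto_eLpNorm_comp_sub {X T G : Type*} [MetricSpace X] [WeaklyLocallyCompactSpace X]
    [MeasurableSpace X] [BorelSpace X] [MeasurableSpace T] [NormedAddCommGroup G] [NormedSpace ℝ G]
    {μ : Measure X} [μ.Regular] [SFinite μ] {ν : ℕ → Measure T} [∀ k, IsProbabilityMeasure (ν k)]
    {h : ℕ → X × T → X} (hh : ∀ k, AEMeasurable (h k) (μ.prod (ν k))) {C : ℝ≥0} (hC : 1 ≤ C)
    (hle : ∀ k, (μ.prod (ν k)).map (h k) ≤ (C : ℝ≥0∞) • μ) {a : ℕ → ℝ}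
    (ha : Tendsto a atTop (𝓝 0)) (hd : ∀ k, ∀ᵐ z ∂(μ.prod (ν k)), dist (h k z) z.1 ≤ a k)
    {p : ℝ≥0∞} (hp : 1 ≤ p) (hpt : p ≠ ∞) {f : X → G} (hf : MemLp f p μ) :
    Tendsto (fun k => eLpNorm (fun z => f (h k z) - f z.1) p (μ.prod (ν k))) atTop (𝓝 0) := by
  rw [ENNReal.tendsto_nhds_zero]
  intro e he
  have hC' : (C : ℝ≥0∞) + 1 + 1 ≠ 0 := by simp
  obtain ⟨η, hη0, hη⟩ : ∃ η : ℝ≥0∞, η ≠ 0 ∧ (C + 1 + 1) * η ≤ e := by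
    refine ⟨min (e / (C + 1 + 1)) 1, ?_, ?_⟩
    · have : e / (C + 1 + 1) ≠ 0 := ENNReal.div_ne_zero.2 ⟨he.ne', by simp⟩
      exact (lt_min (pos_iff_ne_zero.2 this) zero_lt_one).ne'
    · calc (C + 1 + 1 : ℝ≥0∞) * min (e / (C + 1 + 1)) 1 ≤ (C + 1 + 1) * (e / (C + 1 + 1)) := by
            gcongr; exact min_le_left _ _
        _ ≤ e := ENNReal.mul_div_le
  -- `g` is a compactly supported continuous approximation of `f`
  obtain ⟨g, hgc, hfg, hg, hgp⟩ := hf.exists_hasCompactSupport_eLpNorm_sub_le hpt hη0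
  obtain ⟨δ, hδ, hK⟩ := hgc.exists_isCompact_cthickening
  set K := Metric.cthickening δ (tsupport g) with hKdef
  -- a bound for the oscillation of `g` that makes its `L^p` norm over `K` at most `η`
  obtain ⟨b, hb0, hb⟩ : ∃ b : ℝ, 0 < b ∧ ENNReal.ofReal b * μ K ^ p.toReal⁻¹ ≤ η := by
    have hfin : μ K ^ p.toReal⁻¹ ≠ ∞ :=
      ENNReal.rpow_ne_top_of_nonneg (by positivity) hK.measure_lt_top.ne
    have ht : Tendsto (fun b : ℝ => ENNReal.ofReal b * μ K ^ p.toReal⁻¹) (𝓝[>] 0) (𝓝 0) := by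
      have h0 : Tendsto (fun b : ℝ => ENNReal.ofReal b) (𝓝[>] 0) (𝓝 0) := by
        have := (ENNReal.continuous_ofReal.tendsto 0).mono_left
          (nhdsWithin_le_nhds (s := Set.Ioi 0))
        simpa using this
      simpa using ENNReal.Tendsto.mul_const h0 (Or.inr hfin)
    have := (ENNReal.tendsto_nhds_zero.1 ht η (pos_iff_ne_zero.2 hη0)).and self_mem_nhdsWithin
    obtain ⟨b, hb1, hb2⟩ := this.exists
    exact ⟨b, hb2, hb1⟩
  obtain ⟨δ', hδ', huc⟩ := Metric.uniformContinuous_iff.1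
    (hgc.uniformContinuous_of_continuous hg) b hb0
  have hev : ∀ᶠ k in atTop, a k < min δ δ' := ha.eventually (gt_mem_nhds (lt_min hδ hδ'))
  filter_upwards [hev] with k hk
  have hfm := hf.1
  have hgm := hgp.1
  have hac : (μ.prod (ν k)).map (h k) ≪ μ := (Measure.absolutelyContinuous_of_le (hle k)).trans
    Measure.smul_absolutelyContinuous
  have m1 : AEStronglyMeasurable ((f - g) ∘ h k) (μ.prod (ν k)) :=
    ((hfm.sub hgm).mono_ac hac).comp_aemeasurable (hh k)
  have m2 : AEStronglyMeasurable (fun z : X × T => (f - g) z.1) (μ.prod (ν k)) :=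
    (hfm.sub hgm).comp_fst
  have m3 : AEStronglyMeasurable (fun z : X × T => g (h k z) - g z.1) (μ.prod (ν k)) :=
    ((hgm.mono_ac hac).comp_aemeasurable (hh k)).sub hgm.comp_fst
  have e1 : (fun z : X × T => f (h k z) - f z.1) =
      ((f - g) ∘ h k - fun z : X × T => (f - g) z.1) + fun z : X × T => g (h k z) - g z.1 := by
    funext z
    simp only [Pi.add_apply, Pi.sub_apply, Function.comp_apply]
    abel
  have n1 : eLpNorm ((f - g) ∘ h k) p (μ.prod (ν k)) ≤ C * η :=
    (eLpNorm_le_of_map_le hp hC (hh k) (hle k) (hfm.sub hgm)).trans (by gcongr)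
  have n2 : eLpNorm (fun z : X × T => (f - g) z.1) p (μ.prod (ν k)) ≤ η := by
    refine le_of_eq_of_le ?_ hfg
    exact eLpNorm_comp_measurePreserving (hfm.sub hgm) measurePreserving_fst
  have n3 : eLpNorm (fun z : X × T => g (h k z) - g z.1) p (μ.prod (ν k)) ≤ η := by
    have hz : ∀ᵐ z ∂(μ.prod (ν k)), ‖g (h k z) - g z.1‖ ≤
        ‖(K ×ˢ Set.univ : Set (X × T)).indicator (fun _ => b) z‖ := by
      filter_upwards [hd k] with z hz
      have hlt := hz.trans_lt hk
      by_cases hzK : z.1 ∈ K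
      · rw [Set.indicator_of_mem (by simp [hzK]), Real.norm_of_nonneg hb0.le, ← dist_eq_norm]
        exact (huc (hlt.trans_le (min_le_right _ _))).le
      · have h1 : z.1 ∉ tsupport g := fun h' => hzK (Metric.self_subset_cthickening _ h')
        have h2 : h k z ∉ tsupport g := fun h' => hzK
          (Metric.mem_cthickening_of_dist_le _ _ _ _ h'
            (by rw [dist_comm]; exact (hlt.trans_le (min_le_left _ _)).le))
        rw [image_eq_zero_of_notMem_tsupport h1, image_eq_zero_of_notMem_tsupport h2]
        simp
    refine (eLpNorm_mono_ae hz).trans ?_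
    have hKm : MeasurableSet (K ×ˢ Set.univ : Set (X × T)) :=
      hK.measurableSet.prod MeasurableSet.univ
    have hp0 : p ≠ 0 := (zero_lt_one.trans_le hp).ne'
    rw [eLpNorm_indicator_const hKm hp0 hpt, Measure.prod_prod, measure_univ, mul_one, one_div,
      Real.enorm_eq_ofReal hb0.le]
    exact hb
  rw [e1]
  calc _ ≤ (C * η + η) + η :=
        (eLpNorm_add_le (m1.sub m2) m3 hp).trans
          (add_le_add ((eLpNorm_sub_le m1 m2 hp).trans (add_le_add n1 n2)) n3)
    _ = (C + 1 + 1) * η := by ring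
    _ ≤ e := hη

end Averages

/-! ### Mollification -/

section Mollification

variable {m j : ℕ}

/-- The probability measure with density a normed bump function. -/
def bumpMeasure {E : Type*} [NormedAddCommGroup E] [NormedSpace ℝ E] [HasContDiffBump E]
    [MeasurableSpace E] (μ : Measure E) (φ : ContDiffBump (0 : E)) : Measure E :=
  μ.withDensity fun t => ENNReal.ofReal (φ.normed μ t)

lemma measurable_normed {E : Type*} [NormedAddCommGroup E] [NormedSpace ℝ E] [HasContDiffBump E]
    [MeasurableSpace E] [BorelSpace E] (μ : Measure E) (φ : ContDiffBump (0 : E)) :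
    Measurable fun t => (φ.normed μ t).toNNReal :=
  φ.continuous_normed.measurable.real_toNNReal

section Bump

variable {E G : Type*} [NormedAddCommGroup E] [NormedSpace ℝ E] [HasContDiffBump E]
  [MeasurableSpace E] [BorelSpace E] {μ : Measure E} [NormedAddCommGroup G] [NormedSpace ℝ G]
  (φ : ContDiffBump (0 : E))

lemma integral_bumpMeasure (f : E → G) :
    ∫ t, f t ∂(bumpMeasure μ φ) = ∫ t, φ.normed μ t • f t ∂μ := by
  have := integral_withDensity_eq_integral_smul (μ := μ) (measurable_normed μ φ) f
  refine this.trans (integral_congr_ae (Eventually.of_forall fun t => ?_))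
  simp only [NNReal.smul_def, Real.coe_toNNReal _ (φ.nonneg_normed t)]

lemma integrable_bumpMeasure_iff {f : E → G} :
    Integrable f (bumpMeasure μ φ) ↔ Integrable (fun t => φ.normed μ t • f t) μ := by
  have := integrable_withDensity_iff_integrable_smul (μ := μ) (measurable_normed μ φ) (g := f)
  refine this.trans (integrable_congr (Eventually.of_forall fun t => ?_))
  simp only [NNReal.smul_def, Real.coe_toNNReal _ (φ.nonneg_normed t)]

variable [FiniteDimensional ℝ E] [μ.IsAddHaarMeasure]

instance isProbabilityMeasure_bumpMeasure : IsProbabilityMeasure (bumpMeasure μ φ) := by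
  refine ⟨?_⟩
  rw [bumpMeasure, withDensity_apply _ MeasurableSet.univ, Measure.restrict_univ,
    ← ofReal_integral_eq_lintegral_ofReal φ.integrable_normed
      (Eventually.of_forall φ.nonneg_normed), φ.integral_normed, ENNReal.ofReal_one]

lemma ae_norm_lt_bumpMeasure : ∀ᵐ t ∂(bumpMeasure μ φ), ‖t‖ < φ.rOut := by
  have hm : Measurable fun t => ENNReal.ofReal (φ.normed μ t) :=
    (measurable_normed μ φ).coe_nnreal_ennreal
  rw [bumpMeasure, ae_withDensity_iff hm]
  refine Eventually.of_forall fun t ht => ?_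
  have : t ∈ Function.support (φ.normed μ) := fun h0 => ht (by simp [h0])
  rw [φ.support_normed_eq] at this
  simpa using this

end Bump

section Mollify

variable {E : Type*} [NormedAddCommGroup E] [NormedSpace ℝ E] [FiniteDimensional ℝ E]
  [MeasurableSpace E] [BorelSpace E] {μ : Measure E} [μ.IsAddHaarMeasure]

/-- The convolution of a form with a normed bump function. -/
def mollify (μ : Measure E) (φ : ContDiffBump (0 : E)) (α : E → E [⋀^Fin j]→L[ℝ] ℝ) (u : E) :
    E [⋀^Fin j]→L[ℝ] ℝ := ∫ t, φ.normed μ t • α (u - t) ∂μ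

lemma integrable_mollify (φ : ContDiffBump (0 : E)) {α : E → E [⋀^Fin j]→L[ℝ] ℝ}
    (hα : Integrable α μ) (u : E) : Integrable (fun t => φ.normed μ t • α (u - t)) μ :=
  φ.hasCompactSupport_normed.convolutionExists_left (ContinuousLinearMap.lsmul ℝ ℝ)
    φ.continuous_normed hα.locallyIntegrable u

lemma contDiff_mollify (φ : ContDiffBump (0 : E)) {α : E → E [⋀^Fin j]→L[ℝ] ℝ}
    (hα : Integrable α μ) : ContDiff ℝ (⊤ : ℕ∞) (mollify μ φ α) :=
  φ.hasCompactSupport_normed.contDiff_convolution_left (ContinuousLinearMap.lsmul ℝ ℝ)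
    φ.contDiff_normed hα.locallyIntegrable

/-- Derivatives of a mollified function fall on the bump function. The continuous linear map `L` is
applied to the derivative in order to treat exterior differentials. -/
lemma map_fderiv_convolution {G H : Type*} [NormedAddCommGroup G] [NormedSpace ℝ G]
    [FiniteDimensional ℝ G] [NormedAddCommGroup H] [NormedSpace ℝ H] [CompleteSpace H]
    (L : (E →L[ℝ] G) →L[ℝ] H) (φ : ContDiffBump (0 : E)) {f : E → G} (hf : Integrable f μ) (u : E) :
    L (fderiv ℝ (fun u => ∫ t, φ.normed μ t • f (u - t) ∂μ) u) =
        ∫ t, L ((fderiv ℝ (φ.normed μ) t).smulRight (f (u - t))) ∂μ ∧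
      Integrable (fun t => L ((fderiv ℝ (φ.normed μ) t).smulRight (f (u - t)))) μ := by
  have : CompleteSpace G := FiniteDimensional.complete ℝ G
  have h1 := (φ.hasCompactSupport_normed (μ := μ)).hasFDerivAt_convolution_left (μ := μ)
    (ContinuousLinearMap.lsmul ℝ ℝ) (φ.contDiff_normed (n := 1) (μ := μ)) hf.locallyIntegrable u
  have h2 := HasCompactSupport.convolutionExists_left (𝕜 := ℝ)
    ((ContinuousLinearMap.lsmul ℝ ℝ : ℝ →L[ℝ] G →L[ℝ] _).precompL E)
    ((φ.hasCompactSupport_normed (μ := μ)).fderiv ℝ)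
    ((φ.contDiff_normed (n := 1) (μ := μ)).continuous_fderiv one_ne_zero) hf.locallyIntegrable u
  have h3 : Integrable (fun t => (fderiv ℝ (φ.normed μ) t).smulRight (f (u - t))) μ := by
    refine h2.congr (Eventually.of_forall fun t => ?_)
    ext1 v
    simp [ContinuousLinearMap.precompL_apply]
  have h4 : fderiv ℝ (fun u => ∫ t, φ.normed μ t • f (u - t) ∂μ) u =
      ∫ t, (fderiv ℝ (φ.normed μ) t).smulRight (f (u - t)) ∂μ := by
    refine h1.fderiv.trans (integral_congr_ae (Eventually.of_forall fun t => ?_))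
    ext1 v
    simp [ContinuousLinearMap.precompL_apply]
  exact ⟨by rw [h4, ← L.integral_comp_comm h3], L.integrable_comp h3⟩

lemma extDeriv_mollify (φ : ContDiffBump (0 : E)) {α : E → E [⋀^Fin j]→L[ℝ] ℝ}
    (hα : Integrable α μ) (u : E) :
    extDeriv (mollify μ φ α) u = ∫ y, linWedge (fderiv ℝ (φ.normed μ) (u - y)) (α y) ∂μ ∧
      Integrable (fun y => linWedge (fderiv ℝ (φ.normed μ) (u - y)) (α y)) μ := by
  have h5 := map_fderiv_convolution (G := E [⋀^Fin j]→L[ℝ] ℝ) (H := E [⋀^Fin (j + 1)]→L[ℝ] ℝ)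
    (μ := μ) (ContinuousAlternatingMap.alternatizeUncurryFinCLM ℝ E ℝ) φ hα u
  have h6 : (fun t => linWedge (fderiv ℝ (φ.normed μ) t) (α (u - t))) =
      fun t => (fun y => linWedge (fderiv ℝ (φ.normed μ) (u - y)) (α y)) (u - t) := by
    funext t
    simp
  constructor
  · rw [← integral_sub_left_eq_self _ μ u]
    exact h5.1.trans (congrArg (fun f => ∫ t, f t ∂μ) h6)
  · have h7 : Integrable (fun t => linWedge (fderiv ℝ (φ.normed μ) t) (α (u - t))) μ := h5.2
    rw [h6] at h7
    simpa using h7.comp_sub_left u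

lemma mollify_eq (φ : ContDiffBump (0 : E)) (α : E → E [⋀^Fin j]→L[ℝ] ℝ) (u : E) :
    mollify μ φ α u = ∫ y, φ.normed μ (u - y) • α y ∂μ := by
  rw [mollify, ← integral_sub_left_eq_self _ μ u]
  simp

/-- Translations preserve the volume, also after averaging over them. -/
lemma map_sub_bumpMeasure (φ : ContDiffBump (0 : E)) :
    (μ.prod (bumpMeasure μ φ)).map (fun z => z.1 - z.2) = μ := by
  ext A hA
  have hm : Measurable fun z : E × E => z.1 - z.2 := measurable_fst.sub measurable_snd
  rw [Measure.map_apply hm hA, Measure.prod_apply_symm (hm hA)]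
  have : ∀ t, μ ((fun x => (x, t)) ⁻¹' ((fun z : E × E => z.1 - z.2) ⁻¹' A)) = μ A := fun t => by
    have : (fun x => (x, t)) ⁻¹' ((fun z : E × E => z.1 - z.2) ⁻¹' A) =
        (fun x => x - t) ⁻¹' A := rfl
    rw [this, (measurePreserving_sub_right μ t).measure_preimage hA.nullMeasurableSet]
  simp [this]

lemma tendsto_mollify {φ : ℕ → ContDiffBump (0 : E)}
    (hφ : Tendsto (fun k => (φ k).rOut) atTop (𝓝 0)) {α : E → E [⋀^Fin j]→L[ℝ] ℝ}
    (hα : Integrable α μ) :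
    Tendsto (fun k => ∫⁻ u, ‖mollify μ (φ k) α u - α u‖ₑ ∂μ) atTop (𝓝 0) := by
  have h := tendsto_eLpNorm_comp_sub (μ := μ) (ν := fun k => bumpMeasure μ (φ k))
    (h := fun _ z => z.1 - z.2) (C := 1)
    (fun k => (measurable_fst.sub measurable_snd).aemeasurable) le_rfl
    (fun k => by rw [map_sub_bumpMeasure, ENNReal.coe_one, one_smul])
    (a := fun k => (φ k).rOut) hφ (fun k => by
      filter_upwards [Measure.quasiMeasurePreserving_snd.ae
        (ae_norm_lt_bumpMeasure (μ := μ) (φ k))] with z hz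
      simpa [dist_eq_norm] using hz.le)
    le_rfl ENNReal.one_ne_top (memLp_one_iff_integrable.2 hα)
  refine tendsto_of_tendsto_of_tendsto_of_le_of_le tendsto_const_nhds h (fun _ => zero_le)
    fun k => ?_
  have hac : (μ.prod (bumpMeasure μ (φ k))).map (fun z => z.1 - z.2) ≪ μ := by
    rw [map_sub_bumpMeasure]
  have hms : AEStronglyMeasurable (fun z : E × E => α (z.1 - z.2) - α z.1)
      (μ.prod (bumpMeasure μ (φ k))) :=
    ((hα.1.mono_ac hac).comp_aemeasurable (measurable_fst.sub measurable_snd).aemeasurable).sub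
      hα.1.comp_fst
  have h2 := eLpNorm_lintegral_le le_rfl hms
  refine le_trans ?_ h2
  rw [eLpNorm_one_eq_lintegral_enorm]
  refine lintegral_mono fun u => ?_
  have e1 : mollify μ (φ k) α u - α u = ∫ t, (α (u - t) - α u) ∂(bumpMeasure μ (φ k)) := by
    rw [integral_sub ((integrable_bumpMeasure_iff (φ k)).2 (integrable_mollify (φ k) hα u))
      (integrable_const _), integral_const, integral_bumpMeasure, mollify]
    simp
  rw [e1, enorm_eq_self]
  exact enorm_integral_le_lintegral_enorm _

end Mollify

end Mollification

section Approximation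

variable {m j k : ℕ}

lemma wedgeTop_integral_left (h : j + k = m) {X : Type*} [MeasurableSpace X] {μ : Measure X}
    {f : X → EuclideanSpace ℝ (Fin m) [⋀^Fin j]→L[ℝ] ℝ} (hf : Integrable f μ)
    (c : EuclideanSpace ℝ (Fin m) [⋀^Fin k]→L[ℝ] ℝ) :
    wedgeTop h (∫ x, f x ∂μ) c = ∫ x, wedgeTop h (f x) c ∂μ :=
  (((wedgeL h).flip c).integral_comp_comm hf).symm

lemma extDeriv_smul_const_sub {ρ : EuclideanSpace ℝ (Fin m) → ℝ} (hρ : ContDiff ℝ 1 ρ)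
    (u : EuclideanSpace ℝ (Fin m)) (c : EuclideanSpace ℝ (Fin m) [⋀^Fin k]→L[ℝ] ℝ)
    (y : EuclideanSpace ℝ (Fin m)) :
    extDeriv (fun y => ρ (u - y) • c) y = -linWedge (fderiv ℝ ρ (u - y)) c := by
  have h1 : HasFDerivAt (fun y => ρ (u - y)) (-fderiv ℝ ρ (u - y)) y := by
    have h0 := ((hρ.differentiable one_ne_zero) (u - y)).hasFDerivAt
    have h2 : HasFDerivAt (fun y => u - y) (-ContinuousLinearMap.id ℝ _) y :=
      (hasFDerivAt_id y).const_sub u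
    refine (h0.comp y h2).congr_fderiv ?_
    ext v
    simp
  have h2 := (h1.smul_const c).fderiv
  have h3 : (-fderiv ℝ ρ (u - y)).smulRight c = -(fderiv ℝ ρ (u - y)).smulRight c := by
    ext1 v
    simp
  rw [extDeriv, h2, h3]
  exact map_neg (ContinuousAlternatingMap.alternatizeUncurryFinCLM ℝ _ ℝ) _

/-- Mollification commutes with the weak exterior differential, at the points `u` whose neighborhood
involved in the mollification is contained in the set `B` to which the forms are cut off. -/
lemma IsWeakExtDerivOn.extDeriv_mollify {U : Set (EuclideanSpace ℝ (Fin m))}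
    {α : EuclideanSpace ℝ (Fin m) → EuclideanSpace ℝ (Fin m) [⋀^Fin j]→L[ℝ] ℝ}
    {β : EuclideanSpace ℝ (Fin m) → EuclideanSpace ℝ (Fin m) [⋀^Fin (j + 1)]→L[ℝ] ℝ}
    (h : IsWeakExtDerivOn U α β) {B : Set (EuclideanSpace ℝ (Fin m))}
    (hBU : B ⊆ U) (hα : Integrable (B.indicator α)) (hβ : Integrable (B.indicator β))
    (φ : ContDiffBump (0 : EuclideanSpace ℝ (Fin m))) {u : EuclideanSpace ℝ (Fin m)}
    (hu : Metric.closedBall u φ.rOut ⊆ B) :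
    extDeriv (mollify volume φ (B.indicator α)) u = mollify volume φ (B.indicator β) u := by
  rcases Nat.lt_or_ge m (j + 1) with hm | hm
  · rw [continuousAlternatingMap_eq_zero_of_lt hm (extDeriv _ u),
      continuousAlternatingMap_eq_zero_of_lt hm (mollify _ _ _ u)]
  obtain ⟨k, hk⟩ : ∃ k, j + 1 + k = m := ⟨m - (j + 1), by omega⟩
  have hk' : j + (k + 1) = m := by omega
  set ρ : EuclideanSpace ℝ (Fin m) → ℝ := φ.normed volume with hρdef
  have hρ : ContDiff ℝ (⊤ : ℕ∞) ρ := φ.contDiff_normed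
  obtain ⟨e1, i1⟩ := LpForms.extDeriv_mollify (μ := volume) φ hα u
  have i2 : Integrable fun y => ρ (u - y) • B.indicator β y := by
    have := (integrable_mollify (μ := volume) φ hβ u).comp_sub_left u
    simpa using this
  have hts : tsupport (fun y => ρ (u - y)) ⊆ Metric.closedBall u φ.rOut := by
    refine closure_minimal (fun y hy => ?_) Metric.isClosed_closedBall
    have : u - y ∈ Function.support ρ := hy
    rw [hρdef, φ.support_normed_eq] at this
    rw [Metric.mem_closedBall, dist_comm, dist_eq_norm]
    exact (mem_ball_zero_iff.1 this).le
  have hcs : HasCompactSupport fun y => ρ (u - y) :=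
    (isCompact_closedBall u φ.rOut).of_isClosed_subset (isClosed_tsupport _) hts
  have hz : ∀ y, y ∉ B → ρ (u - y) = 0 ∧ fderiv ℝ ρ (u - y) = 0 := fun y hy => by
    have h1 : u - y ∉ tsupport ρ := fun h' => by
      rw [hρdef, φ.tsupport_normed_eq] at h'
      refine hy (hu ?_)
      rw [Metric.mem_closedBall, dist_comm, dist_eq_norm]
      simpa using h'
    exact ⟨image_eq_zero_of_notMem_tsupport h1,
      Function.notMem_support.1 fun h2 => h1 (support_fderiv_subset ℝ h2)⟩
  rw [e1, mollify_eq, ← sub_eq_zero]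
  refine eq_zero_of_wedgeTop_eq_zero hk fun c => ?_
  have ht : IsTestForm U fun y => ρ (u - y) • c :=
    isTestForm_smul_const (hρ.comp (contDiff_const.sub contDiff_id)) hcs
      ((hts.trans hu).trans hBU) c
  -- the test form `y ↦ ρ (u - y) c`, whose differential is minus the product of `dρ (u - y)` and
  -- `c`
  have key := h.integral_eq k hk hk' _ ht
  have hsub : ∀ x y : EuclideanSpace ℝ (Fin m) [⋀^Fin (j + 1)]→L[ℝ] ℝ,
      wedgeTop hk (x - y) c = wedgeTop hk x c - wedgeTop hk y c := fun x y =>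
    map_sub ((wedgeL hk).flip c) x y
  rw [hsub, wedgeTop_integral_left hk i1, wedgeTop_integral_left hk i2, sub_eq_zero]
  have k1 : ∫ y in U, wedgeTop hk' (α y) (extDeriv (fun y => ρ (u - y) • c) y) =
      (-1 : ℝ) ^ (j + 1) *
        ∫ y, wedgeTop hk (linWedge (fderiv ℝ ρ (u - y)) (B.indicator α y)) c := by
    rw [setIntegral_wedgeTop_eq hk' α ht.extDeriv.tsupport_subset, ← integral_const_mul]
    refine integral_congr_ae (Eventually.of_forall fun y => ?_)
    simp only
    rw [extDeriv_smul_const_sub (hρ.of_le (by simp)) u c y]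
    by_cases hy : y ∈ B
    · rw [Set.indicator_of_mem hy, ← neg_one_smul ℝ, wedgeTop_smul_right,
        wedgeTop_linWedge hk hk', pow_succ]
      ring
    · rw [(hz y hy).2, Set.indicator_of_notMem hy, ← linWedgeL_apply, ← linWedgeL_apply, map_zero,
        wedgeTop_zero_left, ← neg_one_smul ℝ, wedgeTop_smul_right]
      have : linWedgeL k (0 : EuclideanSpace ℝ (Fin m) →L[ℝ] ℝ) c = 0 := by
        rw [linWedgeL_apply]
        ext v
        simp [linWedge_apply]
      rw [this, wedgeTop_zero_right]
      simp
  have k2 : ∫ y in U, wedgeTop hk (β y) (ρ (u - y) • c) =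
      ∫ y, wedgeTop hk (ρ (u - y) • B.indicator β y) c := by
    rw [setIntegral_wedgeTop_eq hk β ht.tsupport_subset]
    refine integral_congr_ae (Eventually.of_forall fun y => ?_)
    simp only
    rw [wedgeTop_smul_right, wedgeTop_smul_left]
    by_cases hy : y ∈ B
    · rw [Set.indicator_of_mem hy]
    · rw [(hz y hy).1, zero_mul, zero_mul]
  rw [k1, k2] at key
  exact mul_left_cancel₀ (by simp) key

/-- Weakly differentiable forms are locally approximated in `L^1`, together with their weak
differentials, by smooth forms. -/
lemma IsWeakExtDerivOn.exists_approx {U : Set (EuclideanSpace ℝ (Fin m))}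
    {α : EuclideanSpace ℝ (Fin m) → EuclideanSpace ℝ (Fin m) [⋀^Fin j]→L[ℝ] ℝ}
    {β : EuclideanSpace ℝ (Fin m) → EuclideanSpace ℝ (Fin m) [⋀^Fin (j + 1)]→L[ℝ] ℝ}
    (h : IsWeakExtDerivOn U α β) {u₀ : EuclideanSpace ℝ (Fin m)} {r R : ℝ} (hr : r < R)
    (hR : Metric.closedBall u₀ R ⊆ U) :
    ∃ a : ℕ → EuclideanSpace ℝ (Fin m) → EuclideanSpace ℝ (Fin m) [⋀^Fin j]→L[ℝ] ℝ,
      (∀ k, ContDiff ℝ (⊤ : ℕ∞) (a k)) ∧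
      Tendsto (fun k => ∫⁻ u in Metric.ball u₀ r, ‖a k u - α u‖ₑ) atTop (𝓝 0) ∧
      Tendsto (fun k => ∫⁻ u in Metric.ball u₀ r, ‖extDeriv (a k) u - β u‖ₑ) atTop (𝓝 0) := by
  set B := Metric.closedBall u₀ R with hB
  have hBm : MeasurableSet B := Metric.isClosed_closedBall.measurableSet
  have hBc : IsCompact B := isCompact_closedBall u₀ R
  have hα : Integrable (B.indicator α) :=
    (integrable_indicator_iff (ε' := EuclideanSpace ℝ (Fin m) [⋀^Fin j]→L[ℝ] ℝ) hBm).2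
      (h.1.integrableOn_compact_subset hR hBc)
  have hβ : Integrable (B.indicator β) :=
    (integrable_indicator_iff (ε' := EuclideanSpace ℝ (Fin m) [⋀^Fin (j + 1)]→L[ℝ] ℝ) hBm).2
      (h.2.integrableOn_compact_subset hR hBc)
  have hp : ∀ k : ℕ, 0 < (R - r) / (k + 1) := fun k => div_pos (sub_pos.2 hr) (by positivity)
  set φ : ℕ → ContDiffBump (0 : EuclideanSpace ℝ (Fin m)) := fun k =>
    { rIn := (R - r) / (k + 1) / 2
      rOut := (R - r) / (k + 1)
      rIn_pos := half_pos (hp k)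
      rIn_lt_rOut := half_lt_self (hp k) } with hφ
  have hlim : Tendsto (fun k => (φ k).rOut) atTop (𝓝 0) :=
    ((tendsto_const_div_atTop_nhds_zero_nat (R - r)).comp (tendsto_add_atTop_nat 1)).congr
      fun k => by simp [hφ]
  have hsub : Metric.ball u₀ r ⊆ B :=
    Metric.ball_subset_closedBall.trans (Metric.closedBall_subset_closedBall hr.le)
  refine ⟨fun k => mollify volume (φ k) (B.indicator α), fun k => contDiff_mollify _ hα, ?_, ?_⟩
  · refine tendsto_of_tendsto_of_tendsto_of_le_of_le tendsto_const_nhds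
      (tendsto_mollify hlim hα) (fun _ => zero_le) fun k => ?_
    refine le_trans (le_of_eq ?_) (setLIntegral_le_lintegral (Metric.ball u₀ r) _)
    refine setLIntegral_congr_fun Metric.isOpen_ball.measurableSet fun u hu => ?_
    rw [Set.indicator_of_mem (hsub hu)]
  · refine tendsto_of_tendsto_of_tendsto_of_le_of_le tendsto_const_nhds
      (tendsto_mollify hlim hβ) (fun _ => zero_le) fun k => ?_
    refine le_trans (le_of_eq ?_) (setLIntegral_le_lintegral (Metric.ball u₀ r) _)
    refine setLIntegral_congr_fun Metric.isOpen_ball.measurableSet fun u hu => ?_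
    have hle : (φ k).rOut ≤ R - r :=
      div_le_self (sub_pos.2 hr).le (by linarith [Nat.cast_nonneg (α := ℝ) k])
    have hu' : Metric.closedBall u (φ k).rOut ⊆ B := by
      refine Metric.closedBall_subset_closedBall' ?_
      have := Metric.mem_ball.1 hu
      linarith
    rw [h.extDeriv_mollify hR hα hβ (φ k) hu', Set.indicator_of_mem (hsub hu)]

end Approximation

/-! ### The nearest point retraction -/

section Implicit

variable {V E : Type*} [NormedAddCommGroup V] [InnerProductSpace ℝ V]
  [NormedAddCommGroup E] [InnerProductSpace ℝ E]

lemma isInvertible_of_injective {X Y : Type*} [NormedAddCommGroup X] [NormedSpace ℝ X]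
    [FiniteDimensional ℝ X] [NormedAddCommGroup Y] [NormedSpace ℝ Y] [FiniteDimensional ℝ Y]
    {f : X →L[ℝ] Y} (hf : Function.Injective f)
    (h : Module.finrank ℝ X = Module.finrank ℝ Y) : f.IsInvertible :=
  ⟨(LinearMap.linearEquivOfInjective (f : X →ₗ[ℝ] Y) hf h).toContinuousLinearEquiv, by ext; rfl⟩

lemma eventually_isInvertible {X Y : Type*} [NormedAddCommGroup X]
    [NormedSpace ℝ X] [CompleteSpace X] [NormedAddCommGroup Y] [NormedSpace ℝ Y]
    {f : X →L[ℝ] Y} (hf : f.IsInvertible) : ∀ᶠ f' in 𝓝 f, f'.IsInvertible := by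
  obtain ⟨e, rfl⟩ := hf
  filter_upwards [ContinuousLinearEquiv.nhds e] with f' ⟨e', he'⟩
  exact ⟨e', he'⟩

/-- Continuous solutions of an implicit equation are smooth. -/
lemma contDiffAt_of_implicit {E₁ E₂ F : Type*} [NormedAddCommGroup E₁] [NormedSpace ℝ E₁]
    [CompleteSpace E₁] [NormedAddCommGroup E₂] [NormedSpace ℝ E₂] [CompleteSpace E₂]
    [NormedAddCommGroup F] [NormedSpace ℝ F] [CompleteSpace F] {f : E₁ × E₂ → F} {g : E₁ → E₂}
    {y : E₁} (hf : ContDiffAt ℝ (⊤ : ℕ∞) f (y, g y))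
    (hi : (fderiv ℝ f (y, g y) ∘L .inr ℝ E₁ E₂).IsInvertible) (hg : ContinuousAt g y)
    (h0 : ∀ᶠ z in 𝓝 y, f (z, g z) = f (y, g y)) : ContDiffAt ℝ (⊤ : ℕ∞) g y := by
  have hn : ((⊤ : ℕ∞) : WithTop ℕ∞) ≠ 0 := by simp
  have h1 := hf.eventually_apply_eq_iff_implicitFunction hn hi
  have h2 : Tendsto (fun z => (z, g z)) (𝓝 y) (𝓝 (y, g y)) := (continuousAt_id.prodMk hg)
  refine (hf.contDiffAt_implicitFunction hn hi).congr_of_eventuallyEq ?_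
  filter_upwards [h2.eventually h1, h0] with z hz hz0
  exact (hz.1 hz0).symm

/-- The linear form `v ↦ ⟪y - ψ u, Dψ(u) v⟫`, which vanishes when `ψ u` is a critical point of the
distance from `y`. -/
def normalEq (ψ : V → E) (q : E × V) : V →L[ℝ] ℝ :=
  (innerSL ℝ (q.1 - ψ q.2)).comp (fderiv ℝ ψ q.2)

lemma normalEq_apply (ψ : V → E) (y : E) (u v : V) :
    normalEq ψ (y, u) v = inner ℝ (y - ψ u) (fderiv ℝ ψ u v) := rfl

lemma contDiffAt_normalEq {ψ : V → E} {q : E × V} (h : ContDiffAt ℝ (⊤ : ℕ∞) ψ q.2) :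
    ContDiffAt ℝ (⊤ : ℕ∞) (normalEq ψ) q := by
  have h1 : ContDiffAt ℝ (⊤ : ℕ∞) (fun q : E × V => ψ q.2) q := h.comp q contDiffAt_snd
  have h2 : ContDiffAt ℝ (⊤ : ℕ∞) (fun q : E × V => fderiv ℝ ψ q.2) q :=
    (h.fderiv_right (by simp)).comp q contDiffAt_snd
  exact ((innerSL ℝ).contDiff.contDiffAt.comp q (contDiffAt_fst.sub h1)).clm_comp h2

/-- The partial derivative of the equation in `u` at `y = ψ u`: the term with the second derivative
of `ψ` carries the factor `y - ψ u` and drops out. -/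
lemma fderiv_normalEq_inr {ψ : V → E} {u : V} (h : ContDiffAt ℝ (⊤ : ℕ∞) ψ u) (w v : V) :
    (fderiv ℝ (normalEq ψ) (ψ u, u) ∘L .inr ℝ E V) w v =
      -inner ℝ (fderiv ℝ ψ u w) (fderiv ℝ ψ u v) := by
  have h1 : HasFDerivAt (normalEq ψ) (fderiv ℝ (normalEq ψ) (ψ u, u)) (ψ u, u) :=
    ((contDiffAt_normalEq (q := (ψ u, u)) h).differentiableAt (by simp)).hasFDerivAt
  have h2 : HasFDerivAt (fun z => normalEq ψ (ψ u, z))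
      (fderiv ℝ (normalEq ψ) (ψ u, u) ∘L .inr ℝ E V) u := h1.comp u (hasFDerivAt_prodMk_right _ _)
  have h3 : HasFDerivAt (fun z => innerSL ℝ (ψ u - ψ z)) ((innerSL ℝ).comp (-fderiv ℝ ψ u)) u :=
    (innerSL ℝ : E →L[ℝ] E →L[ℝ] ℝ).hasFDerivAt.comp u
      ((h.differentiableAt (by simp)).hasFDerivAt.const_sub (ψ u))
  have h4 : HasFDerivAt (fderiv ℝ ψ) (fderiv ℝ (fderiv ℝ ψ) u) u :=
    ((h.fderiv_right (m := (⊤ : ℕ∞)) (by simp)).differentiableAt (by simp)).hasFDerivAt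
  have h5 := h2.unique (h3.clm_comp h4)
  rw [h5]
  simp

lemma isInvertible_fderiv_normalEq_inr [FiniteDimensional ℝ V] {ψ : V → E} {u : V}
    (h : ContDiffAt ℝ (⊤ : ℕ∞) ψ u)
    (hi : Function.Injective (fderiv ℝ ψ u)) :
    (fderiv ℝ (normalEq ψ) (ψ u, u) ∘L .inr ℝ E V).IsInvertible := by
  refine isInvertible_of_injective ?_ ?_
  · rw [injective_iff_map_eq_zero]
    intro w hw
    have := fderiv_normalEq_inr h w w
    rw [hw] at this
    simp only [_root_.zero_apply, real_inner_self_eq_norm_sq] at this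
    have h0 : fderiv ℝ ψ u w = 0 := by
      rw [← norm_eq_zero]
      nlinarith [norm_nonneg (fderiv ℝ ψ u w)]
    exact hi (by rw [h0, map_zero])
  · exact (InnerProductSpace.toDual ℝ V).toLinearEquiv.finrank_eq

/-- Near a point of an immersed piece, the critical points of the distance are unique and depend
smoothly on the point from which the distance is measured. -/
lemma exists_implicit_normalEq [FiniteDimensional ℝ V] [FiniteDimensional ℝ E] {ψ : V → E}
    {Ω : Set V} (hΩ : IsOpen Ω)
    (hψ : ContDiffOn ℝ (⊤ : ℕ∞) ψ Ω) {u₀ : V} (hu₀ : u₀ ∈ Ω)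
    (hi : Function.Injective (fderiv ℝ ψ u₀)) :
    ∃ (g : E → V) (W : Set E) (O : Set V), IsOpen W ∧ ψ u₀ ∈ W ∧ O ∈ 𝓝 u₀ ∧ O ⊆ Ω ∧
      ∀ y ∈ W, ContDiffAt ℝ (⊤ : ℕ∞) g y ∧ g y ∈ Ω ∧ normalEq ψ (y, g y) = 0 ∧
        ∀ u ∈ O, normalEq ψ (y, u) = 0 → g y = u := by
  have hψ' : ∀ u ∈ Ω, ContDiffAt ℝ (⊤ : ℕ∞) ψ u := fun u hu => hψ.contDiffAt (hΩ.mem_nhds hu)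
  have hn : ((⊤ : ℕ∞) : WithTop ℕ∞) ≠ 0 := by simp
  set q₀ : E × V := (ψ u₀, u₀) with hq₀
  have hF : ContDiffAt ℝ (⊤ : ℕ∞) (normalEq ψ) q₀ := contDiffAt_normalEq (hψ' u₀ hu₀)
  have hinv := isInvertible_fderiv_normalEq_inr (hψ' u₀ hu₀) hi
  have hF0 : normalEq ψ q₀ = 0 := by
    ext v
    simp [hq₀, normalEq_apply]
  set g := hF.implicitFunction hn hinv with hg
  have hg0 : g (ψ u₀) = u₀ := hF.implicitFunction_apply_self hn hinv
  have hgs : ContDiffAt ℝ (⊤ : ℕ∞) g (ψ u₀) := hF.contDiffAt_implicitFunction hn hinv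
  have e1 : ∀ᶠ y in 𝓝 (ψ u₀), normalEq ψ (y, g y) = 0 := by
    have := hF.eventually_apply_implicitFunction hn hinv
    rwa [hF0] at this
  have e2 : ∀ᶠ v in 𝓝 q₀, normalEq ψ v = 0 ↔ g v.1 = v.2 := by
    have := hF.eventually_apply_eq_iff_implicitFunction hn hinv
    rwa [hF0] at this
  have e3 : ∀ᶠ y in 𝓝 (ψ u₀), ContinuousAt g y := by
    have h1 : ContDiffAt ℝ 1 g (ψ u₀) := hgs.of_le (by simp)
    filter_upwards [h1.eventually (by simp)] with y hy using hy.continuousAt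
  have hgt : Tendsto g (𝓝 (ψ u₀)) (𝓝 u₀) := by
    have := hgs.continuousAt.tendsto
    rwa [hg0] at this
  have hgp : Tendsto (fun y => (y, g y)) (𝓝 (ψ u₀)) (𝓝 q₀) := tendsto_id.prodMk_nhds hgt
  have e4 : ∀ᶠ y in 𝓝 (ψ u₀), g y ∈ Ω := hgt.eventually (hΩ.mem_nhds hu₀)
  have e5 : ∀ᶠ y in 𝓝 (ψ u₀), (fderiv ℝ (normalEq ψ) (y, g y) ∘L .inr ℝ E V).IsInvertible := by
    have hc : ContinuousAt (fun q => fderiv ℝ (normalEq ψ) q ∘L .inr ℝ E V) q₀ :=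
      (hF.fderiv_right (m := (⊤ : ℕ∞)) (by simp)).continuousAt.clm_comp continuousAt_const
    exact hgp.eventually (hc.eventually (eventually_isInvertible hinv))
  rw [hq₀, nhds_prod_eq] at e2
  obtain ⟨P, hP, Q, hQ, hPQ⟩ := eventually_prod_iff.1 e2
  have hall := (((e1.and e3).and (e4.and e5)).and hP)
  obtain ⟨W, hW, hWo, hW0⟩ := eventually_nhds_iff.1 hall
  refine ⟨g, W, {u | Q u} ∩ Ω, hWo, hW0, inter_mem hQ (hΩ.mem_nhds hu₀), Set.inter_subset_right,
    fun y hy => ?_⟩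
  obtain ⟨⟨⟨h1, h3⟩, h4, h5⟩, h6⟩ := hW y hy
  -- Mathlib gives smoothness of `g` at the centre `ψ u₀` only; at the other points of `W` it
  -- follows from the implicit function theorem centred there.
  refine ⟨contDiffAt_of_implicit (contDiffAt_normalEq (hψ' _ h4)) h5 h3 ?_, h4, h1,
    fun u hu h0 => (hPQ h6 hu.1).1 h0⟩
  filter_upwards [hWo.mem_nhds hy] with z hz
  rw [h1, (hW z hz).1.1.1]

end Implicit

section Retraction

variable {n m : ℕ} {M : Set (EuclideanSpace ℝ (Fin n))}

/-- The parametrization of a piece of `M` that belongs to a coordinate system. -/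
def param (e : OpenPartialHomeomorph M (EuclideanSpace ℝ (Fin m))) (u : EuclideanSpace ℝ (Fin m)) :
    EuclideanSpace ℝ (Fin n) := e.symm u

open Classical in
/-- The coordinate map of a coordinate system, extended by zero to `ℝ^n`. -/
def coordMap (e : OpenPartialHomeomorph M (EuclideanSpace ℝ (Fin m)))
    (x : EuclideanSpace ℝ (Fin n)) : EuclideanSpace ℝ (Fin m) :=
  if h : x ∈ M then e ⟨x, h⟩ else 0

lemma coordMap_coe (e : OpenPartialHomeomorph M (EuclideanSpace ℝ (Fin m))) (x : M) :
    coordMap e x = e x := by simp [coordMap]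

lemma coordMap_param {e : OpenPartialHomeomorph M (EuclideanSpace ℝ (Fin m))}
    {u : EuclideanSpace ℝ (Fin m)} (hu : u ∈ e.target) : coordMap e (param e u) = u := by
  rw [param, coordMap_coe, e.right_inv hu]

lemma param_mem (e : OpenPartialHomeomorph M (EuclideanSpace ℝ (Fin m)))
    (u : EuclideanSpace ℝ (Fin m)) : param e u ∈ M := (e.symm u).2

lemma IsCoord.contDiffAt_param {e : OpenPartialHomeomorph M (EuclideanSpace ℝ (Fin m))}
    (he : IsCoord e) {u : EuclideanSpace ℝ (Fin m)} (hu : u ∈ e.target) :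
    ContDiffAt ℝ (⊤ : ℕ∞) (param e) u := he.1.contDiffAt (e.open_target.mem_nhds hu)

/-- `x` is a point of `M` nearest to `y`. -/
def IsNearest (M : Set (EuclideanSpace ℝ (Fin n))) (y x : EuclideanSpace ℝ (Fin n)) : Prop :=
  x ∈ M ∧ ∀ z ∈ M, dist y x ≤ dist y z

lemma IsNearest.normalEq_eq_zero {e : OpenPartialHomeomorph M (EuclideanSpace ℝ (Fin m))}
    (he : IsCoord e) {u : EuclideanSpace ℝ (Fin m)} (hu : u ∈ e.target)
    {y : EuclideanSpace ℝ (Fin n)} (h : IsNearest M y (param e u)) :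
    normalEq (param e) (y, u) = 0 := by
  have hd := ((he.contDiffAt_param hu).differentiableAt (by simp)).hasFDerivAt
  have h1 : HasFDerivAt (fun u => ‖y - param e u‖ ^ 2) _ u := (hd.const_sub y).norm_sq
  have hmin : IsLocalMin (fun u => ‖y - param e u‖ ^ 2) u := Eventually.of_forall fun v => by
    have := h.2 _ (param_mem e v)
    rw [dist_eq_norm, dist_eq_norm] at this
    show ‖y - param e u‖ ^ 2 ≤ ‖y - param e v‖ ^ 2
    gcongr
  have h2 := hmin.hasFDerivAt_eq_zero h1
  ext v
  have h3 := congrArg (fun L => L v) h2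
  simp only [normalEq_apply, _root_.zero_apply, inner_sub_left]
  simp at h3
  linarith

/-- Although `M` need not be closed, points close enough to a given point of `M` have a nearest
point in `M`: the distance attains its minimum over a compact piece, and the rest of `M` is farther.
-/
lemma exists_isNearest (hM : IsSmoothSubmanifold m M) (x₀ : M) :
    ∃ r > 0, ∀ y ∈ Metric.ball (x₀ : EuclideanSpace ℝ (Fin n)) r, ∃ x, IsNearest M y x := by
  obtain ⟨e, he, hx⟩ := hM x₀
  obtain ⟨ρ, hρ, hsub⟩ := Metric.nhds_basis_closedBall.mem_iff.1
    (e.open_target.mem_nhds (e.map_source hx))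
  have hK : IsCompact (e.symm '' Metric.closedBall (e x₀) ρ) :=
    (isCompact_closedBall _ _).image_of_continuousOn (e.continuousOn_symm.mono hsub)
  have hKn : e.symm '' Metric.closedBall (e x₀) ρ ∈ 𝓝 x₀ := by
    have := e.symm.image_mem_nhds (x := e x₀) (e.map_source hx)
      (Metric.closedBall_mem_nhds (e x₀) hρ)
    rwa [e.left_inv hx] at this
  obtain ⟨r, hr, hrK⟩ := Metric.mem_nhds_iff.1 hKn
  refine ⟨r / 2, half_pos hr, fun y hy => ?_⟩
  have hK' : IsCompact ((fun x : M => (x : EuclideanSpace ℝ (Fin n))) ''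
    (e.symm '' Metric.closedBall (e x₀) ρ)) := hK.image continuous_subtype_val
  obtain ⟨x, hxK, hmin⟩ := hK'.exists_isMinOn ⟨x₀, x₀, mem_of_mem_nhds hKn, rfl⟩
    (continuous_const.dist continuous_id : Continuous fun z => dist y z).continuousOn
  refine ⟨x, ?_, fun z hz => ?_⟩
  · obtain ⟨x', -, rfl⟩ := hxK
    exact x'.2
  · by_cases hzr : dist (⟨z, hz⟩ : M) x₀ < r
    · exact hmin ⟨_, hrK hzr, rfl⟩
    · have h1 : dist y x ≤ dist y x₀ := hmin ⟨x₀, mem_of_mem_nhds hKn, rfl⟩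
      have h2 : r ≤ dist z x₀ := not_lt.1 hzr
      have h3 := dist_triangle z y x₀
      rw [Metric.mem_ball] at hy
      rw [dist_comm z y] at h3
      linarith

/-- Near a point of `M` the nearest point is unique and depends smoothly on the given point. -/
lemma exists_nearest_smooth {e : OpenPartialHomeomorph M (EuclideanSpace ℝ (Fin m))}
    (he : IsCoord e) (hM : IsSmoothSubmanifold m M) {x₀ : M} (hx₀ : x₀ ∈ e.source) :
    ∃ (g : EuclideanSpace ℝ (Fin n) → EuclideanSpace ℝ (Fin m))
      (W : Set (EuclideanSpace ℝ (Fin n))), IsOpen W ∧ (x₀ : EuclideanSpace ℝ (Fin n)) ∈ W ∧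
      ∀ y ∈ W, ContDiffAt ℝ (⊤ : ℕ∞) g y ∧ g y ∈ e.target ∧ normalEq (param e) (y, g y) = 0 ∧
        (∃ x, IsNearest M y x) ∧ ∀ x, IsNearest M y x → x = param e (g y) := by
  have hu₀ := e.map_source hx₀
  have hψ₀ : param e (e x₀) = x₀ := by rw [param, e.left_inv hx₀]
  obtain ⟨g, W, O, hW, hW0, hO, hOt, hg⟩ := exists_implicit_normalEq e.open_target
    he.contDiffOn hu₀ (he.injective_fderiv _ hu₀)
  have hOn : e.symm '' O ∈ 𝓝 x₀ := by
    have := e.symm.image_mem_nhds (x := e x₀) hu₀ hO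
    rwa [e.left_inv hx₀] at this
  obtain ⟨r, hr, hrO⟩ := Metric.mem_nhds_iff.1 hOn
  obtain ⟨r', hr', hn⟩ := exists_isNearest hM x₀
  refine ⟨g, W ∩ Metric.ball x₀ (min (r / 2) r'), hW.inter Metric.isOpen_ball,
    ⟨?_, Metric.mem_ball_self (lt_min (half_pos hr) hr')⟩, fun y hy => ?_⟩
  · rw [← hψ₀]
    exact hW0
  obtain ⟨h1, h2, h3, h4⟩ := hg y hy.1
  have hyr : dist y x₀ < min (r / 2) r' := hy.2
  refine ⟨h1, h2, h3, hn y (hyr.trans_le (min_le_right _ _)), fun x hx => ?_⟩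
  have hlt : dist x x₀ < r := by
    have := dist_triangle x y x₀
    have h5 := hx.2 x₀ x₀.2
    have h6 := hyr.trans_le (min_le_left _ _)
    rw [dist_comm x y] at this
    linarith
  obtain ⟨u, huO, hux⟩ := hrO (show (⟨x, hx.1⟩ : M) ∈ Metric.ball x₀ r from hlt)
  have hux' : param e u = x := congrArg Subtype.val hux
  rw [h4 u huO (IsNearest.normalEq_eq_zero he (hOt huO) (hux'.symm ▸ hx)), hux']

end Retraction

/-! ### The tubular neighborhood of the submanifold -/

section Tubular

variable {n m : ℕ} {M : Set (EuclideanSpace ℝ (Fin n))}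

/-- `π` is a smooth retraction of the open neighborhood `N` of `M` onto `M` whose differential at
each point of `M` is the orthogonal projection onto the tangent space. The last condition is stated
in coordinates: `w - Dπ(x) w` is orthogonal to the images of the coordinate directions. -/
structure IsTubularRetraction (m : ℕ) (M N : Set (EuclideanSpace ℝ (Fin n)))
    (π : EuclideanSpace ℝ (Fin n) → EuclideanSpace ℝ (Fin n)) : Prop where
  isOpen : IsOpen N
  subset : M ⊆ N
  mem : ∀ y ∈ N, π y ∈ M
  self : ∀ x ∈ M, π x = x
  contDiffAt : ∀ y ∈ N, ContDiffAt ℝ (⊤ : ℕ∞) π y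
  contDiffAt_coordMap : ∀ e : OpenPartialHomeomorph M (EuclideanSpace ℝ (Fin m)), IsCoord e →
    ∀ y ∈ N, ∀ h : π y ∈ M, ⟨π y, h⟩ ∈ e.source →
      ContDiffAt ℝ (⊤ : ℕ∞) (fun z => coordMap e (π z)) y
  inner_sub_fderiv : ∀ e : OpenPartialHomeomorph M (EuclideanSpace ℝ (Fin m)), IsCoord e →
    ∀ u ∈ e.target, ∀ w v,
      inner ℝ (w - fderiv ℝ π (param e u) w) (fderiv ℝ (param e) u v) = 0

/-- The nearest point map is such a retraction. -/
lemma exists_isTubularRetraction (hM : IsSmoothSubmanifold m M) :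
    ∃ N π, IsTubularRetraction m M N π := by
  classical
  have key : ∀ e : OpenPartialHomeomorph M (EuclideanSpace ℝ (Fin m)), IsCoord e →
      ∀ x₀ ∈ e.source, _ := fun e he x₀ hx₀ => exists_nearest_smooth he hM hx₀
  set π : EuclideanSpace ℝ (Fin n) → EuclideanSpace ℝ (Fin n) := fun y =>
    if h : ∃ x, IsNearest M y x then h.choose else y with hπ
  have hπn : ∀ y, (∃ x, IsNearest M y x) → IsNearest M y (π y) := fun y h => by
    rw [hπ]
    simp only [dif_pos h]
    exact h.choose_spec
  have hself : ∀ x ∈ M, π x = x := fun x hx => by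
    have h : IsNearest M x x := ⟨hx, fun z _ => by simp⟩
    have h1 := (hπn x ⟨x, h⟩).2 x hx
    simpa using (dist_le_zero.1 (h1.trans_eq (dist_self x))).symm
  choose g W hW hxW hg using key
  choose e₀ he₀ hxe₀ using hM
  set N : Set (EuclideanSpace ℝ (Fin n)) := ⋃ x : M, W (e₀ x) (he₀ x) x (hxe₀ x) with hN
  have hNe : ∀ y ∈ N, ∃ x : M, y ∈ W (e₀ x) (he₀ x) x (hxe₀ x) := fun y hy => Set.mem_iUnion.1 hy
  have hWπ : ∀ e he x hx, ∀ y ∈ W e he x hx, π y = param e (g e he x hx y) :=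
    fun e he x hx y hy => (hg e he x hx y hy).2.2.2.2 _ (hπn y (hg e he x hx y hy).2.2.2.1)
  have hmem : ∀ y ∈ N, π y ∈ M := fun y hy => by
    obtain ⟨x, hx⟩ := hNe y hy
    exact (hπn y (hg _ _ _ _ y hx).2.2.2.1).1
  have hsm : ∀ y ∈ N, ContDiffAt ℝ (⊤ : ℕ∞) π y := fun y hy => by
    obtain ⟨x, hx⟩ := hNe y hy
    obtain ⟨h1, h2, -⟩ := hg _ _ _ _ y hx
    refine (((he₀ x).contDiffAt_param h2).comp y h1).congr_of_eventuallyEq ?_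
    filter_upwards [(hW _ _ _ _).mem_nhds hx] with z hz using hWπ _ _ _ _ z hz
  refine ⟨N, π, isOpen_iUnion fun x => hW _ _ _ _, fun x hx =>
    Set.mem_iUnion.2 ⟨⟨x, hx⟩, hxW _ _ _ _⟩, hmem, hself, hsm, ?_, ?_⟩
  · -- Near the point `π y` of `M` the coordinates of the nearest point are given by the smooth `g`;
    -- compose with `π`, using `π ∘ π = π`.
    intro e he y hy h hys
    have h1 : ContDiffAt ℝ (⊤ : ℕ∞) (fun z => coordMap e (π z)) (π y) := by
      have hx := hxW e he ⟨π y, h⟩ hys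
      refine (hg e he _ hys _ hx).1.congr_of_eventuallyEq ?_
      filter_upwards [(hW e he _ hys).mem_nhds hx] with z hz
      rw [hWπ _ _ _ _ z hz, coordMap_param (hg e he _ hys z hz).2.1]
    refine (ContDiffAt.comp y h1 (hsm y hy)).congr_of_eventuallyEq ?_
    have hNo : N ∈ 𝓝 y := (isOpen_iUnion fun x => hW _ _ _ _).mem_nhds hy
    filter_upwards [hNo] with z hz
    simp only [Function.comp_apply]
    rw [hself (π z) (hmem z hz)]
  · -- Differentiate the identity `⟪z - π z, Dψ(g z) v⟫ = 0` at `z = ψ u`, where `z - π z = 0`.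
    intro e he u hu w v
    have hxs := e.map_target hu
    have hx : param e u ∈ W e he (e.symm u) hxs := hxW e he _ hxs
    set g' := g e he (e.symm u) hxs with hg'
    obtain ⟨h1, h2, h3, -⟩ := hg e he _ hxs _ hx
    have hgu : g' (param e u) = u := by
      have := hWπ e he _ hxs _ hx
      rw [hself _ (param_mem e u)] at this
      rw [← coordMap_param hu, this, coordMap_param h2, ← this]
    have hπd : HasFDerivAt π (fderiv ℝ π (param e u)) (param e u) :=
      ((hsm _ (Set.mem_iUnion.2 ⟨⟨_, param_mem e u⟩, hxW _ _ _ _⟩)).differentiableAt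
        (by simp)).hasFDerivAt
    have hgd : HasFDerivAt g' (fderiv ℝ g' (param e u)) (param e u) :=
      (h1.differentiableAt (by simp)).hasFDerivAt
    have hD : HasFDerivAt (fderiv ℝ (param e)) (fderiv ℝ (fderiv ℝ (param e)) u)
        (g' (param e u)) := by
      rw [hgu]
      exact (((he.contDiffAt_param hu).fderiv_right (m := (⊤ : ℕ∞)) (by simp)).differentiableAt
        (by simp)).hasFDerivAt
    have hDv : HasFDerivAt (fun z => fderiv ℝ (param e) (g' z) v) _ (param e u) :=
      (hD.comp (param e u) hgd).clm_apply (hasFDerivAt_const v _)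
    have h4 := ((hasFDerivAt_id (𝕜 := ℝ) (param e u)).sub hπd).inner ℝ hDv
    have h5 : (fun z => inner ℝ ((id - π : EuclideanSpace ℝ (Fin n) → _) z)
        (fderiv ℝ (param e) (g' z) v)) =ᶠ[𝓝 (param e u)]
        fun _ => 0 := by
      filter_upwards [(hW e he _ hxs).mem_nhds hx] with z hz
      have h6 := congrArg (fun L => L v) (hg e he _ hxs z hz).2.2.1
      rw [Pi.sub_apply, hWπ e he _ hxs z hz]
      exact h6
    have h7 := (h4.congr_of_eventuallyEq h5.symm).unique (hasFDerivAt_const (0 : ℝ) (param e u))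
    have h8 := congrArg (fun L => L w) h7
    simpa [fderivInnerCLM_apply, hgu, hself _ (param_mem e u)] using h8

namespace IsTubularRetraction

variable {N : Set (EuclideanSpace ℝ (Fin n))}
  {π : EuclideanSpace ℝ (Fin n) → EuclideanSpace ℝ (Fin n)}

lemma hasFDerivAt (h : IsTubularRetraction m M N π) {y : EuclideanSpace ℝ (Fin n)} (hy : y ∈ N) :
    HasFDerivAt π (fderiv ℝ π y) y := ((h.contDiffAt y hy).differentiableAt (by simp)).hasFDerivAt

lemma mem_nhds (h : IsTubularRetraction m M N π) {y : EuclideanSpace ℝ (Fin n)} (hy : y ∈ N) :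
    N ∈ 𝓝 y := h.isOpen.mem_nhds hy

lemma eventually_mem_source (h : IsTubularRetraction m M N π)
    (e : OpenPartialHomeomorph M (EuclideanSpace ℝ (Fin m)))
    {y : EuclideanSpace ℝ (Fin n)} (hy : y ∈ N) (hs : (⟨π y, h.mem y hy⟩ : M) ∈ e.source) :
    ∀ᶠ z in 𝓝 y, ∃ hz : z ∈ N, (⟨π z, h.mem z hz⟩ : M) ∈ e.source := by
  obtain ⟨O, hO, hOe⟩ := isOpen_induced_iff.1 e.open_source
  have hyO : π y ∈ O := by
    have : (⟨π y, h.mem y hy⟩ : M) ∈ Subtype.val ⁻¹' O := hOe ▸ hs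
    exact this
  filter_upwards [h.mem_nhds hy, (h.contDiffAt y hy).continuousAt (hO.mem_nhds hyO)] with z hz hzO
  refine ⟨hz, ?_⟩
  rw [← hOe]
  exact hzO

lemma eq_param (h : IsTubularRetraction m M N π)
    (e : OpenPartialHomeomorph M (EuclideanSpace ℝ (Fin m)))
    {y : EuclideanSpace ℝ (Fin n)} (hy : y ∈ N) (hs : (⟨π y, h.mem y hy⟩ : M) ∈ e.source) :
    π y = param e (coordMap e (π y)) := by
  have : coordMap e (π y) = e ⟨π y, h.mem y hy⟩ := coordMap_coe e ⟨π y, h.mem y hy⟩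
  rw [this, param, e.left_inv hs]

lemma coordMap_mem_target (h : IsTubularRetraction m M N π)
    (e : OpenPartialHomeomorph M (EuclideanSpace ℝ (Fin m)))
    {y : EuclideanSpace ℝ (Fin n)} (hy : y ∈ N) (hs : (⟨π y, h.mem y hy⟩ : M) ∈ e.source) :
    coordMap e (π y) ∈ e.target := by
  have : coordMap e (π y) = e ⟨π y, h.mem y hy⟩ := coordMap_coe e ⟨π y, h.mem y hy⟩
  rw [this]
  exact e.map_source hs

lemma fderiv_eq_comp (h : IsTubularRetraction m M N π)
    {e : OpenPartialHomeomorph M (EuclideanSpace ℝ (Fin m))} (he : IsCoord e)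
    {y : EuclideanSpace ℝ (Fin n)} (hy : y ∈ N) (hs : (⟨π y, h.mem y hy⟩ : M) ∈ e.source) :
    fderiv ℝ π y = (fderiv ℝ (param e) (coordMap e (π y))).comp
      (fderiv ℝ (fun z => coordMap e (π z)) y) := by
  have h1 : π =ᶠ[𝓝 y] fun z => param e (coordMap e (π z)) := by
    filter_upwards [h.eventually_mem_source e hy hs] with z ⟨hz, hzs⟩ using h.eq_param e hz hzs
  rw [h1.fderiv_eq]
  exact fderiv_comp y ((he.contDiffAt_param (h.coordMap_mem_target e hy hs)).differentiableAt
    (by simp)) ((h.contDiffAt_coordMap e he y hy (h.mem y hy) hs).differentiableAt (by simp))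

/-- The span of the tangent cone of `M` is the image of the differential of a parametrization: since
`π` is the identity on `M`, its differential fixes the tangent vectors. -/
lemma tangentSpaceAt_eq_range (h : IsTubularRetraction m M N π)
    {e : OpenPartialHomeomorph M (EuclideanSpace ℝ (Fin m))} (he : IsCoord e)
    {u : EuclideanSpace ℝ (Fin m)} (hu : u ∈ e.target) :
    tangentSpaceAt M (e.symm u) = (fderiv ℝ (param e) u).range := by
  have hx : param e u ∈ N := h.subset (param_mem e u)
  have hπx : π (param e u) = param e u := h.self _ (param_mem e u)
  apply le_antisymm
  · refine Submodule.span_le.2 fun v hv => ?_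
    have h1 : HasFDerivWithinAt π (fderiv ℝ π (param e u)) M (param e u) :=
      (h.hasFDerivAt hx).hasFDerivWithinAt
    have h2 : HasFDerivWithinAt π (ContinuousLinearMap.id ℝ _) M (param e u) :=
      (hasFDerivWithinAt_id _ _).congr (fun z hz => h.self z hz) hπx
    have h3 : fderiv ℝ π (param e u) v = v := h1.unique_on h2 hv
    have hs : (⟨π (param e u), h.mem _ hx⟩ : M) ∈ e.source := by
      have : (⟨π (param e u), h.mem _ hx⟩ : M) = e.symm u := Subtype.ext hπx
      rw [this]
      exact e.map_target hu
    rw [h.fderiv_eq_comp he hx hs, hπx, coordMap_param hu] at h3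
    exact ⟨_, h3⟩
  · rintro _ ⟨v, rfl⟩
    have h1 : HasFDerivWithinAt (param e) (fderiv ℝ (param e) u) Set.univ u :=
      ((he.contDiffAt_param hu).differentiableAt (by simp)).hasFDerivAt.hasFDerivWithinAt
    refine Submodule.subset_span (tangentConeAt_mono (𝕜 := ℝ) ?_
      (h1.mapsTo_tangent_cone (by rw [tangentConeAt_univ]; exact Set.mem_univ v)))
    rintro _ ⟨w, -, rfl⟩
    exact param_mem e w

lemma fderiv_mem (h : IsTubularRetraction m M N π) (hM : IsSmoothSubmanifold m M)
    {y : EuclideanSpace ℝ (Fin n)} (hy : y ∈ N) (v : EuclideanSpace ℝ (Fin n)) :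
    fderiv ℝ π y v ∈ tangentSpaceAt M ⟨π y, h.mem y hy⟩ := by
  obtain ⟨e, he, hs⟩ := hM ⟨π y, h.mem y hy⟩
  have h1 := h.tangentSpaceAt_eq_range he (h.coordMap_mem_target e hy hs)
  have h2 : e.symm (coordMap e (π y)) = ⟨π y, h.mem y hy⟩ :=
    Subtype.ext (h.eq_param e hy hs).symm
  rw [h2] at h1
  rw [h1, h.fderiv_eq_comp he hy hs]
  exact ⟨_, rfl⟩

/-- On `M` the differential of the retraction is the orthogonal projection onto the tangent
space. -/
lemma fderiv_eq (h : IsTubularRetraction m M N π) (hM : IsSmoothSubmanifold m M) (x : M)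
    (w : EuclideanSpace ℝ (Fin n)) :
    fderiv ℝ π x w = (tangentSpaceAt M x).orthogonalProjectionOnto w := by
  have hx : (x : EuclideanSpace ℝ (Fin n)) ∈ N := h.subset x.2
  symm
  rw [← Submodule.starProjection_apply]
  refine Submodule.eq_starProjection_of_mem_of_inner_eq_zero ?_ fun v hv => ?_
  · have := h.fderiv_mem hM hx w
    have h2 : (⟨π x, h.mem x hx⟩ : M) = x := Subtype.ext (h.self x x.2)
    rwa [h2] at this
  · obtain ⟨e, he, hs⟩ := hM x
    have h1 := h.tangentSpaceAt_eq_range he (e.map_source hs)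
    rw [e.left_inv hs] at h1
    rw [h1] at hv
    obtain ⟨v, rfl⟩ := hv
    have h2 := h.inner_sub_fderiv e he (e x) (e.map_source hs) w v
    rw [show param e (e x) = x from congrArg Subtype.val (e.left_inv hs)] at h2
    exact h2

end IsTubularRetraction
end Tubular

/-! ### The Riemannian volume in coordinates -/

section Volume

variable {n m j : ℕ} {M N : Set (EuclideanSpace ℝ (Fin n))}
  {π : EuclideanSpace ℝ (Fin n) → EuclideanSpace ℝ (Fin n)}

lemma euclideanHausdorffMeasure_image_le {X Y : Type*} [MetricSpace X] [MeasurableSpace X]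
    [BorelSpace X] [MetricSpace Y] [MeasurableSpace Y] [BorelSpace Y] {K : ℝ≥0} {f : X → Y}
    {s : Set X} (h : LipschitzOnWith K f s) (m : ℕ) :
    Measure.euclideanHausdorffMeasure m (f '' s) ≤
      (K : ℝ≥0∞) ^ m * Measure.euclideanHausdorffMeasure m s := by
  rw [Measure.euclideanHausdorffMeasure_def, Measure.euclideanHausdorffMeasure_def,
    Measure.smul_apply, Measure.smul_apply, ENNReal.smul_def, ENNReal.smul_def, smul_eq_mul,
    smul_eq_mul, mul_left_comm]
  gcongr
  simpa using h.hausdorffMeasure_image_le (d := m) (by positivity)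

lemma euclideanHausdorffMeasure_preimage_le {X Y : Type*} [MetricSpace X] [MeasurableSpace X]
    [BorelSpace X] [MetricSpace Y] [MeasurableSpace Y] [BorelSpace Y] {K : ℝ≥0} {f : X → Y}
    (h : AntilipschitzWith K f) (m : ℕ) (s : Set Y) :
    Measure.euclideanHausdorffMeasure m (f ⁻¹' s) ≤
      (K : ℝ≥0∞) ^ m * Measure.euclideanHausdorffMeasure m s := by
  rw [Measure.euclideanHausdorffMeasure_def, Measure.euclideanHausdorffMeasure_def,
    Measure.smul_apply, Measure.smul_apply, ENNReal.smul_def, ENNReal.smul_def, smul_eq_mul,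
    smul_eq_mul, mul_left_comm]
  gcongr
  simpa using h.hausdorffMeasure_preimage_le (d := m) (by positivity) s

/-- An open subset `V` of the target of a coordinate system on which the coordinate map and its
inverse are Lipschitz with constant `K` and have differentials bounded by `K`. In such patches the
norms and measures of `M` and of the coordinate space are comparable, which is all that is needed to
transfer local integrability and `L^1` convergence. -/
structure IsPatch (e : OpenPartialHomeomorph M (EuclideanSpace ℝ (Fin m)))
    (π : EuclideanSpace ℝ (Fin n) → EuclideanSpace ℝ (Fin n)) (V : Set (EuclideanSpace ℝ (Fin m)))
    (K : ℝ≥0) : Prop where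
  isOpen : IsOpen V
  subset : V ⊆ e.target
  lipschitz_symm : LipschitzOnWith K e.symm V
  lipschitz : LipschitzOnWith K e (e.symm '' V)
  norm_fderiv_param : ∀ u ∈ V, ‖fderiv ℝ (param e) u‖ ≤ K
  norm_fderiv_coordMap : ∀ u ∈ V, ‖fderiv ℝ (fun z => coordMap e (π z)) (param e u)‖ ≤ K

lemma IsPatch.mono {e : OpenPartialHomeomorph M (EuclideanSpace ℝ (Fin m))}
    {V V' : Set (EuclideanSpace ℝ (Fin m))} {K : ℝ≥0} (h : IsPatch e π V K) (hV' : IsOpen V')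
    (hs : V' ⊆ V) : IsPatch e π V' K :=
  ⟨hV', hs.trans h.subset, h.lipschitz_symm.mono hs, h.lipschitz.mono (Set.image_mono hs),
    fun u hu => h.norm_fderiv_param u (hs hu), fun u hu => h.norm_fderiv_coordMap u (hs hu)⟩

lemma IsTubularRetraction.exists_isPatch (h : IsTubularRetraction m M N π)
    {e : OpenPartialHomeomorph M (EuclideanSpace ℝ (Fin m))} (he : IsCoord e)
    {u₀ : EuclideanSpace ℝ (Fin m)} (hu₀ : u₀ ∈ e.target) :
    ∃ V K, u₀ ∈ V ∧ IsPatch e π V K := by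
  have hx₀ : param e u₀ ∈ N := h.subset (param_mem e u₀)
  have hπ : π (param e u₀) = param e u₀ := h.self _ (param_mem e u₀)
  have hs : (⟨π (param e u₀), h.mem _ hx₀⟩ : M) ∈ e.source := by
    have : (⟨π (param e u₀), h.mem _ hx₀⟩ : M) = e.symm u₀ := Subtype.ext hπ
    rw [this]
    exact e.map_target hu₀
  have h1 := he.contDiffAt_param hu₀
  have h2 := h.contDiffAt_coordMap e he _ hx₀ (h.mem _ hx₀) hs
  obtain ⟨K₁, s₁, hs₁, hK₁⟩ := (h1.of_le (m := 1) (by simp)).exists_lipschitzOnWith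
  obtain ⟨K₂, s₂, hs₂, hK₂⟩ := (h2.of_le (m := 1) (by simp)).exists_lipschitzOnWith
  have c1 : ContinuousAt (fun u => ‖fderiv ℝ (param e) u‖) u₀ :=
    (h1.fderiv_right (m := (⊤ : ℕ∞)) (by simp)).continuousAt.norm
  have c2 : ContinuousAt (fun u => ‖fderiv ℝ (fun z => coordMap e (π z)) (param e u)‖) u₀ :=
    ((h2.fderiv_right (m := (⊤ : ℕ∞)) (by simp)).continuousAt.comp h1.continuousAt).norm
  set a₁ := ‖fderiv ℝ (param e) u₀‖ + 1 with ha₁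
  set a₂ := ‖fderiv ℝ (fun z => coordMap e (π z)) (param e u₀)‖ + 1 with ha₂
  have e1 := c1.eventually_lt_const (lt_add_one _)
  have e2 := c2.eventually_lt_const (lt_add_one _)
  have e3 : ∀ᶠ u in 𝓝 u₀, param e u ∈ s₂ := h1.continuousAt hs₂
  obtain ⟨V, hV, hVo, hu₀V⟩ := eventually_nhds_iff.1
    (((e1.and e2).and (e3.and hs₁)).and (e.open_target.mem_nhds hu₀))
  set K : ℝ≥0 := max (max K₁ K₂) (max a₁.toNNReal a₂.toNNReal) with hK
  have ha₁K : a₁ ≤ K := (Real.le_coe_toNNReal a₁).trans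
    (NNReal.coe_le_coe.2 ((le_max_left _ _).trans (le_max_right _ _)))
  have ha₂K : a₂ ≤ K := (Real.le_coe_toNNReal a₂).trans
    (NNReal.coe_le_coe.2 ((le_max_right _ _).trans (le_max_right _ _)))
  refine ⟨V, K, hu₀V, hVo, fun u hu => (hV u hu).2, ?_, ?_, fun u hu =>
    (hV u hu).1.1.1.le.trans ha₁K, fun u hu => (hV u hu).1.1.2.le.trans ha₂K⟩
  · intro u hu v hv
    exact (hK₁.weaken ((le_max_left _ _).trans (le_max_left _ _))) (hV u hu).1.2.2 (hV v hv).1.2.2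
  · rintro _ ⟨u, hu, rfl⟩ _ ⟨v, hv, rfl⟩
    have := (hK₂.weaken ((le_max_right _ _).trans (le_max_left _ _) : K₂ ≤ K)) (hV u hu).1.2.1
      (hV v hv).1.2.1
    simp only [h.self _ (param_mem e _)] at this
    simpa only [param, coordMap_coe, Subtype.edist_eq] using this

namespace IsPatch

variable {e : OpenPartialHomeomorph M (EuclideanSpace ℝ (Fin m))}
  {V : Set (EuclideanSpace ℝ (Fin m))} {K : ℝ≥0}

lemma vol_image_le (h : IsPatch e π V K) {A : Set (EuclideanSpace ℝ (Fin m))} (hA : A ⊆ V) :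
    vol m M (e.symm '' A) ≤ (K : ℝ≥0∞) ^ m * volume A := by
  rw [← EuclideanSpace.euclideanHausdorffMeasure_eq_volume]
  exact euclideanHausdorffMeasure_image_le (h.lipschitz_symm.mono hA) m

lemma volume_le (h : IsPatch e π V K) {A : Set (EuclideanSpace ℝ (Fin m))} (hA : A ⊆ V) :
    volume A ≤ (K : ℝ≥0∞) ^ m * vol m M (e.symm '' A) := by
  have : e '' (e.symm '' A) = A := by
    rw [Set.image_image]
    exact (Set.image_congr fun u hu => e.right_inv (h.subset (hA hu))).trans (Set.image_id' A)
  rw [← EuclideanSpace.euclideanHausdorffMeasure_eq_volume]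
  conv_lhs => rw [← this]
  exact euclideanHausdorffMeasure_image_le (h.lipschitz.mono (Set.image_mono hA)) m

lemma isOpen_image (h : IsPatch e π V K) : IsOpen (e.symm '' V) :=
  e.symm.isOpen_image_of_subset_source h.isOpen h.subset

lemma image_subset (h : IsPatch e π V K) : e.symm '' V ⊆ e.source := by
  rintro _ ⟨u, hu, rfl⟩
  exact e.map_target (h.subset hu)

lemma aemeasurable_symm (h : IsPatch e π V K) : AEMeasurable e.symm (volume.restrict V) :=
  (e.continuousOn_symm.mono h.subset).aemeasurable h.isOpen.measurableSet

lemma aemeasurable (h : IsPatch e π V K) :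
    AEMeasurable e ((vol m M).restrict (e.symm '' V)) :=
  (e.continuousOn.mono h.image_subset).aemeasurable h.isOpen_image.measurableSet

lemma map_symm_le (h : IsPatch e π V K) : (volume.restrict V).map e.symm ≤
    ((K : ℝ≥0∞) ^ m) • (vol m M).restrict (e.symm '' V) := by
  refine Measure.le_iff.2 fun A hA => ?_
  rw [Measure.map_apply_of_aemeasurable h.aemeasurable_symm hA, Measure.smul_apply,
    Measure.restrict_apply hA, smul_eq_mul, Measure.restrict_apply' h.isOpen.measurableSet]
  refine (h.volume_le Set.inter_subset_right).trans ?_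
  gcongr
  rintro _ ⟨u, ⟨hu, huV⟩, rfl⟩
  exact ⟨hu, u, huV, rfl⟩

lemma map_le (h : IsPatch e π V K) : ((vol m M).restrict (e.symm '' V)).map e ≤
    ((K : ℝ≥0∞) ^ m) • volume.restrict V := by
  refine Measure.le_iff.2 fun A hA => ?_
  rw [Measure.map_apply_of_aemeasurable h.aemeasurable hA, Measure.smul_apply,
    Measure.restrict_apply hA, smul_eq_mul, Measure.restrict_apply' h.isOpen_image.measurableSet]
  refine le_trans (measure_mono ?_) (h.vol_image_le (A := A ∩ V) Set.inter_subset_right)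
  rintro _ ⟨hx, u, hu, rfl⟩
  refine ⟨u, ⟨?_, hu⟩, rfl⟩
  rwa [Set.mem_preimage, e.right_inv (h.subset hu)] at hx

lemma map_symm_ac (h : IsPatch e π V K) : (volume.restrict V).map e.symm ≪
    (vol m M).restrict (e.symm '' V) :=
  (Measure.absolutelyContinuous_of_le h.map_symm_le).trans Measure.smul_absolutelyContinuous

lemma map_ac (h : IsPatch e π V K) : ((vol m M).restrict (e.symm '' V)).map e ≪
    volume.restrict V :=
  (Measure.absolutelyContinuous_of_le h.map_le).trans Measure.smul_absolutelyContinuous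

lemma lintegral_comp_symm_le (h : IsPatch e π V K) {f : M → ℝ≥0∞}
    (hf : AEMeasurable f ((vol m M).restrict (e.symm '' V))) :
    ∫⁻ u in V, f (e.symm u) ≤ (K : ℝ≥0∞) ^ m * ∫⁻ x in e.symm '' V, f x ∂(vol m M) := by
  rw [← lintegral_map' (hf.mono_ac h.map_symm_ac) h.aemeasurable_symm]
  refine (lintegral_mono' h.map_symm_le le_rfl).trans ?_
  rw [lintegral_smul_measure, smul_eq_mul]

lemma lintegral_comp_le (h : IsPatch e π V K) {f : EuclideanSpace ℝ (Fin m) → ℝ≥0∞}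
    (hf : AEMeasurable f (volume.restrict V)) :
    ∫⁻ x in e.symm '' V, f (e x) ∂(vol m M) ≤ (K : ℝ≥0∞) ^ m * ∫⁻ u in V, f u := by
  rw [← lintegral_map' (hf.mono_ac h.map_ac) h.aemeasurable]
  refine (lintegral_mono' h.map_le le_rfl).trans ?_
  rw [lintegral_smul_measure, smul_eq_mul]

end IsPatch

/-- A submanifold is locally compact, although it need not be closed in `ℝ^n`. -/
lemma weaklyLocallyCompactSpace (hM : IsSmoothSubmanifold m M) : WeaklyLocallyCompactSpace M := by
  refine ⟨fun x₀ => ?_⟩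
  obtain ⟨e, he, hx⟩ := hM x₀
  obtain ⟨ρ, hρ, hsub⟩ := Metric.nhds_basis_closedBall.mem_iff.1
    (e.open_target.mem_nhds (e.map_source hx))
  refine ⟨e.symm '' Metric.closedBall (e x₀) ρ,
    (isCompact_closedBall _ _).image_of_continuousOn (e.continuousOn_symm.mono hsub), ?_⟩
  have := e.symm.image_mem_nhds (x := e x₀) (e.map_source hx)
    (Metric.closedBall_mem_nhds (e x₀) hρ)
  rwa [e.left_inv hx] at this

lemma isLocallyFiniteMeasure_vol (hM : IsSmoothSubmanifold m M) :
    IsLocallyFiniteMeasure (vol m M) := by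
  obtain ⟨N, π, h⟩ := exists_isTubularRetraction hM
  refine ⟨fun x => ?_⟩
  obtain ⟨e, he, hx⟩ := hM x
  obtain ⟨V, K, huV, hV⟩ := h.exists_isPatch he (e.map_source hx)
  obtain ⟨r, hr, hrV⟩ := Metric.mem_nhds_iff.1 (hV.isOpen.mem_nhds huV)
  refine ⟨e.symm '' Metric.ball (e x) r, ?_, (hV.vol_image_le hrV).trans_lt ?_⟩
  · have := e.symm.image_mem_nhds (x := e x) (e.map_source hx) (Metric.ball_mem_nhds (e x) hr)
    rwa [e.left_inv hx] at this
  · exact ENNReal.mul_lt_top (by finiteness) measure_ball_lt_top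

lemma ae_restrict_target (hM : IsSmoothSubmanifold m M)
    {e : OpenPartialHomeomorph M (EuclideanSpace ℝ (Fin m))} (he : IsCoord e) {P : M → Prop}
    (hP : ∀ᵐ x ∂(vol m M), P x) : ∀ᵐ u ∂(volume.restrict e.target), P (e.symm u) := by
  obtain ⟨N, π, h⟩ := exists_isTubularRetraction hM
  rw [ae_restrict_iff' e.open_target.measurableSet, ae_iff]
  refine measure_null_of_locally_null _ fun u hu => ?_
  have hut : u ∈ e.target := by
    by_contra h'
    exact hu fun h'' => absurd h'' h'
  obtain ⟨V, K, huV, hV⟩ := h.exists_isPatch he hut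
  refine ⟨_, inter_mem_nhdsWithin _ (hV.isOpen.mem_nhds huV), ?_⟩
  refine measure_mono_null (t := {u ∈ V | ¬ P (e.symm u)}) (fun v hv => ⟨hv.2, fun h' =>
    hv.1 fun _ => h'⟩) ?_
  refine le_antisymm ((hV.volume_le (Set.sep_subset _ _)).trans ?_) zero_le
  have : vol m M (e.symm '' {u ∈ V | ¬ P (e.symm u)}) = 0 := by
    refine measure_mono_null ?_ hP
    rintro _ ⟨v, hv, rfl⟩
    exact hv.2
  rw [this, mul_zero]

/-! ### Forms in coordinates -/

lemma pullback_eq (e : OpenPartialHomeomorph M (EuclideanSpace ℝ (Fin m))) (ω : Form M j)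
    (u : EuclideanSpace ℝ (Fin m)) : pullback e ω u =
      (ambient ω (e.symm u)).compContinuousLinearMap (fderiv ℝ (param e) u) := rfl

lemma IsTubularRetraction.ambient_comp (h : IsTubularRetraction m M N π)
    (hM : IsSmoothSubmanifold m M) (ω : Form M j) (x : M) :
    (ambient ω x).compContinuousLinearMap (fderiv ℝ π x) = ambient ω x := by
  ext v
  simp only [ambient, ContinuousAlternatingMap.compContinuousLinearMap_apply, Function.comp_def,
    h.fderiv_eq hM, Submodule.orthogonalProjectionOnto_mem_subspace_eq_self]

lemma IsTubularRetraction.ambient_eq (h : IsTubularRetraction m M N π)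
    (hM : IsSmoothSubmanifold m M) {e : OpenPartialHomeomorph M (EuclideanSpace ℝ (Fin m))}
    (he : IsCoord e) (ω : Form M j) {x : M} (hx : x ∈ e.source) :
    ambient ω x = (pullback e ω (e x)).compContinuousLinearMap
      (fderiv ℝ (fun z => coordMap e (π z)) x) := by
  have hxN : (x : EuclideanSpace ℝ (Fin n)) ∈ N := h.subset x.2
  have hs : (⟨π x, h.mem x hxN⟩ : M) ∈ e.source := by
    have : (⟨π x, h.mem x hxN⟩ : M) = x := Subtype.ext (h.self x x.2)
    rwa [this]
  rw [pullback_eq, e.left_inv hx]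
  conv_lhs => rw [← h.ambient_comp hM ω x, h.fderiv_eq_comp he hxN hs, h.self x x.2, coordMap_coe]
  rfl

lemma norm_pullback_le (e : OpenPartialHomeomorph M (EuclideanSpace ℝ (Fin m))) (ω : Form M j)
    (u : EuclideanSpace ℝ (Fin m)) :
    ‖pullback e ω u‖ ≤ ‖ambient ω (e.symm u)‖ * ‖fderiv ℝ (param e) u‖ ^ j := by
  rw [pullback_eq]
  simpa using ContinuousAlternatingMap.norm_compContinuousLinearMap_le (ambient ω (e.symm u))
    (fderiv ℝ (param e) u)

namespace IsPatch

variable {e : OpenPartialHomeomorph M (EuclideanSpace ℝ (Fin m))}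
  {V : Set (EuclideanSpace ℝ (Fin m))} {K : ℝ≥0}

lemma aestronglyMeasurable_pullback (h : IsPatch e π V K) (he : IsCoord e) {ω : Form M j}
    (hω : AEStronglyMeasurable (ambient ω) ((vol m M).restrict (e.symm '' V))) :
    AEStronglyMeasurable (pullback e ω) (volume.restrict V) := by
  have h1 : AEStronglyMeasurable (fun u => ambient ω (e.symm u)) (volume.restrict V) :=
    (hω.mono_ac h.map_symm_ac).comp_aemeasurable h.aemeasurable_symm
  have h2 : AEStronglyMeasurable (fderiv ℝ (param e)) (volume.restrict V) := by
    refine ContinuousOn.aestronglyMeasurable (fun u hu => ?_) h.isOpen.measurableSet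
    exact ((he.contDiffAt_param (h.subset hu)).fderiv_right (m := (⊤ : ℕ∞))
      (by simp)).continuousAt.continuousWithinAt
  exact continuous_compContinuousLinearMap.comp_aestronglyMeasurable (h1.prodMk h2)

lemma aestronglyMeasurable_ambient (h : IsPatch e π V K) (hr : IsTubularRetraction m M N π)
    (hM : IsSmoothSubmanifold m M) (he : IsCoord e) {ω : Form M j}
    (hω : AEStronglyMeasurable (pullback e ω) (volume.restrict V)) :
    AEStronglyMeasurable (ambient ω) ((vol m M).restrict (e.symm '' V)) := by
  have h1 : AEStronglyMeasurable (fun x => pullback e ω (e x))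
      ((vol m M).restrict (e.symm '' V)) :=
    (hω.mono_ac h.map_ac).comp_aemeasurable h.aemeasurable
  have h2 : AEStronglyMeasurable (fun x : M => fderiv ℝ (fun z => coordMap e (π z)) x)
      ((vol m M).restrict (e.symm '' V)) := by
    refine ContinuousOn.aestronglyMeasurable (fun x hx => ?_) h.isOpen_image.measurableSet
    have hxN : (x : EuclideanSpace ℝ (Fin n)) ∈ N := hr.subset x.2
    have hs : (⟨π x, hr.mem x hxN⟩ : M) ∈ e.source := by
      have : (⟨π x, hr.mem x hxN⟩ : M) = x := Subtype.ext (hr.self x x.2)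
      rw [this]
      exact h.image_subset hx
    have h3 := ((hr.contDiffAt_coordMap e he x hxN _ hs).fderiv_right (m := (⊤ : ℕ∞))
      (by simp)).continuousAt
    exact (h3.comp continuous_subtype_val.continuousAt).continuousWithinAt
  refine (continuous_compContinuousLinearMap.comp_aestronglyMeasurable (h1.prodMk h2)).congr ?_
  filter_upwards [ae_restrict_mem h.isOpen_image.measurableSet] with x hx
  exact (hr.ambient_eq hM he ω (h.image_subset hx)).symm

lemma lintegral_pullback_le (h : IsPatch e π V K) {ω : Form M j}
    (hω : AEStronglyMeasurable (ambient ω) ((vol m M).restrict (e.symm '' V))) :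
    ∫⁻ u in V, ‖pullback e ω u‖ₑ ≤
      (K : ℝ≥0∞) ^ (m + j) * ∫⁻ x in e.symm '' V, ‖ambient ω x‖ₑ ∂(vol m M) := by
  have h1 : ∀ u ∈ V, ‖pullback e ω u‖ₑ ≤ (K : ℝ≥0∞) ^ j * ‖ambient ω (e.symm u)‖ₑ := fun u hu => by
    have h2 : ‖pullback e ω u‖ ≤ (K : ℝ) ^ j * ‖ambient ω (e.symm u)‖ := by
      refine (norm_pullback_le e ω u).trans ?_
      rw [mul_comm]
      gcongr
      exact h.norm_fderiv_param u hu
    have h3 : ‖pullback e ω u‖₊ ≤ K ^ j * ‖ambient ω (e.symm u)‖₊ := by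
      rw [← NNReal.coe_le_coe]
      push_cast
      exact h2
    simpa [enorm_eq_nnnorm] using (ENNReal.coe_le_coe.2 h3)
  calc _ ≤ ∫⁻ u in V, (K : ℝ≥0∞) ^ j * ‖ambient ω (e.symm u)‖ₑ :=
        setLIntegral_mono_ae' h.isOpen.measurableSet (Eventually.of_forall h1)
    _ = (K : ℝ≥0∞) ^ j * ∫⁻ u in V, ‖ambient ω (e.symm u)‖ₑ :=
        lintegral_const_mul' _ _ (by finiteness)
    _ ≤ (K : ℝ≥0∞) ^ j * ((K : ℝ≥0∞) ^ m * ∫⁻ x in e.symm '' V, ‖ambient ω x‖ₑ ∂(vol m M)) := by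
        gcongr
        exact h.lintegral_comp_symm_le (f := fun x => ‖ambient ω x‖ₑ) hω.enorm
    _ = _ := by rw [← mul_assoc, ← pow_add, add_comm]

lemma lintegral_ambient_le (h : IsPatch e π V K) (hr : IsTubularRetraction m M N π)
    (hM : IsSmoothSubmanifold m M) (he : IsCoord e) {ω : Form M j}
    (hω : AEStronglyMeasurable (pullback e ω) (volume.restrict V)) :
    ∫⁻ x in e.symm '' V, ‖ambient ω x‖ₑ ∂(vol m M) ≤
      (K : ℝ≥0∞) ^ (m + j) * ∫⁻ u in V, ‖pullback e ω u‖ₑ := by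
  have h1 : ∀ x ∈ e.symm '' V, ‖ambient ω x‖ₑ ≤ (K : ℝ≥0∞) ^ j * ‖pullback e ω (e x)‖ₑ := by
    intro x hx
    have h2 : ‖ambient ω x‖ ≤ (K : ℝ) ^ j * ‖pullback e ω (e x)‖ := by
      rw [hr.ambient_eq hM he ω (h.image_subset hx)]
      refine (ContinuousAlternatingMap.norm_compContinuousLinearMap_le _ _).trans ?_
      rw [mul_comm, Fintype.card_fin]
      gcongr
      obtain ⟨u, hu, rfl⟩ := hx
      exact h.norm_fderiv_coordMap u hu
    have h3 : ‖ambient ω x‖₊ ≤ K ^ j * ‖pullback e ω (e x)‖₊ := by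
      rw [← NNReal.coe_le_coe]
      push_cast
      exact h2
    simpa [enorm_eq_nnnorm] using (ENNReal.coe_le_coe.2 h3)
  calc _ ≤ ∫⁻ x in e.symm '' V, (K : ℝ≥0∞) ^ j * ‖pullback e ω (e x)‖ₑ ∂(vol m M) :=
        setLIntegral_mono_ae' h.isOpen_image.measurableSet (Eventually.of_forall h1)
    _ = (K : ℝ≥0∞) ^ j * ∫⁻ x in e.symm '' V, ‖pullback e ω (e x)‖ₑ ∂(vol m M) :=
        lintegral_const_mul' _ _ (by finiteness)
    _ ≤ (K : ℝ≥0∞) ^ j * ((K : ℝ≥0∞) ^ m * ∫⁻ u in V, ‖pullback e ω u‖ₑ) := by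
        gcongr
        exact h.lintegral_comp_le (f := fun u => ‖pullback e ω u‖ₑ) hω.enorm
    _ = _ := by rw [← mul_assoc, ← pow_add, add_comm]

end IsPatch

lemma locallyIntegrableOn_pullback (hM : IsSmoothSubmanifold m M) {ω : Form M j}
    (hω : LocallyIntegrable (ambient ω) (vol m M))
    {e : OpenPartialHomeomorph M (EuclideanSpace ℝ (Fin m))} (he : IsCoord e) :
    LocallyIntegrableOn (pullback e ω) e.target := by
  obtain ⟨N, π, h⟩ := exists_isTubularRetraction hM
  intro u hu
  obtain ⟨V, K, huV, hV⟩ := h.exists_isPatch he hu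
  obtain ⟨S, hS, hSi⟩ := hω (e.symm u)
  set V' := V ∩ interior (e.target ∩ e.symm ⁻¹' S) with hV'
  have hn : e.target ∩ e.symm ⁻¹' S ∈ 𝓝 u :=
    inter_mem (e.open_target.mem_nhds hu) (e.continuousAt_symm hu hS)
  have huV' : u ∈ V' := ⟨huV, mem_interior_iff_mem_nhds.2 hn⟩
  have hp : IsPatch e π V' K := hV.mono (hV.isOpen.inter isOpen_interior) Set.inter_subset_left
  refine ⟨V', mem_nhdsWithin_of_mem_nhds (hp.isOpen.mem_nhds huV'), ?_⟩
  have hsub : e.symm '' V' ⊆ S := by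
    rintro _ ⟨v, hv, rfl⟩
    exact (interior_subset hv.2).2
  have hi : IntegrableOn (ambient ω) (e.symm '' V') (vol m M) := hSi.mono_set hsub
  refine ⟨hp.aestronglyMeasurable_pullback he hi.1, ?_⟩
  exact (hp.lintegral_pullback_le hi.1).trans_lt (ENNReal.mul_lt_top (by finiteness) hi.2)

lemma locallyIntegrable_ambient (hM : IsSmoothSubmanifold m M) {ω : Form M j}
    (hω : ∀ e : OpenPartialHomeomorph M (EuclideanSpace ℝ (Fin m)), IsCoord e →
      LocallyIntegrableOn (pullback e ω) e.target) :
    LocallyIntegrable (ambient ω) (vol m M) := by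
  obtain ⟨N, π, h⟩ := exists_isTubularRetraction hM
  intro x
  obtain ⟨e, he, hx⟩ := hM x
  have hu := e.map_source hx
  obtain ⟨V, K, huV, hV⟩ := h.exists_isPatch he hu
  obtain ⟨S, hS, hSi⟩ := hω e he (e x) hu
  rw [e.open_target.nhdsWithin_eq hu] at hS
  have hp : IsPatch e π (V ∩ interior S) K :=
    hV.mono (hV.isOpen.inter isOpen_interior) Set.inter_subset_left
  have hxV : x ∈ e.symm '' (V ∩ interior S) :=
    ⟨e x, ⟨huV, mem_interior_iff_mem_nhds.2 hS⟩, e.left_inv hx⟩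
  refine ⟨_, hp.isOpen_image.mem_nhds hxV, ?_⟩
  have hi : IntegrableOn (pullback e ω) (V ∩ interior S) volume :=
    hSi.mono_set (Set.inter_subset_right.trans interior_subset)
  refine ⟨hp.aestronglyMeasurable_ambient h hM he hi.1, ?_⟩
  exact (hp.lintegral_ambient_le h hM he hi.1).trans_lt (ENNReal.mul_lt_top (by finiteness) hi.2)

end Volume

/-! ### Smooth scale functions -/

section Scale

variable {E : Type*} [NormedAddCommGroup E] [NormedSpace ℝ E] [FiniteDimensional ℝ E]

lemma exists_smul_iteratedFDeriv_le {E : Type*} [NormedAddCommGroup E] [NormedSpace ℝ E]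
    {g : E → ℝ} (hg : ContDiff ℝ (⊤ : ℕ∞) g)
    (hc : HasCompactSupport g) (k : ℕ) {b : ℝ} (hb : 0 < b) :
    ∃ r : ℝ, 0 < r ∧ r ≤ b ∧ ∀ i ≤ k, ∀ x, ‖iteratedFDeriv ℝ i (r • g) x‖ ≤ b := by
  have h1 : ∀ i, ∃ R, 0 ≤ R ∧ ∀ x, ‖iteratedFDeriv ℝ i g x‖ ≤ R := fun i => by
    obtain ⟨R, hR⟩ := ((hg.continuous_iteratedFDeriv (m := i)
      (by exact_mod_cast le_top)).norm.bddAbove_range_of_hasCompactSupport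
      ((hc.iteratedFDeriv i).comp_left norm_zero))
    exact ⟨R, (norm_nonneg _).trans (hR ⟨0, rfl⟩), fun x => hR ⟨x, rfl⟩⟩
  choose R hR0 hR using h1
  set S := ∑ i ∈ Finset.range (k + 1), R i with hS
  have hS0 : 0 ≤ S := Finset.sum_nonneg fun i _ => hR0 i
  refine ⟨b / (1 + S), by positivity, div_le_self hb.le (by linarith), fun i hi x => ?_⟩
  rw [iteratedFDeriv_const_smul_apply ((hg.contDiffAt).of_le (by exact_mod_cast le_top)),
    norm_smul, Real.norm_of_nonneg (by positivity)]
  have h2 : R i ≤ S := Finset.single_le_sum (fun i _ => hR0 i) (Finset.mem_range.2 (by omega))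
  calc b / (1 + S) * ‖iteratedFDeriv ℝ i g x‖ ≤ b / (1 + S) * (1 + S) := by
        gcongr
        linarith [hR i x]
    _ = b := by field_simp

/-- Below a nonnegative continuous function there are smooth functions with the same zeros and with
an arbitrarily small Lipschitz constant. -/
lemma exists_smooth_scale {δ : E → ℝ} (hδ : Continuous δ) (hδ0 : ∀ x, 0 ≤ δ x) {κ : ℝ≥0}
    (hκ : 0 < κ) :
    ∃ ε : E → ℝ, ContDiff ℝ (⊤ : ℕ∞) ε ∧ LipschitzWith κ ε ∧
      (∀ x, 0 ≤ ε x ∧ ε x ≤ κ * δ x) ∧ ∀ x, 0 < δ x → 0 < ε x := by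
  have hκ' : (0 : ℝ) < κ := hκ
  set U : Set E := {x | 0 < δ x} with hU
  have hUo : IsOpen U := isOpen_lt continuous_const hδ
  rcases U.eq_empty_or_nonempty with hUe | hUn
  · refine ⟨fun _ => 0, contDiff_const, LipschitzWith.const' 0 |>.weaken zero_le,
      fun x => ⟨le_rfl, by have := hδ0 x; positivity⟩, fun x hx => ?_⟩
    exact absurd (show x ∈ U from hx) (by simp [hUe])
  have hcov : ∀ x, ∃ f : E → ℝ, x ∈ U → tsupport f ⊆ U ∧ HasCompactSupport f ∧
      ContDiff ℝ (⊤ : ℕ∞) f ∧ Set.range f ⊆ Set.Icc 0 1 ∧ f x = 1 := fun x => by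
    by_cases hx : x ∈ U
    · obtain ⟨f, hf⟩ := exists_contDiff_tsupport_subset (n := ⊤) (hUo.mem_nhds hx)
      exact ⟨f, fun _ => hf⟩
    · exact ⟨0, fun h => absurd h hx⟩
  choose f hf using hcov
  obtain ⟨t, htU, htc, ht⟩ := TopologicalSpace.countable_cover_nhdsWithin
    (f := fun x => Function.support (f x)) (s := U) fun x hx => mem_nhdsWithin_of_mem_nhds
      (((hf x hx).2.2.1.continuous.isOpen_support).mem_nhds (by simp [(hf x hx).2.2.2.2]))
  have htn : t.Nonempty := by
    obtain ⟨x, hx⟩ := hUn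
    obtain ⟨y, hy, -⟩ := Set.mem_iUnion₂.1 (ht hx)
    exact ⟨y, hy⟩
  obtain ⟨c, rfl⟩ := htc.exists_eq_range htn
  set g : ℕ → E → ℝ := fun k => f (c k) with hg
  have hcU : ∀ k, c k ∈ U := fun k => htU ⟨k, rfl⟩
  have hg01 : ∀ k x, 0 ≤ g k x ∧ g k x ≤ 1 := fun k x => (hf _ (hcU k)).2.2.2.1 ⟨x, rfl⟩
  -- positive lower bounds of `δ` on the supports
  have hmin : ∀ k, ∃ a : ℝ, 0 < a ∧ a ≤ 1 ∧ ∀ x ∈ tsupport (g k), a ≤ δ x := fun k => by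
    obtain ⟨hs, hcs, -, -, h1⟩ := hf _ (hcU k)
    have hne : (tsupport (g k)).Nonempty := ⟨c k, subset_tsupport _ (by simp [hg, h1])⟩
    obtain ⟨z, hz, hzm⟩ := IsCompact.exists_isMinOn hcs hne hδ.continuousOn
    exact ⟨min (δ z) 1, lt_min (hs hz) one_pos, min_le_right _ _,
      fun x hx => (min_le_left _ _).trans (hzm hx)⟩
  choose a ha0 ha1 ha using hmin
  have hb : ∀ k : ℕ, 0 < κ * (1 / 2 / 2 ^ k) * a k := fun k => by
    have := ha0 k
    positivity
  -- The function sought is `∑ r k * g k`; the `k`-th coefficient is so small that the derivatives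
  -- of order at most `k + 1` of the `k`-th term are at most `κ / 2 ^ (k + 1)`.
  choose r hr0 hrb hr using fun k => exists_smul_iteratedFDeriv_le (hf _ (hcU k)).2.2.1
    (hf _ (hcU k)).2.1 (k + 1) (hb k)
  have hgeo : HasSum (fun k : ℕ => (κ : ℝ) * (1 / 2 / 2 ^ k)) κ := by
    have := (hasSum_geometric_two' (1 : ℝ)).mul_left (κ : ℝ)
    simpa using this
  have hbκ : ∀ k : ℕ, κ * (1 / 2 / 2 ^ k) * a k ≤ κ * (1 / 2 / 2 ^ k) := fun k =>
    mul_le_of_le_one_right (by positivity) (ha1 k)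
  have hle : ∀ k x, r k * g k x ≤ κ * (1 / 2 / 2 ^ k) * δ x := fun k x => by
    by_cases hx : x ∈ tsupport (g k)
    · calc r k * g k x ≤ r k * 1 := by gcongr; exacts [(hr0 k).le, (hg01 k x).2]
        _ ≤ κ * (1 / 2 / 2 ^ k) * a k := by rw [mul_one]; exact hrb k
        _ ≤ _ := by gcongr; exact ha k x hx
    · rw [image_eq_zero_of_notMem_tsupport hx, mul_zero]
      have := hδ0 x
      positivity
  have hnn : ∀ k x, 0 ≤ r k * g k x := fun k x => mul_nonneg (hr0 k).le (hg01 k x).1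
  have hsum : ∀ x, Summable fun k => r k * g k x := fun x =>
    Summable.of_nonneg_of_le (fun k => hnn k x) (fun k => hle k x) (hgeo.summable.mul_right (δ x))
  have hlip : ∀ k, LipschitzWith (Real.toNNReal (κ * (1 / 2 / 2 ^ k))) fun x => r k * g k x := by
    intro k
    have hs : ContDiff ℝ (⊤ : ℕ∞) (r k • g k) := contDiff_const.smul (hf _ (hcU k)).2.2.1
    refine lipschitzWith_of_nnnorm_fderiv_le (𝕜 := ℝ) (f := r k • g k)
      (hs.differentiable (by simp)) fun x => ?_
    rw [← NNReal.coe_le_coe, Real.coe_toNNReal _ (by positivity), coe_nnnorm]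
    have := hr k 1 (by omega) x
    rw [norm_iteratedFDeriv_one] at this
    exact this.trans (hbκ k)
  refine ⟨fun x => ∑' k, r k * g k x, ?_, ?_, fun x => ⟨tsum_nonneg fun k => hnn k x, ?_⟩, ?_⟩
  · refine contDiff_tsum_of_eventually (f := fun k x => r k * g k x)
      (fun k => contDiff_const.mul (hf _ (hcU k)).2.2.1)
      (v := fun _ k => κ * (1 / 2 / 2 ^ k)) (fun k _ => hgeo.summable) fun i _ => ?_
    rw [Nat.cofinite_eq_atTop]
    filter_upwards [eventually_ge_atTop i] with k hk x
    exact (hr k i (by omega) x).trans (hbκ k)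
  · refine LipschitzWith.of_dist_le_mul fun x y => ?_
    rw [Real.dist_eq, ← (hsum x).tsum_sub (hsum y)]
    have h1 : ∀ k, ‖r k * g k x - r k * g k y‖ ≤ κ * (1 / 2 / 2 ^ k) * dist x y := fun k => by
      have := (hlip k).dist_le_mul x y
      rwa [Real.coe_toNNReal _ (by positivity), Real.dist_eq] at this
    exact tsum_of_norm_bounded (hgeo.mul_right (dist x y)) h1
  · exact (hsum x).tsum_le_of_sum_le (fun s => (Finset.sum_le_sum fun k _ => hle k x).trans (by
      rw [← Finset.sum_mul]
      gcongr
      · exact hδ0 x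
      · exact sum_le_hasSum s (fun k _ => by positivity) hgeo))
  · intro x hx
    obtain ⟨y, ⟨k, rfl⟩, hk⟩ := Set.mem_iUnion₂.1 (ht (show x ∈ U from hx))
    have : 0 < g k x := lt_of_le_of_ne (hg01 k x).1 (Ne.symm hk)
    exact (hsum x).tsum_pos (fun k => hnn k x) k (mul_pos (hr0 k) this)

/-- A hereditary family of sets that is locally available along `M` contains balls whose radius is a
`1`-Lipschitz function of the center. -/
lemma exists_radius {X : Type*} [PseudoMetricSpace X] {M : Set X} {G : Set X → Prop}
    (hmono : ∀ s t, s ⊆ t → G t → G s) (hloc : ∀ x ∈ M, ∃ r > 0, G (Metric.ball x r)) :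
    ∃ δ : X → ℝ, LipschitzWith 1 δ ∧ (∀ x, 0 ≤ δ x) ∧ (∀ x, δ x ≤ 1) ∧ (∀ x ∈ M, 0 < δ x) ∧
      ∀ x, 0 < δ x → G (Metric.ball x (δ x)) := by
  -- Half the supremum of the admissible radii at `x`, including the trivial radius `0`, is attained
  -- by an admissible ball; truncation at `1` makes the supremum finite.
  set A : X → Set ℝ := fun x => {r | 0 ≤ r ∧ r ≤ 1 ∧ (0 < r → G (Metric.ball x r))} with hA
  have h0 : ∀ x, (0 : ℝ) ∈ A x := fun x => ⟨le_rfl, zero_le_one, fun h => absurd h (lt_irrefl _)⟩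
  have hbdd : ∀ x, BddAbove (A x) := fun x => ⟨1, fun r hr => hr.2.1⟩
  set s : X → ℝ := fun x => sSup (A x) with hs
  have hs0 : ∀ x, 0 ≤ s x := fun x => le_csSup (hbdd x) (h0 x)
  have hs1 : ∀ x, s x ≤ 1 := fun x => csSup_le ⟨0, h0 x⟩ fun r hr => hr.2.1
  have hlip : ∀ x y, s x ≤ s y + dist x y := fun x y => by
    refine csSup_le ⟨0, h0 x⟩ fun r hr => ?_
    rcases le_or_gt r (dist x y) with h | h
    · linarith [hs0 y]
    · have : r - dist x y ∈ A y := by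
        refine ⟨by linarith, by linarith [hr.2.1, dist_nonneg (x := x) (y := y)], fun h' => ?_⟩
        refine hmono _ _ (Metric.ball_subset_ball' ?_)
          (hr.2.2 (by linarith [dist_nonneg (x := x) (y := y)]))
        rw [dist_comm y x]
        linarith
      linarith [le_csSup (hbdd y) this]
  have hL : LipschitzWith 1 s := LipschitzWith.of_le_add hlip
  refine ⟨fun x => s x / 2, ?_, fun x => by linarith [hs0 x], fun x => by linarith [hs1 x, hs0 x],
    fun x hx => ?_, fun x hx => ?_⟩
  · refine LipschitzWith.of_le_add fun x y => ?_
    linarith [hlip x y, dist_nonneg (x := x) (y := y)]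
  · obtain ⟨r, hr, hG⟩ := hloc x hx
    have : min r 1 ∈ A x := ⟨le_min hr.le zero_le_one, min_le_right _ _, fun _ =>
      hmono _ _ (Metric.ball_subset_ball (min_le_left _ _)) hG⟩
    have h2 := le_csSup (hbdd x) this
    have h3 : 0 < min r 1 := lt_min hr one_pos
    exact half_pos (h3.trans_le h2)
  · obtain ⟨r, hr, hlt⟩ := exists_lt_of_lt_csSup ⟨0, h0 x⟩ (half_lt_self (by linarith : 0 < s x))
    exact hmono _ _ (Metric.ball_subset_ball hlt.le) (hr.2.2 (hx.trans hlt))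

end Scale

/-! ### Small displacements along the submanifold -/

section Displacement

variable {n m : ℕ} {M N : Set (EuclideanSpace ℝ (Fin n))}
  {π : EuclideanSpace ℝ (Fin n) → EuclideanSpace ℝ (Fin n)}
  {G : Set (EuclideanSpace ℝ (Fin n)) → Prop} {κ : ℝ≥0} {ε δ : EuclideanSpace ℝ (Fin n) → ℝ}

/-- `ε` is a smooth function, positive on `M`, with Lipschitz constant at most `κ`, that is at most
`κ` times a radius `δ` of balls around the points of `M` on which the retraction `π` is controlled
and which belong to the family `G`. The bound `1 / 100` is small enough for all the estimates of
displacements below. -/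
structure IsScale (M N : Set (EuclideanSpace ℝ (Fin n)))
    (π : EuclideanSpace ℝ (Fin n) → EuclideanSpace ℝ (Fin n))
    (G : Set (EuclideanSpace ℝ (Fin n)) → Prop) (κ : ℝ≥0)
    (ε δ : EuclideanSpace ℝ (Fin n) → ℝ) : Prop where
  le_const : (κ : ℝ) ≤ 1 / 100
  contDiff : ContDiff ℝ (⊤ : ℕ∞) ε
  lipschitz : LipschitzWith κ ε
  nonneg : ∀ x, 0 ≤ ε x
  le : ∀ x, ε x ≤ κ * δ x
  pos : ∀ x ∈ M, 0 < ε x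
  radius_lipschitz : LipschitzWith 1 δ
  radius_le : ∀ x, δ x ≤ 1
  radius_pos : ∀ x ∈ M, 0 < δ x
  ball_subset : ∀ x ∈ M, Metric.ball x (δ x) ⊆ N
  norm_fderiv_sub : ∀ x ∈ M, ∀ y ∈ Metric.ball x (δ x), ∀ z ∈ Metric.ball x (δ x),
    ‖fderiv ℝ π y - fderiv ℝ π z‖ ≤ κ
  ball_mem : ∀ x ∈ M, G (Metric.ball x (δ x))

lemma IsTubularRetraction.exists_isScale (hr : IsTubularRetraction m M N π)
    (hmono : ∀ s t, s ⊆ t → G t → G s) (hloc : ∀ x ∈ M, ∃ r > 0, G (Metric.ball x r))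
    (hκ : 0 < κ) (hκ' : (κ : ℝ) ≤ 1 / 100) : ∃ ε δ, IsScale M N π G κ ε δ := by
  obtain ⟨δ, h1, h2, h3, h4, h5⟩ := exists_radius (M := M) (G := fun s => s ⊆ N ∧
      (∀ y ∈ s, ∀ z ∈ s, ‖fderiv ℝ π y - fderiv ℝ π z‖ ≤ κ) ∧ G s)
    (fun s t hst ht => ⟨hst.trans ht.1, fun y hy z hz => ht.2.1 y (hst hy) z (hst hz),
      hmono s t hst ht.2.2⟩) (fun x hx => by
        obtain ⟨r, hr0, hG⟩ := hloc x hx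
        have hxN := hr.subset hx
        have hc : ContinuousAt (fderiv ℝ π) x :=
          ((hr.contDiffAt x hxN).fderiv_right (m := (⊤ : ℕ∞)) (by simp)).continuousAt
        have hκ2 : (0 : ℝ) < κ / 2 := half_pos hκ
        have hev := (Metric.continuousAt_iff'.1 hc (κ / 2) hκ2).and (hr.mem_nhds hxN)
        obtain ⟨r', hr', hb⟩ := Metric.eventually_nhds_iff_ball.1 hev
        refine ⟨min r r', lt_min hr0 hr', fun y hy => (hb y (Metric.ball_subset_ball
          (min_le_right _ _) hy)).2, fun y hy z hz => ?_, hmono _ _ (Metric.ball_subset_ball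
          (min_le_left _ _)) hG⟩
        have hy' := (hb y (Metric.ball_subset_ball (min_le_right _ _) hy)).1
        have hz' := (hb z (Metric.ball_subset_ball (min_le_right _ _) hz)).1
        rw [← dist_eq_norm]
        refine (dist_triangle_right _ _ (fderiv ℝ π x)).trans ?_
        linarith)
  obtain ⟨ε, e1, e2, e3, e4⟩ := exists_smooth_scale h1.continuous h2 hκ
  exact ⟨ε, δ, hκ', e1, e2, fun x => (e3 x).1, fun x => (e3 x).2, fun x hx => e4 x (h4 x hx), h1,
    h3, h4, fun x hx => (h5 x (h4 x hx)).1, fun x hx => (h5 x (h4 x hx)).2.1,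
    fun x hx => (h5 x (h4 x hx)).2.2⟩

/-- The displacement of `x` by `s · ε(x) · t`, where `τ = (t, s)`. The vector `t` is averaged over a
ball, and `s` runs from `0` (no displacement) to `1` in the homotopy. -/
def shift (ε : EuclideanSpace ℝ (Fin n) → ℝ) (x : EuclideanSpace ℝ (Fin n))
    (τ : EuclideanSpace ℝ (Fin n) × ℝ) : EuclideanSpace ℝ (Fin n) := x + (τ.2 * ε x) • τ.1

/-- The set of the parameters `(t, s)` of admissible displacements. The operators use vectors of
norm at most `1` only; the larger radius leaves room for the proof that the pull-back of a locally
integrable form under `π` is integrable on balls of radius `2 ε(x)`. -/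
def paramSet (n : ℕ) : Set (EuclideanSpace ℝ (Fin n) × ℝ) :=
  Metric.closedBall 0 4 ×ˢ Set.Icc 0 1

lemma isCompact_paramSet (n : ℕ) : IsCompact (paramSet n) :=
  (isCompact_closedBall _ _).prod isCompact_Icc

open Classical in
/-- The displacement of a point of `M` followed by the retraction onto `M`. For parameters that are
not admissible it is the identity, so that it is antilipschitz for all parameters. -/
def move (π : EuclideanSpace ℝ (Fin n) → EuclideanSpace ℝ (Fin n))
    (ε : EuclideanSpace ℝ (Fin n) → ℝ) (z : M × (EuclideanSpace ℝ (Fin n) × ℝ)) : M :=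
  if h : z.2 ∈ paramSet n ∧ π (shift ε z.1 z.2) ∈ M then ⟨π (shift ε z.1 z.2), h.2⟩ else z.1

lemma dist_shift (ε : EuclideanSpace ℝ (Fin n) → ℝ) {x : EuclideanSpace ℝ (Fin n)}
    (hx : 0 ≤ ε x) {τ : EuclideanSpace ℝ (Fin n) × ℝ} (hτ : τ ∈ paramSet n) :
    dist (shift ε x τ) x ≤ 4 * ε x := by
  obtain ⟨h1, h2, h3⟩ := hτ
  rw [mem_closedBall_zero_iff] at h1
  rw [shift, dist_eq_norm, add_sub_cancel_left, norm_smul, norm_mul, Real.norm_of_nonneg h2,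
    Real.norm_of_nonneg hx]
  calc τ.2 * ε x * ‖τ.1‖ ≤ 1 * ε x * 4 := by gcongr
    _ = _ := by ring

lemma continuous_shift (hε : Continuous ε) :
    Continuous fun z : EuclideanSpace ℝ (Fin n) × (EuclideanSpace ℝ (Fin n) × ℝ) =>
      shift ε z.1 z.2 := by
  unfold shift
  fun_prop

/-- The differential of `x ↦ shift ε x τ`. -/
def shiftDeriv (ε : EuclideanSpace ℝ (Fin n) → ℝ) (x : EuclideanSpace ℝ (Fin n))
    (τ : EuclideanSpace ℝ (Fin n) × ℝ) : EuclideanSpace ℝ (Fin n) →L[ℝ] EuclideanSpace ℝ (Fin n) :=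
  ContinuousLinearMap.id ℝ _ + (τ.2 • fderiv ℝ ε x).smulRight τ.1

lemma hasFDerivAt_shift {x : EuclideanSpace ℝ (Fin n)} (hε : DifferentiableAt ℝ ε x)
    (τ : EuclideanSpace ℝ (Fin n) × ℝ) :
    HasFDerivAt (fun x => shift ε x τ) (shiftDeriv ε x τ) x :=
  (hasFDerivAt_id x).add ((hε.hasFDerivAt.const_mul τ.2).smul_const τ.1)

lemma norm_shiftDeriv_sub_id_le (hε : LipschitzWith κ ε) (x : EuclideanSpace ℝ (Fin n))
    {τ : EuclideanSpace ℝ (Fin n) × ℝ} (hτ : τ ∈ paramSet n) :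
    ‖shiftDeriv ε x τ - ContinuousLinearMap.id ℝ _‖ ≤ 4 * κ := by
  obtain ⟨h1, h2, h3⟩ := hτ
  rw [mem_closedBall_zero_iff] at h1
  have h4 : ‖fderiv ℝ ε x‖ ≤ κ := norm_fderiv_le_of_lipschitz ℝ hε
  rw [shiftDeriv, add_sub_cancel_left, ContinuousLinearMap.norm_smulRight_apply, norm_smul,
    Real.norm_of_nonneg h2]
  calc τ.2 * ‖fderiv ℝ ε x‖ * ‖τ.1‖ ≤ 1 * κ * 4 := by gcongr
    _ = _ := by ring

lemma norm_shiftDeriv_le (hε : LipschitzWith κ ε) (hκ : (κ : ℝ) ≤ 1 / 100)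
    (x : EuclideanSpace ℝ (Fin n))
    {τ : EuclideanSpace ℝ (Fin n) × ℝ} (hτ : τ ∈ paramSet n) : ‖shiftDeriv ε x τ‖ ≤ 2 := by
  have h1 := norm_shiftDeriv_sub_id_le hε x hτ
  have h2 := norm_le_norm_add_norm_sub' (shiftDeriv ε x τ) (ContinuousLinearMap.id ℝ _)
  have h3 := ContinuousLinearMap.norm_id_le (𝕜 := ℝ) (E := EuclideanSpace ℝ (Fin n))
  linarith

lemma IsTubularRetraction.norm_fderiv_le (hr : IsTubularRetraction m M N π)
    (hM : IsSmoothSubmanifold m M) {x : EuclideanSpace ℝ (Fin n)} (hx : x ∈ M) :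
    ‖fderiv ℝ π x‖ ≤ 1 := by
  refine ContinuousLinearMap.opNorm_le_bound _ zero_le_one fun v => ?_
  rw [one_mul, hr.fderiv_eq hM ⟨x, hx⟩ v]
  exact ((tangentSpaceAt M ⟨x, hx⟩).orthogonalProjectionOnto.le_opNorm v).trans
    (mul_le_of_le_one_left (norm_nonneg v) (Submodule.orthogonalProjectionOnto_norm_le _))

namespace IsScale

lemma shift_mem_ball (hs : IsScale M N π G κ ε δ) {x : EuclideanSpace ℝ (Fin n)} (hx : x ∈ M)
    {τ : EuclideanSpace ℝ (Fin n) × ℝ} (hτ : τ ∈ paramSet n) :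
    shift ε x τ ∈ Metric.ball x (δ x) := by
  have h1 := dist_shift ε (hs.nonneg x) hτ
  have h2 := hs.le x
  have h3 := hs.radius_pos x hx
  have h4 := hs.le_const
  rw [Metric.mem_ball]
  nlinarith

lemma shift_mem (hs : IsScale M N π G κ ε δ) {x : EuclideanSpace ℝ (Fin n)} (hx : x ∈ M)
    {τ : EuclideanSpace ℝ (Fin n) × ℝ} (hτ : τ ∈ paramSet n) : shift ε x τ ∈ N :=
  hs.ball_subset x hx (hs.shift_mem_ball hx hτ)

lemma norm_fderiv_le (hs : IsScale M N π G κ ε δ) (hr : IsTubularRetraction m M N π)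
    (hM : IsSmoothSubmanifold m M) {x y : EuclideanSpace ℝ (Fin n)} (hx : x ∈ M)
    (hy : y ∈ Metric.ball x (δ x)) : ‖fderiv ℝ π y‖ ≤ 2 := by
  have h1 := hs.norm_fderiv_sub x hx y hy x (Metric.mem_ball_self (hs.radius_pos x hx))
  have h2 := norm_le_norm_add_norm_sub' (fderiv ℝ π y) (fderiv ℝ π x)
  have h3 := hr.norm_fderiv_le hM hx
  have h4 := hs.le_const
  linarith

lemma dist_retraction_shift_le (hs : IsScale M N π G κ ε δ) (hr : IsTubularRetraction m M N π)
    (hM : IsSmoothSubmanifold m M) {x : EuclideanSpace ℝ (Fin n)} (hx : x ∈ M)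
    {τ : EuclideanSpace ℝ (Fin n) × ℝ} (hτ : τ ∈ paramSet n) :
    dist (π (shift ε x τ)) x ≤ 8 * ε x := by
  have h1 := (convex_ball x (δ x)).norm_image_sub_le_of_norm_fderiv_le (𝕜 := ℝ) (f := π)
    (fun y hy => (hr.hasFDerivAt (hs.ball_subset x hx hy)).differentiableAt)
    (fun y hy => hs.norm_fderiv_le hr hM hx hy) (Metric.mem_ball_self (hs.radius_pos x hx))
    (hs.shift_mem_ball hx hτ)
  rw [hr.self x hx, ← dist_eq_norm, ← dist_eq_norm] at h1
  have h2 := dist_shift ε (hs.nonneg x) hτ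
  linarith

lemma coe_move (hs : IsScale M N π G κ ε δ) (hr : IsTubularRetraction m M N π) (x : M)
    {τ : EuclideanSpace ℝ (Fin n) × ℝ} (hτ : τ ∈ paramSet n) :
    (move π ε (x, τ) : EuclideanSpace ℝ (Fin n)) = π (shift ε x τ) := by
  rw [move, dif_pos ⟨hτ, hr.mem _ (hs.shift_mem x.2 hτ)⟩]

lemma dist_move_le (hs : IsScale M N π G κ ε δ) (hr : IsTubularRetraction m M N π)
    (hM : IsSmoothSubmanifold m M) (x : M) {τ : EuclideanSpace ℝ (Fin n) × ℝ}
    (hτ : τ ∈ paramSet n) : dist (move π ε (x, τ)) x ≤ 8 * ε x := by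
  rw [Subtype.dist_eq, hs.coe_move hr x hτ]
  exact hs.dist_retraction_shift_le hr hM x.2 hτ

/-- Close to `x` the difference of the displacement and the identity has a small differential, and
for distant points the displacement is small compared with the distance. -/
lemma norm_sub_le (hs : IsScale M N π G κ ε δ) (hr : IsTubularRetraction m M N π)
    (hM : IsSmoothSubmanifold m M) {x y : EuclideanSpace ℝ (Fin n)} (hx : x ∈ M) (hy : y ∈ M)
    {τ : EuclideanSpace ℝ (Fin n) × ℝ} (hτ : τ ∈ paramSet n) :
    ‖(π (shift ε y τ) - y) - (π (shift ε x τ) - x)‖ ≤ 1 / 2 * ‖y - x‖ := by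
  have hκ := hs.le_const
  have hκ0 : (0 : ℝ) ≤ κ := κ.2
  have hδ := hs.radius_pos x hx
  rcases lt_or_ge (dist y x) (δ x / 2) with hlt | hge
  · have hb : ∀ z ∈ Metric.ball x (δ x / 2), z ∈ Metric.ball x (δ x) ∧
        shift ε z τ ∈ Metric.ball x (δ x) := fun z hz => by
      rw [Metric.mem_ball] at hz
      refine ⟨by rw [Metric.mem_ball]; linarith, ?_⟩
      have h1 := dist_shift ε (hs.nonneg z) hτ
      have h2 := hs.le z
      have h3 := hs.radius_lipschitz.dist_le_mul z x
      rw [Real.dist_eq, NNReal.coe_one, one_mul] at h3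
      have h4 := (abs_le.1 h3).2
      have h5 := dist_triangle (shift ε z τ) z x
      rw [Metric.mem_ball]
      nlinarith
    have hd : ∀ z ∈ Metric.ball x (δ x / 2), HasFDerivWithinAt
        (fun z => π (shift ε z τ) - π z)
        ((fderiv ℝ π (shift ε z τ)).comp (shiftDeriv ε z τ) - fderiv ℝ π z)
        (Metric.ball x (δ x / 2)) z := fun z hz => by
      have h1 := hr.hasFDerivAt (hs.ball_subset x hx (hb z hz).2)
      have h2 := hr.hasFDerivAt (hs.ball_subset x hx (hb z hz).1)
      exact ((h1.comp z (hasFDerivAt_shift (hs.contDiff.differentiable (by simp) z) τ)).sub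
        h2).hasFDerivWithinAt
    have hbd : ∀ z ∈ Metric.ball x (δ x / 2),
        ‖(fderiv ℝ π (shift ε z τ)).comp (shiftDeriv ε z τ) - fderiv ℝ π z‖ ≤ 1 / 2 := by
      intro z hz
      have e1 : (fderiv ℝ π (shift ε z τ)).comp (shiftDeriv ε z τ) - fderiv ℝ π z =
          (fderiv ℝ π (shift ε z τ)).comp (shiftDeriv ε z τ - ContinuousLinearMap.id ℝ _) +
            (fderiv ℝ π (shift ε z τ) - fderiv ℝ π z) := by
        ext1 v
        simp
      have h1 := hs.norm_fderiv_le hr hM hx (hb z hz).2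
      have h2 := norm_shiftDeriv_sub_id_le hs.lipschitz z hτ
      have h3 := hs.norm_fderiv_sub x hx _ (hb z hz).2 _ (hb z hz).1
      rw [e1]
      calc _ ≤ ‖fderiv ℝ π (shift ε z τ)‖ * ‖shiftDeriv ε z τ - ContinuousLinearMap.id ℝ _‖ + κ :=
            (norm_add_le _ _).trans (add_le_add (ContinuousLinearMap.opNorm_comp_le _ _) h3)
        _ ≤ 2 * (4 * κ) + κ := by gcongr
        _ ≤ 1 / 2 := by linarith
    have := (convex_ball x (δ x / 2)).norm_image_sub_le_of_norm_hasFDerivWithin_le hd hbd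
      (Metric.mem_ball_self (half_pos hδ)) (Metric.mem_ball.2 hlt)
    simpa only [hr.self x hx, hr.self y hy] using this
  · -- Each displacement is at most `8 ε ≤ 8 κ δ`, and here `δ x ≤ 2 ‖y - x‖`.
    have h1 := hs.dist_retraction_shift_le hr hM hx hτ
    have h2 := hs.dist_retraction_shift_le hr hM hy hτ
    have h3 := hs.le x
    have h4 := hs.lipschitz.dist_le_mul y x
    rw [Real.dist_eq] at h4
    have h5 := (abs_le.1 h4).2
    rw [dist_eq_norm] at h1 h2 hge h5
    refine (_root_.norm_sub_le _ _).trans ?_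
    nlinarith

lemma antilipschitzWith_move (hs : IsScale M N π G κ ε δ) (hr : IsTubularRetraction m M N π)
    (hM : IsSmoothSubmanifold m M) (τ : EuclideanSpace ℝ (Fin n) × ℝ) :
    AntilipschitzWith 2 fun x : M => move π ε (x, τ) := by
  refine AntilipschitzWith.of_le_mul_dist fun y x => ?_
  by_cases hτ : τ ∈ paramSet n
  · have h1 := hs.norm_sub_le hr hM x.2 y.2 hτ
    rw [Subtype.dist_eq, Subtype.dist_eq, hs.coe_move hr x hτ, hs.coe_move hr y hτ, dist_eq_norm,
      dist_eq_norm]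
    have h2 : ‖(y : EuclideanSpace ℝ (Fin n)) - x‖ ≤ ‖π (shift ε y τ) - π (shift ε x τ)‖ +
        ‖(π (shift ε y τ) - y) - (π (shift ε x τ) - x)‖ := by
      refine le_trans (le_of_eq ?_) (_root_.norm_sub_le _ _)
      congr 1
      abel
    push_cast
    linarith
  · have h1 : ∀ x : M, move π ε (x, τ) = x := fun x => by
      rw [move, dif_neg fun h => hτ h.1]
    rw [h1, h1]
    push_cast
    linarith [dist_nonneg (x := y) (y := x)]

lemma continuousOn_move (hs : IsScale M N π G κ ε δ) (hr : IsTubularRetraction m M N π) :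
    ContinuousOn (move π ε) ((Set.univ : Set M) ×ˢ paramSet n) := by
  rw [Topology.IsInducing.subtypeVal.continuousOn_iff]
  have h1 : ContinuousOn (fun z : M × (EuclideanSpace ℝ (Fin n) × ℝ) => π (shift ε z.1 z.2))
      ((Set.univ : Set M) ×ˢ paramSet n) := fun z hz => by
    have h2 := (hr.contDiffAt _ (hs.shift_mem z.1.2 hz.2)).continuousAt
    have h3 : Continuous fun z : M × (EuclideanSpace ℝ (Fin n) × ℝ) => shift ε z.1 z.2 :=
      (continuous_shift hs.contDiff.continuous).comp
        ((continuous_subtype_val.comp continuous_fst).prodMk continuous_snd)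
    exact (ContinuousAt.comp (g := π) (x := z) h2 h3.continuousAt).continuousWithinAt
  exact h1.congr fun z hz => hs.coe_move hr z.1 hz.2

variable {P : Measure (EuclideanSpace ℝ (Fin n) × ℝ)}

lemma _root_.LpForms.ae_mem_paramSet [SFinite P] (μ : Measure M) [SFinite μ]
    (hP : ∀ᵐ τ ∂P, τ ∈ paramSet n) :
    ∀ᵐ z ∂(μ.prod P), z ∈ (Set.univ : Set M) ×ˢ paramSet n := by
  filter_upwards [Measure.quasiMeasurePreserving_snd.ae hP] with z hz using ⟨Set.mem_univ _, hz⟩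

variable [IsProbabilityMeasure P]

lemma aemeasurable_move (hs : IsScale M N π G κ ε δ) (hr : IsTubularRetraction m M N π)
    [SFinite (vol m M)] (hP : ∀ᵐ τ ∂P, τ ∈ paramSet n) :
    AEMeasurable (move π ε) ((vol m M).prod P) := by
  have hm : MeasurableSet ((Set.univ : Set M) ×ˢ paramSet n) :=
    MeasurableSet.univ.prod (isCompact_paramSet n).measurableSet
  have h1 := (hs.continuousOn_move hr).aemeasurable (μ := (vol m M).prod P) hm
  rwa [Measure.restrict_eq_self_of_ae_mem (ae_mem_paramSet _ hP)] at h1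

/-- Preimages under displacements have at most `2 ^ m` times the volume, since the displacements are
antilipschitz. Hence composition with `move` is bounded on every `L^p`. -/
lemma map_move_le (hs : IsScale M N π G κ ε δ) (hr : IsTubularRetraction m M N π)
    (hM : IsSmoothSubmanifold m M) [SFinite (vol m M)] (hP : ∀ᵐ τ ∂P, τ ∈ paramSet n) :
    ((vol m M).prod P).map (move π ε) ≤ ((2 ^ m : ℝ≥0) : ℝ≥0∞) • vol m M := by
  have hae := hs.aemeasurable_move (m := m) hr hP
  refine Measure.le_iff.2 fun A hA => ?_
  rw [Measure.map_apply_of_aemeasurable hae hA]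
  have hm : MeasurableSet ((Set.univ : Set M) ×ˢ paramSet n) :=
    MeasurableSet.univ.prod (isCompact_paramSet n).measurableSet
  have hS : MeasurableSet (((Set.univ : Set M) ×ˢ paramSet n) ∩ move π ε ⁻¹' A) := by
    have := hm.subtype_image
      ((continuousOn_iff_continuous_domRestrict.1 (hs.continuousOn_move hr)).measurable hA)
    rwa [← Subtype.image_preimage_coe]
  have hle : (move π ε ⁻¹' A : Set (M × (EuclideanSpace ℝ (Fin n) × ℝ)))
      ≤ᵐ[(vol m M).prod P] (((Set.univ : Set M) ×ˢ paramSet n) ∩ move π ε ⁻¹' A : Set _) := by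
    filter_upwards [ae_mem_paramSet (vol m M) hP] with z hz hzA using ⟨hz, hzA⟩
  refine (measure_mono_ae hle).trans ?_
  rw [Measure.prod_apply_symm hS]
  have h1 : ∀ τ, vol m M ((fun x => (x, τ)) ⁻¹'
      (((Set.univ : Set M) ×ˢ paramSet n) ∩ move π ε ⁻¹' A)) ≤ 2 ^ m * vol m M A := fun τ =>
    (measure_mono fun x hx => hx.2).trans
      (euclideanHausdorffMeasure_preimage_le (hs.antilipschitzWith_move hr hM τ) m A)
  refine (lintegral_mono h1).trans ?_
  simp

end IsScale
end Displacement

/-! ### Averages of displaced forms -/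

section Kernel

variable {n m j k : ℕ} {M N : Set (EuclideanSpace ℝ (Fin n))}
  {π : EuclideanSpace ℝ (Fin n) → EuclideanSpace ℝ (Fin n)}
  {G : Set (EuclideanSpace ℝ (Fin n)) → Prop} {κ : ℝ≥0} {ε δ : EuclideanSpace ℝ (Fin n) → ℝ}

/-- A bound that does not depend on the degree, since forms of large degree vanish. -/
lemma norm_compContinuousLinearMap_le_pow {F : Type*} [NormedAddCommGroup F] [NormedSpace ℝ F]
    (A : EuclideanSpace ℝ (Fin n) [⋀^Fin j]→L[ℝ] ℝ) {L : F →L[ℝ] EuclideanSpace ℝ (Fin n)} {b : ℝ}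
    (hb : 1 ≤ b) (hL : ‖L‖ ≤ b) : ‖A.compContinuousLinearMap L‖ ≤ b ^ n * ‖A‖ := by
  rcases Nat.lt_or_ge n j with hj | hj
  · rw [continuousAlternatingMap_eq_zero_of_lt hj A]
    have : (0 : EuclideanSpace ℝ (Fin n) [⋀^Fin j]→L[ℝ] ℝ).compContinuousLinearMap L = 0 := rfl
    rw [this]
    simp
  · refine (ContinuousAlternatingMap.norm_compContinuousLinearMap_le A L).trans ?_
    rw [Fintype.card_fin, mul_comm]
    have h1 : ‖L‖ ^ j ≤ b ^ j := by gcongr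
    have h2 : b ^ j ≤ b ^ n := pow_le_pow_right₀ hb hj
    gcongr
    exact h1.trans h2

open Classical in
/-- The pull-back of a form on `M` under the retraction `π`; it is meaningful on the neighborhood
`N` only, and zero at the points that `π` does not map into `M`. -/
def extForm (π : EuclideanSpace ℝ (Fin n) → EuclideanSpace ℝ (Fin n)) (ω : Form M j)
    (y : EuclideanSpace ℝ (Fin n)) : EuclideanSpace ℝ (Fin n) [⋀^Fin j]→L[ℝ] ℝ :=
  if h : π y ∈ M then (ambient ω ⟨π y, h⟩).compContinuousLinearMap (fderiv ℝ π y) else 0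

/-- The restriction to `M` of a form on `ℝ^n`. -/
def restrictForm (M : Set (EuclideanSpace ℝ (Fin n)))
    (Θ : EuclideanSpace ℝ (Fin n) → EuclideanSpace ℝ (Fin n) [⋀^Fin j]→L[ℝ] ℝ) : Form M j :=
  fun x => (Θ x).compContinuousLinearMap (tangentSpaceAt M x).subtypeL

/-- The pull-back of `Ω` under the displacement `x ↦ shift ε x τ`. -/
def pullShift (ε : EuclideanSpace ℝ (Fin n) → ℝ)
    (Ω : EuclideanSpace ℝ (Fin n) → EuclideanSpace ℝ (Fin n) [⋀^Fin j]→L[ℝ] ℝ)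
    (x : EuclideanSpace ℝ (Fin n)) (τ : EuclideanSpace ℝ (Fin n) × ℝ) :
    EuclideanSpace ℝ (Fin n) [⋀^Fin j]→L[ℝ] ℝ :=
  (Ω (shift ε x τ)).compContinuousLinearMap (shiftDeriv ε x τ)

/-- The contraction of the pull-back of `Ω` under `(s, x) ↦ shift ε x (t, s)` with `∂/∂s`. -/
def contractShift (ε : EuclideanSpace ℝ (Fin n) → ℝ)
    (Ω : EuclideanSpace ℝ (Fin n) → EuclideanSpace ℝ (Fin n) [⋀^Fin (j + 1)]→L[ℝ] ℝ)
    (x : EuclideanSpace ℝ (Fin n)) (τ : EuclideanSpace ℝ (Fin n) × ℝ) :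
    EuclideanSpace ℝ (Fin n) [⋀^Fin j]→L[ℝ] ℝ :=
  ((Ω (shift ε x τ)).curryLeft (ε x • τ.1)).compContinuousLinearMap (shiftDeriv ε x τ)

lemma ambient_restrictForm
    (Θ : EuclideanSpace ℝ (Fin n) → EuclideanSpace ℝ (Fin n) [⋀^Fin j]→L[ℝ] ℝ)
    (hr : IsTubularRetraction m M N π) (hM : IsSmoothSubmanifold m M) (x : M) :
    ambient (restrictForm M Θ) x = (Θ x).compContinuousLinearMap (fderiv ℝ π x) := by
  ext v
  simp [ambient, restrictForm, Function.comp_def, hr.fderiv_eq hM]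

lemma norm_restrictForm_le
    (Θ : EuclideanSpace ℝ (Fin n) → EuclideanSpace ℝ (Fin n) [⋀^Fin j]→L[ℝ] ℝ)
    (x : M) : ‖restrictForm M Θ x‖ ≤ ‖Θ x‖ := by
  refine ContinuousAlternatingMap.opNorm_le_bound _ (norm_nonneg _) fun v => ?_
  have := (Θ x).le_opNorm (fun i => (v i : EuclideanSpace ℝ (Fin n)))
  simpa [restrictForm, Function.comp_def] using this

namespace IsScale

lemma extForm_shift (hs : IsScale M N π G κ ε δ) (hr : IsTubularRetraction m M N π)
    (ω : Form M j) (x : M) {τ : EuclideanSpace ℝ (Fin n) × ℝ} (hτ : τ ∈ paramSet n) :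
    extForm π ω (shift ε x τ) =
      (ambient ω (move π ε (x, τ))).compContinuousLinearMap (fderiv ℝ π (shift ε x τ)) := by
  have h := hr.mem _ (hs.shift_mem x.2 hτ)
  have h2 : move π ε (x, τ) = ⟨π (shift ε x τ), h⟩ := Subtype.ext (hs.coe_move hr x hτ)
  rw [extForm, dif_pos h, h2]

lemma norm_extForm_shift_le (hs : IsScale M N π G κ ε δ) (hr : IsTubularRetraction m M N π)
    (hM : IsSmoothSubmanifold m M) (ω : Form M j) (x : M) {τ : EuclideanSpace ℝ (Fin n) × ℝ}
    (hτ : τ ∈ paramSet n) :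
    ‖extForm π ω (shift ε x τ)‖ ≤ 2 ^ n * ‖ambient ω (move π ε (x, τ))‖ := by
  rw [hs.extForm_shift hr ω x hτ]
  exact norm_compContinuousLinearMap_le_pow _ (by norm_num)
    (hs.norm_fderiv_le hr hM x.2 (hs.shift_mem_ball x.2 hτ))

lemma norm_pullShift_le (hs : IsScale M N π G κ ε δ) (hr : IsTubularRetraction m M N π)
    (hM : IsSmoothSubmanifold m M) (ω : Form M j) (x : M) {τ : EuclideanSpace ℝ (Fin n) × ℝ}
    (hτ : τ ∈ paramSet n) :
    ‖pullShift ε (extForm π ω) x τ‖ ≤ 4 ^ n * ‖ambient ω (move π ε (x, τ))‖ := by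
  have h1 := norm_compContinuousLinearMap_le_pow (extForm π ω (shift ε x τ)) (b := 2)
    (by norm_num) (norm_shiftDeriv_le hs.lipschitz hs.le_const x hτ)
  have h2 := hs.norm_extForm_shift_le hr hM ω x hτ
  calc _ ≤ (2 : ℝ) ^ n * (2 ^ n * ‖ambient ω (move π ε (x, τ))‖) := h1.trans (by gcongr)
    _ = _ := by rw [← mul_assoc, ← mul_pow]; norm_num

lemma norm_contractShift_le (hs : IsScale M N π G κ ε δ) (hr : IsTubularRetraction m M N π)
    (hM : IsSmoothSubmanifold m M) (ω : Form M (j + 1)) (x : M)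
    {τ : EuclideanSpace ℝ (Fin n) × ℝ} (hτ : τ ∈ paramSet n) :
    ‖contractShift ε (extForm π ω) x τ‖ ≤ 4 ^ n * 4 * κ * ‖ambient ω (move π ε (x, τ))‖ := by
  have h1 := norm_compContinuousLinearMap_le_pow
    ((extForm π ω (shift ε x τ)).curryLeft (ε x • τ.1)) (b := 2)
    (by norm_num) (norm_shiftDeriv_le hs.lipschitz hs.le_const x hτ)
  have h2 := hs.norm_extForm_shift_le hr hM ω x hτ
  have h3 := norm_curryLeft_apply_le (extForm π ω (shift ε x τ)) (ε x • τ.1)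
  have h4 : ‖ε x • τ.1‖ ≤ κ * 4 := by
    rw [norm_smul, Real.norm_of_nonneg (hs.nonneg x)]
    have h5 := mem_closedBall_zero_iff.1 hτ.1
    have h6 := hs.le x
    have h7 : ε x ≤ κ := h6.trans (mul_le_of_le_one_right κ.2 (hs.radius_le x))
    gcongr
  calc _ ≤ (2 : ℝ) ^ n * ((2 ^ n * ‖ambient ω (move π ε (x, τ))‖) * (κ * 4)) := by
        refine h1.trans ?_
        gcongr
        refine h3.trans ?_
        gcongr
    _ = ((2 * 2) ^ n) * 4 * κ * ‖ambient ω (move π ε (x, τ))‖ := by rw [mul_pow]; ring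
    _ = _ := by norm_num

variable {P : Measure (EuclideanSpace ℝ (Fin n) × ℝ)} [IsProbabilityMeasure P]

lemma aestronglyMeasurable_comp_move {H : Type*} [NormedAddCommGroup H]
    (hs : IsScale M N π G κ ε δ) (hr : IsTubularRetraction m M N π)
    (hM : IsSmoothSubmanifold m M) [SFinite (vol m M)] (hP : ∀ᵐ τ ∂P, τ ∈ paramSet n)
    {f : M → H} (hf : AEStronglyMeasurable f (vol m M)) :
    AEStronglyMeasurable (fun z => f (move π ε z)) ((vol m M).prod P) :=
  (hf.mono_ac ((Measure.absolutelyContinuous_of_le (hs.map_move_le hr hM hP)).trans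
    Measure.smul_absolutelyContinuous)).comp_aemeasurable (hs.aemeasurable_move hr hP)

lemma aestronglyMeasurable_extForm_shift (hs : IsScale M N π G κ ε δ)
    (hr : IsTubularRetraction m M N π) (hM : IsSmoothSubmanifold m M) [SFinite (vol m M)]
    (hP : ∀ᵐ τ ∂P, τ ∈ paramSet n) {ω : Form M j}
    (hω : AEStronglyMeasurable (ambient ω) (vol m M)) :
    AEStronglyMeasurable (fun z : M × (EuclideanSpace ℝ (Fin n) × ℝ) =>
      extForm π ω (shift ε z.1 z.2)) ((vol m M).prod P) := by
  have h1 := hs.aestronglyMeasurable_comp_move hr hM hP hω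
  have hm : MeasurableSet ((Set.univ : Set M) ×ˢ paramSet n) :=
    MeasurableSet.univ.prod (isCompact_paramSet n).measurableSet
  have h2 : AEStronglyMeasurable (fun z : M × (EuclideanSpace ℝ (Fin n) × ℝ) =>
      fderiv ℝ π (shift ε z.1 z.2)) ((vol m M).prod P) := by
    have h3 : ContinuousOn (fun z : M × (EuclideanSpace ℝ (Fin n) × ℝ) =>
        fderiv ℝ π (shift ε z.1 z.2)) ((Set.univ : Set M) ×ˢ paramSet n) := fun z hz => by
      have h4 := ((hr.contDiffAt _ (hs.shift_mem z.1.2 hz.2)).fderiv_right (m := (⊤ : ℕ∞))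
        (by simp)).continuousAt
      have h5 : Continuous fun z : M × (EuclideanSpace ℝ (Fin n) × ℝ) => shift ε z.1 z.2 :=
        (continuous_shift hs.contDiff.continuous).comp
          ((continuous_subtype_val.comp continuous_fst).prodMk continuous_snd)
      exact (ContinuousAt.comp (g := fderiv ℝ π) (x := z) h4 h5.continuousAt).continuousWithinAt
    have h6 := h3.aestronglyMeasurable (μ := (vol m M).prod P) hm
    rwa [Measure.restrict_eq_self_of_ae_mem (ae_mem_paramSet _ hP)] at h6
  refine (continuous_compContinuousLinearMap.comp_aestronglyMeasurable (h1.prodMk h2)).congr ?_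
  filter_upwards [ae_mem_paramSet (vol m M) hP] with z hz
  exact (hs.extForm_shift hr ω z.1 hz.2).symm

lemma continuous_shiftDeriv {X : Type*} [TopologicalSpace X] (hε : ContDiff ℝ (⊤ : ℕ∞) ε)
    {f : X → EuclideanSpace ℝ (Fin n)} {g : X → EuclideanSpace ℝ (Fin n) × ℝ} (hf : Continuous f)
    (hg : Continuous g) : Continuous fun z => shiftDeriv ε (f z) (g z) := by
  have h : Continuous (fderiv ℝ ε) := hε.continuous_fderiv (by simp)
  have h1 : Continuous fun z =>
      ContinuousLinearMap.smulRightL ℝ (EuclideanSpace ℝ (Fin n)) (EuclideanSpace ℝ (Fin n))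
        ((g z).2 • fderiv ℝ ε (f z)) (g z).1 :=
    ((ContinuousLinearMap.smulRightL ℝ (EuclideanSpace ℝ (Fin n))
      (EuclideanSpace ℝ (Fin n))).continuous.comp
      (hg.snd.smul (h.comp hf))).clm_apply hg.fst
  exact continuous_const.add h1

lemma _root_.LpForms.aestronglyMeasurable_compContinuousLinearMap {X V W : Type*}
    [MeasurableSpace X] {μ : Measure X} [NormedAddCommGroup V] [NormedSpace ℝ V]
    [FiniteDimensional ℝ V] [NormedAddCommGroup W] [NormedSpace ℝ W] {f : X → W [⋀^Fin j]→L[ℝ] ℝ}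
    {L : X → V →L[ℝ] W} (hf : AEStronglyMeasurable f μ) (hL : AEStronglyMeasurable L μ) :
    AEStronglyMeasurable (fun x => (f x).compContinuousLinearMap (L x)) μ :=
  continuous_compContinuousLinearMap.comp_aestronglyMeasurable (hf.prodMk hL)

lemma aestronglyMeasurable_pullShift (hs : IsScale M N π G κ ε δ)
    (hr : IsTubularRetraction m M N π) (hM : IsSmoothSubmanifold m M) [SFinite (vol m M)]
    (hP : ∀ᵐ τ ∂P, τ ∈ paramSet n) {ω : Form M j}
    (hω : AEStronglyMeasurable (ambient ω) (vol m M)) :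
    AEStronglyMeasurable (fun z : M × (EuclideanSpace ℝ (Fin n) × ℝ) =>
      pullShift ε (extForm π ω) z.1 z.2) ((vol m M).prod P) := by
  have h2 := (continuous_shiftDeriv (X := M × (EuclideanSpace ℝ (Fin n) × ℝ)) hs.contDiff
    (continuous_subtype_val.comp continuous_fst) continuous_snd).aestronglyMeasurable
    (μ := (vol m M).prod P)
  exact aestronglyMeasurable_compContinuousLinearMap
    (hs.aestronglyMeasurable_extForm_shift hr hM hP hω) h2

lemma aestronglyMeasurable_contractShift (hs : IsScale M N π G κ ε δ)
    (hr : IsTubularRetraction m M N π) (hM : IsSmoothSubmanifold m M) [SFinite (vol m M)]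
    (hP : ∀ᵐ τ ∂P, τ ∈ paramSet n) {ω : Form M (j + 1)}
    (hω : AEStronglyMeasurable (ambient ω) (vol m M)) :
    AEStronglyMeasurable (fun z : M × (EuclideanSpace ℝ (Fin n) × ℝ) =>
      contractShift ε (extForm π ω) z.1 z.2) ((vol m M).prod P) := by
  have h2 := (continuous_shiftDeriv (X := M × (EuclideanSpace ℝ (Fin n) × ℝ)) hs.contDiff
    (continuous_subtype_val.comp continuous_fst) continuous_snd).aestronglyMeasurable
    (μ := (vol m M).prod P)
  have h3 : Continuous fun z : M × (EuclideanSpace ℝ (Fin n) × ℝ) => ε z.1 • z.2.1 :=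
    (hs.contDiff.continuous.comp (continuous_subtype_val.comp continuous_fst)).smul
      continuous_snd.fst
  have h4 := (contDiff_curryLeft_apply (E := EuclideanSpace ℝ (Fin n)) (j := j)
    (k := 0)).continuous.comp_aestronglyMeasurable
    ((hs.aestronglyMeasurable_extForm_shift hr hM hP hω).prodMk h3.aestronglyMeasurable)
  exact aestronglyMeasurable_compContinuousLinearMap h4 h2

end IsScale

/-- `F` is a measurable family of forms whose value at `(x, τ)` is bounded by the value of `ω` at
the displaced point. This treats `pullShift` and `contractShift` at the same time. -/
structure IsKernel (m : ℕ) (π : EuclideanSpace ℝ (Fin n) → EuclideanSpace ℝ (Fin n))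
    (ε : EuclideanSpace ℝ (Fin n) → ℝ) (P : Measure (EuclideanSpace ℝ (Fin n) × ℝ)) (ω : Form M j)
    (c : ℝ≥0) (F : EuclideanSpace ℝ (Fin n) → EuclideanSpace ℝ (Fin n) × ℝ →
      EuclideanSpace ℝ (Fin n) [⋀^Fin k]→L[ℝ] ℝ) : Prop where
  aestronglyMeasurable_form : AEStronglyMeasurable (ambient ω) (vol m M)
  aestronglyMeasurable : AEStronglyMeasurable
    (fun z : M × (EuclideanSpace ℝ (Fin n) × ℝ) => F z.1 z.2) ((vol m M).prod P)
  norm_le : ∀ (x : M), ∀ τ ∈ paramSet n, ‖F x τ‖ ≤ c * ‖ambient ω (move π ε (x, τ))‖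

namespace IsKernel

variable {P : Measure (EuclideanSpace ℝ (Fin n) × ℝ)}
  {ω : Form M j} {c : ℝ≥0} {F : EuclideanSpace ℝ (Fin n) → EuclideanSpace ℝ (Fin n) × ℝ →
      EuclideanSpace ℝ (Fin n) [⋀^Fin k]→L[ℝ] ℝ}

lemma enorm_le (h : IsKernel m π ε P ω c F) (x : M) {τ : EuclideanSpace ℝ (Fin n) × ℝ}
    (hτ : τ ∈ paramSet n) : ‖F x τ‖ₑ ≤ c * ‖ambient ω (move π ε (x, τ))‖ₑ := by
  have h3 : ‖F x τ‖₊ ≤ c * ‖ambient ω (move π ε (x, τ))‖₊ := by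
    rw [← NNReal.coe_le_coe]
    push_cast
    exact h.norm_le x τ hτ
  simpa [enorm_eq_nnnorm] using (ENNReal.coe_le_coe.2 h3)

variable [IsProbabilityMeasure P]

lemma aestronglyMeasurable_integral (h : IsKernel m π ε P ω c F) [SFinite (vol m M)] :
    AEStronglyMeasurable (fun x : M => ∫ τ, F x τ ∂P) (vol m M) :=
  h.aestronglyMeasurable.integral_prod_right'

/-- By Minkowski's integral inequality averages satisfy the same `L^p` bounds as displaced forms,
with a constant that does not depend on `p`. -/
lemma eLpNorm_le (h : IsKernel m π ε P ω c F) (hs : IsScale M N π G κ ε δ)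
    (hr : IsTubularRetraction m M N π) (hM : IsSmoothSubmanifold m M) [SFinite (vol m M)]
    (hP : ∀ᵐ τ ∂P, τ ∈ paramSet n) {p : ℝ≥0∞} (hp : 1 ≤ p) :
    eLpNorm (fun x : M => ∫ τ, F x τ ∂P) p (vol m M) ≤
      (c * 2 ^ m : ℝ≥0) * eLpNorm (ambient ω) p (vol m M) := by
  have h1 : eLpNorm (fun x : M => ∫ τ, F x τ ∂P) p (vol m M) ≤
      eLpNorm (fun x : M => ∫⁻ τ, ‖F x τ‖ₑ ∂P) p (vol m M) :=
    eLpNorm_mono_enorm fun x => by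
      rw [enorm_eq_self]
      exact enorm_integral_le_lintegral_enorm _
  have h2 := eLpNorm_lintegral_le (G := EuclideanSpace ℝ (Fin n) [⋀^Fin k]→L[ℝ] ℝ) hp
    h.aestronglyMeasurable
  have h3 : eLpNorm (fun z : M × (EuclideanSpace ℝ (Fin n) × ℝ) => F z.1 z.2) p
      ((vol m M).prod P) ≤ c * eLpNorm (ambient ω ∘ move π ε) p ((vol m M).prod P) := by
    refine eLpNorm_le_nnreal_smul_eLpNorm_of_ae_le_mul ?_ p
    filter_upwards [ae_mem_paramSet (vol m M) hP] with z hz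
    rw [← NNReal.coe_le_coe]
    push_cast
    exact h.norm_le z.1 z.2 hz.2
  have h4 := eLpNorm_le_of_map_le (G := EuclideanSpace ℝ (Fin n) [⋀^Fin j]→L[ℝ] ℝ)
    hp (one_le_pow₀ (by norm_num : (1 : ℝ≥0) ≤ 2)) (hs.aemeasurable_move hr hP)
    (hs.map_move_le hr hM hP) h.aestronglyMeasurable_form
  refine h1.trans (h2.trans (h3.trans ?_))
  rw [ENNReal.coe_mul, mul_assoc]
  gcongr

/-- The local version of the `L^1` bound. -/
lemma setLIntegral_le (h : IsKernel m π ε P ω c F) (hs : IsScale M N π G κ ε δ)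
    (hr : IsTubularRetraction m M N π) (hM : IsSmoothSubmanifold m M) [SFinite (vol m M)]
    (hP : ∀ᵐ τ ∂P, τ ∈ paramSet n) {S S' : Set M} (hS : MeasurableSet S) (hS' : MeasurableSet S')
    (hSS' : ∀ x ∈ S, ∀ τ ∈ paramSet n, move π ε (x, τ) ∈ S') :
    ∫⁻ x in S, (∫⁻ τ, ‖F x τ‖ₑ ∂P) ∂(vol m M) ≤
      (c * 2 ^ m : ℝ≥0) * ∫⁻ x in S', ‖ambient ω x‖ₑ ∂(vol m M) := by
  set f : M → ℝ≥0∞ := S'.indicator fun x => ‖ambient ω x‖ₑ with hf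
  have hfm : AEMeasurable f (vol m M) := (h.aestronglyMeasurable_form.enorm).indicator hS'
  have hac : ((vol m M).prod P).map (move π ε) ≪ vol m M :=
    (Measure.absolutelyContinuous_of_le (hs.map_move_le hr hM hP)).trans
      Measure.smul_absolutelyContinuous
  have h1 : ∀ x ∈ S, ∫⁻ τ, ‖F x τ‖ₑ ∂P ≤ ∫⁻ τ, c * f (move π ε (x, τ)) ∂P := fun x hx => by
    refine lintegral_mono_ae ?_
    filter_upwards [hP] with τ hτ
    rw [hf, Set.indicator_of_mem (hSS' x hx τ hτ)]
    exact h.enorm_le x hτ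
  calc ∫⁻ x in S, (∫⁻ τ, ‖F x τ‖ₑ ∂P) ∂(vol m M)
      ≤ ∫⁻ x in S, (∫⁻ τ, c * f (move π ε (x, τ)) ∂P) ∂(vol m M) :=
        setLIntegral_mono_ae' hS (Eventually.of_forall h1)
    _ ≤ ∫⁻ x, (∫⁻ τ, c * f (move π ε (x, τ)) ∂P) ∂(vol m M) := setLIntegral_le_lintegral _ _
    _ = ∫⁻ z, c * f (move π ε z) ∂((vol m M).prod P) := by
        rw [lintegral_prod]
        exact ((hfm.mono_ac hac).comp_aemeasurable (hs.aemeasurable_move hr hP)).const_mul _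
    _ = c * ∫⁻ x, f x ∂(((vol m M).prod P).map (move π ε)) := by
        rw [lintegral_const_mul' _ _ ENNReal.coe_ne_top,
          lintegral_map' (hfm.mono_ac hac) (hs.aemeasurable_move hr hP)]
    _ ≤ c * ∫⁻ x, f x ∂(((2 ^ m : ℝ≥0) : ℝ≥0∞) • vol m M) := by
        gcongr
        exact hs.map_move_le hr hM hP
    _ = _ := by
        rw [lintegral_smul_measure, smul_eq_mul, hf, lintegral_indicator hS', ENNReal.coe_mul,
          mul_assoc]

/-- The averages exist almost everywhere, also for forms that are only locally integrable. -/
lemma ae_integrable (h : IsKernel m π ε P ω c F) (hs : IsScale M N π G κ ε δ)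
    (hr : IsTubularRetraction m M N π) (hM : IsSmoothSubmanifold m M) [SFinite (vol m M)]
    (hP : ∀ᵐ τ ∂P, τ ∈ paramSet n) (hω : LocallyIntegrable (ambient ω) (vol m M)) :
    (∀ᵐ x : M ∂(vol m M), Integrable (F x) P) ∧
      LocallyIntegrable (fun x : M => ∫ τ, F x τ ∂P) (vol m M) := by
  have := weaklyLocallyCompactSpace hM
  have key : ∀ x₀ : M, ∃ K ∈ 𝓝 x₀, MeasurableSet K ∧
      ∫⁻ x in K, (∫⁻ τ, ‖F x τ‖ₑ ∂P) ∂(vol m M) < ∞ := fun x₀ => by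
    obtain ⟨K, hK, hKn⟩ := exists_compact_mem_nhds x₀
    have hK' : IsCompact (move π ε '' (K ×ˢ paramSet n)) :=
      (hK.prod (isCompact_paramSet n)).image_of_continuousOn
        ((hs.continuousOn_move hr).mono (Set.prod_mono (Set.subset_univ _) le_rfl))
    refine ⟨K, hKn, hK.measurableSet, ?_⟩
    refine (h.setLIntegral_le hs hr hM hP hK.measurableSet hK'.measurableSet
      (fun x hx τ hτ => ⟨(x, τ), ⟨hx, hτ⟩, rfl⟩)).trans_lt ?_
    exact ENNReal.mul_lt_top (by finiteness) (hω.integrableOn_isCompact hK').2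
  have hmeas : ∀ᵐ x : M ∂(vol m M), AEStronglyMeasurable (F x) P :=
    h.aestronglyMeasurable.prodMk_left
  constructor
  · rw [ae_iff]
    refine measure_null_of_locally_null _ fun x₀ _ => ?_
    obtain ⟨K, hK, hKm, hKf⟩ := key x₀
    refine ⟨_, inter_mem_nhdsWithin _ hK, ?_⟩
    have h2 : AEMeasurable (fun x : M => ∫⁻ τ, ‖F x τ‖ₑ ∂P) ((vol m M).restrict K) :=
      (h.aestronglyMeasurable.enorm.lintegral_prod_right').restrict
    have h1 : ∀ᵐ x ∂(vol m M), x ∈ K → ∫⁻ τ, ‖F x τ‖ₑ ∂P < ∞ :=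
      (ae_restrict_iff' hKm).1 (ae_lt_top' h2 hKf.ne)
    have h3 : ∀ᵐ x : M ∂(vol m M), ¬ (¬ Integrable (F x) P ∧ x ∈ K) := by
      filter_upwards [h1, hmeas] with x hx hm hn
      exact hn.1 ⟨hm, hx hn.2⟩
    rw [ae_iff] at h3
    refine measure_mono_null (fun x hx => ?_) h3
    simpa using hx
  · intro x₀
    obtain ⟨K, hK, hKm, hKf⟩ := key x₀
    refine ⟨K, hK, h.aestronglyMeasurable_integral.restrict, lt_of_le_of_lt ?_ hKf⟩
    exact lintegral_mono fun x => enorm_integral_le_lintegral_enorm _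

end IsKernel
end Kernel

/-! ### Smoothness of the regularized forms -/

section Parametric

variable {P T F F' : Type*} [NormedAddCommGroup P] [NormedSpace ℝ P] [NormedAddCommGroup T]
  [NormedSpace ℝ T] [MeasurableSpace T] [BorelSpace T] [NormedAddCommGroup F] [NormedSpace ℝ F]
  [NormedAddCommGroup F'] [NormedSpace ℝ F'] {μ : Measure T}

/-- Integrals against a kernel that depends smoothly on a parameter are smooth. -/
lemma contDiffOn_integral_clm_apply {f : T → F'} {g : P → T → F' →L[ℝ] F} {s : Set P} {k : Set T}
    (hs : IsOpen s) (hk : IsCompact k) (hgs : ∀ p, ∀ t, p ∈ s → t ∉ k → g p t = 0)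
    (hf : LocallyIntegrable f μ)
    (hg : ContDiffOn ℝ (⊤ : ℕ∞) (fun q : P × T => g q.1 q.2) (s ×ˢ Set.univ)) :
    ContDiffOn ℝ (⊤ : ℕ∞) (fun p => ∫ t, g p t (f t) ∂μ) s := by
  -- The integral is the value at `0` of the convolution of `f` with the kernel `t ↦ g p (-t)`.
  set g' : P → T → F' →L[ℝ] F := fun p t => g p (-t) with hg'
  have h1 : ContDiffOn ℝ (⊤ : ℕ∞) (Function.uncurry g') (s ×ˢ Set.univ) := by
    have h2 : ContDiff ℝ (⊤ : ℕ∞) fun q : P × T => (q.1, -q.2) :=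
      contDiff_fst.prodMk contDiff_snd.neg
    exact hg.comp h2.contDiffOn fun q hq => ⟨hq.1, Set.mem_univ _⟩
  have h3 := contDiffOn_convolution_right_with_param (n := ⊤) (μ := μ) (f := f) (g := g')
    ((ContinuousLinearMap.apply ℝ F : F' →L[ℝ] _)) (k := (fun t => -t) ⁻¹' k) hs
    ((Homeomorph.neg T).isCompact_preimage.2 hk) (fun p t hp ht => hgs p (-t) hp ht) hf h1
  have h4 : ContDiff ℝ (⊤ : ℕ∞) fun p : P => (p, (0 : T)) := contDiff_id.prodMk contDiff_const
  refine (h3.comp h4.contDiffOn fun p hp => ⟨hp, Set.mem_univ _⟩).congr fun p _ => ?_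
  simp [MeasureTheory.convolution, hg']

lemma contDiffOn_integral_smul_clm_apply {f : T → F'} {c : P → T → ℝ} {g : P → T → F' →L[ℝ] F}
    {s : Set P} {k : Set T} (hs : IsOpen s) (hk : IsCompact k)
    (hcs : ∀ p, ∀ t, p ∈ s → t ∉ k → c p t = 0) (hf : LocallyIntegrable f μ)
    (hc : ContDiffOn ℝ (⊤ : ℕ∞) (fun q : P × T => c q.1 q.2) (s ×ˢ Set.univ))
    (hg : ContDiffOn ℝ (⊤ : ℕ∞) (fun q : P × T => g q.1 q.2) (s ×ˢ Set.univ)) :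
    ContDiffOn ℝ (⊤ : ℕ∞) (fun p => ∫ t, c p t • g p t (f t) ∂μ) s :=
  contDiffOn_integral_clm_apply (g := fun p t => c p t • g p t) hs hk
    (fun p t hp ht => by rw [hcs p t hp ht, zero_smul]) hf (hc.smul hg)

end Parametric

section Pullback

variable {n m j : ℕ} {M N : Set (EuclideanSpace ℝ (Fin n))}
  {π : EuclideanSpace ℝ (Fin n) → EuclideanSpace ℝ (Fin n)}

lemma contDiff_compContinuousLinearMapCLM {V W : Type*} [NormedAddCommGroup V] [NormedSpace ℝ V]
    [FiniteDimensional ℝ V] [NormedAddCommGroup W] [NormedSpace ℝ W] [FiniteDimensional ℝ W] :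
    ContDiff ℝ (⊤ : ℕ∞) fun L : V →L[ℝ] W =>
      (ContinuousAlternatingMap.compContinuousLinearMapCLM L :
        (W [⋀^Fin j]→L[ℝ] ℝ) →L[ℝ] V [⋀^Fin j]→L[ℝ] ℝ) := by
  rw [contDiff_clm_apply_iff]
  exact fun A => contDiff_compContinuousLinearMap.comp (contDiff_const.prodMk contDiff_id)

lemma pullback_restrictForm (hr : IsTubularRetraction m M N π)
    {e : OpenPartialHomeomorph M (EuclideanSpace ℝ (Fin m))} (he : IsCoord e)
    (Θ : EuclideanSpace ℝ (Fin n) → EuclideanSpace ℝ (Fin n) [⋀^Fin j]→L[ℝ] ℝ)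
    {u : EuclideanSpace ℝ (Fin m)} (hu : u ∈ e.target) :
    pullback e (restrictForm M Θ) u =
      (Θ (param e u)).compContinuousLinearMap (fderiv ℝ (param e) u) := by
  ext v
  have h : ∀ w, fderiv ℝ (param e) u w ∈ tangentSpaceAt M (e.symm u) := fun w => by
    rw [hr.tangentSpaceAt_eq_range he hu]
    exact ⟨w, rfl⟩
  have h2 : ∀ w, (((tangentSpaceAt M (e.symm u)).orthogonalProjectionOnto
      (fderiv ℝ (param e) u w) : tangentSpaceAt M (e.symm u)) : EuclideanSpace ℝ (Fin n)) =
        fderiv ℝ (param e) u w := fun w => by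
    rw [← Submodule.starProjection_apply]
    exact Submodule.starProjection_eq_self_iff.2 (h w)
  show Θ (e.symm u) (fun i => (((tangentSpaceAt M (e.symm u)).orthogonalProjectionOnto
      (fderiv ℝ (param e) u (v i)) : tangentSpaceAt M (e.symm u)) : EuclideanSpace ℝ (Fin n))) = _
  simp only [h2]
  rfl

lemma contDiffAt_compContinuousLinearMap {X V W : Type*} [NormedAddCommGroup X] [NormedSpace ℝ X]
    [NormedAddCommGroup V] [NormedSpace ℝ V] [FiniteDimensional ℝ V] [NormedAddCommGroup W]
    [NormedSpace ℝ W] {f : X → W [⋀^Fin j]→L[ℝ] ℝ} {L : X → V →L[ℝ] W} {x : X}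
    (hf : ContDiffAt ℝ (⊤ : ℕ∞) f x) (hL : ContDiffAt ℝ (⊤ : ℕ∞) L x) :
    ContDiffAt ℝ (⊤ : ℕ∞) (fun x => (f x).compContinuousLinearMap (L x)) x :=
  (contDiff_compContinuousLinearMap (E := V) (F := W) (k := (⊤ : ℕ∞))).contDiffAt.comp x
    (hf.prodMk hL)

lemma isSmooth_restrictForm (hr : IsTubularRetraction m M N π)
    {Θ : EuclideanSpace ℝ (Fin n) → EuclideanSpace ℝ (Fin n) [⋀^Fin j]→L[ℝ] ℝ}
    (hΘ : ∀ x ∈ M, ContDiffAt ℝ (⊤ : ℕ∞) Θ x) : IsSmooth m (restrictForm M Θ) := by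
  intro e he u hu
  have h1 := he.contDiffAt_param hu
  have h2 : ContDiffAt ℝ (⊤ : ℕ∞) (fun u => (Θ (param e u)).compContinuousLinearMap
      (fderiv ℝ (param e) u)) u :=
    contDiffAt_compContinuousLinearMap ((hΘ _ (param_mem e u)).comp u h1)
      (h1.fderiv_right (by simp))
  refine ContDiffAt.contDiffWithinAt (h2.congr_of_eventuallyEq ?_)
  filter_upwards [e.open_target.mem_nhds hu] with v hv using pullback_restrictForm hr he Θ hv

end Pullback

/-! ### Smoothness of averages -/

section Affine

variable {E G : Type*} [NormedAddCommGroup E] [NormedSpace ℝ E] [FiniteDimensional ℝ E]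
  [MeasurableSpace E] [BorelSpace E] {μ : Measure E} [μ.IsAddHaarMeasure] [NormedAddCommGroup G]

lemma integrableOn_ball_comp_affine {f : E → G} {x : E} {c r : ℝ} (hc : 0 < c) :
    IntegrableOn (fun t => f (x + c • t)) (Metric.ball 0 r) μ ↔
      IntegrableOn f (Metric.ball x (c * r)) μ := by
  rw [← integrable_indicator_iff (ε' := G) measurableSet_ball,
    ← integrable_indicator_iff (ε' := G) measurableSet_ball]
  have h1 : (Metric.ball (0 : E) r).indicator (fun t => f (x + c • t)) =
      fun t => (fun z => (Metric.ball x (c * r)).indicator f (x + z)) (c • t) := by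
    funext t
    have h2 : x + c • t ∈ Metric.ball x (c * r) ↔ t ∈ Metric.ball (0 : E) r := by
      rw [Metric.mem_ball, dist_eq_norm, add_sub_cancel_left, norm_smul, Real.norm_of_nonneg hc.le,
        mem_ball_zero_iff, mul_lt_mul_iff_right₀ hc]
    by_cases ht : t ∈ Metric.ball (0 : E) r
    · simp only [Set.indicator_of_mem ht, Set.indicator_of_mem (h2.2 ht)]
    · simp only [Set.indicator_of_notMem ht, Set.indicator_of_notMem fun h => ht (h2.1 h)]
  rw [h1]
  refine (integrable_comp_smul_iff μ (fun z => (Metric.ball x (c * r)).indicator f (x + z))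
    hc.ne').trans ?_
  constructor
  · intro h
    have := h.comp_add_left (-x)
    simpa using this
  · intro h
    exact h.comp_add_left x

lemma integral_comp_affine [NormedSpace ℝ G] (f : E → G) (x : E) {c : ℝ} (hc : 0 < c) :
    ∫ t, f (x + c • t) ∂μ = (c ^ Module.finrank ℝ E)⁻¹ • ∫ y, f y ∂μ := by
  have h1 := Measure.integral_comp_smul_of_nonneg μ (fun z => f (x + z)) c (hR := hc.le)
  rw [integral_add_left_eq_self] at h1
  exact h1

lemma integrable_prod_dirac_iff {X Y : Type*} [MeasurableSpace X] [MeasurableSpace Y]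
    [MeasurableSingletonClass Y] {ν : Measure X} [SFinite ν] (y : Y) {F : X × Y → G} :
    Integrable F (ν.prod (Measure.dirac y)) ↔ Integrable (fun x => F (x, y)) ν := by
  rw [Measure.prod_dirac, (measurableEmbedding_prod_mk_right y).integrable_map_iff]
  rfl

lemma integral_prod_dirac [NormedSpace ℝ G] {X Y : Type*} [MeasurableSpace X] [MeasurableSpace Y]
    [MeasurableSingletonClass Y] {ν : Measure X} [SFinite ν] (y : Y) (F : X × Y → G) :
    ∫ τ, F τ ∂(ν.prod (Measure.dirac y)) = ∫ x, F (x, y) ∂ν := by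
  rw [Measure.prod_dirac, (measurableEmbedding_prod_mk_right y).integral_map]

lemma integrable_bumpMeasure_of_integrableOn [NormedSpace ℝ G] (φ : ContDiffBump (0 : E))
    {f : E → G} (hf : IntegrableOn f (Metric.ball 0 φ.rOut) μ) :
    Integrable f (bumpMeasure μ φ) := by
  rw [integrable_bumpMeasure_iff]
  have h1 : (fun t => φ.normed μ t • f t) =
      fun t => φ.normed μ t • (Metric.ball 0 φ.rOut).indicator f t := by
    funext t
    by_cases ht : t ∈ Metric.ball (0 : E) φ.rOut
    · rw [Set.indicator_of_mem ht]
    · rw [← φ.support_normed_eq (μ := μ), Function.notMem_support] at ht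
      rw [ht, zero_smul, zero_smul]
  rw [h1]
  obtain ⟨C, hC⟩ := φ.continuous_normed.bounded_above_of_compact_support (f := φ.normed μ)
    φ.hasCompactSupport_normed
  refine Integrable.bdd_smul ?_ C φ.continuous_normed.aestronglyMeasurable
    (Eventually.of_forall hC)
  rwa [integrable_indicator_iff (ε' := G) measurableSet_ball]

lemma integrableOn_of_integrable_bumpMeasure [NormedSpace ℝ G] (φ : ContDiffBump (0 : E))
    {f : E → G} (hf : Integrable f (bumpMeasure μ φ)) :
    IntegrableOn f (Metric.ball 0 φ.rIn) μ := by
  rw [integrable_bumpMeasure_iff] at hf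
  have h1 := (hf.integrableOn (s := Metric.ball 0 φ.rIn)).smul (∫ x, φ x ∂μ)
  refine IntegrableOn.congr_fun (ε := G) h1 (fun t ht => ?_) measurableSet_ball
  simp only [Pi.smul_apply]
  rw [φ.normed_def, φ.one_of_mem_closedBall (Metric.ball_subset_closedBall ht), smul_smul,
    mul_one_div_cancel (φ.integral_pos (μ := μ)).ne', one_smul]

end Affine

section Regular

variable {n m j k : ℕ} {M N : Set (EuclideanSpace ℝ (Fin n))}
  {π : EuclideanSpace ℝ (Fin n) → EuclideanSpace ℝ (Fin n)}
  {G : Set (EuclideanSpace ℝ (Fin n)) → Prop} {κ : ℝ≥0} {ε δ : EuclideanSpace ℝ (Fin n) → ℝ}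

/-- A bump function around the origin with support of radius `1`. -/
def stdBump (n : ℕ) : ContDiffBump (0 : EuclideanSpace ℝ (Fin n)) :=
  ⟨1 / 2, 1, by norm_num, by norm_num⟩

/-- The weight with which the displacements are averaged by the regularization operators: `t` has a
smooth density, and `s = 1`. -/
def regMeasure (n : ℕ) : Measure (EuclideanSpace ℝ (Fin n) × ℝ) :=
  (bumpMeasure volume (stdBump n)).prod (Measure.dirac 1)

/-- The weight with which the displacements are averaged by the homotopy operators: `t` has the same
density, and `s` is uniformly distributed on `[0, 1]`. -/
def homMeasure (n : ℕ) : Measure (EuclideanSpace ℝ (Fin n) × ℝ) :=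
  (bumpMeasure volume (stdBump n)).prod (volume.restrict (Set.Icc 0 1))

instance : IsProbabilityMeasure (volume.restrict (Set.Icc (0 : ℝ) 1)) :=
  ⟨by simp⟩

instance isProbabilityMeasure_regMeasure : IsProbabilityMeasure (regMeasure n) := by
  unfold regMeasure; infer_instance

instance isProbabilityMeasure_homMeasure : IsProbabilityMeasure (homMeasure n) := by
  unfold homMeasure; infer_instance

lemma ae_mem_paramSet_of_prod (φ : ContDiffBump (0 : EuclideanSpace ℝ (Fin n))) (hφ : φ.rOut ≤ 4)
    {ν : Measure ℝ} [SFinite ν] (hν : ∀ᵐ s ∂ν, s ∈ Set.Icc (0 : ℝ) 1) :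
    ∀ᵐ τ ∂((bumpMeasure volume φ).prod ν), τ ∈ paramSet n := by
  filter_upwards [Measure.quasiMeasurePreserving_fst.ae (ae_norm_lt_bumpMeasure (μ := volume) φ),
    Measure.quasiMeasurePreserving_snd.ae hν] with τ h1 h2
  exact ⟨mem_closedBall_zero_iff.2 (h1.le.trans hφ), h2⟩

lemma ae_mem_paramSet_regMeasure : ∀ᵐ τ ∂(regMeasure n), τ ∈ paramSet n :=
  ae_mem_paramSet_of_prod _ (by norm_num [stdBump]) (by simp [ae_dirac_eq])

lemma ae_mem_paramSet_homMeasure : ∀ᵐ τ ∂(homMeasure n), τ ∈ paramSet n :=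
  ae_mem_paramSet_of_prod _ (by norm_num [stdBump]) (ae_restrict_mem measurableSet_Icc)

lemma vol_pos_of_mem_nhds (hM : IsSmoothSubmanifold m M) {x : M} {s : Set M} (hs : s ∈ 𝓝 x) :
    0 < vol m M s := by
  obtain ⟨N, π, hr⟩ := exists_isTubularRetraction hM
  obtain ⟨e, he, hx⟩ := hM x
  obtain ⟨V, K, huV, hV⟩ := hr.exists_isPatch he (e.map_source hx)
  have h1 : V ∩ e.symm ⁻¹' s ∈ 𝓝 (e x) := by
    refine inter_mem (hV.isOpen.mem_nhds huV) (e.continuousAt_symm (e.map_source hx) ?_)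
    rwa [e.left_inv hx]
  have h2 : 0 < volume (V ∩ e.symm ⁻¹' s) := Measure.measure_pos_of_mem_nhds _ h1
  have h3 := hV.volume_le (A := V ∩ e.symm ⁻¹' s) Set.inter_subset_left
  have h4 : vol m M (e.symm '' (V ∩ e.symm ⁻¹' s)) ≤ vol m M s :=
    measure_mono (by rintro _ ⟨u, hu, rfl⟩; exact hu.2)
  by_contra h5
  have h6 : vol m M s = 0 := by simpa using h5
  rw [h6] at h4
  rw [le_antisymm h4 zero_le, mul_zero] at h3
  exact absurd h2 (not_lt.2 h3)

namespace IsScale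

lemma scale_sub_le (hs : IsScale M N π G κ ε δ) {x x₀ : EuclideanSpace ℝ (Fin n)} {a : ℝ}
    (hx : dist x x₀ ≤ a) : |ε x - ε x₀| ≤ a / 100 := by
  have h1 := hs.lipschitz.dist_le_mul x x₀
  have h2 := hs.le_const
  rw [Real.dist_eq] at h1
  nlinarith [dist_nonneg (x := x) (y := x₀), κ.2]

/-- The extension of a locally integrable form to the neighborhood is locally integrable near `M`:
its average over displacements exists at almost every point of `M`, in particular at some point
close to `x₀`, and involves all the values near `x₀`. -/
lemma integrableOn_extForm (hs : IsScale M N π G κ ε δ) (hr : IsTubularRetraction m M N π)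
    (hM : IsSmoothSubmanifold m M) [SFinite (vol m M)] {ω : Form M j}
    (hω : LocallyIntegrable (ambient ω) (vol m M)) {x₀ : EuclideanSpace ℝ (Fin n)} (hx₀ : x₀ ∈ M) :
    IntegrableOn (extForm π ω) (Metric.ball x₀ (2 * ε x₀)) := by
  -- The density is constant on the ball of radius `3`. At a point `x` close to `x₀` this covers the
  -- ball around `x` of radius `3 ε(x)`, which contains the ball around `x₀` of radius `2 ε(x₀)`.
  set φ : ContDiffBump (0 : EuclideanSpace ℝ (Fin n)) := ⟨3, 4, by norm_num, by norm_num⟩ with hφ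
  set P : Measure (EuclideanSpace ℝ (Fin n) × ℝ) :=
    (bumpMeasure volume φ).prod (Measure.dirac 1) with hP
  have hPm : ∀ᵐ τ ∂P, τ ∈ paramSet n :=
    ae_mem_paramSet_of_prod _ (by norm_num [hφ]) (by simp [ae_dirac_eq])
  have hker : IsKernel m π ε P ω (2 ^ n) (fun x τ => extForm π ω (shift ε x τ)) :=
    ⟨hω.aestronglyMeasurable, hs.aestronglyMeasurable_extForm_shift hr hM hPm
      hω.aestronglyMeasurable, fun x τ hτ => by
        simpa using hs.norm_extForm_shift_le hr hM ω x hτ⟩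
  have hae := (hker.ae_integrable hs hr hM hPm hω).1
  have hε := hs.pos x₀ hx₀
  have hpos : 0 < vol m M (Metric.ball (⟨x₀, hx₀⟩ : M) (ε x₀ / 4)) :=
    vol_pos_of_mem_nhds hM (Metric.ball_mem_nhds _ (by positivity))
  obtain ⟨x, hxb, hxi⟩ : ∃ x ∈ Metric.ball (⟨x₀, hx₀⟩ : M) (ε x₀ / 4),
      Integrable (fun τ => extForm π ω (shift ε x τ)) P := by
    by_contra! hcon
    refine hpos.ne' (measure_mono_null (fun x hx => ?_) (ae_iff.1 hae))
    exact hcon x hx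
  have hd : dist (x : EuclideanSpace ℝ (Fin n)) x₀ < ε x₀ / 4 := hxb
  have h1 := (abs_le.1 (hs.scale_sub_le hd.le)).1
  rw [hP, integrable_prod_dirac_iff] at hxi
  have h2 := integrableOn_of_integrable_bumpMeasure φ hxi
  simp only [shift, one_mul] at h2
  rw [integrableOn_ball_comp_affine (hs.pos x x.2)] at h2
  refine h2.mono_set (Metric.ball_subset_ball' ?_)
  have h3 : φ.rIn = 3 := rfl
  rw [h3, dist_comm]
  linarith

end IsScale

/-- The average of the pull-backs of `Ω` under displacements. -/
def average (ε : EuclideanSpace ℝ (Fin n) → ℝ)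
    (Ω : EuclideanSpace ℝ (Fin n) → EuclideanSpace ℝ (Fin n) [⋀^Fin j]→L[ℝ] ℝ)
    (x : EuclideanSpace ℝ (Fin n)) : EuclideanSpace ℝ (Fin n) [⋀^Fin j]→L[ℝ] ℝ :=
  ∫ τ, pullShift ε Ω x τ ∂(regMeasure n)

/-- The homotopy between `Ω` and its average. -/
def averageHom (ε : EuclideanSpace ℝ (Fin n) → ℝ)
    (Ω : EuclideanSpace ℝ (Fin n) → EuclideanSpace ℝ (Fin n) [⋀^Fin (j + 1)]→L[ℝ] ℝ)
    (x : EuclideanSpace ℝ (Fin n)) : EuclideanSpace ℝ (Fin n) [⋀^Fin j]→L[ℝ] ℝ :=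
  ∫ τ, contractShift ε Ω x τ ∂(homMeasure n)

lemma integrable_pullShift
    {Ω : EuclideanSpace ℝ (Fin n) → EuclideanSpace ℝ (Fin n) [⋀^Fin j]→L[ℝ] ℝ}
    {x : EuclideanSpace ℝ (Fin n)} (hε : ContDiff ℝ (⊤ : ℕ∞) ε) (hx : 0 < ε x)
    (hΩ : IntegrableOn Ω (Metric.ball x (2 * ε x))) :
    Integrable (pullShift ε Ω x) (regMeasure n) := by
  have h0 : IntegrableOn Ω (Metric.ball x (ε x * (stdBump n).rOut)) :=
    hΩ.mono_set (Metric.ball_subset_ball (by simp only [stdBump]; linarith))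
  have h1 : Integrable (fun t => Ω (shift ε x (t, 1))) (bumpMeasure volume (stdBump n)) := by
    refine integrable_bumpMeasure_of_integrableOn _ ?_
    simp only [shift, one_mul]
    rwa [integrableOn_ball_comp_affine hx]
  rw [regMeasure, integrable_prod_dirac_iff]
  have hc : Continuous fun t : EuclideanSpace ℝ (Fin n) => shiftDeriv ε x (t, 1) :=
    IsScale.continuous_shiftDeriv hε continuous_const (continuous_id.prodMk continuous_const)
  obtain ⟨b, hb⟩ :=
    (isCompact_closedBall (0 : EuclideanSpace ℝ (Fin n)) 1).exists_bound_of_continuousOn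
      hc.continuousOn
  refine (h1.norm.const_mul ((max b 1) ^ n)).mono' ?_ ?_
  · exact aestronglyMeasurable_compContinuousLinearMap h1.1 hc.aestronglyMeasurable
  · filter_upwards [ae_norm_lt_bumpMeasure (μ := volume) (stdBump n)] with t ht
    exact norm_compContinuousLinearMap_le_pow _ (le_max_right _ _)
      ((hb t (mem_closedBall_zero_iff.2 ht.le)).trans (le_max_left _ _))

lemma contDiffAt_shiftDeriv {X : Type*} [NormedAddCommGroup X] [NormedSpace ℝ X]
    (hε : ContDiff ℝ (⊤ : ℕ∞) ε) {f : X → EuclideanSpace ℝ (Fin n)}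
    {g : X → EuclideanSpace ℝ (Fin n) × ℝ} {x : X} (hf : ContDiffAt ℝ (⊤ : ℕ∞) f x)
    (hg : ContDiffAt ℝ (⊤ : ℕ∞) g x) :
    ContDiffAt ℝ (⊤ : ℕ∞) (fun z => shiftDeriv ε (f z) (g z)) x := by
  have h : ContDiff ℝ (⊤ : ℕ∞) (fderiv ℝ ε) := hε.fderiv_right (by simp)
  have h0 : ContDiffAt ℝ (⊤ : ℕ∞) (fun z => (g z).2 • fderiv ℝ ε (f z)) x :=
    hg.snd.smul (h.contDiffAt.comp x hf)
  have h1 : ContDiff ℝ (⊤ : ℕ∞) fun q : (EuclideanSpace ℝ (Fin n) →L[ℝ] ℝ) ×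
      EuclideanSpace ℝ (Fin n) => (q.1.smulRight q.2 :
        EuclideanSpace ℝ (Fin n) →L[ℝ] EuclideanSpace ℝ (Fin n)) :=
    isBoundedBilinearMap_smulRight.contDiff
  exact contDiffAt_const.add (h1.contDiffAt.comp x (h0.prodMk hg.fst))

/-- After the substitution `y = x + ε(x) t` the form `Ω` is integrated against a kernel that
depends smoothly on `x`. -/
lemma IsScale.contDiffAt_average (hs : IsScale M N π G κ ε δ)
    {Ω : EuclideanSpace ℝ (Fin n) → EuclideanSpace ℝ (Fin n) [⋀^Fin j]→L[ℝ] ℝ}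
    {x₀ : EuclideanSpace ℝ (Fin n)} (hx₀ : x₀ ∈ M)
    (hΩ : IntegrableOn Ω (Metric.ball x₀ (2 * ε x₀))) :
    ContDiffAt ℝ (⊤ : ℕ∞) (average ε Ω) x₀ := by
  have hε₀ := hs.pos x₀ hx₀
  set s := Metric.ball x₀ (ε x₀ / 4) with hsdef
  set f := (Metric.ball x₀ (2 * ε x₀)).indicator Ω with hfdef
  have hclose : ∀ x ∈ s, 0 < ε x ∧ ε x ≤ 5 / 4 * ε x₀ := fun x hx => by
    have := abs_le.1 (hs.scale_sub_le (Metric.mem_ball.1 hx).le)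
    constructor <;> linarith
  set q : EuclideanSpace ℝ (Fin n) → EuclideanSpace ℝ (Fin n) → EuclideanSpace ℝ (Fin n) :=
    fun x y => (ε x)⁻¹ • (y - x) with hq
  set g : EuclideanSpace ℝ (Fin n) → EuclideanSpace ℝ (Fin n) →
      (EuclideanSpace ℝ (Fin n) [⋀^Fin j]→L[ℝ] ℝ) →L[ℝ]
        EuclideanSpace ℝ (Fin n) [⋀^Fin j]→L[ℝ] ℝ :=
    fun x y => ContinuousAlternatingMap.compContinuousLinearMapCLM (shiftDeriv ε x (q x y, 1))
    with hg
  set c : EuclideanSpace ℝ (Fin n) → EuclideanSpace ℝ (Fin n) → ℝ :=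
    fun x y => (stdBump n).normed volume (q x y) with hc
  have hsupp : ∀ x ∈ s, ∀ t : EuclideanSpace ℝ (Fin n), (stdBump n).normed volume t ≠ 0 →
      x + ε x • t ∈ Metric.ball x₀ (3 / 2 * ε x₀) := fun x hx t ht => by
    have h1 : t ∈ Metric.ball (0 : EuclideanSpace ℝ (Fin n)) (stdBump n).rOut := by
      rw [← (stdBump n).support_normed_eq (μ := volume)]
      exact ht
    have h2 : ‖t‖ < 1 := by simpa [stdBump] using h1
    have h3 := hclose x hx
    have h4 : dist (x + ε x • t) x ≤ ε x := by
      rw [dist_eq_norm, add_sub_cancel_left, norm_smul, Real.norm_of_nonneg h3.1.le]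
      exact mul_le_of_le_one_right h3.1.le h2.le
    have h5 := dist_triangle (x + ε x • t) x x₀
    have h6 := Metric.mem_ball.1 hx
    rw [Metric.mem_ball]
    linarith
  have hqq : ∀ x ∈ s, ∀ y, x + ε x • q x y = y := fun x hx y => by
    rw [hq]
    simp only
    rw [smul_inv_smul₀ (hclose x hx).1.ne', add_sub_cancel]
  have hqd : ∀ z : EuclideanSpace ℝ (Fin n) × EuclideanSpace ℝ (Fin n), z.1 ∈ s →
      ContDiffAt ℝ (⊤ : ℕ∞) (fun z : EuclideanSpace ℝ (Fin n) × EuclideanSpace ℝ (Fin n) =>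
        q z.1 z.2) z := fun z hz =>
    ((hs.contDiff.contDiffAt.comp z contDiffAt_fst).inv (hclose z.1 hz).1.ne').smul
      (contDiffAt_snd.sub contDiffAt_fst)
  have hmain : ContDiffOn ℝ (⊤ : ℕ∞) (fun x => ∫ y, c x y • g x y (f y)) s := by
    refine contDiffOn_integral_smul_clm_apply Metric.isOpen_ball
      (isCompact_closedBall x₀ (3 / 2 * ε x₀)) (fun x y hx hy => ?_) ?_
      (fun z hz => ?_) (fun z hz => ?_)
    · by_contra h
      have := hsupp x hx _ h
      rw [hqq x hx] at this
      exact hy (Metric.ball_subset_closedBall this)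
    · have h1 : Integrable f :=
        (integrable_indicator_iff (ε' := EuclideanSpace ℝ (Fin n) [⋀^Fin j]→L[ℝ] ℝ)
          measurableSet_ball).2 hΩ
      exact h1.locallyIntegrable
    · exact (((stdBump n).contDiff_normed (n := ⊤) (μ := volume)).contDiffAt.comp z
        (hqd z hz.1)).contDiffWithinAt
    · have h2 := contDiffAt_shiftDeriv hs.contDiff (contDiffAt_fst (n := (⊤ : ℕ∞)) (p := z))
        ((hqd z hz.1).prodMk (contDiffAt_const (c := (1 : ℝ))))
      exact ((contDiff_compContinuousLinearMapCLM (j := j)).contDiffAt.comp z h2).contDiffWithinAt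
  have heq : ∀ x ∈ s, average ε Ω x = ((ε x) ^ n)⁻¹ • ∫ y, c x y • g x y (f y) := fun x hx => by
    have h1 := integral_comp_affine (μ := volume) (fun y => c x y • g x y (f y)) x (hclose x hx).1
    rw [finrank_euclideanSpace_fin] at h1
    rw [← h1, average, regMeasure, integral_prod_dirac, integral_bumpMeasure]
    refine integral_congr_ae (Eventually.of_forall fun t => ?_)
    have h2 : q x (x + ε x • t) = t := by
      rw [hq]
      simp only
      rw [add_sub_cancel_left, inv_smul_smul₀ (hclose x hx).1.ne']
    simp only [hg, hc, h2]
    by_cases ht : (stdBump n).normed volume t = 0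
    · rw [ht, zero_smul, zero_smul]
    · have h3 : f (x + ε x • t) = Ω (x + ε x • t) :=
        Set.indicator_of_mem (Metric.ball_subset_ball (by linarith) (hsupp x hx t ht)) _
      rw [h3, pullShift, shift, one_mul]
      rfl
  have hs' : s ∈ 𝓝 x₀ := Metric.ball_mem_nhds _ (by positivity)
  have h1 : ContDiffAt ℝ (⊤ : ℕ∞) (fun x => ((ε x) ^ n)⁻¹ • ∫ y, c x y • g x y (f y)) x₀ :=
    ((hs.contDiff.contDiffAt.pow n).inv (pow_ne_zero _ hε₀.ne')).smul (hmain.contDiffAt hs')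
  exact h1.congr_of_eventuallyEq (by filter_upwards [hs'] with x hx using heq x hx)

end Regular

/-! ### The homotopy formula for smooth forms -/

section ParametricCompact

lemma aestronglyMeasurable_slice {X T Z : Type*} [TopologicalSpace X] [NormedAddCommGroup T]
    [MeasurableSpace T] [BorelSpace T] [NormedAddCommGroup Z] {P : Measure T} {K : Set T}
    {s : Set X} {Φ : X × T → Z}
    (hK : IsCompact K) (hP : ∀ᵐ τ ∂P, τ ∈ K) (hΦ : ContinuousOn Φ (s ×ˢ K)) {x : X} (hx : x ∈ s) :
    AEStronglyMeasurable (fun τ => Φ (x, τ)) P := by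
  have h1 : ContinuousOn (fun τ => Φ (x, τ)) K :=
    hΦ.comp (by fun_prop) fun τ hτ => ⟨hx, hτ⟩
  have h2 := h1.aestronglyMeasurable_of_isCompact (μ := P) hK hK.measurableSet
  rwa [Measure.restrict_eq_self_of_ae_mem hP] at h2

variable {X T H H' : Type*} [NormedAddCommGroup X] [NormedSpace ℝ X]
  [NormedAddCommGroup T] [NormedSpace ℝ T] [MeasurableSpace T] [BorelSpace T]
  [NormedAddCommGroup H] [NormedSpace ℝ H]
  [NormedAddCommGroup H'] [NormedSpace ℝ H']
  {P : Measure T} [IsFiniteMeasure P] {K : Set T} {O : Set (X × T)} {F : X → T → H} {x₀ : X}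

/-- Averages over a compact set of parameters of a smooth family of functions are smooth. -/
lemma contDiffAt_integral_of_isCompact [FiniteDimensional ℝ T] (hK : IsCompact K)
    (hP : ∀ᵐ τ ∂P, τ ∈ K) (hO : IsOpen O)
    (hF : ∀ z ∈ O, ContDiffAt ℝ (⊤ : ℕ∞) (fun z : X × T => F z.1 z.2) z)
    (hx₀ : ∀ τ ∈ K, (x₀, τ) ∈ O) : ContDiffAt ℝ (⊤ : ℕ∞) (fun x => ∫ τ, F x τ ∂P) x₀ := by
  obtain ⟨U, V, hU, hV, hxU, hKV, hUV⟩ := generalized_tube_lemma (isCompact_singleton (x := x₀)) hK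
    hO (fun z hz => by
      obtain ⟨h1, h2⟩ := hz
      rw [Set.mem_singleton_iff] at h1
      have := hx₀ z.2 h2
      rwa [← h1] at this)
  obtain ⟨χ, hχ, hχc, hχV, V', -, hKV', hχ1⟩ := exists_cutoff hK hV hKV
  have h1 : ContDiffOn ℝ (⊤ : ℕ∞) (fun x => ∫ τ, (ContinuousLinearMap.toSpanSingleton ℝ
      (χ τ • F x τ)) (1 : ℝ) ∂P) U := by
    refine contDiffOn_integral_clm_apply (f := fun _ => (1 : ℝ))
      (g := fun x τ => ContinuousLinearMap.toSpanSingleton ℝ (χ τ • F x τ)) hU hχc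
      (fun x τ _ hτ => ?_) (locallyIntegrable_const _) fun z hz => ?_
    · rw [image_eq_zero_of_notMem_tsupport hτ, zero_smul]
      exact ContinuousLinearMap.toSpanSingleton_zero ℝ
    · have h2 : ContDiffAt ℝ (⊤ : ℕ∞) (fun z : X × T => χ z.2 • F z.1 z.2) z := by
        by_cases hz2 : z.2 ∈ tsupport χ
        · exact (hχ.contDiffAt.comp z contDiffAt_snd).smul (hF z (hUV ⟨hz.1, hχV hz2⟩))
        · have h3 : ∀ᶠ w : X × T in 𝓝 z, w.2 ∉ tsupport χ :=
            continuousAt_snd.eventually ((isClosed_tsupport χ).isOpen_compl.mem_nhds hz2)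
          refine (contDiffAt_const (c := (0 : H))).congr_of_eventuallyEq ?_
          filter_upwards [h3] with w hw
          rw [image_eq_zero_of_notMem_tsupport hw, zero_smul]
      have h4 : ContDiff ℝ (⊤ : ℕ∞) fun y : H => ContinuousLinearMap.toSpanSingleton ℝ y :=
        (ContinuousLinearMap.toSpanSingletonCLE (𝕜 := ℝ) (E := H)).contDiff
      exact (h4.contDiffAt.comp z h2).contDiffWithinAt
  refine (h1.contDiffAt (hU.mem_nhds (hxU rfl))).congr_of_eventuallyEq
    (Eventually.of_forall fun x => ?_)
  refine integral_congr_ae ?_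
  filter_upwards [hP] with τ hτ
  rw [ContinuousLinearMap.toSpanSingleton_apply, hχ1 τ (hKV' hτ), one_smul, one_smul]

/-- Differentiation under the integral sign, followed by a linear map `L` of the differential (in
the application, alternatization). -/
lemma map_fderiv_integral_of_isCompact [FiniteDimensional ℝ X] [CompleteSpace H]
    [CompleteSpace H'] (L : (X →L[ℝ] H) →L[ℝ] H') (hK : IsCompact K)
    (hP : ∀ᵐ τ ∂P, τ ∈ K) (hO : IsOpen O)
    (hF : ∀ z ∈ O, ContDiffAt ℝ (⊤ : ℕ∞) (fun z : X × T => F z.1 z.2) z)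
    (hx₀ : ∀ τ ∈ K, (x₀, τ) ∈ O) :
    L (fderiv ℝ (fun x => ∫ τ, F x τ ∂P) x₀) = ∫ τ, L (fderiv ℝ (fun x => F x τ) x₀) ∂P ∧
      Integrable (fun τ => L (fderiv ℝ (fun x => F x τ) x₀)) P := by
  obtain ⟨U, V, hU, hV, hxU, hKV, hUV⟩ := generalized_tube_lemma (isCompact_singleton (x := x₀)) hK
    hO (fun z hz => by
      obtain ⟨h1, h2⟩ := hz
      rw [Set.mem_singleton_iff] at h1
      have := hx₀ z.2 h2
      rwa [← h1] at this)
  obtain ⟨r, hr, hrU⟩ := Metric.nhds_basis_closedBall.mem_iff.1 (hU.mem_nhds (hxU rfl))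
  set F' : X → T → X →L[ℝ] H := fun x τ =>
    (fderiv ℝ (fun z : X × T => F z.1 z.2) (x, τ)).comp (ContinuousLinearMap.inl ℝ X T) with hF'
  have hz : ∀ x ∈ Metric.closedBall x₀ r, ∀ τ ∈ K, (x, τ) ∈ O := fun x hx τ hτ =>
    hUV ⟨hrU hx, hKV hτ⟩
  have hd : ∀ x ∈ Metric.closedBall x₀ r, ∀ τ ∈ K, HasFDerivAt (fun x => F x τ) (F' x τ) x :=
    fun x hx τ hτ => by
      have h1 := ((hF _ (hz x hx τ hτ)).differentiableAt (by simp)).hasFDerivAt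
      have h2 : HasFDerivAt (fun e : X => (e, τ)) (ContinuousLinearMap.inl ℝ X T) x :=
        hasFDerivAt_prodMk_left x τ
      exact HasFDerivAt.comp (g := fun z : X × T => F z.1 z.2) x h1 h2
  have hc' : ContinuousOn (fun z : X × T => F' z.1 z.2)
      (Metric.closedBall x₀ r ×ˢ K) := fun z hzz => by
    have h1 := ((hF _ (hz _ hzz.1 _ hzz.2)).fderiv_right (m := (⊤ : ℕ∞)) (by simp)).continuousAt
    exact (ContinuousAt.clm_comp h1 continuousAt_const).continuousWithinAt
  have hc : ContinuousOn (fun z : X × T => F z.1 z.2) (Metric.closedBall x₀ r ×ˢ K) :=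
    fun z hzz => (hF _ (hz _ hzz.1 _ hzz.2)).continuousAt.continuousWithinAt
  obtain ⟨b, hb⟩ := ((isCompact_closedBall x₀ r).prod hK).exists_bound_of_continuousOn hc'
  obtain ⟨b', hb'⟩ := ((isCompact_closedBall x₀ r).prod hK).exists_bound_of_continuousOn hc
  have hx₀r := Metric.mem_closedBall_self (x := x₀) hr.le
  have hint : Integrable (F' x₀) P :=
    (integrable_const b).mono' (aestronglyMeasurable_slice hK hP hc' hx₀r) (by
      filter_upwards [hP] with τ hτ using hb (x₀, τ) ⟨hx₀r, hτ⟩)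
  have hmain := hasFDerivAt_integral_of_dominated_of_fderiv_le (𝕜 := ℝ) (μ := P)
    (F := F) (F' := F') (bound := fun _ => b)
    (Metric.closedBall_mem_nhds x₀ hr)
    (by filter_upwards [Metric.closedBall_mem_nhds x₀ hr] with x hx using
      aestronglyMeasurable_slice hK hP hc hx)
    ((integrable_const b').mono' (aestronglyMeasurable_slice hK hP hc hx₀r) (by
      filter_upwards [hP] with τ hτ using hb' (x₀, τ) ⟨hx₀r, hτ⟩))
    (aestronglyMeasurable_slice hK hP hc' hx₀r)
    (by filter_upwards [hP] with τ hτ x hx using hb (x, τ) ⟨hx, hτ⟩)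
    (integrable_const b) (by filter_upwards [hP] with τ hτ x hx using hd x hx τ hτ)
  have hL : (fun τ => L (fderiv ℝ (fun x => F x τ) x₀)) =ᵐ[P] fun τ => L (F' x₀ τ) := by
    filter_upwards [hP] with τ hτ
    rw [(hd x₀ hx₀r τ hτ).fderiv]
  refine ⟨?_, (L.integrable_comp hint).congr hL.symm⟩
  rw [hmain.fderiv, integral_congr_ae hL, L.integral_comp_comm hint]

end ParametricCompact

section Cylinder

variable {n j : ℕ}

lemma hasDerivAt_restrict_cylinder {Θ : ℝ × EuclideanSpace ℝ (Fin n) →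
      (ℝ × EuclideanSpace ℝ (Fin n)) [⋀^Fin j]→L[ℝ] ℝ} {s : ℝ}
    {x : EuclideanSpace ℝ (Fin n)} (hΘ : DifferentiableAt ℝ Θ (s, x)) :
    HasDerivAt (fun s => (Θ (s, x)).compContinuousLinearMap (ContinuousLinearMap.inr ℝ ℝ _))
      ((fderiv ℝ Θ (s, x) (1, 0)).compContinuousLinearMap (ContinuousLinearMap.inr ℝ ℝ _)) s := by
  have h1 : HasDerivAt (fun s : ℝ => (s, x)) ((1 : ℝ), (0 : EuclideanSpace ℝ (Fin n))) s :=
    (hasDerivAt_id s).prodMk (hasDerivAt_const s x)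
  have h2 := hΘ.hasFDerivAt.comp_hasDerivAt s h1
  exact (ContinuousAlternatingMap.compContinuousLinearMapCLM (f := ContinuousLinearMap.inr ℝ ℝ
    (EuclideanSpace ℝ (Fin n)))).hasFDerivAt.comp_hasDerivAt s h2

/-- The homotopy formula for a form `Θ` on the cylinder `ℝ × ℝ^n`: the derivative in `s` of the
restriction of `Θ` to the slice `{s} × ℝ^n` is `d ι_s Θ + ι_s d Θ`, with `ι_s` the contraction with
`∂/∂s` followed by restriction. -/
lemma hasDerivAt_cylinder {Θ : ℝ × EuclideanSpace ℝ (Fin n) →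
      (ℝ × EuclideanSpace ℝ (Fin n)) [⋀^Fin (j + 1)]→L[ℝ] ℝ} {s : ℝ}
    {x : EuclideanSpace ℝ (Fin n)} (hΘ : DifferentiableAt ℝ Θ (s, x)) :
    HasDerivAt (fun s => (Θ (s, x)).compContinuousLinearMap (ContinuousLinearMap.inr ℝ ℝ _))
      (extDeriv (fun x => ((Θ (s, x)).curryLeft (1, 0)).compContinuousLinearMap
        (ContinuousLinearMap.inr ℝ ℝ _)) x +
        ((extDeriv Θ (s, x)).curryLeft (1, 0)).compContinuousLinearMap
          (ContinuousLinearMap.inr ℝ ℝ _)) s := by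
  convert hasDerivAt_restrict_cylinder hΘ using 1
  have h3 : HasFDerivAt (fun x => Θ (s, x)) ((fderiv ℝ Θ (s, x)).comp
      (ContinuousLinearMap.inr ℝ ℝ (EuclideanSpace ℝ (Fin n)))) x :=
    HasFDerivAt.comp (g := Θ) x hΘ.hasFDerivAt (hasFDerivAt_prodMk_right s x)
  let C : ((ℝ × EuclideanSpace ℝ (Fin n)) [⋀^Fin (j + 1)]→L[ℝ] ℝ) →L[ℝ]
      (EuclideanSpace ℝ (Fin n) [⋀^Fin j]→L[ℝ] ℝ) :=
    (ContinuousAlternatingMap.compContinuousLinearMapCLM (f := ContinuousLinearMap.inr ℝ ℝ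
      (EuclideanSpace ℝ (Fin n)))).comp
      ((ContinuousLinearMap.apply ℝ ((ℝ × EuclideanSpace ℝ (Fin n)) [⋀^Fin j]→L[ℝ] ℝ)
        ((1 : ℝ), (0 : EuclideanSpace ℝ (Fin n)))).comp
        (ContinuousAlternatingMap.curryLeftLI (𝕜 := ℝ) (E := ℝ × EuclideanSpace ℝ (Fin n)) (F := ℝ)
          (n := j)).toContinuousLinearMap)
  have h4 : HasFDerivAt (fun x => ((Θ (s, x)).curryLeft (1, 0)).compContinuousLinearMap
        (ContinuousLinearMap.inr ℝ ℝ (EuclideanSpace ℝ (Fin n)))) (C.comp ((fderiv ℝ Θ (s, x)).comp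
      (ContinuousLinearMap.inr ℝ ℝ (EuclideanSpace ℝ (Fin n))))) x :=
    HasFDerivAt.comp (g := fun A => C A) x C.hasFDerivAt h3
  ext v
  rw [extDeriv, h4.fderiv]
  simp only [ContinuousAlternatingMap.add_apply,
    ContinuousAlternatingMap.alternatizeUncurryFin_apply, extDeriv,
    ContinuousAlternatingMap.compContinuousLinearMap_apply,
    ContinuousAlternatingMap.curryLeft_apply_apply]
  -- In `dΘ` with first argument `∂/∂s` the first summand is the derivative in `s`; the others
  -- cancel against the differential of the contraction.
  rw [Fin.sum_univ_succ (n := j + 1)]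
  have h5 : ∀ (i : Fin (j + 1)), Fin.removeNth (α := fun _ => ℝ × EuclideanSpace ℝ (Fin n)) i.succ
      (Matrix.vecCons ((1 : ℝ), (0 : EuclideanSpace ℝ (Fin n)))
        (⇑(ContinuousLinearMap.inr ℝ ℝ (EuclideanSpace ℝ (Fin n))) ∘ v)) =
      Matrix.vecCons ((1 : ℝ), (0 : EuclideanSpace ℝ (Fin n)))
        (⇑(ContinuousLinearMap.inr ℝ ℝ (EuclideanSpace ℝ (Fin n))) ∘ i.removeNth v) := fun i => by
    funext k
    refine Fin.cases ?_ (fun k => ?_) k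
    · simp [Fin.removeNth]
    · simp [Fin.removeNth]
  simp only [h5]
  have h6 : Fin.removeNth (α := fun _ => ℝ × EuclideanSpace ℝ (Fin n)) 0
      (Matrix.vecCons ((1 : ℝ), (0 : EuclideanSpace ℝ (Fin n)))
        (⇑(ContinuousLinearMap.inr ℝ ℝ (EuclideanSpace ℝ (Fin n))) ∘ v)) =
      ⇑(ContinuousLinearMap.inr ℝ ℝ (EuclideanSpace ℝ (Fin n))) ∘ v := rfl
  rw [h6]
  have h7 : ∀ i : Fin (j + 1), ((-1 : ℤ) ^ ((i.succ : Fin (j + 1 + 1)) : ℕ)) = -(-1) ^ (i : ℕ) :=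
    fun i => by rw [Fin.val_succ, pow_succ]; ring
  simp only [h7, Fin.val_zero, pow_zero, one_smul, Matrix.cons_val_zero, Matrix.cons_val_succ,
    neg_smul, Finset.sum_neg_distrib]
  have h8 : ∀ i : Fin (j + 1), (C.comp ((fderiv ℝ Θ (s, x)).comp
      (ContinuousLinearMap.inr ℝ ℝ (EuclideanSpace ℝ (Fin n)))) (v i)) (i.removeNth v) =
      fderiv ℝ Θ (s, x) ((⇑(ContinuousLinearMap.inr ℝ ℝ (EuclideanSpace ℝ (Fin n))) ∘ v) i)
        (Matrix.vecCons ((1 : ℝ), (0 : EuclideanSpace ℝ (Fin n)))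
        (⇑(ContinuousLinearMap.inr ℝ ℝ (EuclideanSpace ℝ (Fin n))) ∘ i.removeNth v)) := fun i => rfl
  simp only [h8]
  abel

/-- The homotopy formula for a function on the cylinder `ℝ × ℝ^n`. -/
lemma hasDerivAt_cylinder_zero {Θ : ℝ × EuclideanSpace ℝ (Fin n) →
      (ℝ × EuclideanSpace ℝ (Fin n)) [⋀^Fin 0]→L[ℝ] ℝ} {s : ℝ}
    {x : EuclideanSpace ℝ (Fin n)} (hΘ : DifferentiableAt ℝ Θ (s, x)) :
    HasDerivAt (fun s => (Θ (s, x)).compContinuousLinearMap (ContinuousLinearMap.inr ℝ ℝ _))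
      (((extDeriv Θ (s, x)).curryLeft (1, 0)).compContinuousLinearMap
          (ContinuousLinearMap.inr ℝ ℝ _)) s := by
  convert hasDerivAt_restrict_cylinder hΘ using 1
  ext v
  simp only [ContinuousAlternatingMap.alternatizeUncurryFin_apply,
    extDeriv, ContinuousAlternatingMap.compContinuousLinearMap_apply,
    ContinuousAlternatingMap.curryLeft_apply_apply]
  rw [Fin.sum_univ_succ]
  simp only [Finset.univ_eq_empty, Finset.sum_empty, add_zero, Fin.val_zero, pow_zero, one_smul,
    Matrix.cons_val_zero]
  congr 1

end Cylinder

section Shift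

variable {n j : ℕ} {ε : EuclideanSpace ℝ (Fin n) → ℝ}

/-- The displacements of the points of `ℝ^n` in the direction `t`, as a map on a cylinder. -/
def shiftMap (ε : EuclideanSpace ℝ (Fin n) → ℝ) (t : EuclideanSpace ℝ (Fin n))
    (z : ℝ × EuclideanSpace ℝ (Fin n)) : EuclideanSpace ℝ (Fin n) := shift ε z.2 (t, z.1)

lemma contDiff_shiftMap (hε : ContDiff ℝ (⊤ : ℕ∞) ε) (t : EuclideanSpace ℝ (Fin n)) :
    ContDiff ℝ (⊤ : ℕ∞) (shiftMap ε t) :=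
  contDiff_snd.add ((contDiff_fst.mul (hε.comp contDiff_snd)).smul contDiff_const)

lemma fderiv_shiftMap (hε : ContDiff ℝ (⊤ : ℕ∞) ε) (t : EuclideanSpace ℝ (Fin n)) (s : ℝ)
    (x : EuclideanSpace ℝ (Fin n)) :
    fderiv ℝ (shiftMap ε t) (s, x) (1, 0) = ε x • t ∧
      (fderiv ℝ (shiftMap ε t) (s, x)).comp (ContinuousLinearMap.inr ℝ ℝ _) =
        shiftDeriv ε x (t, s) := by
  have h := ((contDiff_shiftMap hε t).differentiable (by simp) (s, x)).hasFDerivAt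
  constructor
  · have h1 : HasDerivAt (fun s : ℝ => (s, x)) ((1 : ℝ), (0 : EuclideanSpace ℝ (Fin n))) s :=
      (hasDerivAt_id s).prodMk (hasDerivAt_const s x)
    have h2 : HasDerivAt (fun s : ℝ => x + (s * ε x) • t) (ε x • t) s := by
      simpa using (((hasDerivAt_id s).mul_const (ε x)).smul_const t).const_add x
    have h3 : HasDerivAt (fun s : ℝ => x + (s * ε x) • t)
      (fderiv ℝ (shiftMap ε t) (s, x) (1, 0)) s :=
      HasFDerivAt.comp_hasDerivAt (l := shiftMap ε t) s h h1
    exact h3.unique h2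
  · exact (HasFDerivAt.comp (g := shiftMap ε t) x h (hasFDerivAt_prodMk_right s x)).unique
      (hasFDerivAt_shift (hε.differentiable (by simp) x) (t, s))

lemma pullback_shiftMap (hε : ContDiff ℝ (⊤ : ℕ∞) ε)
    (A : EuclideanSpace ℝ (Fin n) [⋀^Fin j]→L[ℝ] ℝ) (t : EuclideanSpace ℝ (Fin n)) (s : ℝ)
    (x : EuclideanSpace ℝ (Fin n)) :
    (A.compContinuousLinearMap (fderiv ℝ (shiftMap ε t) (s, x))).compContinuousLinearMap
      (ContinuousLinearMap.inr ℝ ℝ _) = A.compContinuousLinearMap (shiftDeriv ε x (t, s)) := by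
  rw [← (fderiv_shiftMap hε t s x).2]
  rfl

lemma contract_shiftMap (hε : ContDiff ℝ (⊤ : ℕ∞) ε)
    (A : EuclideanSpace ℝ (Fin n) [⋀^Fin (j + 1)]→L[ℝ] ℝ) (t : EuclideanSpace ℝ (Fin n)) (s : ℝ)
    (x : EuclideanSpace ℝ (Fin n)) :
    ((A.compContinuousLinearMap (fderiv ℝ (shiftMap ε t) (s, x))).curryLeft
      (1, 0)).compContinuousLinearMap (ContinuousLinearMap.inr ℝ ℝ _) =
      (A.curryLeft (ε x • t)).compContinuousLinearMap (shiftDeriv ε x (t, s)) := by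
  rw [← (fderiv_shiftMap hε t s x).2, ← (fderiv_shiftMap hε t s x).1]
  ext v
  simp only [ContinuousAlternatingMap.compContinuousLinearMap_apply,
    ContinuousAlternatingMap.curryLeft_apply_apply]
  congr 1
  funext k
  refine Fin.cases ?_ (fun k => ?_) k
  · rfl
  · rfl

lemma differentiableAt_pullback_shiftMap (hε : ContDiff ℝ (⊤ : ℕ∞) ε)
    {Ω : EuclideanSpace ℝ (Fin n) → EuclideanSpace ℝ (Fin n) [⋀^Fin j]→L[ℝ] ℝ}
    {x t : EuclideanSpace ℝ (Fin n)} {s : ℝ} (hΩ : ContDiffAt ℝ (⊤ : ℕ∞) Ω (shift ε x (t, s))) :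
    DifferentiableAt ℝ (fun z => (Ω (shiftMap ε t z)).compContinuousLinearMap
      (fderiv ℝ (shiftMap ε t) z)) (s, x) := by
  have h1 := contDiff_shiftMap hε t
  have h2 : ContDiffAt ℝ (⊤ : ℕ∞) (fun z => Ω (shiftMap ε t z)) (s, x) :=
    ContDiffAt.comp (g := Ω) (s, x) hΩ h1.contDiffAt
  exact (contDiffAt_compContinuousLinearMap h2
    (h1.contDiffAt.fderiv_right (m := (⊤ : ℕ∞)) (by simp))).differentiableAt (by simp)

lemma extDeriv_pullback_shiftMap (hε : ContDiff ℝ (⊤ : ℕ∞) ε)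
    {Ω : EuclideanSpace ℝ (Fin n) → EuclideanSpace ℝ (Fin n) [⋀^Fin j]→L[ℝ] ℝ}
    {x t : EuclideanSpace ℝ (Fin n)} {s : ℝ} (hΩ : ContDiffAt ℝ (⊤ : ℕ∞) Ω (shift ε x (t, s))) :
    extDeriv (fun z => (Ω (shiftMap ε t z)).compContinuousLinearMap
      (fderiv ℝ (shiftMap ε t) z)) (s, x) =
        (extDeriv Ω (shift ε x (t, s))).compContinuousLinearMap (fderiv ℝ (shiftMap ε t) (s, x)) :=
  extDeriv_pullback (f := shiftMap ε t) (x := (s, x)) (hΩ.differentiableAt (by simp))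
    (contDiff_shiftMap hε t).contDiffAt (by simpa using ENat.LEInfty.out)

lemma hasDerivAt_pullShift (hε : ContDiff ℝ (⊤ : ℕ∞) ε)
    {Ω : EuclideanSpace ℝ (Fin n) → EuclideanSpace ℝ (Fin n) [⋀^Fin (j + 1)]→L[ℝ] ℝ}
    {x t : EuclideanSpace ℝ (Fin n)} {s : ℝ} (hΩ : ContDiffAt ℝ (⊤ : ℕ∞) Ω (shift ε x (t, s))) :
    HasDerivAt (fun s => pullShift ε Ω x (t, s))
      (extDeriv (fun x => contractShift ε Ω x (t, s)) x + contractShift ε (extDeriv Ω) x (t, s))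
      s := by
  have h := hasDerivAt_cylinder (differentiableAt_pullback_shiftMap hε hΩ)
  rw [extDeriv_pullback_shiftMap hε hΩ] at h
  simp only [pullback_shiftMap hε, contract_shiftMap hε] at h
  exact h

lemma hasDerivAt_pullShift_zero (hε : ContDiff ℝ (⊤ : ℕ∞) ε)
    {Ω : EuclideanSpace ℝ (Fin n) → EuclideanSpace ℝ (Fin n) [⋀^Fin 0]→L[ℝ] ℝ}
    {x t : EuclideanSpace ℝ (Fin n)} {s : ℝ} (hΩ : ContDiffAt ℝ (⊤ : ℕ∞) Ω (shift ε x (t, s))) :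
    HasDerivAt (fun s => pullShift ε Ω x (t, s)) (contractShift ε (extDeriv Ω) x (t, s)) s := by
  have h := hasDerivAt_cylinder_zero (differentiableAt_pullback_shiftMap hε hΩ)
  rw [extDeriv_pullback_shiftMap hε hΩ] at h
  simp only [pullback_shiftMap hε, contract_shiftMap hε] at h
  exact h

lemma pullShift_zero_right
    (Ω : EuclideanSpace ℝ (Fin n) → EuclideanSpace ℝ (Fin n) [⋀^Fin j]→L[ℝ] ℝ)
    (x t : EuclideanSpace ℝ (Fin n)) : pullShift ε Ω x (t, 0) = Ω x := by
  ext v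
  simp [pullShift, shift, shiftDeriv]

end Shift

/-! ### The homotopy operators on smooth forms -/

section Smooth

variable {n m j : ℕ} {M N : Set (EuclideanSpace ℝ (Fin n))}
  {π : EuclideanSpace ℝ (Fin n) → EuclideanSpace ℝ (Fin n)}
  {G : Set (EuclideanSpace ℝ (Fin n)) → Prop} {κ : ℝ≥0} {ε δ : EuclideanSpace ℝ (Fin n) → ℝ}

lemma contDiff_shift (hε : ContDiff ℝ (⊤ : ℕ∞) ε) :
    ContDiff ℝ (⊤ : ℕ∞) fun z : EuclideanSpace ℝ (Fin n) × (EuclideanSpace ℝ (Fin n) × ℝ) =>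
      shift ε z.1 z.2 :=
  contDiff_fst.add ((contDiff_snd.snd.mul (hε.comp contDiff_fst)).smul contDiff_snd.fst)

lemma contDiffAt_contractShift (hε : ContDiff ℝ (⊤ : ℕ∞) ε)
    {Ω : EuclideanSpace ℝ (Fin n) → EuclideanSpace ℝ (Fin n) [⋀^Fin (j + 1)]→L[ℝ] ℝ}
    {z : EuclideanSpace ℝ (Fin n) × (EuclideanSpace ℝ (Fin n) × ℝ)}
    (hΩ : ContDiffAt ℝ (⊤ : ℕ∞) Ω (shift ε z.1 z.2)) :
    ContDiffAt ℝ (⊤ : ℕ∞) (fun z : EuclideanSpace ℝ (Fin n) × (EuclideanSpace ℝ (Fin n) × ℝ) =>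
      contractShift ε Ω z.1 z.2) z := by
  have h1 : ContDiffAt ℝ (⊤ : ℕ∞) (fun z : EuclideanSpace ℝ (Fin n) ×
      (EuclideanSpace ℝ (Fin n) × ℝ) => Ω (shift ε z.1 z.2)) z :=
    ContDiffAt.comp (g := Ω) z hΩ (contDiff_shift hε).contDiffAt
  have h2 : ContDiffAt ℝ (⊤ : ℕ∞) (fun z : EuclideanSpace ℝ (Fin n) ×
      (EuclideanSpace ℝ (Fin n) × ℝ) => ε z.1 • z.2.1) z :=
    ((hε.comp contDiff_fst).smul contDiff_snd.fst).contDiffAt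
  have h3 : ContDiffAt ℝ (⊤ : ℕ∞) (fun z : EuclideanSpace ℝ (Fin n) ×
      (EuclideanSpace ℝ (Fin n) × ℝ) => (Ω (shift ε z.1 z.2)).curryLeft (ε z.1 • z.2.1)) z :=
    ContDiffAt.comp (g := fun q : (EuclideanSpace ℝ (Fin n) [⋀^Fin (j + 1)]→L[ℝ] ℝ) ×
      EuclideanSpace ℝ (Fin n) => q.1.curryLeft q.2) z
      (contDiff_curryLeft_apply (E := EuclideanSpace ℝ (Fin n)) (j := j)).contDiffAt (h1.prodMk h2)
  exact contDiffAt_compContinuousLinearMap h3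
    (contDiffAt_shiftDeriv hε contDiffAt_fst contDiffAt_snd)

lemma contDiffAt_extDeriv
    {Ω : EuclideanSpace ℝ (Fin n) → EuclideanSpace ℝ (Fin n) [⋀^Fin j]→L[ℝ] ℝ}
    {x : EuclideanSpace ℝ (Fin n)} (hΩ : ContDiffAt ℝ (⊤ : ℕ∞) Ω x) :
    ContDiffAt ℝ (⊤ : ℕ∞) (extDeriv Ω) x :=
  ContDiffAt.comp (g := fun A => ContinuousAlternatingMap.alternatizeUncurryFinCLM ℝ
    (EuclideanSpace ℝ (Fin n)) ℝ A) x (ContinuousLinearMap.contDiff _).contDiffAt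
    (hΩ.fderiv_right (m := (⊤ : ℕ∞)) (by simp))

namespace IsScale

variable {Ω : EuclideanSpace ℝ (Fin n) → EuclideanSpace ℝ (Fin n) [⋀^Fin (j + 1)]→L[ℝ] ℝ}
  {x : EuclideanSpace ℝ (Fin n)}

lemma isOpen_shift_preimage (hs : IsScale M N π G κ ε δ) (hr : IsTubularRetraction m M N π) :
    IsOpen {z : EuclideanSpace ℝ (Fin n) × (EuclideanSpace ℝ (Fin n) × ℝ) |
      shift ε z.1 z.2 ∈ N} :=
  hr.isOpen.preimage (continuous_shift hs.contDiff.continuous)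

lemma contDiffAt_averageHom (hs : IsScale M N π G κ ε δ) (hr : IsTubularRetraction m M N π)
    (hΩ : ∀ y ∈ N, ContDiffAt ℝ (⊤ : ℕ∞) Ω y) (hx : x ∈ M) :
    ContDiffAt ℝ (⊤ : ℕ∞) (averageHom ε Ω) x :=
  contDiffAt_integral_of_isCompact (isCompact_paramSet n) ae_mem_paramSet_homMeasure
    (hs.isOpen_shift_preimage hr) (fun _ hz => contDiffAt_contractShift hs.contDiff (hΩ _ hz))
    fun _ hτ => hs.shift_mem hx hτ

lemma extDeriv_averageHom (hs : IsScale M N π G κ ε δ) (hr : IsTubularRetraction m M N π)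
    (hΩ : ∀ y ∈ N, ContDiffAt ℝ (⊤ : ℕ∞) Ω y) (hx : x ∈ M) :
    extDeriv (averageHom ε Ω) x =
        ∫ τ, extDeriv (fun x => contractShift ε Ω x τ) x ∂(homMeasure n) ∧
      Integrable (fun τ => extDeriv (fun x => contractShift ε Ω x τ) x) (homMeasure n) :=
  map_fderiv_integral_of_isCompact (H := EuclideanSpace ℝ (Fin n) [⋀^Fin j]→L[ℝ] ℝ)
    (H' := EuclideanSpace ℝ (Fin n) [⋀^Fin (j + 1)]→L[ℝ] ℝ)
    (ContinuousAlternatingMap.alternatizeUncurryFinCLM ℝ (EuclideanSpace ℝ (Fin n)) ℝ)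
    (isCompact_paramSet n) ae_mem_paramSet_homMeasure
    (hs.isOpen_shift_preimage hr) (fun _ hz => contDiffAt_contractShift hs.contDiff (hΩ _ hz))
    fun _ hτ => hs.shift_mem hx hτ

lemma integrable_contractShift (hs : IsScale M N π G κ ε δ)
    (hΩ : ∀ y ∈ N, ContDiffAt ℝ (⊤ : ℕ∞) Ω y) (hx : x ∈ M) :
    Integrable (contractShift ε Ω x) (homMeasure n) := by
  have h1 : ContinuousOn (contractShift ε Ω x) (paramSet n) := fun τ hτ => by
    have h2 := (contDiffAt_contractShift (z := (x, τ)) hs.contDiff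
      (hΩ _ (hs.shift_mem hx hτ))).continuousAt
    have h3 : ContinuousAt (fun τ : EuclideanSpace ℝ (Fin n) × ℝ => (x, τ)) τ := by fun_prop
    exact (ContinuousAt.comp (x := τ) h2 h3).continuousWithinAt
  have h2 := h1.integrableOn_compact (μ := homMeasure n) (isCompact_paramSet n)
  rwa [IntegrableOn, Measure.restrict_eq_self_of_ae_mem ae_mem_paramSet_homMeasure] at h2

end IsScale

/-- The fundamental theorem of calculus in the parameter `s`, averaged over `t`. -/
lemma average_sub_eq {Ω : EuclideanSpace ℝ (Fin n) → EuclideanSpace ℝ (Fin n) [⋀^Fin j]→L[ℝ] ℝ}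
    {x : EuclideanSpace ℝ (Fin n)}
    {Z : EuclideanSpace ℝ (Fin n) × ℝ → EuclideanSpace ℝ (Fin n) [⋀^Fin j]→L[ℝ] ℝ}
    (hZ : Integrable Z (homMeasure n))
    (hd : ∀ τ ∈ paramSet n, HasDerivAt (fun s => pullShift ε Ω x (τ.1, s)) (Z τ) τ.2) :
    average ε Ω x - Ω x = ∫ τ, Z τ ∂(homMeasure n) := by
  have h1 : ∀ᵐ t ∂(bumpMeasure volume (stdBump n)),
      ∫ s in Set.Icc (0 : ℝ) 1, Z (t, s) = pullShift ε Ω x (t, 1) - Ω x := by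
    filter_upwards [ae_norm_lt_bumpMeasure (μ := volume) (stdBump n), hZ.prod_right_ae]
      with t ht hi
    have ht' : t ∈ Metric.closedBall (0 : EuclideanSpace ℝ (Fin n)) 4 :=
      mem_closedBall_zero_iff.2 (ht.le.trans (by norm_num [stdBump]))
    rw [integral_Icc_eq_integral_Ioc, ← intervalIntegral.integral_of_le zero_le_one,
      intervalIntegral.integral_eq_sub_of_hasDerivAt (f := fun s => pullShift ε Ω x (t, s)),
      pullShift_zero_right]
    · intro s hs
      rw [Set.uIcc_of_le zero_le_one] at hs
      exact hd (t, s) ⟨ht', hs⟩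
    · rw [intervalIntegrable_iff_integrableOn_Icc_of_le zero_le_one]
      exact hi
  have h2 : Integrable (fun t => pullShift ε Ω x (t, 1) - Ω x)
      (bumpMeasure volume (stdBump n)) := hZ.integral_prod_left.congr h1
  have h3 : Integrable (fun t => pullShift ε Ω x (t, 1)) (bumpMeasure volume (stdBump n)) := by
    refine (h2.add (integrable_const (Ω x))).congr (Eventually.of_forall fun t => ?_)
    simp
  rw [homMeasure, integral_prod _ hZ, integral_congr_ae h1, integral_sub h3 (integrable_const _),
    average, regMeasure, integral_prod_dirac]
  simp

namespace IsScale

/-- The homotopy formula for smooth forms on a neighborhood of `M` in `ℝ^n`. -/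
lemma average_sub_eq_extDeriv (hs : IsScale M N π G κ ε δ) (hr : IsTubularRetraction m M N π)
    {Ω : EuclideanSpace ℝ (Fin n) → EuclideanSpace ℝ (Fin n) [⋀^Fin (j + 1)]→L[ℝ] ℝ}
    {x : EuclideanSpace ℝ (Fin n)} (hΩ : ∀ y ∈ N, ContDiffAt ℝ (⊤ : ℕ∞) Ω y)
    (hx : x ∈ M) :
    average ε Ω x - Ω x = extDeriv (averageHom ε Ω) x + averageHom ε (extDeriv Ω) x := by
  have hdΩ : ∀ y ∈ N, ContDiffAt ℝ (⊤ : ℕ∞) (extDeriv Ω) y := fun y hy =>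
    contDiffAt_extDeriv (hΩ y hy)
  have h1 := hs.extDeriv_averageHom hr hΩ hx
  have h2 := hs.integrable_contractShift hdΩ hx
  rw [h1.1, averageHom, ← integral_add h1.2 h2]
  exact average_sub_eq (h1.2.add h2) fun τ hτ =>
    hasDerivAt_pullShift hs.contDiff (hΩ _ (hs.shift_mem hx hτ))

/-- The homotopy formula for functions. -/
lemma average_sub_eq_zero (hs : IsScale M N π G κ ε δ)
    {Ω : EuclideanSpace ℝ (Fin n) → EuclideanSpace ℝ (Fin n) [⋀^Fin 0]→L[ℝ] ℝ}
    {x : EuclideanSpace ℝ (Fin n)} (hΩ : ∀ y ∈ N, ContDiffAt ℝ (⊤ : ℕ∞) Ω y)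
    (hx : x ∈ M) :
    average ε Ω x - Ω x = averageHom ε (extDeriv Ω) x := by
  have hdΩ : ∀ y ∈ N, ContDiffAt ℝ (⊤ : ℕ∞) (extDeriv Ω) y := fun y hy =>
    contDiffAt_extDeriv (hΩ y hy)
  exact average_sub_eq (hs.integrable_contractShift hdΩ hx) fun τ hτ =>
    hasDerivAt_pullShift_zero hs.contDiff (hΩ _ (hs.shift_mem hx hτ))

end IsScale

namespace IsTubularRetraction

lemma extForm_eq (hr : IsTubularRetraction m M N π)
    {e : OpenPartialHomeomorph M (EuclideanSpace ℝ (Fin m))} (he : IsCoord e) (ω : Form M j)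
    {y : EuclideanSpace ℝ (Fin n)} (hy : y ∈ N) (hs : (⟨π y, hr.mem y hy⟩ : M) ∈ e.source) :
    extForm π ω y = (pullback e ω (coordMap e (π y))).compContinuousLinearMap
      (fderiv ℝ (fun z => coordMap e (π z)) y) := by
  have h1 : coordMap e (π y) = e ⟨π y, hr.mem y hy⟩ := coordMap_coe e ⟨π y, hr.mem y hy⟩
  rw [extForm, dif_pos (hr.mem y hy), hr.fderiv_eq_comp he hy hs, pullback_eq, h1, e.left_inv hs]
  rfl

lemma contDiffAt_extForm (hr : IsTubularRetraction m M N π) (hM : IsSmoothSubmanifold m M)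
    {ω : Form M j} (hω : IsSmooth m ω) {y : EuclideanSpace ℝ (Fin n)} (hy : y ∈ N) :
    ContDiffAt ℝ (⊤ : ℕ∞) (extForm π ω) y ∧
      ∀ η : Form M (j + 1), IsExtDeriv m ω η → extDeriv (extForm π ω) y = extForm π η y := by
  obtain ⟨e, he, hs⟩ := hM ⟨π y, hr.mem y hy⟩
  have hq := hr.contDiffAt_coordMap e he y hy (hr.mem y hy) hs
  have ht : coordMap e (π y) ∈ e.target := hr.coordMap_mem_target e hy hs
  have hp : ContDiffAt ℝ (⊤ : ℕ∞) (pullback e ω) (coordMap e (π y)) :=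
    (hω e he).contDiffAt (e.open_target.mem_nhds ht)
  have hev : extForm π ω =ᶠ[𝓝 y] fun y => (pullback e ω (coordMap e (π y))).compContinuousLinearMap
      (fderiv ℝ (fun z => coordMap e (π z)) y) := by
    filter_upwards [hr.eventually_mem_source e hy hs] with z ⟨hz, hzs⟩ using
      hr.extForm_eq he ω hz hzs
  constructor
  · refine ContDiffAt.congr_of_eventuallyEq ?_ hev
    exact contDiffAt_compContinuousLinearMap
      (ContDiffAt.comp (g := pullback e ω) y hp hq) (hq.fderiv_right (by simp))
  · intro η hη
    rw [hev.extDeriv_eq, extDeriv_pullback (f := fun z => coordMap e (π z))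
      (hp.differentiableAt (by simp)) hq (by simpa using ENat.LEInfty.out),
      hr.extForm_eq he η hy hs, hη e he _ ht]

lemma restrictForm_extForm (hr : IsTubularRetraction m M N π) (hM : IsSmoothSubmanifold m M)
    (ω : Form M j) : restrictForm M (extForm π ω) = ω := by
  funext x
  have hx : π x ∈ M := by rw [hr.self x x.2]; exact x.2
  have h2 : (⟨π x, hx⟩ : M) = x := Subtype.ext (hr.self x x.2)
  have h1 : extForm π ω x = ambient ω x := by
    rw [extForm, dif_pos hx, h2, hr.ambient_comp hM]
  rw [restrictForm, h1]
  ext v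
  simp [ambient, Function.comp_def]

end IsTubularRetraction

lemma isExtDeriv_restrictForm (hr : IsTubularRetraction m M N π)
    {Θ : EuclideanSpace ℝ (Fin n) → EuclideanSpace ℝ (Fin n) [⋀^Fin j]→L[ℝ] ℝ}
    (hΘ : ∀ x ∈ M, ContDiffAt ℝ (⊤ : ℕ∞) Θ x) :
    IsExtDeriv m (restrictForm M Θ) (restrictForm M (extDeriv Θ)) := by
  intro e he u hu
  have hev : pullback e (restrictForm M Θ) =ᶠ[𝓝 u] fun u =>
      (Θ (param e u)).compContinuousLinearMap (fderiv ℝ (param e) u) := by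
    filter_upwards [e.open_target.mem_nhds hu] with v hv using pullback_restrictForm hr he Θ hv
  rw [hev.extDeriv_eq, extDeriv_pullback (f := param e)
    ((hΘ _ (param_mem e u)).differentiableAt (by simp)) (he.contDiffAt_param hu)
    (by simpa using ENat.LEInfty.out), pullback_restrictForm hr he _ hu]

/-- The regularization of a form on `M`. -/
def regForm (π : EuclideanSpace ℝ (Fin n) → EuclideanSpace ℝ (Fin n))
    (ε : EuclideanSpace ℝ (Fin n) → ℝ) (ω : Form M j) : Form M j :=
  restrictForm M (average ε (extForm π ω))

/-- The homotopy between a form on `M` and its regularization. -/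
def homForm (π : EuclideanSpace ℝ (Fin n) → EuclideanSpace ℝ (Fin n))
    (ε : EuclideanSpace ℝ (Fin n) → ℝ) (ω : Form M (j + 1)) : Form M j :=
  restrictForm M (averageHom ε (extForm π ω))

namespace IsScale

lemma isSmooth_regForm (hs : IsScale M N π G κ ε δ) (hr : IsTubularRetraction m M N π)
    (hM : IsSmoothSubmanifold m M) [SFinite (vol m M)] {ω : Form M j}
    (hω : LocallyIntegrable (ambient ω) (vol m M)) : IsSmooth m (regForm π ε ω) :=
  isSmooth_restrictForm hr fun _ hx => hs.contDiffAt_average hx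
    (hs.integrableOn_extForm hr hM hω hx)

lemma isSmooth_homForm (hs : IsScale M N π G κ ε δ) (hr : IsTubularRetraction m M N π)
    (hM : IsSmoothSubmanifold m M) {ω : Form M (j + 1)} (hω : IsSmooth m ω) :
    IsSmooth m (homForm π ε ω) :=
  isSmooth_restrictForm hr fun _ hx => hs.contDiffAt_averageHom hr
    (fun _ hy => (hr.contDiffAt_extForm hM hω hy).1) hx

lemma averageHom_congr (hs : IsScale M N π G κ ε δ)
    {Ω Ω' : EuclideanSpace ℝ (Fin n) → EuclideanSpace ℝ (Fin n) [⋀^Fin (j + 1)]→L[ℝ] ℝ}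
    (h : ∀ y ∈ N, Ω y = Ω' y) {x : EuclideanSpace ℝ (Fin n)} (hx : x ∈ M) :
    averageHom ε Ω x = averageHom ε Ω' x := by
  refine integral_congr_ae ?_
  filter_upwards [ae_mem_paramSet_homMeasure] with τ hτ
  rw [contractShift, contractShift, h _ (hs.shift_mem hx hτ)]

/-- The homotopy formula for smooth forms on `M`, as a formula for `d A ω`. -/
lemma isExtDeriv_homForm (hs : IsScale M N π G κ ε δ) (hr : IsTubularRetraction m M N π)
    (hM : IsSmoothSubmanifold m M) {ω : Form M (j + 1)} {η : Form M (j + 1 + 1)}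
    (hω : IsSmooth m ω) (hη : IsExtDeriv m ω η) :
    IsExtDeriv m (homForm π ε ω) (regForm π ε ω - ω - homForm π ε η) := by
  have h1 := isExtDeriv_restrictForm hr (M := M) (Θ := averageHom ε (extForm π ω)) fun _ hx =>
    hs.contDiffAt_averageHom hr (fun _ hy => (hr.contDiffAt_extForm hM hω hy).1) hx
  have h2 : regForm π ε ω - restrictForm M (extForm π ω) - homForm π ε η =
      restrictForm M (extDeriv (averageHom ε (extForm π ω))) := by
    funext x
    have h3 := hs.average_sub_eq_extDeriv hr (fun _ hy => (hr.contDiffAt_extForm hM hω hy).1) x.2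
    rw [hs.averageHom_congr (fun y hy => (hr.contDiffAt_extForm hM hω hy).2 η hη) x.2] at h3
    have h4 := eq_sub_of_add_eq h3.symm
    show _ = (extDeriv (averageHom ε (extForm π ω)) x).compContinuousLinearMap _
    rw [h4]
    rfl
  rw [hr.restrictForm_extForm hM ω] at h2
  rw [h2]
  exact h1

lemma regForm_sub_eq (hs : IsScale M N π G κ ε δ) (hr : IsTubularRetraction m M N π)
    (hM : IsSmoothSubmanifold m M) {ω : Form M 0} {η : Form M 1}
    (hω : IsSmooth m ω) (hη : IsExtDeriv m ω η) : regForm π ε ω - ω = homForm π ε η := by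
  have h2 : regForm π ε ω - restrictForm M (extForm π ω) = homForm π ε η := by
    funext x
    have h3 := hs.average_sub_eq_zero (fun _ hy => (hr.contDiffAt_extForm hM hω hy).1) x.2
    rw [hs.averageHom_congr (fun y hy => (hr.contDiffAt_extForm hM hω hy).2 η hη) x.2] at h3
    show _ = (averageHom ε (extForm π η) x).compContinuousLinearMap _
    rw [← h3]
    rfl
  rwa [hr.restrictForm_extForm hM ω] at h2

end IsScale

end Smooth

/-! ### Local approximation of weakly differentiable forms by smooth forms -/

section Approximation

variable {n m j : ℕ} {M N : Set (EuclideanSpace ℝ (Fin n))}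
  {π : EuclideanSpace ℝ (Fin n) → EuclideanSpace ℝ (Fin n)}

/-- A form with compact support in the image of a coordinate system `e`, extended by zero to a
neighborhood of `M` through the retraction `π`. -/
def coordExt (e : OpenPartialHomeomorph M (EuclideanSpace ℝ (Fin m)))
    (π : EuclideanSpace ℝ (Fin n) → EuclideanSpace ℝ (Fin n))
    (α : EuclideanSpace ℝ (Fin m) → EuclideanSpace ℝ (Fin m) [⋀^Fin j]→L[ℝ] ℝ) :
    EuclideanSpace ℝ (Fin n) → EuclideanSpace ℝ (Fin n) [⋀^Fin j]→L[ℝ] ℝ :=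
  {y | π y ∈ Subtype.val '' e.source}.indicator fun y =>
    (α (coordMap e (π y))).compContinuousLinearMap (fderiv ℝ (fun z => coordMap e (π z)) y)

lemma contDiffAt_coordExt (hr : IsTubularRetraction m M N π)
    {e : OpenPartialHomeomorph M (EuclideanSpace ℝ (Fin m))} (he : IsCoord e)
    {α : EuclideanSpace ℝ (Fin m) → EuclideanSpace ℝ (Fin m) [⋀^Fin j]→L[ℝ] ℝ}
    (hα : ContDiff ℝ (⊤ : ℕ∞) α) (hc : HasCompactSupport α) (hsupp : tsupport α ⊆ e.target)
    {x : EuclideanSpace ℝ (Fin n)} (hx : x ∈ M) : ContDiffAt ℝ (⊤ : ℕ∞) (coordExt e π α) x := by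
  have hxN := hr.subset hx
  have hπx : (⟨π x, hr.mem x hxN⟩ : M) = ⟨x, hx⟩ := Subtype.ext (hr.self x hx)
  by_cases hxs : (⟨π x, hr.mem x hxN⟩ : M) ∈ e.source
  · have hq := hr.contDiffAt_coordMap e he x hxN (hr.mem x hxN) hxs
    have h1 : ContDiffAt ℝ (⊤ : ℕ∞) (fun y => (α (coordMap e (π y))).compContinuousLinearMap
        (fderiv ℝ (fun z => coordMap e (π z)) y)) x :=
      contDiffAt_compContinuousLinearMap (ContDiffAt.comp (g := α) x hα.contDiffAt hq)
        (hq.fderiv_right (by simp))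
    refine h1.congr_of_eventuallyEq ?_
    filter_upwards [hr.eventually_mem_source e hxN hxs] with y ⟨hy, hys⟩
    exact Set.indicator_of_mem (s := {y | π y ∈ Subtype.val '' e.source}) ⟨_, hys, rfl⟩ _
  · have hC : IsCompact (Subtype.val '' (e.symm '' tsupport α)) :=
      (hc.isCompact.image_of_continuousOn (e.continuousOn_symm.mono hsupp)).image
        continuous_subtype_val
    have hxC : π x ∉ Subtype.val '' (e.symm '' tsupport α) := by
      rintro ⟨_, ⟨u, hu, rfl⟩, h⟩
      apply hxs
      have : (⟨π x, hr.mem x hxN⟩ : M) = e.symm u := Subtype.ext h.symm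
      rw [this]
      exact e.map_target (hsupp hu)
    refine (contDiffAt_const (c := 0)).congr_of_eventuallyEq ?_
    filter_upwards [(hr.contDiffAt x hxN).continuousAt (hC.isClosed.isOpen_compl.mem_nhds hxC)]
      with y hy
    refine Set.indicator_apply_eq_zero.2 fun hys => ?_
    obtain ⟨z, hz, hzy⟩ := hys
    have h1 : coordMap e (π y) ∉ tsupport α := fun h => by
      rw [← hzy, coordMap_coe] at h
      exact hy ⟨z, ⟨e z, h, e.left_inv hz⟩, hzy⟩
    rw [image_eq_zero_of_notMem_tsupport h1]
    rfl

lemma pullback_coordExt (hr : IsTubularRetraction m M N π)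
    {e : OpenPartialHomeomorph M (EuclideanSpace ℝ (Fin m))} (he : IsCoord e)
    (α : EuclideanSpace ℝ (Fin m) → EuclideanSpace ℝ (Fin m) [⋀^Fin j]→L[ℝ] ℝ)
    {u : EuclideanSpace ℝ (Fin m)} (hu : u ∈ e.target) :
    pullback e (restrictForm M (coordExt e π α)) u = α u := by
  have hxN : param e u ∈ N := hr.subset (param_mem e u)
  have hself : ∀ v, π (param e v) = param e v := fun v => hr.self _ (param_mem e v)
  have hs : (⟨π (param e u), hr.mem _ hxN⟩ : M) ∈ e.source := by
    have : (⟨π (param e u), hr.mem _ hxN⟩ : M) = e.symm u := Subtype.ext (hself u)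
    rw [this]
    exact e.map_target hu
  have hq := hr.contDiffAt_coordMap e he _ hxN (hr.mem _ hxN) hs
  have h1 : HasFDerivAt (fun v => coordMap e (π (param e v)))
      ((fderiv ℝ (fun z => coordMap e (π z)) (param e u)).comp (fderiv ℝ (param e) u)) u :=
    HasFDerivAt.comp (g := fun z => coordMap e (π z)) u
      (hq.differentiableAt (by simp)).hasFDerivAt
      ((he.contDiffAt_param hu).differentiableAt (by simp)).hasFDerivAt
  have h2 : HasFDerivAt (fun v => coordMap e (π (param e v)))
      (ContinuousLinearMap.id ℝ _) u := by
    refine (hasFDerivAt_id u).congr_of_eventuallyEq ?_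
    filter_upwards [e.open_target.mem_nhds hu] with v hv
    rw [hself, coordMap_param hv]
    rfl
  rw [pullback_restrictForm hr he _ hu, coordExt, Set.indicator_of_mem
    (show param e u ∈ {y | π y ∈ Subtype.val '' e.source} from ⟨_, hs, rfl⟩), hself,
    coordMap_param hu]
  have h3 := h1.unique h2
  ext v
  have h4 : ∀ w, fderiv ℝ (fun z => coordMap e (π z)) (param e u) (fderiv ℝ (param e) u w) = w :=
    fun w => DFunLike.congr_fun h3 w
  simp only [ContinuousAlternatingMap.compContinuousLinearMap_apply, Function.comp_def, h4]

lemma IsExtDeriv.isSmooth {ω : Form M j} {η : Form M (j + 1)} (hω : IsSmooth m ω)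
    (h : IsExtDeriv m ω η) : IsSmooth m η := fun e he => by
  have h1 : ContDiffOn ℝ (⊤ : ℕ∞) (extDeriv (pullback e ω)) e.target := fun u hu => by
    have h2 : ContDiffAt ℝ (⊤ : ℕ∞) (pullback e ω) u :=
      (hω e he).contDiffAt (e.open_target.mem_nhds hu)
    exact (contDiffAt_extDeriv h2).contDiffWithinAt
  exact h1.congr fun u hu => h e he u hu

/-- On `M ∩ s` every weakly differentiable form is, together with its differential, a limit in `L^1`
of smooth forms. -/
def HasSmoothApprox (m : ℕ) (M s : Set (EuclideanSpace ℝ (Fin n))) : Prop :=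
  ∀ (j : ℕ) (ω : Form M j) (η : Form M (j + 1)), IsWeakExtDeriv m ω η →
    ∃ (a : ℕ → Form M j) (b : ℕ → Form M (j + 1)), (∀ k, IsSmooth m (a k)) ∧
      (∀ k, IsExtDeriv m (a k) (b k)) ∧
      Tendsto (fun k => ∫⁻ x in {x : M | (x : EuclideanSpace ℝ (Fin n)) ∈ s},
        ‖ambient (a k - ω) x‖ₑ ∂(vol m M)) atTop (𝓝 0) ∧
      Tendsto (fun k => ∫⁻ x in {x : M | (x : EuclideanSpace ℝ (Fin n)) ∈ s},
        ‖ambient (b k - η) x‖ₑ ∂(vol m M)) atTop (𝓝 0)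

lemma HasSmoothApprox.mono {s t : Set (EuclideanSpace ℝ (Fin n))} (hst : s ⊆ t)
    (h : HasSmoothApprox m M t) : HasSmoothApprox m M s := fun j ω η hω => by
  obtain ⟨a, b, h1, h2, h3, h4⟩ := h j ω η hω
  have hm : ∀ {i : ℕ} (θ : Form M i),
      ∫⁻ x in {x : M | (x : EuclideanSpace ℝ (Fin n)) ∈ s}, ‖ambient θ x‖ₑ ∂(vol m M) ≤
        ∫⁻ x in {x : M | (x : EuclideanSpace ℝ (Fin n)) ∈ t}, ‖ambient θ x‖ₑ ∂(vol m M) :=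
    fun θ => lintegral_mono_set fun x hx => hst hx
  exact ⟨a, b, h1, h2,
    tendsto_of_tendsto_of_tendsto_of_le_of_le tendsto_const_nhds h3 (fun _ => zero_le)
      fun k => hm _,
    tendsto_of_tendsto_of_tendsto_of_le_of_le tendsto_const_nhds h4 (fun _ => zero_le)
      fun k => hm _⟩

lemma IsPatch.tendsto_lintegral {e : OpenPartialHomeomorph M (EuclideanSpace ℝ (Fin m))}
    {V W : Set (EuclideanSpace ℝ (Fin m))} {K : ℝ≥0} (hV : IsPatch e π V K)
    (hr : IsTubularRetraction m M N π) (hM : IsSmoothSubmanifold m M) (he : IsCoord e)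
    {θ : Form M j} {a : ℕ → Form M j} {α : ℕ → EuclideanSpace ℝ (Fin m) →
      EuclideanSpace ℝ (Fin m) [⋀^Fin j]→L[ℝ] ℝ} (hVW : V ⊆ W)
    (hθ : LocallyIntegrableOn (pullback e θ) e.target) (ha : ∀ k, IsSmooth m (a k))
    (haα : ∀ k, ∀ u ∈ V, pullback e (a k) u = α k u)
    (hlim : Tendsto (fun k => ∫⁻ u in W, ‖α k u - pullback e θ u‖ₑ) atTop (𝓝 0))
    {s : Set M} (hs : s ⊆ e.symm '' V) :
    Tendsto (fun k => ∫⁻ x in s, ‖ambient (a k - θ) x‖ₑ ∂(vol m M)) atTop (𝓝 0) := by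
  have h1 : Tendsto (fun k => (K : ℝ≥0∞) ^ (m + j) * ∫⁻ u in W, ‖α k u - pullback e θ u‖ₑ) atTop
      (𝓝 0) := by
    simpa using ENNReal.Tendsto.const_mul hlim (Or.inr (by finiteness))
  refine tendsto_of_tendsto_of_tendsto_of_le_of_le tendsto_const_nhds h1 (fun _ => zero_le)
    fun k => ?_
  refine (lintegral_mono_set hs).trans ?_
  have hm1 : AEStronglyMeasurable (pullback e (a k)) (volume.restrict V) :=
    (((ha k) e he).continuousOn.mono hV.subset).aestronglyMeasurable hV.isOpen.measurableSet
  have hm2 : AEStronglyMeasurable (pullback e θ) (volume.restrict V) :=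
    hθ.aestronglyMeasurable.mono_measure (Measure.restrict_mono hV.subset le_rfl)
  refine (hV.lintegral_ambient_le hr hM he (ω := a k - θ) (hm1.sub hm2)).trans ?_
  refine mul_le_mul_right (le_trans (le_of_eq ?_) (lintegral_mono_set hVW)) _
  refine setLIntegral_congr_fun hV.isOpen.measurableSet fun u hu => ?_
  have : pullback e (a k - θ) u = pullback e (a k) u - pullback e θ u := rfl
  simp only [this, haα k u hu]

/-- Mollifications in a coordinate system, cut off and extended by zero, are smooth approximations.
-/
lemma exists_hasSmoothApprox (hr : IsTubularRetraction m M N π) (hM : IsSmoothSubmanifold m M)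
    {x : EuclideanSpace ℝ (Fin n)} (hx : x ∈ M) :
    ∃ r > 0, HasSmoothApprox m M (Metric.ball x r) := by
  obtain ⟨e, he, hxs⟩ := hM ⟨x, hx⟩
  set u₀ := e ⟨x, hx⟩ with hu₀
  have hut : u₀ ∈ e.target := e.map_source hxs
  obtain ⟨V, K, huV, hV⟩ := hr.exists_isPatch he hut
  obtain ⟨R, hR, hRV⟩ := Metric.nhds_basis_closedBall.mem_iff.1 (hV.isOpen.mem_nhds huV)
  have hP : IsPatch e π (Metric.ball u₀ (R / 3)) K := hV.mono Metric.isOpen_ball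
    ((Metric.ball_subset_closedBall.trans (Metric.closedBall_subset_closedBall (by linarith))).trans
      hRV)
  have hn : e.symm '' Metric.ball u₀ (R / 3) ∈ 𝓝 (⟨x, hx⟩ : M) := by
    refine hP.isOpen_image.mem_nhds ⟨u₀, Metric.mem_ball_self (by positivity), e.left_inv hxs⟩
  obtain ⟨r, hr0, hrb⟩ := Metric.mem_nhds_iff.1 hn
  obtain ⟨χ, hχ, hχc, hχs, W, hW, hKW, hχ1⟩ := exists_cutoff
    (isCompact_closedBall u₀ (R / 3)) (Metric.isOpen_ball (x := u₀) (ε := R / 2))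
    (Metric.closedBall_subset_ball (by linarith))
  have hχt : tsupport χ ⊆ e.target := hχs.trans ((Metric.ball_subset_closedBall.trans
    (Metric.closedBall_subset_closedBall (by linarith))).trans (hRV.trans hV.subset))
  have hbW : Metric.ball u₀ (R / 3) ⊆ W := Metric.ball_subset_closedBall.trans hKW
  refine ⟨r, hr0, fun j ω η hω => ?_⟩
  have hw := hω e he
  obtain ⟨a, ha, hl, hl'⟩ := hw.exists_approx (r := R / 2) (R := R) (u₀ := u₀)
    (by linarith) (hRV.trans hV.subset)
  set α : ℕ → EuclideanSpace ℝ (Fin m) → EuclideanSpace ℝ (Fin m) [⋀^Fin j]→L[ℝ] ℝ :=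
    fun k u => χ u • a k u with hα
  have hαd : ∀ k, ContDiff ℝ (⊤ : ℕ∞) (α k) := fun k => hχ.smul (ha k)
  have hαc : ∀ k, HasCompactSupport (α k) := fun k => hχc.smul_right
  have hαs : ∀ k, tsupport (α k) ⊆ e.target := fun k =>
    (tsupport_smul_subset_left χ (a k)).trans hχt
  have hΘ : ∀ k, ∀ x ∈ M, ContDiffAt ℝ (⊤ : ℕ∞) (coordExt e π (α k)) x := fun k x hx =>
    contDiffAt_coordExt hr he (hαd k) (hαc k) (hαs k) hx
  have hsm : ∀ k, IsSmooth m (restrictForm M (coordExt e π (α k))) := fun k =>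
    isSmooth_restrictForm hr (hΘ k)
  have hext : ∀ k, IsExtDeriv m (restrictForm M (coordExt e π (α k)))
      (restrictForm M (extDeriv (coordExt e π (α k)))) := fun k =>
    isExtDeriv_restrictForm hr (hΘ k)
  have hsub : {y : M | (y : EuclideanSpace ℝ (Fin n)) ∈ Metric.ball x r} ⊆
      e.symm '' Metric.ball u₀ (R / 3) := fun y hy => hrb hy
  refine ⟨fun k => restrictForm M (coordExt e π (α k)),
    fun k => restrictForm M (extDeriv (coordExt e π (α k))), hsm, hext,
    hP.tendsto_lintegral hr hM he (α := a) (Metric.ball_subset_ball (by linarith)) hw.1 hsm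
      (fun k u hu => ?_) hl hsub,
    hP.tendsto_lintegral hr hM he (α := fun k => extDeriv (a k))
      (Metric.ball_subset_ball (by linarith)) hw.2
      (fun k => IsExtDeriv.isSmooth (hsm k) (hext k)) (fun k u hu => ?_) hl' hsub⟩
  · rw [pullback_coordExt hr he _ (hP.subset hu), hα]
    simp only
    rw [hχ1 u (hbW hu), one_smul]
  · rw [hext k e he u (hP.subset hu)]
    refine Filter.EventuallyEq.extDeriv_eq ?_
    filter_upwards [Metric.isOpen_ball.mem_nhds hu] with v hv
    rw [pullback_coordExt hr he _ (hP.subset hv), hα]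
    simp only
    rw [hχ1 v (hbW hv), one_smul]

end Approximation

/-! ### Averaging operators on forms -/

section Averaging

variable {n m j k : ℕ} {M N : Set (EuclideanSpace ℝ (Fin n))}
  {π : EuclideanSpace ℝ (Fin n) → EuclideanSpace ℝ (Fin n)}
  {G : Set (EuclideanSpace ℝ (Fin n)) → Prop} {κ : ℝ≥0} {ε δ : EuclideanSpace ℝ (Fin n) → ℝ}

lemma eLpNorm_ambient (p : ℝ≥0∞) (ω : Form M j) :
    eLpNorm (ambient ω) p (vol m M) = lpNorm m p ω := by
  rw [lpNorm, ← eLpNorm_norm]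
  simp only [norm_ambient]

lemma ambient_eq_zero_iff {ω : Form M j} {x : M} : ambient ω x = 0 ↔ ω x = 0 := by
  have h1 : ‖ambient ω x‖ = 0 ↔ ambient ω x = 0 := norm_eq_zero
  have h2 : ‖ω x‖ = 0 ↔ ω x = 0 := norm_eq_zero (E := (tangentSpaceAt M x) [⋀^Fin j]→L[ℝ] ℝ)
  rw [← h1, norm_ambient, h2]

lemma enorm_ambient_eq_zero_iff {ω : Form M j} {x : M} : ‖ambient ω x‖ₑ = 0 ↔ ω x = 0 := by
  have h1 : ‖ambient ω x‖ₑ = 0 ↔ ambient ω x = 0 :=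
    enorm_eq_zero (E := EuclideanSpace ℝ (Fin n) [⋀^Fin j]→L[ℝ] ℝ)
  rw [h1, ambient_eq_zero_iff]

/-- The average with respect to `P` of forms `F Ω x τ`, where `Ω` is the extension of a form on `M`
to a neighborhood. -/
def averageForm (π : EuclideanSpace ℝ (Fin n) → EuclideanSpace ℝ (Fin n))
    (P : Measure (EuclideanSpace ℝ (Fin n) × ℝ))
    (F : (EuclideanSpace ℝ (Fin n) → EuclideanSpace ℝ (Fin n) [⋀^Fin j]→L[ℝ] ℝ) →
      EuclideanSpace ℝ (Fin n) → EuclideanSpace ℝ (Fin n) × ℝ →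
        EuclideanSpace ℝ (Fin n) [⋀^Fin k]→L[ℝ] ℝ) (ω : Form M j) : Form M k :=
  restrictForm M fun x => ∫ τ, F (extForm π ω) x τ ∂P

/-- `F Ω x τ` depends linearly on `Ω` and is bounded by the values of `Ω` at displaced points. -/
structure IsAveraging (m : ℕ) (M : Set (EuclideanSpace ℝ (Fin n)))
    (π : EuclideanSpace ℝ (Fin n) → EuclideanSpace ℝ (Fin n))
    (ε : EuclideanSpace ℝ (Fin n) → ℝ) (P : Measure (EuclideanSpace ℝ (Fin n) × ℝ)) (c : ℝ≥0)
    (F : (EuclideanSpace ℝ (Fin n) → EuclideanSpace ℝ (Fin n) [⋀^Fin j]→L[ℝ] ℝ) →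
      EuclideanSpace ℝ (Fin n) → EuclideanSpace ℝ (Fin n) × ℝ →
        EuclideanSpace ℝ (Fin n) [⋀^Fin k]→L[ℝ] ℝ) : Prop where
  map_add : ∀ Ω Ω' x τ, F (Ω + Ω') x τ = F Ω x τ + F Ω' x τ
  map_smul : ∀ (a : ℝ) Ω x τ, F (a • Ω) x τ = a • F Ω x τ
  isKernel : ∀ ω : Form M j, AEStronglyMeasurable (ambient ω) (vol m M) →
    IsKernel m π ε P ω c (F (extForm π ω))
  ae_mem : ∀ᵐ τ ∂P, τ ∈ paramSet n

lemma IsScale.isAveraging_pullShift (hs : IsScale M N π G κ ε δ) (hr : IsTubularRetraction m M N π)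
    (hM : IsSmoothSubmanifold m M) [SFinite (vol m M)] :
    IsAveraging (j := j) m M π ε (regMeasure n) (4 ^ n) (pullShift ε) where
  map_add _ _ _ _ := rfl
  map_smul _ _ _ _ := rfl
  isKernel ω hω := ⟨hω, hs.aestronglyMeasurable_pullShift hr hM ae_mem_paramSet_regMeasure hω,
    fun x τ hτ => by simpa using hs.norm_pullShift_le hr hM ω x hτ⟩
  ae_mem := ae_mem_paramSet_regMeasure

lemma IsScale.isAveraging_contractShift (hs : IsScale M N π G κ ε δ)
    (hr : IsTubularRetraction m M N π) (hM : IsSmoothSubmanifold m M) [SFinite (vol m M)] :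
    IsAveraging (j := j + 1) m M π ε (homMeasure n) (4 ^ n * 4 * κ) (contractShift ε) where
  map_add _ _ _ _ := rfl
  map_smul _ _ _ _ := rfl
  isKernel ω hω := ⟨hω, hs.aestronglyMeasurable_contractShift hr hM ae_mem_paramSet_homMeasure hω,
    fun x τ hτ => by simpa using hs.norm_contractShift_le hr hM ω x hτ⟩
  ae_mem := ae_mem_paramSet_homMeasure

lemma extForm_add (ω ω' : Form M j) : extForm π (ω + ω') = extForm π ω + extForm π ω' := by
  funext y
  by_cases h : π y ∈ M
  · simp only [extForm, dif_pos h, Pi.add_apply]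
    rfl
  · simp [extForm, dif_neg h]

lemma extForm_smul (a : ℝ) (ω : Form M j) : extForm π (a • ω) = a • extForm π ω := by
  funext y
  by_cases h : π y ∈ M
  · simp only [extForm, dif_pos h, Pi.smul_apply]
    rfl
  · simp [extForm, dif_neg h]

namespace IsAveraging

variable {P : Measure (EuclideanSpace ℝ (Fin n) × ℝ)} {c : ℝ≥0}
  {F : (EuclideanSpace ℝ (Fin n) → EuclideanSpace ℝ (Fin n) [⋀^Fin j]→L[ℝ] ℝ) →
      EuclideanSpace ℝ (Fin n) → EuclideanSpace ℝ (Fin n) × ℝ →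
        EuclideanSpace ℝ (Fin n) [⋀^Fin k]→L[ℝ] ℝ} {ω ω' : Form M j}

lemma enorm_ambient_le (π : EuclideanSpace ℝ (Fin n) → EuclideanSpace ℝ (Fin n))
    (F : (EuclideanSpace ℝ (Fin n) → EuclideanSpace ℝ (Fin n) [⋀^Fin j]→L[ℝ] ℝ) →
      EuclideanSpace ℝ (Fin n) → EuclideanSpace ℝ (Fin n) × ℝ →
        EuclideanSpace ℝ (Fin n) [⋀^Fin k]→L[ℝ] ℝ) (ω : Form M j) (x : M) :
    ‖ambient (averageForm π P F ω) x‖ₑ ≤ ‖∫ τ, F (extForm π ω) x τ ∂P‖ₑ := by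
  rw [enorm_le_iff_norm_le, norm_ambient]
  exact norm_restrictForm_le _ x

lemma aestronglyMeasurable [IsProbabilityMeasure P] (h : IsAveraging m M π ε P c F)
    (hr : IsTubularRetraction m M N π)
    (hM : IsSmoothSubmanifold m M) [SFinite (vol m M)]
    (hω : AEStronglyMeasurable (ambient ω) (vol m M)) :
    AEStronglyMeasurable (ambient (averageForm π P F ω)) (vol m M) := by
  have h1 := (h.isKernel ω hω).aestronglyMeasurable_integral
  have h2 : Continuous fun x : M => fderiv ℝ π x := continuous_iff_continuousAt.2 fun x =>
    ContinuousAt.comp (g := fderiv ℝ π) (((hr.contDiffAt x (hr.subset x.2)).fderiv_right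
      (m := (⊤ : ℕ∞)) (by simp)).continuousAt) continuous_subtype_val.continuousAt
  refine (aestronglyMeasurable_compContinuousLinearMap h1 h2.aestronglyMeasurable).congr
    (Eventually.of_forall fun x => ?_)
  exact (ambient_restrictForm (fun x => ∫ τ, F (extForm π ω) x τ ∂P) hr hM x).symm

lemma locallyIntegrable [IsProbabilityMeasure P] (h : IsAveraging m M π ε P c F)
    (hs : IsScale M N π G κ ε δ)
    (hr : IsTubularRetraction m M N π) (hM : IsSmoothSubmanifold m M) [SFinite (vol m M)]
    (hω : LocallyIntegrable (ambient ω) (vol m M)) :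
    LocallyIntegrable (ambient (averageForm π P F ω)) (vol m M) := by
  have hm := hω.aestronglyMeasurable
  refine ((h.isKernel ω hm).ae_integrable hs hr hM h.ae_mem hω).2.mono
    (h.aestronglyMeasurable hr hM hm) (Eventually.of_forall fun x => ?_)
  rw [norm_ambient]
  exact norm_restrictForm_le _ x

lemma averageForm_add_apply (h : IsAveraging m M π ε P c F) {x : M}
    (hx : Integrable (F (extForm π ω) x) P) (hx' : Integrable (F (extForm π ω') x) P) :
    averageForm π P F (ω + ω') x = averageForm π P F ω x + averageForm π P F ω' x := by
  have h1 : ∫ τ, F (extForm π (ω + ω')) x τ ∂P =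
      ∫ τ, F (extForm π ω) x τ ∂P + ∫ τ, F (extForm π ω') x τ ∂P := by
    rw [← integral_add hx hx', extForm_add]
    simp only [h.map_add]
  rw [averageForm, restrictForm, h1]
  rfl

lemma averageForm_smul (h : IsAveraging m M π ε P c F) (a : ℝ) (ω : Form M j) :
    averageForm π P F (a • ω) = a • averageForm π P F ω := by
  funext x
  have h1 : ∫ τ, F (extForm π (a • ω)) x τ ∂P = a • ∫ τ, F (extForm π ω) x τ ∂P := by
    rw [← integral_smul, extForm_smul]
    simp only [h.map_smul]
  rw [averageForm, restrictForm, h1]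
  rfl

lemma ae_add [IsProbabilityMeasure P] (h : IsAveraging m M π ε P c F) (hs : IsScale M N π G κ ε δ)
    (hr : IsTubularRetraction m M N π) (hM : IsSmoothSubmanifold m M) [SFinite (vol m M)]
    (hω : LocallyIntegrable (ambient ω) (vol m M))
    (hω' : LocallyIntegrable (ambient ω') (vol m M)) :
    ∀ᵐ x ∂(vol m M), averageForm π P F (ω + ω') x =
      averageForm π P F ω x + averageForm π P F ω' x := by
  filter_upwards [((h.isKernel ω hω.aestronglyMeasurable).ae_integrable hs hr hM h.ae_mem hω).1,
    ((h.isKernel ω' hω'.aestronglyMeasurable).ae_integrable hs hr hM h.ae_mem hω').1]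
    with x hx hx' using h.averageForm_add_apply hx hx'

lemma ae_sub [IsProbabilityMeasure P] (h : IsAveraging m M π ε P c F) (hs : IsScale M N π G κ ε δ)
    (hr : IsTubularRetraction m M N π) (hM : IsSmoothSubmanifold m M) [SFinite (vol m M)]
    (hω : LocallyIntegrable (ambient ω) (vol m M))
    (hω' : LocallyIntegrable (ambient ω') (vol m M)) :
    ∀ᵐ x ∂(vol m M), averageForm π P F (ω - ω') x =
      averageForm π P F ω x - averageForm π P F ω' x := by
  have h1 : LocallyIntegrable (ambient ((-1 : ℝ) • ω')) (vol m M) := hω'.smul (-1 : ℝ)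
  filter_upwards [h.ae_add hs hr hM hω h1] with x hx
  have h2 : ω + (-1 : ℝ) • ω' = ω - ω' := by rw [neg_one_smul, sub_eq_add_neg]
  rw [h2, h.averageForm_smul] at hx
  rw [hx, sub_eq_add_neg]
  congr 1
  exact neg_one_smul ℝ (averageForm π P F ω' x)

/-- The local `L^1` bound. -/
lemma setLIntegral_le [IsProbabilityMeasure P] (h : IsAveraging m M π ε P c F)
    (hs : IsScale M N π G κ ε δ)
    (hr : IsTubularRetraction m M N π) (hM : IsSmoothSubmanifold m M) [SFinite (vol m M)]
    (hω : AEStronglyMeasurable (ambient ω) (vol m M)) {S S' : Set M} (hS : MeasurableSet S)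
    (hS' : MeasurableSet S') (hSS' : ∀ x ∈ S, ∀ τ ∈ paramSet n, move π ε (x, τ) ∈ S') :
    ∫⁻ x in S, ‖ambient (averageForm π P F ω) x‖ₑ ∂(vol m M) ≤
      (c * 2 ^ m : ℝ≥0) * ∫⁻ x in S', ‖ambient ω x‖ₑ ∂(vol m M) := by
  refine le_trans (lintegral_mono fun x => ?_)
    ((h.isKernel ω hω).setLIntegral_le hs hr hM h.ae_mem hS hS' hSS')
  exact (enorm_ambient_le π F ω x).trans (enorm_integral_le_lintegral_enorm _)

lemma isLp [IsProbabilityMeasure P] (h : IsAveraging m M π ε P c F) (hs : IsScale M N π G κ ε δ)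
    (hr : IsTubularRetraction m M N π) (hM : IsSmoothSubmanifold m M) [SFinite (vol m M)]
    {p : ℝ≥0∞} (hp : 1 ≤ p) (hω : IsLp m p ω) :
    IsLp m p (averageForm π P F ω) ∧
      lpNorm m p (averageForm π P F ω) ≤ (c * 2 ^ m : ℝ≥0) * lpNorm m p ω := by
  have h1 : lpNorm m p (averageForm π P F ω) ≤ (c * 2 ^ m : ℝ≥0) * lpNorm m p ω := by
    rw [← eLpNorm_ambient, ← eLpNorm_ambient]
    refine le_trans (eLpNorm_mono_enorm fun x => ?_)
      ((h.isKernel ω hω.1).eLpNorm_le hs hr hM h.ae_mem hp)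
    exact enorm_ambient_le π F ω x
  exact ⟨⟨h.aestronglyMeasurable hr hM hω.1, h1.trans_lt (ENNReal.mul_lt_top (by finiteness) hω.2)⟩,
    h1⟩

/-- Averages vanish at the points around which the given form vanishes. -/
lemma ae_eq_zero [IsProbabilityMeasure P] (h : IsAveraging m M π ε P c F)
    (hs : IsScale M N π G κ ε δ)
    (hr : IsTubularRetraction m M N π) (hM : IsSmoothSubmanifold m M) [SFinite (vol m M)]
    (hω : AEStronglyMeasurable (ambient ω) (vol m M)) {S S' : Set M} (hS : MeasurableSet S)
    (hS' : MeasurableSet S') (hSS' : ∀ x ∈ S, ∀ τ ∈ paramSet n, move π ε (x, τ) ∈ S')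
    (h0 : ∀ᵐ x ∂(vol m M), x ∈ S' → ω x = 0) :
    ∀ᵐ x ∂(vol m M), x ∈ S → averageForm π P F ω x = 0 := by
  have h1 := h.setLIntegral_le hs hr hM hω hS hS' hSS'
  have h2 : ∫⁻ x in S', ‖ambient ω x‖ₑ ∂(vol m M) = 0 := by
    refine (lintegral_congr_ae ?_).trans lintegral_zero
    filter_upwards [(ae_restrict_iff' hS').2 h0] with x hx
    exact enorm_ambient_eq_zero_iff.2 hx
  rw [h2, mul_zero] at h1
  have h3 := (lintegral_eq_zero_iff' (h.aestronglyMeasurable hr hM hω).enorm.restrict).1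
    (le_antisymm h1 zero_le)
  filter_upwards [(ae_restrict_iff' hS).1 h3] with x hx hxS
  exact enorm_ambient_eq_zero_iff.1 (hx hxS)

end IsAveraging

/-- Displacements of points of a smaller ball remain in the ball on which a scale is controlled. -/
lemma IsScale.move_mem_ball (hs : IsScale M N π G κ ε δ) (hr : IsTubularRetraction m M N π)
    (hM : IsSmoothSubmanifold m M) {x₀ : EuclideanSpace ℝ (Fin n)} {x : M}
    (hx : (x : EuclideanSpace ℝ (Fin n)) ∈ Metric.ball x₀ (δ x₀ / 2))
    {τ : EuclideanSpace ℝ (Fin n) × ℝ} (hτ : τ ∈ paramSet n) :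
    (move π ε (x, τ) : EuclideanSpace ℝ (Fin n)) ∈ Metric.ball x₀ (δ x₀) := by
  have h1 : dist (move π ε (x, τ) : EuclideanSpace ℝ (Fin n)) x ≤ 8 * ε x :=
    hs.dist_move_le hr hM x hτ
  have h2 := hs.le x
  have h3 := hs.le_const
  have h4 := hs.radius_lipschitz.dist_le_mul x x₀
  rw [Real.dist_eq, NNReal.coe_one, one_mul] at h4
  have h5 := (abs_le.1 h4).2
  have h6 := Metric.mem_ball.1 hx
  have h7 := dist_triangle (move π ε (x, τ) : EuclideanSpace ℝ (Fin n)) x x₀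
  have h8 := hs.radius_pos x x.2
  rw [Metric.mem_ball]
  nlinarith

end Averaging

/-! ### The homotopy formula for weakly differentiable forms -/

section WeakHomotopy

variable {n m j k : ℕ} {M N : Set (EuclideanSpace ℝ (Fin n))}
  {π : EuclideanSpace ℝ (Fin n) → EuclideanSpace ℝ (Fin n)}
  {G : Set (EuclideanSpace ℝ (Fin n)) → Prop} {κ : ℝ≥0} {ε δ : EuclideanSpace ℝ (Fin n) → ℝ}

lemma ambient_sub (ω ω' : Form M j) : ambient (ω - ω') = ambient ω - ambient ω' := rfl

lemma aestronglyMeasurable_ambient_sub {ω ω' : Form M j}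
    (h : AEStronglyMeasurable (ambient ω) (vol m M))
    (h' : AEStronglyMeasurable (ambient ω') (vol m M)) :
    AEStronglyMeasurable (ambient (ω - ω')) (vol m M) := by
  rw [ambient_sub]
  exact AEStronglyMeasurable.sub (β := EuclideanSpace ℝ (Fin n) [⋀^Fin j]→L[ℝ] ℝ) h h'

lemma locallyIntegrable_ambient_sub {ω ω' : Form M j}
    (h : LocallyIntegrable (ambient ω) (vol m M))
    (h' : LocallyIntegrable (ambient ω') (vol m M)) :
    LocallyIntegrable (ambient (ω - ω')) (vol m M) := by
  rw [ambient_sub]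
  exact LocallyIntegrable.sub (E := EuclideanSpace ℝ (Fin n) [⋀^Fin j]→L[ℝ] ℝ) h h'

/-- Convergence in `L^1` on a subset of `M`. -/
def TendstoL1 (m : ℕ) (S : Set M) (a : ℕ → Form M j) (ω : Form M j) : Prop :=
  Tendsto (fun k => ∫⁻ x in S, ‖ambient (a k - ω) x‖ₑ ∂(vol m M)) atTop (𝓝 0)

lemma TendstoL1.mono {S S' : Set M} {a : ℕ → Form M j} {ω : Form M j} (h : TendstoL1 m S' a ω)
    (hS : S ⊆ S') : TendstoL1 m S a ω :=
  tendsto_of_tendsto_of_tendsto_of_le_of_le tendsto_const_nhds h (fun _ => zero_le)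
    fun _ => lintegral_mono_set hS

lemma TendstoL1.sub {S : Set M} {a a' : ℕ → Form M j} {ω ω' : Form M j} (h : TendstoL1 m S a ω)
    (h' : TendstoL1 m S a' ω') (ha : ∀ k, AEStronglyMeasurable (ambient (a k)) (vol m M))
    (hω : AEStronglyMeasurable (ambient ω) (vol m M)) :
    TendstoL1 m S (fun k => a k - a' k) (ω - ω') := by
  have h1 := Tendsto.add h h'
  rw [add_zero] at h1
  refine tendsto_of_tendsto_of_tendsto_of_le_of_le tendsto_const_nhds h1 (fun _ => zero_le)
    fun k => ?_
  have hm : AEStronglyMeasurable (ambient (a k - ω)) (vol m M) :=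
    aestronglyMeasurable_ambient_sub (ha k) hω
  dsimp only
  rw [← lintegral_add_left' hm.enorm.restrict]
  refine lintegral_mono fun x => ?_
  have h2 : ambient (a k - a' k - (ω - ω')) x = ambient (a k - ω) x - ambient (a' k - ω') x := by
    show ambient (a k) x - ambient (a' k) x - (ambient ω x - ambient ω' x) =
      (ambient (a k) x - ambient ω x) - (ambient (a' k) x - ambient ω' x)
    abel
  rw [h2]
  exact enorm_sub_le

lemma TendstoL1.tendsto_pullback {e : OpenPartialHomeomorph M (EuclideanSpace ℝ (Fin m))}
    {V : Set (EuclideanSpace ℝ (Fin m))} {K : ℝ≥0} (hV : IsPatch e π V K)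
    {a : ℕ → Form M j} {ω : Form M j} (h : TendstoL1 m (e.symm '' V) a ω)
    (ha : ∀ k, AEStronglyMeasurable (ambient (a k)) (vol m M))
    (hω : AEStronglyMeasurable (ambient ω) (vol m M)) :
    Tendsto (fun k => ∫⁻ u in V, ‖pullback e (a k) u - pullback e ω u‖ₑ) atTop (𝓝 0) := by
  have h1 := ENNReal.Tendsto.const_mul h (Or.inr (show ((K : ℝ≥0∞) ^ (m + j)) ≠ ∞ by finiteness))
  rw [mul_zero] at h1
  refine tendsto_of_tendsto_of_tendsto_of_le_of_le tendsto_const_nhds h1 (fun _ => zero_le)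
    fun k => ?_
  have hm : AEStronglyMeasurable (ambient (a k - ω)) (vol m M) :=
    aestronglyMeasurable_ambient_sub (ha k) hω
  exact hV.lintegral_pullback_le (ω := a k - ω) hm.restrict

lemma IsSmooth.locallyIntegrable (hM : IsSmoothSubmanifold m M) {ω : Form M j}
    (hω : IsSmooth m ω) : LocallyIntegrable (ambient ω) (vol m M) :=
  locallyIntegrable_ambient hM fun e he =>
    (hω e he).continuousOn.locallyIntegrableOn e.open_target.measurableSet

lemma IsWeakExtDeriv.locallyIntegrable (hM : IsSmoothSubmanifold m M) {ω : Form M j}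
    {η : Form M (j + 1)} (h : IsWeakExtDeriv m ω η) :
    LocallyIntegrable (ambient ω) (vol m M) ∧ LocallyIntegrable (ambient η) (vol m M) :=
  ⟨locallyIntegrable_ambient hM fun e he => (h e he).1,
    locallyIntegrable_ambient hM fun e he => (h e he).2⟩

/-- Smooth forms are weakly differentiable. -/
lemma IsExtDeriv.isWeakExtDeriv {ω : Form M j} {η : Form M (j + 1)} (hω : IsSmooth m ω)
    (h : IsExtDeriv m ω η) : IsWeakExtDeriv m ω η := fun e he =>
  isWeakExtDerivOn_of_contDiffOn e.open_target (hω e he) (h e he)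

lemma IsAveraging.tendstoL1 {P : Measure (EuclideanSpace ℝ (Fin n) × ℝ)} [IsProbabilityMeasure P]
    {c : ℝ≥0} {F : (EuclideanSpace ℝ (Fin n) → EuclideanSpace ℝ (Fin n) [⋀^Fin j]→L[ℝ] ℝ) →
      EuclideanSpace ℝ (Fin n) → EuclideanSpace ℝ (Fin n) × ℝ →
        EuclideanSpace ℝ (Fin n) [⋀^Fin k]→L[ℝ] ℝ} (h : IsAveraging m M π ε P c F)
    (hs : IsScale M N π G κ ε δ) (hr : IsTubularRetraction m M N π) (hM : IsSmoothSubmanifold m M)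
    [SFinite (vol m M)] {a : ℕ → Form M j} {ω : Form M j} {S S' : Set M} (hS : MeasurableSet S)
    (hS' : MeasurableSet S') (hSS' : ∀ x ∈ S, ∀ τ ∈ paramSet n, move π ε (x, τ) ∈ S')
    (ha : ∀ k, LocallyIntegrable (ambient (a k)) (vol m M))
    (hω : LocallyIntegrable (ambient ω) (vol m M)) (hlim : TendstoL1 m S' a ω) :
    TendstoL1 m S (fun k => averageForm π P F (a k)) (averageForm π P F ω) := by
  have h1 := ENNReal.Tendsto.const_mul hlim
    (Or.inr (show ((c * 2 ^ m : ℝ≥0) : ℝ≥0∞) ≠ ∞ by finiteness))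
  rw [mul_zero] at h1
  refine tendsto_of_tendsto_of_tendsto_of_le_of_le tendsto_const_nhds h1 (fun _ => zero_le)
    fun k => ?_
  have hm : AEStronglyMeasurable (ambient (a k - ω)) (vol m M) :=
    aestronglyMeasurable_ambient_sub (ha k).aestronglyMeasurable hω.aestronglyMeasurable
  refine le_trans (le_of_eq ?_) (h.setLIntegral_le hs hr hM hm hS hS' hSS')
  refine lintegral_congr_ae (ae_restrict_of_ae ?_)
  filter_upwards [h.ae_sub hs hr hM (ha k) hω] with x hx
  have h2 : ambient (averageForm π P F (a k) - averageForm π P F ω) x =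
      ambient (averageForm π P F (a k - ω)) x := by
    rw [ambient, ambient, hx]
    rfl
  rw [h2]

namespace IsScale

/-- Near every point the terms of the homotopy formula are limits in `L^1` of those of smooth forms.
The term `Aω` exists in positive degree `j = i + 1` only. -/
lemma exists_approx (hs : IsScale M N π (HasSmoothApprox m M) κ ε δ)
    (hr : IsTubularRetraction m M N π) (hM : IsSmoothSubmanifold m M) [SFinite (vol m M)]
    {ω : Form M j} {η : Form M (j + 1)} (hω : IsWeakExtDeriv m ω η) (x₀ : M) :
    ∃ S, IsOpen S ∧ x₀ ∈ S ∧ ∃ (a : ℕ → Form M j) (b : ℕ → Form M (j + 1)),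
      (∀ k, IsSmooth m (a k)) ∧ (∀ k, IsExtDeriv m (a k) (b k)) ∧
      TendstoL1 m S a ω ∧ TendstoL1 m S (fun k => regForm π ε (a k)) (regForm π ε ω) ∧
      TendstoL1 m S (fun k => homForm π ε (b k)) (homForm π ε η) ∧
      ∀ (i : ℕ) (hi : i + 1 = j), TendstoL1 m S (fun k => homForm π ε (hi ▸ a k : Form M (i + 1)))
        (homForm π ε (hi ▸ ω : Form M (i + 1))) := by
  obtain ⟨a, b, ha, hb, h1, h2⟩ := hs.ball_mem x₀ x₀.2 j ω η hω
  have hδ := hs.radius_pos x₀ x₀.2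
  set S : Set M := {x : M | (x : EuclideanSpace ℝ (Fin n)) ∈
    Metric.ball (x₀ : EuclideanSpace ℝ (Fin n)) (δ x₀ / 2)} with hS
  set S' : Set M := {x : M | (x : EuclideanSpace ℝ (Fin n)) ∈
    Metric.ball (x₀ : EuclideanSpace ℝ (Fin n)) (δ x₀)} with hS'
  have hSo : IsOpen S := Metric.isOpen_ball.preimage continuous_subtype_val
  have hSo' : IsOpen S' := Metric.isOpen_ball.preimage continuous_subtype_val
  have hSS' : ∀ x ∈ S, ∀ τ ∈ paramSet n, move π ε (x, τ) ∈ S' := fun x hx τ hτ =>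
    hs.move_mem_ball hr hM hx hτ
  have hl := hω.locallyIntegrable hM
  have hal : ∀ k, LocallyIntegrable (ambient (a k)) (vol m M) := fun k =>
    (ha k).locallyIntegrable hM
  have hbl : ∀ k, LocallyIntegrable (ambient (b k)) (vol m M) := fun k =>
    ((hb k).isSmooth (ha k)).locallyIntegrable hM
  refine ⟨S, hSo, by simpa [hS] using half_pos hδ, a, b, ha, hb, ?_, ?_, ?_, ?_⟩
  · exact TendstoL1.mono (S' := S') h1 fun x hx =>
      Metric.ball_subset_ball (by linarith) hx
  · exact (hs.isAveraging_pullShift hr hM).tendstoL1 hs hr hM hSo.measurableSet hSo'.measurableSet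
      hSS' hal hl.1 h1
  · exact (hs.isAveraging_contractShift hr hM).tendstoL1 hs hr hM hSo.measurableSet
      hSo'.measurableSet hSS' hbl hl.2 h2
  · intro i hi
    subst hi
    exact (hs.isAveraging_contractShift hr hM).tendstoL1 hs hr hM hSo.measurableSet
      hSo'.measurableSet hSS' hal hl.1 h1

/-- The homotopy formula in positive degrees. It holds for smooth forms, and both sides are
continuous under local `L^1` convergence of a form and its weak differential. -/
lemma isWeakExtDeriv_homForm (hs : IsScale M N π (HasSmoothApprox m M) κ ε δ)
    (hr : IsTubularRetraction m M N π) (hM : IsSmoothSubmanifold m M) [SFinite (vol m M)]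
    {ω : Form M (j + 1)} {η : Form M (j + 1 + 1)} (hω : IsWeakExtDeriv m ω η) :
    IsWeakExtDeriv m (homForm π ε ω) (regForm π ε ω - ω - homForm π ε η) := by
  have hl := hω.locallyIntegrable hM
  have hA := hs.isAveraging_contractShift (j := j) hr hM
  have hA' := hs.isAveraging_contractShift (j := j + 1) hr hM
  have hR := hs.isAveraging_pullShift (j := j + 1) hr hM
  have hAω := hA.locallyIntegrable hs hr hM hl.1
  have hRω := hR.locallyIntegrable hs hr hM hl.1
  have hAη := hA'.locallyIntegrable hs hr hM hl.2
  have hβ : LocallyIntegrable (ambient (regForm π ε ω - ω - homForm π ε η)) (vol m M) :=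
    locallyIntegrable_ambient_sub (locallyIntegrable_ambient_sub hRω hl.1) hAη
  intro e he
  refine isWeakExtDerivOn_of_locally e.open_target fun u hu => ?_
  obtain ⟨S, hSo, hxS, a, b, ha, hb, h1, h2, h3, h4⟩ := hs.exists_approx hr hM hω (e.symm u)
  have h4' := h4 j rfl
  obtain ⟨V₀, K, huV₀, hV₀⟩ := hr.exists_isPatch he hu
  have hn : V₀ ∩ e.symm ⁻¹' S ∈ 𝓝 u :=
    inter_mem (hV₀.isOpen.mem_nhds huV₀) (e.continuousAt_symm hu (hSo.mem_nhds hxS))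
  obtain ⟨V, hVs, hVo, huV⟩ := mem_nhds_iff.1 hn
  have hV : IsPatch e π V K := hV₀.mono hVo fun v hv => (hVs hv).1
  have hVS : e.symm '' V ⊆ S := by
    rintro _ ⟨v, hv, rfl⟩
    exact (hVs hv).2
  have hal : ∀ k, LocallyIntegrable (ambient (a k)) (vol m M) := fun k =>
    (ha k).locallyIntegrable hM
  have hbl : ∀ k, LocallyIntegrable (ambient (b k)) (vol m M) := fun k =>
    ((hb k).isSmooth (ha k)).locallyIntegrable hM
  have hRa : ∀ k, LocallyIntegrable (ambient (regForm π ε (a k))) (vol m M) := fun k =>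
    hR.locallyIntegrable hs hr hM (hal k)
  have hAa : ∀ k, LocallyIntegrable (ambient (homForm π ε (a k))) (vol m M) := fun k =>
    hA.locallyIntegrable hs hr hM (hal k)
  have hAb : ∀ k, LocallyIntegrable (ambient (homForm π ε (b k))) (vol m M) := fun k =>
    hA'.locallyIntegrable hs hr hM (hbl k)
  refine ⟨V, hVo, huV, hV.subset, ?_⟩
  have hlim := (h2.sub h1 (fun k => (hRa k).aestronglyMeasurable) hRω.aestronglyMeasurable).sub h3
    (fun k => aestronglyMeasurable_ambient_sub (hRa k).aestronglyMeasurable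
      (hal k).aestronglyMeasurable)
    (aestronglyMeasurable_ambient_sub hRω.aestronglyMeasurable hl.1.aestronglyMeasurable)
  refine isWeakExtDerivOn_of_tendsto (a := fun k => pullback e (homForm π ε (a k)))
    (b := fun k => pullback e (regForm π ε (a k) - a k - homForm π ε (b k))) hVo
    ((locallyIntegrableOn_pullback hM hAω he).mono_set hV.subset)
    ((locallyIntegrableOn_pullback hM hβ he).mono_set hV.subset) (fun k => ?_) ?_ ?_
  · exact ((hs.isExtDeriv_homForm hr hM (ha k) (hb k)).isWeakExtDeriv
      (hs.isSmooth_homForm hr hM (ha k)) e he).mono hV.subset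
  · exact (h4'.mono hVS).tendsto_pullback hV (fun k => (hAa k).aestronglyMeasurable)
      hAω.aestronglyMeasurable
  · exact (hlim.mono hVS).tendsto_pullback hV (fun k => aestronglyMeasurable_ambient_sub
      (aestronglyMeasurable_ambient_sub (hRa k).aestronglyMeasurable
        (hal k).aestronglyMeasurable) (hAb k).aestronglyMeasurable) hβ.aestronglyMeasurable

/-- The homotopy formula for functions. -/
lemma ae_regForm_sub_eq (hs : IsScale M N π (HasSmoothApprox m M) κ ε δ)
    (hr : IsTubularRetraction m M N π) (hM : IsSmoothSubmanifold m M) [SFinite (vol m M)]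
    {ω : Form M 0} {η : Form M 1} (hω : IsWeakExtDeriv m ω η) :
    ∀ᵐ x ∂(vol m M), regForm π ε ω x - ω x = homForm π ε η x := by
  have hl := hω.locallyIntegrable hM
  have hA := hs.isAveraging_contractShift (j := 0) hr hM
  have hR := hs.isAveraging_pullShift (j := 0) hr hM
  have hRω := hR.locallyIntegrable hs hr hM hl.1
  have hAη := hA.locallyIntegrable hs hr hM hl.2
  have hβ : LocallyIntegrable (ambient (regForm π ε ω - ω - homForm π ε η)) (vol m M) :=
    locallyIntegrable_ambient_sub (locallyIntegrable_ambient_sub hRω hl.1) hAη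
  rw [ae_iff]
  refine measure_null_of_locally_null _ fun x₀ _ => ?_
  obtain ⟨S, hSo, hxS, a, b, ha, hb, h1, h2, h3, -⟩ := hs.exists_approx hr hM hω x₀
  have hal : ∀ k, LocallyIntegrable (ambient (a k)) (vol m M) := fun k =>
    (ha k).locallyIntegrable hM
  have hRa : ∀ k, LocallyIntegrable (ambient (regForm π ε (a k))) (vol m M) := fun k =>
    hR.locallyIntegrable hs hr hM (hal k)
  have hlim := (h2.sub h1 (fun k => (hRa k).aestronglyMeasurable) hRω.aestronglyMeasurable).sub h3
    (fun k => aestronglyMeasurable_ambient_sub (hRa k).aestronglyMeasurable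
      (hal k).aestronglyMeasurable)
    (aestronglyMeasurable_ambient_sub hRω.aestronglyMeasurable hl.1.aestronglyMeasurable)
  have h5 : ∀ k, ∫⁻ x in S, ‖ambient (regForm π ε (a k) - a k - homForm π ε (b k) -
      (regForm π ε ω - ω - homForm π ε η)) x‖ₑ ∂(vol m M) =
      ∫⁻ x in S, ‖ambient (regForm π ε ω - ω - homForm π ε η) x‖ₑ ∂(vol m M) := fun k => by
    rw [hs.regForm_sub_eq hr hM (ha k) (hb k), sub_self, zero_sub]
    refine lintegral_congr fun x => ?_
    have : ambient (-(regForm π ε ω - ω - homForm π ε η)) x =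
      -ambient (regForm π ε ω - ω - homForm π ε η) x := rfl
    rw [this, enorm_neg]
  rw [TendstoL1] at hlim
  simp only [h5] at hlim
  have h6 := tendsto_nhds_unique tendsto_const_nhds hlim
  have h7 := (lintegral_eq_zero_iff' hβ.aestronglyMeasurable.enorm.restrict).1 h6
  refine ⟨_, inter_mem_nhdsWithin _ (hSo.mem_nhds hxS), ?_⟩
  have h8 := (ae_restrict_iff' hSo.measurableSet).1 h7
  rw [ae_iff] at h8
  refine measure_mono_null (fun x hx => ?_) h8
  intro hx'
  refine hx.1 ?_
  have h9 := enorm_ambient_eq_zero_iff.1 (hx' hx.2)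
  exact sub_eq_zero.1 h9

end IsScale

end WeakHomotopy

/-! ### Convergence of the averages in `L^p` -/

section Convergence

variable {n m j k : ℕ} {M N : Set (EuclideanSpace ℝ (Fin n))}
  {π : EuclideanSpace ℝ (Fin n) → EuclideanSpace ℝ (Fin n)}
  {G : Set (EuclideanSpace ℝ (Fin n)) → Prop} {κ : ℝ≥0} {ε δ : EuclideanSpace ℝ (Fin n) → ℝ}

lemma norm_compContinuousLinearMap_sub_le {V W : Type*} [NormedAddCommGroup V] [NormedSpace ℝ V]
    [NormedAddCommGroup W] [NormedSpace ℝ W] (A : W [⋀^Fin j]→L[ℝ] ℝ) {L L' : V →L[ℝ] W} {b : ℝ}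
    (hb : 1 ≤ b) (hL : ‖L‖ ≤ b) (hL' : ‖L'‖ ≤ b) :
    ‖A.compContinuousLinearMap L - A.compContinuousLinearMap L'‖ ≤
      j * b ^ j * ‖L - L'‖ * ‖A‖ := by
  have hb0 : 0 ≤ b := zero_le_one.trans hb
  refine ContinuousAlternatingMap.opNorm_le_bound _ (by positivity) fun v => ?_
  have h1 := A.norm_image_sub_le' (fun i => L (v i)) (fun i => L' (v i))
  refine h1.trans ?_
  have h2 : ∀ i : Fin j, (∏ l, if l = i then ‖L (v i) - L' (v i)‖
      else max ‖L (v l)‖ ‖L' (v l)‖) ≤ b ^ j * ‖L - L'‖ * ∏ l, ‖v l‖ := fun i => by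
    have h3 : ∀ l : Fin j, (if l = i then ‖L (v i) - L' (v i)‖
        else max ‖L (v l)‖ ‖L' (v l)‖) ≤ (if l = i then ‖L - L'‖ else b) * ‖v l‖ := fun l => by
      split_ifs with hl
      · rw [hl]
        exact (L - L').le_opNorm (v i)
      · exact max_le (L.le_of_opNorm_le hL _) (L'.le_of_opNorm_le hL' _)
    refine (Finset.prod_le_prod (fun l _ => ?_) fun l _ => h3 l).trans ?_
    · split_ifs <;> positivity
    · rw [Finset.prod_mul_distrib, Finset.prod_ite, Finset.prod_const, Finset.prod_const,
        Finset.filter_eq']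
      simp only [Finset.mem_univ, if_true, Finset.card_singleton, pow_one]
      have h4 : b ^ (Finset.univ.filter fun l : Fin j => ¬l = i).card ≤ b ^ j :=
        pow_le_pow_right₀ hb ((Finset.card_le_univ _).trans (by simp))
      rw [mul_comm ‖L - L'‖]
      gcongr
  calc _ ≤ ‖A‖ * ∑ _i : Fin j, b ^ j * ‖L - L'‖ * ∏ l, ‖v l‖ := by
        gcongr with i _
        exact h2 i
    _ = _ := by
        rw [Finset.sum_const, Finset.card_univ, Fintype.card_fin, nsmul_eq_mul]
        ring

namespace IsScale

/-- The pull-back under a displacement is close to the value of the form at the displaced point. -/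
lemma norm_pullShift_sub_le (hs : IsScale M N π G κ ε δ) (hr : IsTubularRetraction m M N π)
    (hM : IsSmoothSubmanifold m M) (ω : Form M j) (x : M) {τ : EuclideanSpace ℝ (Fin n) × ℝ}
    (hτ : τ ∈ paramSet n) :
    ‖pullShift ε (extForm π ω) x τ - ambient ω x‖ ≤
      4 ^ n * ‖ambient ω (move π ε (x, τ)) - ambient ω x‖ +
        j * 4 ^ j * (9 * κ) * ‖ambient ω x‖ := by
  set L := (fderiv ℝ π (shift ε x τ)).comp (shiftDeriv ε x τ) with hL
  set L' := fderiv ℝ π (x : EuclideanSpace ℝ (Fin n)) with hL'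
  have h1 := hs.norm_fderiv_le hr hM x.2 (hs.shift_mem_ball x.2 hτ)
  have h2 := norm_shiftDeriv_le hs.lipschitz hs.le_const x hτ
  have h3 : ‖L‖ ≤ 4 := by
    refine (ContinuousLinearMap.opNorm_comp_le _ _).trans ?_
    calc _ ≤ (2 : ℝ) * 2 := by gcongr
      _ = 4 := by norm_num
  have h4 : ‖L'‖ ≤ 4 := (hr.norm_fderiv_le hM x.2).trans (by norm_num)
  have h5 : ‖L - L'‖ ≤ 9 * κ := by
    have e1 : L - L' =
        (fderiv ℝ π (shift ε x τ)).comp (shiftDeriv ε x τ - ContinuousLinearMap.id ℝ _) +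
          (fderiv ℝ π (shift ε x τ) - L') := by
      ext1 v
      simp [hL]
    have h6 := norm_shiftDeriv_sub_id_le hs.lipschitz x hτ
    have h7 := hs.norm_fderiv_sub x x.2 _ (hs.shift_mem_ball x.2 hτ) _
      (Metric.mem_ball_self (hs.radius_pos x x.2))
    rw [e1]
    calc _ ≤ ‖fderiv ℝ π (shift ε x τ)‖ * ‖shiftDeriv ε x τ - ContinuousLinearMap.id ℝ _‖ + κ :=
          (norm_add_le _ _).trans (add_le_add (ContinuousLinearMap.opNorm_comp_le _ _) h7)
      _ ≤ 2 * (4 * κ) + κ := by gcongr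
      _ = 9 * κ := by ring
  have h8 : pullShift ε (extForm π ω) x τ - ambient ω x =
      (ambient ω (move π ε (x, τ)) - ambient ω x).compContinuousLinearMap L +
        ((ambient ω x).compContinuousLinearMap L - (ambient ω x).compContinuousLinearMap L') := by
    rw [hr.ambient_comp hM, pullShift, hs.extForm_shift hr ω x hτ]
    ext v
    simp [hL, Function.comp_def]
  rw [h8]
  refine (norm_add_le _ _).trans (add_le_add ?_ ?_)
  · exact norm_compContinuousLinearMap_le_pow _ (by norm_num) h3
  · refine (norm_compContinuousLinearMap_sub_le (ambient ω x) (by norm_num) h3 h4).trans ?_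
    gcongr

lemma _root_.LpForms.enorm_regForm_sub_le (ω : Form M j) (x : M)
    (hx : Integrable (pullShift ε (extForm π ω) x) (regMeasure n)) :
    ‖ambient (regForm π ε ω - ω) x‖ₑ ≤
      ∫⁻ τ, ‖pullShift ε (extForm π ω) x τ - ambient ω x‖ₑ ∂(regMeasure n) := by
  have h1 : (regForm π ε ω - ω) x = restrictForm M (fun _ =>
      ∫ τ, (pullShift ε (extForm π ω) x τ - ambient ω x) ∂(regMeasure n)) x := by
    rw [integral_sub hx (integrable_const _), integral_const]
    simp only [probReal_univ, one_smul]
    rw [restrictForm, Form.sub_apply]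
    ext v
    simp [regForm, restrictForm, average, ambient, Function.comp_def]
  refine le_trans ?_ (enorm_integral_le_lintegral_enorm _)
  rw [enorm_le_iff_norm_le, norm_ambient, h1]
  exact norm_restrictForm_le (fun _ => ∫ τ, (pullShift ε (extForm π ω) x τ - ambient ω x)
    ∂(regMeasure n)) x

/-- The distance of a form to its regularization is controlled by the distance to the displaced
forms, up to a multiple of the small constant `κ`, which bounds the variation of the differentials
of the displacements. -/
lemma lpNorm_regForm_sub_le (hs : IsScale M N π G κ ε δ) (hr : IsTubularRetraction m M N π)
    (hM : IsSmoothSubmanifold m M) [SFinite (vol m M)] {p : ℝ≥0∞} (hp : 1 ≤ p) {ω : Form M j}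
    (hω : IsLp m p ω) (hl : LocallyIntegrable (ambient ω) (vol m M)) :
    lpNorm m p (regForm π ε ω - ω) ≤
      (4 ^ n : ℝ≥0) * eLpNorm (fun z : M × (EuclideanSpace ℝ (Fin n) × ℝ) =>
        ambient ω (move π ε z) - ambient ω z.1) p ((vol m M).prod (regMeasure n)) +
      (j * 4 ^ j * (9 * κ) : ℝ≥0) * lpNorm m p ω := by
  have hm1 := hs.aestronglyMeasurable_comp_move hr hM ae_mem_paramSet_regMeasure hω.1
  have hm2 : AEStronglyMeasurable (fun z : M × (EuclideanSpace ℝ (Fin n) × ℝ) => ambient ω z.1)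
    ((vol m M).prod (regMeasure n)) := hω.1.comp_fst
  have hm3 := hs.aestronglyMeasurable_pullShift hr hM ae_mem_paramSet_regMeasure hω.1
  have h1 : eLpNorm (fun z : M × (EuclideanSpace ℝ (Fin n) × ℝ) => ambient ω z.1) p
      ((vol m M).prod (regMeasure n)) = lpNorm m p ω := by
    rw [← eLpNorm_ambient]
    exact eLpNorm_comp_measurePreserving (g := ambient ω) hω.1 measurePreserving_fst
  rw [← eLpNorm_ambient]
  have h2 : eLpNorm (ambient (regForm π ε ω - ω)) p (vol m M) ≤
      eLpNorm (fun x : M => ∫⁻ τ, ‖pullShift ε (extForm π ω) x τ - ambient ω x‖ₑ ∂(regMeasure n))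
        p (vol m M) :=
    eLpNorm_mono_enorm fun x => (enorm_regForm_sub_le ω x
      (integrable_pullShift hs.contDiff (hs.pos x x.2)
        (hs.integrableOn_extForm hr hM hl x.2))).trans_eq (enorm_eq_self _).symm
  refine h2.trans ((eLpNorm_lintegral_le (G := EuclideanSpace ℝ (Fin n) [⋀^Fin j]→L[ℝ] ℝ) hp
    (F := fun z : M × (EuclideanSpace ℝ (Fin n) × ℝ) => pullShift ε (extForm π ω) z.1 z.2 -
      ambient ω z.1) (hm3.sub hm2)).trans ?_)
  rw [← h1]
  have h3 : eLpNorm (fun z : M × (EuclideanSpace ℝ (Fin n) × ℝ) =>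
      pullShift ε (extForm π ω) z.1 z.2 - ambient ω z.1) p ((vol m M).prod (regMeasure n)) ≤
      eLpNorm ((fun z : M × (EuclideanSpace ℝ (Fin n) × ℝ) =>
        (4 ^ n : ℝ) * ‖ambient ω (move π ε z) - ambient ω z.1‖) +
          fun z => (j * 4 ^ j * (9 * κ) : ℝ) * ‖ambient ω z.1‖) p
        ((vol m M).prod (regMeasure n)) := by
    refine eLpNorm_mono_ae_real ?_
    filter_upwards [ae_mem_paramSet (vol m M) ae_mem_paramSet_regMeasure] with z hz
    exact hs.norm_pullShift_sub_le hr hM ω z.1 hz.2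
  refine h3.trans ((eLpNorm_add_le ((hm1.sub hm2).norm.const_mul _) (hm2.norm.const_mul _)
    hp).trans (le_of_eq ?_))
  congr 1
  · have h4 := eLpNorm_const_smul (4 ^ n : ℝ) (fun z : M × (EuclideanSpace ℝ (Fin n) × ℝ) =>
      ‖ambient ω (move π ε z) - ambient ω z.1‖) p ((vol m M).prod (regMeasure n))
    rw [eLpNorm_norm] at h4
    refine h4.trans ?_
    congr 1
    rw [enorm_eq_nnnorm]
    norm_num
  · have h4 := eLpNorm_const_smul (j * 4 ^ j * (9 * κ) : ℝ)
      (fun z : M × (EuclideanSpace ℝ (Fin n) × ℝ) => ‖ambient ω z.1‖) p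
      ((vol m M).prod (regMeasure n))
    rw [eLpNorm_norm] at h4
    refine h4.trans ?_
    congr 1
    rw [enorm_eq_nnnorm]
    congr 1
    ext
    push_cast
    exact Real.norm_of_nonneg (by positivity)

end IsScale

/-- Regularizations of `L^p` forms converge in `L^p` when the scale tends to zero. -/
lemma tendsto_lpNorm_regForm_sub {ε δ : ℕ → EuclideanSpace ℝ (Fin n) → ℝ} {κ : ℕ → ℝ≥0}
    (hs : ∀ i, IsScale M N π G (κ i) (ε i) (δ i)) (hκ : Tendsto κ atTop (𝓝 0))
    (hr : IsTubularRetraction m M N π)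
    (hM : IsSmoothSubmanifold m M) [SFinite (vol m M)] {p : ℝ≥0∞} (hp : 1 ≤ p) (hp' : p ≠ ∞)
    {ω : Form M j} (hω : IsLp m p ω) (hl : LocallyIntegrable (ambient ω) (vol m M)) :
    Tendsto (fun i => lpNorm m p (regForm π (ε i) ω - ω)) atTop (𝓝 0) := by
  have := weaklyLocallyCompactSpace hM
  have := isLocallyFiniteMeasure_vol hM
  have hκ' : Tendsto (fun i => 8 * (κ i : ℝ)) atTop (𝓝 0) := by
    have := (NNReal.tendsto_coe.2 hκ).const_mul 8
    simpa using this
  have h1 := tendsto_eLpNorm_comp_sub (μ := vol m M) (ν := fun _ => regMeasure n)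
    (h := fun i => move π (ε i))
    (fun i => (hs i).aemeasurable_move hr ae_mem_paramSet_regMeasure)
    (one_le_pow₀ (by norm_num : (1 : ℝ≥0) ≤ 2))
    (fun i => (hs i).map_move_le hr hM ae_mem_paramSet_regMeasure) hκ' (fun i => by
      filter_upwards [ae_mem_paramSet (vol m M) ae_mem_paramSet_regMeasure] with z hz
      refine ((hs i).dist_move_le hr hM z.1 hz.2).trans ?_
      have h6 := (hs i).le z.1
      have h7 : ε i z.1 ≤ κ i := h6.trans (mul_le_of_le_one_right (κ i).2 ((hs i).radius_le z.1))
      linarith) hp hp' (isLp_iff_memLp.1 hω)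
  have h2 := ENNReal.Tendsto.const_mul h1
    (Or.inr (show ((4 ^ n : ℝ≥0) : ℝ≥0∞) ≠ ∞ by finiteness))
  have h3 : Tendsto (fun i => (j * 4 ^ j * (9 * κ i) : ℝ≥0)) atTop (𝓝 0) := by
    have := (hκ.const_mul 9).const_mul (j * 4 ^ j : ℝ≥0)
    simpa using this
  have h4 := ENNReal.Tendsto.mul_const (ENNReal.tendsto_coe.2 h3)
    (Or.inr hω.2.ne : ((0 : ℝ≥0) : ℝ≥0∞) ≠ 0 ∨ lpNorm m p ω ≠ ∞)
  have h5 := h2.add h4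
  rw [mul_zero, ENNReal.coe_zero, zero_mul, add_zero] at h5
  exact tendsto_of_tendsto_of_tendsto_of_le_of_le tendsto_const_nhds h5 (fun _ => zero_le)
    fun i => (hs i).lpNorm_regForm_sub_le hr hM hp hω hl

end Convergence

/-! ### Forms that agree almost everywhere -/

section AlmostEverywhere

variable {n m j k : ℕ} {M N : Set (EuclideanSpace ℝ (Fin n))}
  {π : EuclideanSpace ℝ (Fin n) → EuclideanSpace ℝ (Fin n)}

lemma pullback_ae_eq (hM : IsSmoothSubmanifold m M)
    {e : OpenPartialHomeomorph M (EuclideanSpace ℝ (Fin m))} (he : IsCoord e) {ω ω' : Form M j}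
    (h : ∀ᵐ x ∂(vol m M), ω x = ω' x) :
    pullback e ω =ᵐ[volume.restrict e.target] pullback e ω' := by
  filter_upwards [ae_restrict_target hM he h] with u hu
  rw [pullback, pullback, hu]

lemma IsWeakExtDeriv.congr_ae (hM : IsSmoothSubmanifold m M) {ω ω' : Form M j}
    {η η' : Form M (j + 1)} (h : IsWeakExtDeriv m ω η) (hω : ∀ᵐ x ∂(vol m M), ω x = ω' x)
    (hη : ∀ᵐ x ∂(vol m M), η x = η' x) : IsWeakExtDeriv m ω' η' := fun e he =>
  (h e he).congr_ae e.open_target (pullback_ae_eq hM he hω) (pullback_ae_eq hM he hη)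

lemma ambient_ae_eq {ω ω' : Form M j} (h : ∀ᵐ x ∂(vol m M), ω x = ω' x) :
    ambient ω =ᵐ[vol m M] ambient ω' := by
  filter_upwards [h] with x hx
  rw [ambient, ambient, hx]

lemma lpNorm_congr_ae {p : ℝ≥0∞} {ω ω' : Form M j} (h : ∀ᵐ x ∂(vol m M), ω x = ω' x) :
    lpNorm m p ω = lpNorm m p ω' := by
  rw [← eLpNorm_ambient, ← eLpNorm_ambient]
  exact eLpNorm_congr_ae (ambient_ae_eq h)

lemma IsLp.congr_ae {p : ℝ≥0∞} {ω ω' : Form M j} (hω : IsLp m p ω)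
    (h : ∀ᵐ x ∂(vol m M), ω x = ω' x) : IsLp m p ω' :=
  ⟨hω.1.congr (ambient_ae_eq h), lpNorm_congr_ae h ▸ hω.2⟩

lemma IsLp.sub {p : ℝ≥0∞} {ω ω' : Form M j} (hω : IsLp m p ω) (hω' : IsLp m p ω') :
    IsLp m p (ω - ω') := by
  have h := hω.add (hω'.smul (-1 : ℝ))
  rwa [neg_one_smul, ← sub_eq_add_neg] at h

lemma IsSmooth.sub {ω ω' : Form M j} (hω : IsSmooth m ω) (hω' : IsSmooth m ω') :
    IsSmooth m (ω - ω') := by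
  have h := hω.add (hω'.smul (-1 : ℝ))
  rwa [neg_one_smul, ← sub_eq_add_neg] at h

/-- A weak exterior differential of a smooth form that is itself smooth is the exterior
differential. -/
lemma IsWeakExtDeriv.isExtDeriv {ω : Form M j} {η : Form M (j + 1)} (h : IsWeakExtDeriv m ω η)
    (hω : IsSmooth m ω) (hη : IsSmooth m η) : IsExtDeriv m ω η := fun e he =>
  (h e he).eq_extDeriv e.open_target (hω e he) (hη e he).continuousOn

/-- A smooth form that vanishes almost everywhere is zero. -/
lemma IsSmooth.eq_zero_of_ae (hM : IsSmoothSubmanifold m M) {ω : Form M j} (hω : IsSmooth m ω)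
    (h : ∀ᵐ x ∂(vol m M), ω x = 0) : ω = 0 := by
  obtain ⟨N, π, hr⟩ := exists_isTubularRetraction hM
  funext x
  by_contra hx
  have h1 : ∀ y : M, extForm π ω y = ambient ω y := fun y => by
    have hy : π y ∈ M := by rw [hr.self y y.2]; exact y.2
    have h2 : (⟨π y, hy⟩ : M) = y := Subtype.ext (hr.self y y.2)
    rw [extForm, dif_pos hy, h2, hr.ambient_comp hM]
  have h2 : ContinuousAt (fun y : M => extForm π ω y) x :=
    ContinuousAt.comp (g := extForm π ω)
      (hr.contDiffAt_extForm hM hω (hr.subset x.2)).1.continuousAt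
      continuous_subtype_val.continuousAt
  have h3 : extForm π ω x ≠ 0 := by
    rw [h1]
    exact fun h0 => hx (ambient_eq_zero_iff.1 h0)
  have h4 : {y : M | ω y ≠ 0} ∈ 𝓝 x := by
    filter_upwards [h2.eventually_ne h3] with y hy
    rw [h1] at hy
    exact fun h0 => hy (ambient_eq_zero_iff.2 h0)
  exact (vol_pos_of_mem_nhds hM h4).ne' (ae_iff.1 h)

lemma isClosed_essSupport (ω : Form M j) : IsClosed (essSupport m ω) := by
  rw [← isOpen_compl_iff, isOpen_iff_mem_nhds]
  intro x hx
  simp only [essSupport, Set.mem_compl_iff, Set.mem_ofPred_eq, not_forall, not_not] at hx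
  obtain ⟨U, hU, h⟩ := hx
  filter_upwards [eventually_mem_nhds_iff.2 hU] with y hy hy'
  exact hy' U hy h

lemma ae_eq_zero_of_notMem_essSupport (ω : Form M j) :
    ∀ᵐ x ∂(vol m M), x ∈ (essSupport m ω)ᶜ → ω x = 0 := by
  rw [ae_iff]
  refine measure_null_of_locally_null _ fun x hx => ?_
  have hx' : x ∈ (essSupport m ω)ᶜ := by
    by_contra h'
    exact hx fun h'' => absurd h'' h'
  simp only [essSupport, Set.mem_compl_iff, Set.mem_ofPred_eq, not_forall, not_not] at hx'
  obtain ⟨U, hU, h⟩ := hx'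
  refine ⟨_, inter_mem_nhdsWithin _ hU, measure_mono_null (fun y hy => ?_) (ae_iff.1 h)⟩
  exact fun h0 => hy.1 fun _ => h0 hy.2

lemma essSupport_congr_ae {ω ω' : Form M j} (h : ∀ᵐ x ∂(vol m M), ω x = ω' x) :
    essSupport m ω = essSupport m ω' := by
  have key : ∀ {ω ω' : Form M j}, (∀ᵐ x ∂(vol m M), ω x = ω' x) →
      essSupport m ω ⊆ essSupport m ω' := fun {ω ω'} h x hx U hU h0 => hx U hU (by
    filter_upwards [h, h0] with y hy hy0 hyU
    rw [hy, hy0 hyU])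
  exact Set.Subset.antisymm (key h) (key (h.mono fun _ hx => hx.symm))

/-- A map that is linear up to an error in a subspace differs from a linear map by such an error. -/
lemma exists_linearMap_sub_mem {V W : Type*} [AddCommGroup V] [Module ℝ V] [AddCommGroup W]
    [Module ℝ W] (K : Submodule ℝ W) (T : V → W) (hadd : ∀ v w, T (v + w) - (T v + T w) ∈ K)
    (hsmul : ∀ (a : ℝ) v, T (a • v) - a • T v ∈ K) : ∃ L : V →ₗ[ℝ] W, ∀ v, L v - T v ∈ K := by
  let T' : V →ₗ[ℝ] W ⧸ K :=
    { toFun := fun v => K.mkQ (T v)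
      map_add' := fun v w => by
        rw [← map_add, ← sub_eq_zero, ← map_sub]
        exact (Submodule.Quotient.mk_eq_zero K).2 (hadd v w)
      map_smul' := fun a v => by
        rw [RingHom.id_apply, ← map_smul, ← sub_eq_zero, ← map_sub]
        exact (Submodule.Quotient.mk_eq_zero K).2 (hsmul a v) }
  obtain ⟨s, hs⟩ := K.mkQ.exists_rightInverse_of_surjective
    (LinearMap.range_eq_top.2 K.mkQ_surjective)
  refine ⟨s ∘ₗ T', fun v => ?_⟩
  have h1 : K.mkQ (s (T' v)) = T' v := LinearMap.congr_fun hs (T' v)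
  refine (Submodule.Quotient.mk_eq_zero K).1 ?_
  have h2 : K.mkQ ((s ∘ₗ T') v - T v) = K.mkQ (s (T' v)) - K.mkQ (T v) := map_sub _ _ _
  refine h2.trans ?_
  rw [h1]
  exact sub_self _

/-- The forms that vanish almost everywhere. -/
def nullForms (m : ℕ) (M : Set (EuclideanSpace ℝ (Fin n))) (j : ℕ) : Submodule ℝ (Form M j) where
  carrier := {ω | ∀ᵐ x ∂(vol m M), ω x = 0}
  add_mem' := fun {ω ω'} h h' => by
    rw [Set.mem_ofPred_eq] at h h' ⊢
    filter_upwards [h, h'] with x hx hx'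
    rw [Form.add_apply, hx, hx', add_zero]
  zero_mem' := by
    rw [Set.mem_ofPred_eq]
    exact Eventually.of_forall fun _ => rfl
  smul_mem' := fun c ω h => by
    rw [Set.mem_ofPred_eq] at h ⊢
    filter_upwards [h] with x hx
    rw [Form.smul_apply, hx, smul_zero]

lemma sub_mem_nullForms {ω ω' : Form M j} :
    ω - ω' ∈ nullForms m M j ↔ ∀ᵐ x ∂(vol m M), ω x = ω' x := by
  show (∀ᵐ x ∂(vol m M), (ω - ω') x = 0) ↔ _
  refine eventually_congr (Eventually.of_forall fun x => ?_)
  rw [Form.sub_apply]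
  exact sub_eq_zero

end AlmostEverywhere

/-! ### The operators -/

section Operators

variable {n m j k : ℕ} {M N : Set (EuclideanSpace ℝ (Fin n))}
  {π : EuclideanSpace ℝ (Fin n) → EuclideanSpace ℝ (Fin n)}
  {G : Set (EuclideanSpace ℝ (Fin n)) → Prop} {κ : ℝ≥0} {ε δ : EuclideanSpace ℝ (Fin n) → ℝ}

lemma locallyIntegrable_of_mem_weakForms (hM : IsSmoothSubmanifold m M) {ω : Form M j}
    (hω : ω ∈ weakForms m M j) : LocallyIntegrable (ambient ω) (vol m M) := by
  obtain ⟨η, h⟩ := hω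
  exact (h.locallyIntegrable hM).1

namespace IsScale

lemma homForm_mem_weakForms (hs : IsScale M N π (HasSmoothApprox m M) κ ε δ)
    (hr : IsTubularRetraction m M N π) (hM : IsSmoothSubmanifold m M) [SFinite (vol m M)]
    {ω : Form M (j + 1)} (hω : ω ∈ weakForms m M (j + 1)) : homForm π ε ω ∈ weakForms m M j := by
  obtain ⟨η, h⟩ := hω
  exact ⟨_, hs.isWeakExtDeriv_homForm hr hM h⟩

lemma integrable_regForm (hs : IsScale M N π G κ ε δ) (hr : IsTubularRetraction m M N π)
    (hM : IsSmoothSubmanifold m M) [SFinite (vol m M)] {ω : Form M j}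
    (hω : LocallyIntegrable (ambient ω) (vol m M)) (x : M) :
    Integrable (pullShift ε (extForm π ω) x) (regMeasure n) :=
  integrable_pullShift hs.contDiff (hs.pos x x.2) (hs.integrableOn_extForm hr hM hω x.2)

/-- The regularization operator associated with a scale. It is linear everywhere and not only up to
null sets, since the averages that define it exist at every point. -/
def regOp (hs : IsScale M N π G κ ε δ) (hr : IsTubularRetraction m M N π)
    (hM : IsSmoothSubmanifold m M) [SFinite (vol m M)] (j : ℕ) :
    weakForms m M j →ₗ[ℝ] smoothForms m M j where
  toFun ω := ⟨regForm π ε ω, hs.isSmooth_regForm hr hM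
    (locallyIntegrable_of_mem_weakForms hM ω.2)⟩
  map_add' ω ω' := by
    refine Subtype.ext ?_
    funext x
    have h := (hs.isAveraging_pullShift hr hM).averageForm_add_apply
      (hs.integrable_regForm hr hM (locallyIntegrable_of_mem_weakForms hM ω.2) x)
      (hs.integrable_regForm hr hM (locallyIntegrable_of_mem_weakForms hM ω'.2) x)
    exact h
  map_smul' a ω := by
    have h := (hs.isAveraging_pullShift hr hM).averageForm_smul a (ω : Form M j)
    exact Subtype.ext h

/-- The averages `homForm π ε ω` exist only almost everywhere, so that `ω ↦ homForm π ε ω` is linear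
only up to null sets; a linear choice of representatives makes it linear. -/
lemma exists_homOp (hs : IsScale M N π (HasSmoothApprox m M) κ ε δ)
    (hr : IsTubularRetraction m M N π) (hM : IsSmoothSubmanifold m M) [SFinite (vol m M)] (j : ℕ) :
    ∃ A : weakForms m M (j + 1) →ₗ[ℝ] weakForms m M j, ∀ ω : weakForms m M (j + 1),
      ∀ᵐ x ∂(vol m M), (A ω : Form M j) x = homForm π ε (ω : Form M (j + 1)) x := by
  have hA := hs.isAveraging_contractShift (j := j) hr hM
  obtain ⟨A, h⟩ := exists_linearMap_sub_mem ((nullForms m M j).comap (weakForms m M j).subtype)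
    (fun ω : weakForms m M (j + 1) => (⟨homForm π ε (ω : Form M (j + 1)),
      hs.homForm_mem_weakForms hr hM ω.2⟩ : weakForms m M j)) (fun ω ω' =>
        sub_mem_nullForms.2 (hA.ae_add hs hr hM (locallyIntegrable_of_mem_weakForms hM ω.2)
          (locallyIntegrable_of_mem_weakForms hM ω'.2)))
    (fun a ω => sub_mem_nullForms.2 (Eventually.of_forall fun x =>
      congrFun (hA.averageForm_smul a (ω : Form M (j + 1))) x))
  exact ⟨A, fun ω => sub_mem_nullForms.1 (h ω)⟩

end IsScale

/-- Averages over small displacements of a form that is supported in a closed set are supported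
close to this set. -/
lemma IsAveraging.essSupport_subset {P : Measure (EuclideanSpace ℝ (Fin n) × ℝ)}
    [IsProbabilityMeasure P] {c : ℝ≥0}
    {F : (EuclideanSpace ℝ (Fin n) → EuclideanSpace ℝ (Fin n) [⋀^Fin j]→L[ℝ] ℝ) →
      EuclideanSpace ℝ (Fin n) → EuclideanSpace ℝ (Fin n) × ℝ →
        EuclideanSpace ℝ (Fin n) [⋀^Fin k]→L[ℝ] ℝ} (h : IsAveraging m M π ε P c F)
    (hs : IsScale M N π G κ ε δ) (hr : IsTubularRetraction m M N π) (hM : IsSmoothSubmanifold m M)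
    [SFinite (vol m M)] {ω : Form M j} (hω : AEStronglyMeasurable (ambient ω) (vol m M)) {r : ℝ}
    (hκ : 16 * (κ : ℝ) < r) :
    essSupport m (averageForm π P F ω) ⊆ Metric.thickening r (essSupport m ω) := by
  intro x hx
  by_contra hx'
  -- A displaced point of the ball of radius `r / 2` around `x` has distance less than `r` from `x`.
  have hr0 : 0 < r := lt_of_le_of_lt (by positivity) hκ
  refine hx (Metric.ball x (r / 2)) (Metric.ball_mem_nhds x (half_pos hr0))
    (h.ae_eq_zero hs hr hM hω measurableSet_ball (isClosed_essSupport ω).measurableSet.compl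
      (fun y hy τ hτ hmem => hx' ?_) (ae_eq_zero_of_notMem_essSupport ω))
  rw [Metric.mem_thickening_iff]
  refine ⟨_, hmem, ?_⟩
  have h1 := hs.dist_move_le hr hM y hτ
  have h2 : ε y ≤ κ := (hs.le y).trans (mul_le_of_le_one_right κ.2 (hs.radius_le y))
  have h3 := dist_triangle_right x (move π ε (y, τ)) y
  have h4 := Metric.mem_ball'.1 hy
  linarith

end Operators

/-! ### Comparison of the cohomology groups -/

section Cohomology

variable {n m j : ℕ} {M N : Set (EuclideanSpace ℝ (Fin n))}
  {π : EuclideanSpace ℝ (Fin n) → EuclideanSpace ℝ (Fin n)}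
  {κ : ℝ≥0} {ε δ : EuclideanSpace ℝ (Fin n) → ℝ} {p : ℝ≥0∞}

lemma mem_weakCoboundaries_zero_iff {ω : Form M 0} :
    ω ∈ weakCoboundaries m M p 0 ↔ ∀ᵐ x ∂(vol m M), ω x = 0 := Iff.rfl

lemma smoothLpForms_le : smoothLpForms m M p j ≤ weakLpForms m M p j :=
  fun _ ⟨h1, h2, η, h3, h4⟩ => ⟨h2, η, h3.isWeakExtDeriv h1, h4⟩

lemma smoothCocycles_le : smoothCocycles m M p j ≤ weakCocycles m M p j :=
  fun _ ⟨h1, h2⟩ => ⟨smoothLpForms_le h1, h2.isWeakExtDeriv h1.1⟩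

lemma smoothCoboundaries_le : smoothCoboundaries m M p j ≤ weakCoboundaries m M p j := by
  cases j with
  | zero =>
    intro ω hω
    have h0 : ω = 0 := (Submodule.mem_bot ℝ).1 hω
    rw [h0]
    exact zero_mem _
  | succ j =>
    rintro ω ⟨α, hα, h⟩
    exact ⟨α, smoothLpForms_le hα, h.isWeakExtDeriv hα.1⟩

namespace IsScale

/-- The homotopy formula in all degrees: `Rω - ω - A d̄ω` is weakly closed. -/
lemma exists_regForm_sub_eq (hs : IsScale M N π (HasSmoothApprox m M) κ ε δ)
    (hr : IsTubularRetraction m M N π) (hM : IsSmoothSubmanifold m M) [SFinite (vol m M)]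
    {ω : Form M j} {η : Form M (j + 1)} (hω : IsWeakExtDeriv m ω η) :
    ∃ β : Form M j, IsWeakExtDeriv m β 0 ∧
      ∀ᵐ x ∂(vol m M), regForm π ε ω x - homForm π ε η x = (ω + β) x := by
  cases j with
  | zero =>
    refine ⟨0, .zero, ?_⟩
    filter_upwards [hs.ae_regForm_sub_eq hr hM hω] with x hx
    rw [← hx, add_zero]
    exact sub_sub_cancel _ _
  | succ j =>
    refine ⟨_, (hs.isWeakExtDeriv_homForm hr hM hω).isWeakExtDeriv_zero, .of_forall fun x => ?_⟩
    have h : ω + (regForm π ε ω - ω - homForm π ε η) = regForm π ε ω - homForm π ε η := by abel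
    rw [h]
    rfl

/-- If `ω` is a smooth weak exterior differential of `α`, then it is the exterior differential of
the smooth form `Rα - Aω`. -/
lemma isExtDeriv_regForm_sub (hs : IsScale M N π (HasSmoothApprox m M) κ ε δ)
    (hr : IsTubularRetraction m M N π) (hM : IsSmoothSubmanifold m M) [SFinite (vol m M)]
    {α : Form M j} {ω : Form M (j + 1)} (h : IsWeakExtDeriv m α ω) (hω : IsSmooth m ω) :
    IsSmooth m (regForm π ε α - homForm π ε ω) ∧
      IsExtDeriv m (regForm π ε α - homForm π ε ω) ω := by
  have h1 : IsSmooth m (regForm π ε α - homForm π ε ω) :=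
    (hs.isSmooth_regForm hr hM (h.locallyIntegrable hM).1).sub (hs.isSmooth_homForm hr hM hω)
  obtain ⟨β, hβ, hae⟩ := hs.exists_regForm_sub_eq hr hM h
  have h2 := h.add hβ
  rw [add_zero] at h2
  have h3 : IsWeakExtDeriv m (regForm π ε α - homForm π ε ω) ω :=
    h2.congr_ae hM (hae.mono fun _ hx => hx.symm) (.of_forall fun _ => rfl)
  exact ⟨h1, h3.isExtDeriv h1 hω⟩

lemma homForm_zero (hs : IsScale M N π (HasSmoothApprox m M) κ ε δ)
    (hr : IsTubularRetraction m M N π) (hM : IsSmoothSubmanifold m M) [SFinite (vol m M)] :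
    homForm π ε (0 : Form M (j + 1)) = 0 := by
  have h := (hs.isAveraging_contractShift (j := j) hr hM).averageForm_smul 0 0
  rw [zero_smul, zero_smul] at h
  exact h

lemma isLp_regForm (hs : IsScale M N π (HasSmoothApprox m M) κ ε δ)
    (hr : IsTubularRetraction m M N π) (hM : IsSmoothSubmanifold m M) [SFinite (vol m M)]
    (hp : 1 ≤ p) {ω : Form M j} (hω : IsLp m p ω) : IsLp m p (regForm π ε ω) :=
  ((hs.isAveraging_pullShift hr hM).isLp hs hr hM hp hω).1

lemma isLp_homForm (hs : IsScale M N π (HasSmoothApprox m M) κ ε δ)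
    (hr : IsTubularRetraction m M N π) (hM : IsSmoothSubmanifold m M) [SFinite (vol m M)]
    (hp : 1 ≤ p) {ω : Form M (j + 1)} (hω : IsLp m p ω) : IsLp m p (homForm π ε ω) :=
  ((hs.isAveraging_contractShift hr hM).isLp hs hr hM hp hω).1

lemma mem_smoothCoboundaries (hs : IsScale M N π (HasSmoothApprox m M) κ ε δ)
    (hr : IsTubularRetraction m M N π) (hM : IsSmoothSubmanifold m M) [SFinite (vol m M)]
    (hp : 1 ≤ p) {ω : Form M j} (hω : ω ∈ smoothCocycles m M p j)
    (h : ω ∈ weakCoboundaries m M p j) : ω ∈ smoothCoboundaries m M p j := by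
  cases j with
  | zero => exact (Submodule.mem_bot ℝ).2 (hω.1.1.eq_zero_of_ae hM h)
  | succ j =>
    obtain ⟨α, hα, hd⟩ := h
    obtain ⟨h1, h2⟩ := hs.isExtDeriv_regForm_sub hr hM hd hω.1.1
    exact ⟨_, ⟨h1, (hs.isLp_regForm hr hM hp hα.1).sub (hs.isLp_homForm hr hM hp hω.1.2.1), ω, h2,
      hω.1.2.1⟩, h2⟩

lemma regForm_mem_smoothCocycles (hs : IsScale M N π (HasSmoothApprox m M) κ ε δ)
    (hr : IsTubularRetraction m M N π) (hM : IsSmoothSubmanifold m M) [SFinite (vol m M)]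
    (hp : 1 ≤ p) {ω : Form M j} (hω : ω ∈ weakCocycles m M p j) :
    regForm π ε ω ∈ smoothCocycles m M p j := by
  obtain ⟨h1, h2⟩ := hs.isExtDeriv_regForm_sub hr hM hω.2 .zero
  rw [hs.homForm_zero hr hM, sub_zero] at h1 h2
  exact ⟨⟨h1, hs.isLp_regForm hr hM hp hω.1.1, 0, h2, .zero⟩, h2⟩

lemma regForm_sub_mem_weakCoboundaries (hs : IsScale M N π (HasSmoothApprox m M) κ ε δ)
    (hr : IsTubularRetraction m M N π) (hM : IsSmoothSubmanifold m M) [SFinite (vol m M)]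
    (hp : 1 ≤ p) {ω : Form M j} (hω : ω ∈ weakCocycles m M p j) :
    regForm π ε ω - ω ∈ weakCoboundaries m M p j := by
  cases j with
  | zero =>
    refine mem_weakCoboundaries_zero_iff.2 ?_
    filter_upwards [hs.ae_regForm_sub_eq hr hM hω.2] with x hx
    rw [hs.homForm_zero hr hM] at hx
    exact hx
  | succ j =>
    have h := hs.isWeakExtDeriv_homForm hr hM hω.2
    rw [hs.homForm_zero hr hM, sub_zero] at h
    exact ⟨homForm π ε ω, ⟨hs.isLp_homForm hr hM hp hω.1.1, _, h,
      (hs.isLp_regForm hr hM hp hω.1.1).sub hω.1.1⟩, h⟩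

/-- The inclusion of the smooth forms induces isomorphisms in cohomology. -/
lemma exists_cohomology_equiv (hs : IsScale M N π (HasSmoothApprox m M) κ ε δ)
    (hr : IsTubularRetraction m M N π) (hM : IsSmoothSubmanifold m M) [SFinite (vol m M)]
    (hp : 1 ≤ p) (j : ℕ) : ∃ Λ : smoothCohomology m M p j ≃ₗ[ℝ] weakCohomology m M p j,
      ∀ ω : smoothCocycles m M p j, ∃ h : (ω : Form M j) ∈ weakCocycles m M p j,
        Λ (Submodule.Quotient.mk ω) = Submodule.Quotient.mk ⟨(ω : Form M j), h⟩ := by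
  set f : smoothCohomology m M p j →ₗ[ℝ] weakCohomology m M p j :=
    Submodule.mapQ _ _ (Submodule.inclusion smoothCocycles_le)
      (fun ω hω => smoothCoboundaries_le hω) with hf
  have hfm : ∀ ω : smoothCocycles m M p j, f (Submodule.Quotient.mk ω) =
      Submodule.Quotient.mk ⟨(ω : Form M j), smoothCocycles_le ω.2⟩ := fun ω => rfl
  refine ⟨LinearEquiv.ofBijective f ⟨?_, ?_⟩, fun ω => ⟨smoothCocycles_le ω.2, hfm ω⟩⟩
  · rw [injective_iff_map_eq_zero]
    intro q hq
    induction q using Submodule.Quotient.induction_on with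
    | _ ω =>
      rw [hfm, Submodule.Quotient.mk_eq_zero] at hq
      rw [Submodule.Quotient.mk_eq_zero]
      exact hs.mem_smoothCoboundaries hr hM hp ω.2 hq
  · intro q
    induction q using Submodule.Quotient.induction_on with
    | _ ω =>
      refine ⟨Submodule.Quotient.mk ⟨regForm π ε ω, hs.regForm_mem_smoothCocycles hr hM hp ω.2⟩, ?_⟩
      rw [hfm, Submodule.Quotient.eq]
      exact hs.regForm_sub_mem_weakCoboundaries hr hM hp ω.2

end IsScale

end Cohomology

lemma sFinite_vol {n m : ℕ} {M : Set (EuclideanSpace ℝ (Fin n))} (hM : IsSmoothSubmanifold m M) :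
    SFinite (vol m M) := by
  have := isLocallyFiniteMeasure_vol hM
  infer_instance

end

end LpForms

open LpForms in
theorem theorem3p1 (n m : ℕ) (M : Set (EuclideanSpace ℝ (Fin n)))
    (hM : IsSmoothSubmanifold m M) :
    -- the regularization operators `R i : Ω̄^j(M) → Ω^j(M)` and `A i : Ω̄^(j+1)(M) → Ω̄^j(M)`;
    -- `A i` is zero on forms of degree `0`
    (∃ (R : ℕ → (j : ℕ) → weakForms m M j →ₗ[ℝ] smoothForms m M j)
      (A : ℕ → (j : ℕ) → weakForms m M (j + 1) →ₗ[ℝ] weakForms m M j),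
      -- `R i ω - ω = d̄ (A i ω) + A i (d̄ ω)`, in degree `0` and in positive degrees
      (∀ (i : ℕ) (ω : weakForms m M 0) (η : Form M 1) (h : IsWeakExtDeriv m (ω : Form M 0) η),
        ∀ᵐ x ∂(vol m M), (R i 0 ω : Form M 0) x - (ω : Form M 0) x
          = (A i 0 ⟨η, h.mem_weakForms⟩ : Form M 0) x) ∧
      (∀ (i j : ℕ) (ω : weakForms m M (j + 1)) (η : Form M (j + 1 + 1))
        (h : IsWeakExtDeriv m (ω : Form M (j + 1)) η),
        ∃ β : Form M (j + 1), IsWeakExtDeriv m (A i j ω : Form M j) β ∧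
          ∀ᵐ x ∂(vol m M), (R i (j + 1) ω : Form M (j + 1)) x - (ω : Form M (j + 1)) x
            = β x + (A i (j + 1) ⟨η, h.mem_weakForms⟩ : Form M (j + 1)) x) ∧
      -- `L^p` bounds
      (∀ i : ℕ, ∃ C : ℝ≥0, ∀ p : ℝ≥0∞, 1 ≤ p →
        (∀ (j : ℕ) (ω : weakForms m M j), IsLp m p (ω : Form M j) →
          IsLp m p (R i j ω : Form M j) ∧
            lpNorm m p (R i j ω : Form M j) ≤ C * lpNorm m p (ω : Form M j)) ∧
        (∀ (j : ℕ) (ω : weakForms m M (j + 1)), IsLp m p (ω : Form M (j + 1)) →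
          IsLp m p (A i j ω : Form M j) ∧
            lpNorm m p (A i j ω : Form M j) ≤ C * lpNorm m p (ω : Form M (j + 1)))) ∧
      -- `L^p` convergence
      (∀ p : ℝ≥0∞, 1 ≤ p → p < ∞ →
        (∀ (j : ℕ) (ω : weakForms m M j), IsLp m p (ω : Form M j) →
          Tendsto (fun i => lpNorm m p ((R i j ω : Form M j) - (ω : Form M j))) atTop (𝓝 0)) ∧
        (∀ (j : ℕ) (ω : weakForms m M (j + 1)), IsLp m p (ω : Form M (j + 1)) →
          Tendsto (fun i => lpNorm m p (A i j ω : Form M j)) atTop (𝓝 0))) ∧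
      -- supports
      (∀ (j : ℕ) (ω : weakForms m M j) (W : Set M),
        (∃ δ : ℝ, 0 < δ ∧ Metric.thickening δ (essSupport m (ω : Form M j)) ⊆ W) →
          ∀ᶠ i in atTop, essSupport m (R i j ω : Form M j) ⊆ W) ∧
      (∀ (j : ℕ) (ω : weakForms m M (j + 1)) (W : Set M),
        (∃ δ : ℝ, 0 < δ ∧ Metric.thickening δ (essSupport m (ω : Form M (j + 1))) ⊆ W) →
          ∀ᶠ i in atTop, essSupport m (A i j ω : Form M j) ⊆ W)) ∧
    -- for every `p ∈ [1, ∞]`, the inclusions `Ω_p^j(M) ⊆ Ω̄_p^j(M)` form a cochain map and induce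
    -- isomorphisms in cohomology
    (∀ p : ℝ≥0∞, 1 ≤ p →
      (∀ j : ℕ, smoothLpForms m M p j ≤ weakLpForms m M p j) ∧
      (∀ (j : ℕ) (ω : Form M j) (η : Form M (j + 1)), ω ∈ smoothLpForms m M p j →
        IsExtDeriv m ω η → IsWeakExtDeriv m ω η) ∧
      (∀ j : ℕ, ∃ Λ : smoothCohomology m M p j ≃ₗ[ℝ] weakCohomology m M p j,
        ∀ ω : smoothCocycles m M p j, ∃ h : (ω : Form M j) ∈ weakCocycles m M p j,
          Λ (Submodule.Quotient.mk ω) =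
            Submodule.Quotient.mk ⟨(ω : Form M j), h⟩)) := by
  obtain ⟨N, π, hr⟩ := exists_isTubularRetraction hM
  have := sFinite_vol hM
  -- Lipschitz constants that satisfy the bound required of scales and tend to zero
  set κ : ℕ → ℝ≥0 := fun i => 1 / 100 * (1 / (i + 1)) with hκ
  have hκ0 : Tendsto κ atTop (𝓝 0) := by
    have h := (tendsto_one_div_add_atTop_nhds_zero_nat (𝕜 := ℝ≥0)).const_mul (1 / 100)
    rwa [mul_zero] at h
  have hκ1 : ∀ i, (κ i : ℝ) ≤ 1 / 100 := fun i => by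
    rw [hκ]
    push_cast
    have h : (1 : ℝ) / (i + 1) ≤ 1 := by
      rw [div_le_one (by positivity)]
      linarith [(Nat.cast_nonneg i : (0 : ℝ) ≤ i)]
    linarith
  have hex : ∀ i, ∃ ε δ, IsScale M N π (HasSmoothApprox m M) (κ i) ε δ := fun i =>
    hr.exists_isScale (fun _ _ hst h => h.mono hst) (fun _ hx => exists_hasSmoothApprox hr hM hx)
      (by simp only [hκ]; positivity) (hκ1 i)
  choose ε δ hs using hex
  have hR := fun (i j : ℕ) => (hs i).isAveraging_pullShift (j := j) hr hM
  have hH := fun (i j : ℕ) => (hs i).isAveraging_contractShift (j := j) hr hM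
  choose A hA using fun (i j : ℕ) => (hs i).exists_homOp hr hM j
  have hκr : ∀ {r : ℝ}, 0 < r → ∀ᶠ i in atTop, 16 * (κ i : ℝ) < r := fun {r} h => by
    have h1 := (NNReal.tendsto_coe.2 hκ0).const_mul 16
    rw [NNReal.coe_zero, mul_zero] at h1
    exact h1.eventually_lt_const h
  refine ⟨⟨fun i j => (hs i).regOp hr hM j, A, ?_, ?_, ?_, ?_, ?_, ?_⟩, fun p hp =>
    ⟨fun j => smoothLpForms_le, fun j ω η hω h => h.isWeakExtDeriv hω.1,
      fun j => (hs 0).exists_cohomology_equiv hr hM hp j⟩⟩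
  · intro i ω η h
    filter_upwards [(hs i).ae_regForm_sub_eq hr hM h, hA i 0 ⟨η, h.mem_weakForms⟩] with x hx hx'
    rw [hx']
    exact hx
  · intro i j ω η h
    refine ⟨_, ((hs i).isWeakExtDeriv_homForm hr hM h).congr_ae hM
      ((hA i j ω).mono fun _ hx => hx.symm) (.of_forall fun _ => rfl), ?_⟩
    filter_upwards [hA i (j + 1) ⟨η, h.mem_weakForms⟩] with x hx
    rw [hx]
    exact (sub_add_cancel _ _).symm
  · intro i
    refine ⟨max (4 ^ n * 2 ^ m) (4 ^ n * 4 * κ i * 2 ^ m), fun p hp => ⟨fun j ω hω => ?_,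
      fun j ω hω => ?_⟩⟩
    · obtain ⟨h1, h2⟩ := (hR i j).isLp (hs i) hr hM hp hω
      refine ⟨h1, h2.trans ?_⟩
      gcongr
      exact le_max_left _ _
    · obtain ⟨h1, h2⟩ := (hH i j).isLp (hs i) hr hM hp hω
      have h3 := (hA i j ω).mono fun _ hx => hx.symm
      refine ⟨h1.congr_ae h3, ?_⟩
      rw [← lpNorm_congr_ae h3]
      refine h2.trans ?_
      gcongr
      exact le_max_right _ _
  · intro p hp hp'
    refine ⟨fun j ω hω => ?_, fun j ω hω => ?_⟩
    · exact tendsto_lpNorm_regForm_sub hs hκ0 hr hM hp hp'.ne hω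
        (locallyIntegrable_of_mem_weakForms hM ω.2)
    · have h1 : Tendsto (fun i => (4 ^ n * 4 * κ i * 2 ^ m : ℝ≥0)) atTop (𝓝 0) := by
        have h := (hκ0.const_mul (4 ^ n * 4)).mul_const (2 ^ m)
        rwa [mul_zero, zero_mul] at h
      have h2 := ENNReal.Tendsto.mul_const (ENNReal.tendsto_coe.2 h1)
        (Or.inr hω.2.ne : ((0 : ℝ≥0) : ℝ≥0∞) ≠ 0 ∨ lpNorm m p (ω : Form M (j + 1)) ≠ ∞)
      rw [ENNReal.coe_zero, zero_mul] at h2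
      refine tendsto_of_tendsto_of_tendsto_of_le_of_le tendsto_const_nhds h2 (fun _ => zero_le)
        fun i => ?_
      dsimp only
      rw [lpNorm_congr_ae (hA i j ω)]
      exact ((hH i j).isLp (hs i) hr hM hp hω).2
  · rintro j ω W ⟨r, hr0, hW⟩
    filter_upwards [hκr hr0] with i hi
    exact ((hR i j).essSupport_subset (hs i) hr hM
      (locallyIntegrable_of_mem_weakForms hM ω.2).aestronglyMeasurable hi).trans hW
  · rintro j ω W ⟨r, hr0, hW⟩
    filter_upwards [hκr hr0] with i hi
    rw [essSupport_congr_ae (hA i j ω)]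
    exact ((hH i j).essSupport_subset (hs i) hr hM
      (locallyIntegrable_of_mem_weakForms hM ω.2).aestronglyMeasurable hi).trans hW
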